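/- Notation (one space dimension). Fix a smooth $\rho:\mathbb R\to[0,1]$ with $\rho(\xi)=1$ for $|\xi|\le\frac12$ and $\rho(\xi)=0$ for $|\xi|\ge1$, put $\sigma_k(\xi)=\rho(\xi-k)\big(\sum_{l\in\mathbb Z}\rho(\xi-l)\big)^{-1}$ and $\square_k=\mathscr F^{-1}\sigma_k\mathscr F$, $k\in\mathbb Z$. For $s\in\mathbb R$, $1\le p\le\infty$, let $M^s_{p,1}=\{f\in\mathscr S'(\mathbb R):\|f\|_{M^s_{p,1}}=\sum_{k\in\mathbb Z}(1+|k|)^s\|\square_kf\|_{L^p}<\infty\}$. Let $\varphi(D)$ be the Fourier multiplier with symbol $\varphi(\xi)=\frac{\xi}{1+\xi^2}$ (where $D=-i\partial_x$), and $S(t)=e^{-it\varphi(D)}$. For $\sigma<-1$ let $$\beta_\sigma=\frac{\sigma+1}{1-2\sigma}\ \text{ if } -4\le\sigma<-1,\qquad \beta_\sigma=\frac{-3}{1-2\sigma}\ \text{ if }\sigma\le-4 .$$ **Theorem.** Let $\lambda\ge1$ be an integer, $p=\lambda+2$, $s\ge0$, $\sigma<-1$ and $0<\theta\le-\frac1\sigma$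 be such that $0<\frac{-\lambda\theta\beta_\sigma}{\lambda+2}<1$, and put $r=\frac{\lambda(\lambda+2)}{\lambda+2+\lambda\theta\beta_\sigma}$. Then there exists $\epsilon>0$ such that for every $u_0\in\mathscr S'(\mathbb R)$ with $\|S(t)u_0\|_{L^r(\mathbb R;M^s_{p,1})}<\epsilon$ the integral form of the generalized Benjamin–Bona–Mahony equation $u_t+u_x-u_{xxt}+u^\lambda u_x=0$, $u(0)=u_0$, namely $$u(t)=S(t)u_0-\frac{i}{\lambda+1}\int_0^tS(t-\tau)\varphi(D)\big[u(\tau)^{\lambda+1}\big]\,d\tau ,$$ has a unique global solution $u\in L^r(\mathbb R;M^s_{p,1})$. Here a solution satisfies the equation for almost every $t\in\mathbb R$, the integral being a Bochner integral in $M^s_{p,1}$. If $u_0$ is real-valued, then so is $u(t)$ for almost every $t$. -/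

import Mathlib

open MeasureTheory Filter Topology
open scoped SchwartzMap ENNReal

noncomputable section

namespace GBBM

/-- The Fourier multiplier `m(D) = ℱ⁻¹ m ℱ`, `D = -i∂ₓ`, on tempered distributions on the line. The
symbol `m` is a function of the angular frequency `ξ` (so that `∂ₓ` has symbol `iξ`); Mathlib's
Fourier transform uses the frequency `y` with `ξ = 2πy`. -/
def multiplier (m : ℝ → ℂ) (f : 𝓢'(ℝ, ℂ)) : 𝓢'(ℝ, ℂ) :=
  TemperedDistribution.fourierMultiplierCLM ℂ (fun y : ℝ => m (2 * Real.pi * y)) f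

/-- The tempered distribution `f` is given by integration against the function `g`. -/
def IsRep (f : 𝓢'(ℝ, ℂ)) (g : ℝ → ℂ) : Prop :=
  ∀ ψ : 𝓢(ℝ, ℂ), f ψ = ∫ x, ψ x * g x

/-- The `L^p` norm (`1 ≤ p ≤ ∞`) of a tempered distribution; it is `∞` if the distribution is not
given by an `L^p` function. -/
def lpNorm (p : ℝ≥0∞) (f : 𝓢'(ℝ, ℂ)) : ℝ≥0∞ :=
  ⨅ (g : ℝ → ℂ) (_ : MemLp g p volume ∧ IsRep f g), eLpNorm g p volume

/-- The admissible bump functions from which the frequency-uniform decomposition is built. -/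
structure IsBump (ρ : ℝ → ℝ) : Prop where
  smooth : ContDiff ℝ (⊤ : ℕ∞) ρ
  nonneg : ∀ ξ, 0 ≤ ρ ξ
  le_one : ∀ ξ, ρ ξ ≤ 1
  eq_one : ∀ ξ, |ξ| ≤ 1 / 2 → ρ ξ = 1
  eq_zero : ∀ ξ, 1 ≤ |ξ| → ρ ξ = 0

/-- `σ_k(ξ) = ρ(ξ - k) / ∑_l ρ(ξ - l)`. -/
def cutoff (ρ : ℝ → ℝ) (k : ℤ) (ξ : ℝ) : ℝ :=
  ρ (ξ - k) / ∑' l : ℤ, ρ (ξ - l)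

/-- The frequency-uniform decomposition operator `□_k = ℱ⁻¹ σ_k ℱ`. -/
def box (ρ : ℝ → ℝ) (k : ℤ) (f : 𝓢'(ℝ, ℂ)) : 𝓢'(ℝ, ℂ) :=
  multiplier (fun ξ => (cutoff ρ k ξ : ℂ)) f

/-- The norm of the modulation space `M^s_{p,q}(ℝ)`, with value `∞` off the space. -/
def modNorm (ρ : ℝ → ℝ) (s : ℝ) (p q : ℝ≥0∞) (f : 𝓢'(ℝ, ℂ)) : ℝ≥0∞ :=
  if q = ∞ then ⨆ k : ℤ, ENNReal.ofReal ((1 + |(k : ℝ)|) ^ s) * lpNorm p (box ρ k f)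
  else (∑' k : ℤ, (ENNReal.ofReal ((1 + |(k : ℝ)|) ^ s) * lpNorm p (box ρ k f)) ^ q.toReal)
    ^ (1 / q.toReal)

/-- The norm of `L^r(μ; M^s_{p,q})`, `1 ≤ r < ∞`, for a measure `μ` on the time axis. -/
def bochnerNorm (ρ : ℝ → ℝ) (s : ℝ) (p q : ℝ≥0∞) (r : ℝ) (μ : Measure ℝ)
    (F : ℝ → 𝓢'(ℝ, ℂ)) : ℝ≥0∞ :=
  (∫⁻ t, modNorm ρ s p q (F t) ^ r ∂μ) ^ (1 / r)

/-- `F ∈ L^r(μ; M^s_{p,q})`: `F` is strongly measurable, i.e. it is `μ`-a.e. the limit, in the norm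
of `M^s_{p,q}`, of simple functions with values in `M^s_{p,q}`, and its `L^r` norm is finite. -/
def MemBochner (ρ : ℝ → ℝ) (s : ℝ) (p q : ℝ≥0∞) (r : ℝ) (μ : Measure ℝ)
    (F : ℝ → 𝓢'(ℝ, ℂ)) : Prop :=
  (∃ a : ℕ → SimpleFunc ℝ 𝓢'(ℝ, ℂ),
    (∀ n t, modNorm ρ s p q (a n t) < ∞) ∧
    ∀ᵐ t ∂μ, Tendsto (fun n => modNorm ρ s p q (F t - a n t)) atTop (𝓝 0)) ∧
  bochnerNorm ρ s p q r μ F < ∞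

theorem memLp_top_pow {g : ℝ → ℂ} (hg : MemLp g ∞ volume) (m : ℕ) :
    MemLp (fun x => g x ^ m) ∞ volume := by
  induction m with
  | zero => simpa using memLp_top_const (μ := (volume : Measure ℝ)) (1 : ℂ)
  | succ m ih =>
    simp only [pow_succ]
    exact hg.mul ih

open Classical in
/-- The pointwise power `f^m` of a tempered distribution given by a bounded measurable function
(as all elements of `M^s_{p,1}`, `s ≥ 0`, are); the value is `0` for other distributions. -/
def distPow (m : ℕ) (f : 𝓢'(ℝ, ℂ)) : 𝓢'(ℝ, ℂ) :=
  if h : ∃ g : ℝ → ℂ, MemLp g ∞ volume ∧ IsRep f g then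
    Lp.toTemperedDistribution ((memLp_top_pow h.choose_spec.1 m).toLp (fun x => h.choose x ^ m))
  else 0

/-- The symbol `φ(ξ) = ξ / (1 + ξ²)`. -/
def phi (ξ : ℝ) : ℝ := ξ / (1 + ξ ^ 2)

/-- `φ(D)`. -/
def phiD (f : 𝓢'(ℝ, ℂ)) : 𝓢'(ℝ, ℂ) := multiplier (fun ξ => (phi ξ : ℂ)) f

/-- The linear group `S(t) = e^{-itφ(D)}`. -/
def S (t : ℝ) (f : 𝓢'(ℝ, ℂ)) : 𝓢'(ℝ, ℂ) :=
  multiplier (fun ξ => Complex.exp (-Complex.I * t * phi ξ)) f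

/-- The integrand `τ ↦ S(t - τ) φ(D) [u(τ)^{λ+1}]` of the Duhamel integral. -/
def duhamel (lam : ℕ) (u : ℝ → 𝓢'(ℝ, ℂ)) (t τ : ℝ) : 𝓢'(ℝ, ℂ) :=
  S (t - τ) (phiD (distPow (lam + 1) (u τ)))

/-- `u` solves `u(t) = S(t)u₀ - i/(λ+1) ∫₀ᵗ S(t-τ) φ(D) [u(τ)^{λ+1}] dτ` for almost every `t`, where
the integral is a Bochner integral in `M^s_{p,q}`: the integrand is Bochner integrable there between
`0` and `t`, and the value of the integral is tested against Schwartz functions. -/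
def IsSolution (ρ : ℝ → ℝ) (lam : ℕ) (s : ℝ) (p q : ℝ≥0∞) (u₀ : 𝓢'(ℝ, ℂ))
    (u : ℝ → 𝓢'(ℝ, ℂ)) : Prop :=
  ∀ᵐ t : ℝ, MemBochner ρ s p q 1 (volume.restrict (Set.uIoc 0 t)) (duhamel lam u t) ∧
    ∀ ψ : 𝓢(ℝ, ℂ), u t ψ =
      S t u₀ ψ - Complex.I / ((lam : ℂ) + 1) * ∫ τ in (0 : ℝ)..t, duhamel lam u t τ ψ

/-- A real-valued tempered distribution. -/
def IsReal (f : 𝓢'(ℝ, ℂ)) : Prop :=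
  ∀ ψ : 𝓢(ℝ, ℂ), (∀ x, (ψ x).im = 0) → (f ψ).im = 0

/-- The decay exponent `β_σ`, for `σ < -1`. -/
def beta (σ : ℝ) : ℝ :=
  if -4 ≤ σ then (σ + 1) / (1 - 2 * σ) else -3 / (1 - 2 * σ)

end GBBM

end

/-! Put p = λ+2 and γ = -θβ_σ. All that matters about σ and θ is 0 < γ ≤ 1/6 (`neg_mul_beta_le`);
then 1 - λ/r = λγ/(λ+2), so r lies slightly above λ (`exponent_bounds`).

Dispersion. On the block at frequency k the kernel of S(t)φ(D) is an oscillatory integral with phase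
xξ - tφ(ξ). The second derivative φ'' has simple zeros at 0 and ±√3 and decays like |ξ|^{-3}, a loss
which the amplitude φ ~ 1/ξ compensates. The second derivative test `norm_kernel_grp_le` bounds the
kernel by a multiple of (1+|t|)^{-1/3} uniformly in k, and interpolation with Plancherel yields the
decay (1+|t|)^{-κ}, κ = λ/(3(λ+2)), from M^s_{p',1} to M^s_{p,1} (`exists_modNorm_decay`). Since
p/(λ+1) = p', the product estimate `exists_modNorm_mul_le` puts u^{λ+1} exactly into M^s_{p',1}.

Existence. The integral equation becomes a fixed point problem in the Banach space `ModSpace`. The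
contraction is measured in the sup norm in time only: Hölder in time needs κ > 1 - λ/r, which is γ <
1/3. The L^r bound need not contract; it only has to be preserved, since by Fatou it survives limits
(`exists_fixedPoint`). How it is preserved depends on λ. For λ ≥ 5, Young's inequality in time
suffices. As u is small and bounded, the power λ+1 may be lowered to min(λ+1, r), and the remaining
condition 1/r < κ follows from λ² > 3(λ+2). For λ = 4 one has κ = 2/9 ≤ 1/r and the decay must be
improved to |t|^{-1/4}. Away from the degenerate frequencies 0, ±√3 it is better already. Near them,
at frequency scale δ = |t|^{-1/4}, the nonlinearity is controlled by local L² averages at spatial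
scale 1/δ. Group velocities are at most 1, so these averages change little during a time 1/δ
(`local_energy`), and the smallness of the linear solution in L^r of time makes them small. This
holds for u as well, because u is kept L²-close to the linear solution
(`exists_norm_duhamelMap_gain_le`). For λ ≤ 3 the same energy argument shows that a linear solution
in L^r vanishes (`eq_zero_of_lintegral_group`), so the data are 0 and so is the solution.

Uniqueness and reality. Any solution agrees almost everywhere with a continuous one, and continuous
solutions are unique by Grönwall, without smallness (`ae_eq_of_isSolution`). Real-valuedness is a
closed condition invariant under the iteration, hence inherited by the fixed point. -/

noncomputable section

namespace GBBM

/-! ### The `L^p` norm of a tempered distribution -/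

theorem IsRep.congr {f : 𝓢'(ℝ, ℂ)} {g g' : ℝ → ℂ} (h : IsRep f g) (hg : g =ᵐ[volume] g') :
    IsRep f g' := fun ψ => by
  rw [h ψ]
  refine integral_congr_ae ?_
  filter_upwards [hg] with x hx
  rw [hx]

theorem isRep_coe {p : ℝ≥0∞} [Fact (1 ≤ p)] (g : Lp ℂ p (volume : Measure ℝ)) :
    IsRep (g : 𝓢'(ℝ, ℂ)) g := fun ψ => by
  simp [Lp.toTemperedDistribution_apply]

theorem isRep_toLp {p : ℝ≥0∞} [Fact (1 ≤ p)] {g : ℝ → ℂ} (hg : MemLp g p volume) :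
    IsRep (hg.toLp g : Lp ℂ p (volume : Measure ℝ)) g :=
  (isRep_coe _).congr hg.coeFn_toLp

theorem IsRep.eq_coe {p : ℝ≥0∞} [Fact (1 ≤ p)] {f : 𝓢'(ℝ, ℂ)} {g : ℝ → ℂ} (h : IsRep f g)
    (hg : MemLp g p volume) : f = (hg.toLp g : Lp ℂ p (volume : Measure ℝ)) := by
  ext ψ
  rw [h ψ, isRep_toLp hg ψ]

/-- Smooth compactly supported functions are Schwartz functions, so the fundamental lemma of the
calculus of variations applies. Thus the infimum in `lpNorm` runs over a single class of functions.
-/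
theorem IsRep.ae_eq {f : 𝓢'(ℝ, ℂ)} {g g' : ℝ → ℂ} (h : IsRep f g) (h' : IsRep f g')
    (hg : LocallyIntegrable g) (hg' : LocallyIntegrable g') : g =ᵐ[volume] g' := by
  refine ae_eq_of_integral_contDiff_smul_eq hg hg' fun u hu hc => ?_
  have hc' : HasCompactSupport (Complex.ofRealCLM ∘ u) := hc.comp_left rfl
  have hu' : ContDiff ℝ (⊤ : ℕ∞) (Complex.ofRealCLM ∘ u) := by fun_prop
  have := (h (hc'.toSchwartzMap hu')).symm.trans (h' (hc'.toSchwartzMap hu'))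
  simpa [Complex.real_smul] using this

theorem IsRep.ae_eq_of_memLp {p q : ℝ≥0∞} (hp : 1 ≤ p) (hq : 1 ≤ q) {f : 𝓢'(ℝ, ℂ)}
    {g g' : ℝ → ℂ} (h : IsRep f g) (h' : IsRep f g')
    (hg : MemLp g p volume) (hg' : MemLp g' q volume) : g =ᵐ[volume] g' :=
  h.ae_eq h' (hg.locallyIntegrable hp) (hg'.locallyIntegrable hq)

theorem lpNorm_le {p : ℝ≥0∞} {f : 𝓢'(ℝ, ℂ)} {g : ℝ → ℂ} (hg : MemLp g p volume)
    (h : IsRep f g) : lpNorm p f ≤ eLpNorm g p volume :=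
  iInf₂_le g ⟨hg, h⟩

theorem lpNorm_eq {p : ℝ≥0∞} (hp : 1 ≤ p) {f : 𝓢'(ℝ, ℂ)} {g : ℝ → ℂ} (hg : MemLp g p volume)
    (h : IsRep f g) : lpNorm p f = eLpNorm g p volume := by
  refine le_antisymm (lpNorm_le hg h) (le_iInf₂ fun g' hg' => ?_)
  rw [eLpNorm_congr_ae (h.ae_eq_of_memLp hp hp hg'.2 hg hg'.1)]

theorem exists_rep {p : ℝ≥0∞} {f : 𝓢'(ℝ, ℂ)} (h : lpNorm p f < ∞) :
    ∃ g : ℝ → ℂ, MemLp g p volume ∧ IsRep f g := by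
  simp only [lpNorm, iInf_lt_iff] at h
  obtain ⟨g, hg, -⟩ := h
  exact ⟨g, hg⟩

theorem lpNorm_coe {p : ℝ≥0∞} [hp : Fact (1 ≤ p)] (g : Lp ℂ p (volume : Measure ℝ)) :
    lpNorm p (g : 𝓢'(ℝ, ℂ)) = ‖g‖ₑ := by
  rw [lpNorm_eq hp.out (Lp.memLp g) (isRep_coe g), Lp.enorm_def]

theorem exists_coe_eq {p : ℝ≥0∞} [Fact (1 ≤ p)] {f : 𝓢'(ℝ, ℂ)} (h : lpNorm p f < ∞) :
    ∃ g : Lp ℂ p (volume : Measure ℝ), (g : 𝓢'(ℝ, ℂ)) = f := by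
  obtain ⟨g, hg, hfg⟩ := exists_rep h
  exact ⟨hg.toLp g, (hfg.eq_coe hg).symm⟩

theorem coe_add {p : ℝ≥0∞} [Fact (1 ≤ p)] (g g' : Lp ℂ p (volume : Measure ℝ)) :
    ((g + g' : Lp ℂ p (volume : Measure ℝ)) : 𝓢'(ℝ, ℂ)) = (g : 𝓢'(ℝ, ℂ)) + (g' : 𝓢'(ℝ, ℂ)) :=
  (Lp.toTemperedDistributionCLM ℂ volume p).map_add g g'

theorem coe_smul {p : ℝ≥0∞} [Fact (1 ≤ p)] (c : ℂ) (g : Lp ℂ p (volume : Measure ℝ)) :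
    ((c • g : Lp ℂ p (volume : Measure ℝ)) : 𝓢'(ℝ, ℂ)) = c • (g : 𝓢'(ℝ, ℂ)) :=
  (Lp.toTemperedDistributionCLM ℂ volume p).map_smul c g

theorem coe_zero {p : ℝ≥0∞} [Fact (1 ≤ p)] :
    ((0 : Lp ℂ p (volume : Measure ℝ)) : 𝓢'(ℝ, ℂ)) = 0 :=
  (Lp.toTemperedDistributionCLM ℂ volume p).map_zero

theorem lpNorm_zero {p : ℝ≥0∞} (hp : 1 ≤ p) : lpNorm p 0 = 0 := by
  have : Fact (1 ≤ p) := ⟨hp⟩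
  rw [← coe_zero (p := p), lpNorm_coe]
  simp

theorem eq_zero_of_lpNorm {p : ℝ≥0∞} (hp : 1 ≤ p) {f : 𝓢'(ℝ, ℂ)} (h : lpNorm p f = 0) :
    f = 0 := by
  have : Fact (1 ≤ p) := ⟨hp⟩
  obtain ⟨g, rfl⟩ := exists_coe_eq (p := p) (f := f) (by simp [h])
  rw [lpNorm_coe, enorm_eq_zero] at h
  rw [h, coe_zero]

theorem lpNorm_add_le {p : ℝ≥0∞} (hp : 1 ≤ p) (f f' : 𝓢'(ℝ, ℂ)) :
    lpNorm p (f + f') ≤ lpNorm p f + lpNorm p f' := by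
  have : Fact (1 ≤ p) := ⟨hp⟩
  rcases eq_or_ne (lpNorm p f) ∞ with h | h
  · simp [h]
  rcases eq_or_ne (lpNorm p f') ∞ with h' | h'
  · simp [h']
  obtain ⟨g, rfl⟩ := exists_coe_eq h.lt_top
  obtain ⟨g', rfl⟩ := exists_coe_eq h'.lt_top
  rw [← coe_add, lpNorm_coe, lpNorm_coe, lpNorm_coe]
  exact enorm_add_le _ _

theorem lpNorm_smul_le {p : ℝ≥0∞} (hp : 1 ≤ p) (c : ℂ) (f : 𝓢'(ℝ, ℂ)) :
    lpNorm p (c • f) ≤ ‖c‖ₑ * lpNorm p f := by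
  have : Fact (1 ≤ p) := ⟨hp⟩
  rcases eq_or_ne (lpNorm p f) ∞ with h | h
  · rcases eq_or_ne c 0 with rfl | hc
    · rw [zero_smul ℂ f, lpNorm_zero hp]; exact zero_le
    · rw [h, ENNReal.mul_top (by simpa using hc)]
      exact le_top
  obtain ⟨g, rfl⟩ := exists_coe_eq h.lt_top
  rw [← coe_smul, lpNorm_coe, lpNorm_coe, enorm_smul]

theorem lpNorm_smul {p : ℝ≥0∞} (hp : 1 ≤ p) (c : ℂ) (f : 𝓢'(ℝ, ℂ)) :
    lpNorm p (c • f) = ‖c‖ₑ * lpNorm p f := by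
  rcases eq_or_ne c 0 with rfl | hc
  · rw [zero_smul ℂ f, lpNorm_zero hp]; simp
  refine le_antisymm (lpNorm_smul_le hp c f) ?_
  have h := lpNorm_smul_le hp c⁻¹ (c • f)
  rw [smul_smul, inv_mul_cancel₀ hc, one_smul] at h
  calc ‖c‖ₑ * lpNorm p f ≤ ‖c‖ₑ * (‖c⁻¹‖ₑ * lpNorm p (c • f)) := by gcongr
    _ = lpNorm p (c • f) := by
      rw [← mul_assoc, ← enorm_mul, mul_inv_cancel₀ hc]
      simp

/-- Countable subadditivity along series converging in the sense of distributions. -/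
theorem lpNorm_hasSum_le {ι : Type*} {p : ℝ≥0∞} (hp : 1 ≤ p) (h : ι → 𝓢'(ℝ, ℂ)) (H : 𝓢'(ℝ, ℂ))
    (hH : ∀ ψ : 𝓢(ℝ, ℂ), HasSum (fun i => h i ψ) (H ψ)) :
    lpNorm p H ≤ ∑' i, lpNorm p (h i) := by
  have : Fact (1 ≤ p) := ⟨hp⟩
  rcases eq_or_ne (∑' i, lpNorm p (h i)) ∞ with ht | ht
  · simp [ht]
  choose g hg using fun i => exists_coe_eq (p := p) (f := h i) (ENNReal.ne_top_of_tsum_ne_top ht i).lt_top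
  have hsum : Summable fun i => ‖g i‖ := by
    have : ∀ i, lpNorm p (h i) = ‖g i‖ₑ := fun i => by rw [← hg i, lpNorm_coe]
    simp_rw [this] at ht
    have h2 := ENNReal.summable_toReal ht
    simpa using h2
  -- Absolute convergence in the Banach space L^p provides a sum there; it is `H` because evaluation
  -- at a test function is continuous on L^p.
  have hs : HasSum g (∑' i, g i) := hsum.of_norm.hasSum
  have hHeq : H = ((∑' i, g i : Lp ℂ p (volume : Measure ℝ)) : 𝓢'(ℝ, ℂ)) := by
    ext ψ
    refine (hH ψ).unique ?_
    have h1 := hs.mapL (Lp.toTemperedDistributionCLM ℂ volume p)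
    have h2 := h1.mapL (PointwiseConvergenceCLM.evalCLM (RingHom.id ℂ) ℂ ψ)
    have h3 : (fun i => h i ψ) = fun i => Lp.toTemperedDistribution (g i) ψ :=
      funext fun i => by rw [hg i]
    rw [h3]
    exact h2
  rw [hHeq, lpNorm_coe]
  calc ‖∑' i, g i‖ₑ ≤ ∑' i, ‖g i‖ₑ := enorm_tsum_le_tsum_enorm 
    _ = ∑' i, lpNorm p (h i) := by simp_rw [← hg, lpNorm_coe]

open FourierTransform

/-! ### Algebra of Fourier multipliers -/

theorem hasTemperateGrowth_dilate {m : ℝ → ℂ} (hm : m.HasTemperateGrowth) :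
    (fun y : ℝ => m (2 * Real.pi * y)).HasTemperateGrowth := by
  have h : (fun y : ℝ => 2 * Real.pi * y).HasTemperateGrowth := by fun_prop
  exact hm.comp h

theorem multiplier_apply (m : ℝ → ℂ) (f : 𝓢'(ℝ, ℂ)) (ψ : 𝓢(ℝ, ℂ)) :
    multiplier m f ψ =
      f (𝓕 (SchwartzMap.smulLeftCLM ℂ (fun y : ℝ => m (2 * Real.pi * y)) (𝓕⁻ ψ))) := rfl

theorem multiplier_add (m : ℝ → ℂ) (f f' : 𝓢'(ℝ, ℂ)) :
    multiplier m (f + f') = multiplier m f + multiplier m f' := map_add _ _ _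

theorem multiplier_sub (m : ℝ → ℂ) (f f' : 𝓢'(ℝ, ℂ)) :
    multiplier m (f - f') = multiplier m f - multiplier m f' := map_sub _ _ _

theorem multiplier_smul (m : ℝ → ℂ) (c : ℂ) (f : 𝓢'(ℝ, ℂ)) :
    multiplier m (c • f) = c • multiplier m f := map_smul _ _ _

theorem multiplier_zero (m : ℝ → ℂ) : multiplier m 0 = 0 := map_zero _

theorem multiplier_multiplier {m₁ m₂ : ℝ → ℂ} (h₁ : m₁.HasTemperateGrowth)
    (h₂ : m₂.HasTemperateGrowth) (f : 𝓢'(ℝ, ℂ)) :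
    multiplier m₁ (multiplier m₂ f) = multiplier (fun ξ => m₁ ξ * m₂ ξ) f := by
  unfold multiplier
  rw [TemperedDistribution.fourierMultiplierCLM_fourierMultiplierCLM_apply
    (hasTemperateGrowth_dilate h₂) (hasTemperateGrowth_dilate h₁)]
  congr 2
  ext y
  simp [mul_comm]

theorem multiplier_one (f : 𝓢'(ℝ, ℂ)) : multiplier (fun _ => 1) f = f := by
  unfold multiplier
  rw [TemperedDistribution.fourierMultiplierCLM_const]
  exact one_smul ℂ f

theorem multiplier_fun_add {m₁ m₂ : ℝ → ℂ} (h₁ : m₁.HasTemperateGrowth)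
    (h₂ : m₂.HasTemperateGrowth) (f : 𝓢'(ℝ, ℂ)) :
    multiplier (fun ξ => m₁ ξ + m₂ ξ) f = multiplier m₁ f + multiplier m₂ f := by
  ext ψ
  have := SchwartzMap.smulLeftCLM_add (F := ℂ) (hasTemperateGrowth_dilate h₁)
    (hasTemperateGrowth_dilate h₂)
  have h3 : SchwartzMap.smulLeftCLM ℂ (fun y : ℝ => m₁ (2 * Real.pi * y) + m₂ (2 * Real.pi * y))
      (𝓕⁻ ψ) = SchwartzMap.smulLeftCLM ℂ (fun y : ℝ => m₁ (2 * Real.pi * y)) (𝓕⁻ ψ) +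
       SchwartzMap.smulLeftCLM ℂ (fun y : ℝ => m₂ (2 * Real.pi * y)) (𝓕⁻ ψ) :=
    congrArg (fun T : 𝓢(ℝ, ℂ) →L[ℂ] 𝓢(ℝ, ℂ) => T (𝓕⁻ ψ)) this
  have h4 : (multiplier m₁ f + multiplier m₂ f) ψ = multiplier m₁ f ψ + multiplier m₂ f ψ := rfl
  rw [h4, multiplier_apply, multiplier_apply, multiplier_apply, h3, FourierTransform.fourier_add,
    map_add]

theorem multiplier_fun_smul {m : ℝ → ℂ} (h : m.HasTemperateGrowth) (c : ℂ) (f : 𝓢'(ℝ, ℂ)) :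
    multiplier (fun ξ => c * m ξ) f = c • multiplier m f := by
  have := multiplier_multiplier (m₁ := fun _ => c) (by fun_prop) h f
  rw [← this]
  unfold multiplier
  rw [TemperedDistribution.fourierMultiplierCLM_const]
  rfl

theorem multiplier_fun_zero (f : 𝓢'(ℝ, ℂ)) : multiplier (fun _ => 0) f = 0 := by
  have := multiplier_fun_smul (m := fun _ => 1) (by fun_prop) 0 f
  simp only [zero_mul] at this
  rw [this]
  exact zero_smul ℂ (multiplier (fun _ => 1) f)

theorem multiplier_fun_sub {m₁ m₂ : ℝ → ℂ} (h₁ : m₁.HasTemperateGrowth)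
    (h₂ : m₂.HasTemperateGrowth) (f : 𝓢'(ℝ, ℂ)) :
    multiplier (fun ξ => m₁ ξ - m₂ ξ) f = multiplier m₁ f - multiplier m₂ f := by
  rw [eq_sub_iff_add_eq, ← multiplier_fun_add (by fun_prop) h₂]
  simp

theorem multiplier_fun_sum {ι : Type*} {m : ι → ℝ → ℂ} {s : Finset ι}
    (h : ∀ i ∈ s, (m i).HasTemperateGrowth) (f : 𝓢'(ℝ, ℂ)) :
    multiplier (fun ξ => ∑ i ∈ s, m i ξ) f = ∑ i ∈ s, multiplier (m i) f := by
  classical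
  induction s using Finset.induction_on with
  | empty => simpa using multiplier_fun_zero f
  | insert a s ha ih =>
    simp only [Finset.sum_insert ha]
    rw [multiplier_fun_add (h a (by simp)) (Function.HasTemperateGrowth.sum fun i hi => h i (by simp [hi])),
      ih fun i hi => h i (by simp [hi])]

/-! ### Symbols and their convolution kernels. -/

/-- Smooth compactly supported symbols. -/
structure IsSymbol (m : ℝ → ℂ) : Prop where
  smooth : ContDiff ℝ (⊤ : ℕ∞) m
  compact : HasCompactSupport m

theorem IsSymbol.temperate {m : ℝ → ℂ} (h : IsSymbol m) : m.HasTemperateGrowth :=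
  h.compact.hasTemperateGrowth h.smooth

theorem IsSymbol.mul {m a : ℝ → ℂ} (h : IsSymbol m) (ha : ContDiff ℝ (⊤ : ℕ∞) a) :
    IsSymbol fun ξ => m ξ * a ξ :=
  ⟨h.smooth.mul ha, h.compact.mul_right⟩

theorem IsSymbol.dilate {m : ℝ → ℂ} (h : IsSymbol m) :
    IsSymbol fun y : ℝ => m (2 * Real.pi * y) := by
  refine ⟨h.smooth.comp (by fun_prop), ?_⟩
  have := h.compact.comp_homeomorph (Homeomorph.mulLeft₀ (2 * Real.pi) (by positivity))
  exact this

/-- The convolution kernel `ℱ⁻¹ m` of the multiplier `m(D)`. -/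
def kernel (m : ℝ → ℂ) (x : ℝ) : ℂ := 𝓕⁻ (fun y : ℝ => m (2 * Real.pi * y)) x

/-- The dilated symbol as a Schwartz function. -/
def IsSymbol.toSchwartz {m : ℝ → ℂ} (h : IsSymbol m) : 𝓢(ℝ, ℂ) :=
  h.dilate.compact.toSchwartzMap h.dilate.smooth

theorem IsSymbol.toSchwartz_apply {m : ℝ → ℂ} (h : IsSymbol m) (y : ℝ) :
    h.toSchwartz y = m (2 * Real.pi * y) := rfl

theorem IsSymbol.kernel_eq {m : ℝ → ℂ} (h : IsSymbol m) : kernel m = 𝓕⁻ h.toSchwartz := by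
  rw [SchwartzMap.fourierInv_coe]
  rfl

theorem kernel_apply (m : ℝ → ℂ) (x : ℝ) :
    kernel m x = ∫ y : ℝ, Complex.exp (2 * Real.pi * (y * x) * Complex.I) * m (2 * Real.pi * y) := by
  rw [kernel, Real.fourierInv_eq']
  simp [mul_assoc, mul_comm, mul_left_comm]

theorem IsSymbol.continuous_kernel {m : ℝ → ℂ} (h : IsSymbol m) : Continuous (kernel m) := by
  rw [h.kernel_eq]
  exact SchwartzMap.continuous _

theorem schwartz_decay (κ : 𝓢(ℝ, ℂ)) : ∃ B : ℝ, 0 ≤ B ∧ ∀ x, ‖κ x‖ ≤ B / (1 + x ^ 2) := by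
  obtain ⟨C₀, h₀⟩ := κ.decay 0 0
  obtain ⟨C₂, h₂⟩ := κ.decay 2 0
  refine ⟨C₀ + C₂, ?_, fun x => ?_⟩
  · have := h₀.1
    have := h₂.1
    positivity
  · rw [le_div_iff₀ (by positivity)]
    have a := h₀.2 x
    have b := h₂.2 x
    simp only [pow_zero, one_mul, norm_iteratedFDeriv_zero, Real.norm_eq_abs, sq_abs] at a b
    nlinarith

theorem IsSymbol.kernel_decay {m : ℝ → ℂ} (h : IsSymbol m) :
    ∃ B : ℝ, 0 ≤ B ∧ ∀ x, ‖kernel m x‖ ≤ B / (1 + x ^ 2) := by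
  rw [h.kernel_eq]
  exact schwartz_decay _

/-- Convolution with a kernel. -/
def conv (κ g : ℝ → ℂ) (x : ℝ) : ℂ := ∫ y, κ (x - y) * g y

/-! ### Young's inequality -/

/-- Hölder in y for the splitting W = W^{1-1/q} W^{1/q} leaves ∫ W(x-y) g(y)^q dy, and Tonelli in x
finishes. The case q = 1 has no conjugate exponent and is Tonelli alone. -/
theorem young_lintegral {q : ℝ} (hq : 1 ≤ q) {W g : ℝ → ℝ≥0∞} (hW : Measurable W)
    (hg : AEMeasurable g) :
    ∫⁻ x, (∫⁻ y, W (x - y) * g y) ^ q ≤ (∫⁻ x, W x) ^ q * ∫⁻ y, g y ^ q := by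
  have hWx : ∀ x, Measurable fun y => W (x - y) := fun x => hW.comp (by fun_prop)
  have hint : ∀ x, ∫⁻ y, W (x - y) = ∫⁻ y, W y := fun x =>
    lintegral_sub_left_eq_self W x
  have key : ∀ x, (∫⁻ y, W (x - y) * g y) ^ q ≤
      (∫⁻ y, W y) ^ (q - 1) * ∫⁻ y, W (x - y) * g y ^ q := by
    intro x
    rcases eq_or_lt_of_le hq with rfl | hq1
    · simp
    have hc : (q / (q - 1)).HolderConjugate q := (Real.HolderConjugate.conjExponent hq1).symm
    have h1 : ∀ y, W (x - y) * g y = W (x - y) ^ (1 / (q / (q - 1))) *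
        (W (x - y) ^ (1 / q) * g y) := by
      intro y
      rw [← mul_assoc, ← ENNReal.rpow_add_of_nonneg _ _ (by have := hc.pos; positivity) (by positivity)]
      have : 1 / (q / (q - 1)) + 1 / q = 1 := by simpa using hc.inv_add_inv_eq_one
      rw [this, ENNReal.rpow_one]
    have h2 := ENNReal.lintegral_mul_le_Lp_mul_Lq volume hc
      (f := fun y => W (x - y) ^ (1 / (q / (q - 1)))) (g := fun y => W (x - y) ^ (1 / q) * g y)
      ((hWx x).pow_const _).aemeasurable (((hWx x).pow_const _).aemeasurable.mul hg)
    simp only [Pi.mul_apply] at h2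
    simp_rw [← h1] at h2
    have hq0 : 0 < q := by linarith
    calc (∫⁻ y, W (x - y) * g y) ^ q ≤ _ := ENNReal.rpow_le_rpow h2 hq0.le
      _ = _ := by
        rw [ENNReal.mul_rpow_of_nonneg _ _ hq0.le, ← ENNReal.rpow_mul, ← ENNReal.rpow_mul]
        have e1 : 1 / (q / (q - 1)) * q = q - 1 := by field_simp
        have e2 : 1 / q * q = 1 := by field_simp
        have e3 : ∀ a : ℝ≥0∞, (a ^ (1 / (q / (q - 1)))) ^ (q / (q - 1)) = a := by
          intro a
          rw [← ENNReal.rpow_mul, one_div_mul_cancel hc.pos.ne', ENNReal.rpow_one]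
        have e4 : ∀ y, (W (x - y) ^ (1 / q) * g y) ^ q = W (x - y) * g y ^ q := by
          intro y
          rw [ENNReal.mul_rpow_of_nonneg _ _ hq0.le, ← ENNReal.rpow_mul, e2, ENNReal.rpow_one]
        simp_rw [e3, e4, e1, e2, ENNReal.rpow_one, hint]
  calc ∫⁻ x, (∫⁻ y, W (x - y) * g y) ^ q
      ≤ ∫⁻ x, (∫⁻ y, W y) ^ (q - 1) * ∫⁻ y, W (x - y) * g y ^ q := lintegral_mono key
    _ = (∫⁻ y, W y) ^ (q - 1) * ∫⁻ x, ∫⁻ y, W (x - y) * g y ^ q := by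
      refine lintegral_const_mul'' _ ?_
      refine AEMeasurable.lintegral_prod_right' (f := fun z : ℝ × ℝ => W (z.1 - z.2) * g z.2 ^ q) ?_
      exact (hW.comp (by fun_prop)).aemeasurable.mul ((hg.comp_snd).pow_const _)
    _ = (∫⁻ y, W y) ^ (q - 1) * ((∫⁻ y, W y) * ∫⁻ y, g y ^ q) := by
      congr 1
      rw [lintegral_lintegral_swap]
      · rw [← lintegral_const_mul'' _ (hg.pow_const q)]
        refine lintegral_congr fun y => ?_
        have hWy : Measurable fun x => W (x - y) := hW.comp (by fun_prop)
        rw [lintegral_mul_const _ hWy, lintegral_sub_right_eq_self W y]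
      · exact (hW.comp (by fun_prop)).aemeasurable.mul ((hg.comp_snd).pow_const _)
    _ = _ := by
      rw [← mul_assoc]
      congr 1
      nth_rw 2 [← ENNReal.rpow_one (∫⁻ y, W y)]
      rw [← ENNReal.rpow_add_of_nonneg _ _ (by linarith) (by norm_num)]
      simp

/-- The weight `1 / (1 + x²)` in `ℝ≥0∞`. -/
def cauchyWeight (x : ℝ) : ℝ≥0∞ := ENNReal.ofReal (1 / (1 + x ^ 2))

theorem measurable_cauchyWeight : Measurable cauchyWeight := by
  unfold cauchyWeight
  fun_prop

theorem cauchyWeight_le_one (x : ℝ) : cauchyWeight x ≤ 1 := by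
  unfold cauchyWeight
  rw [ENNReal.ofReal_le_one, div_le_one (by positivity)]
  nlinarith [sq_nonneg x]

theorem lintegral_cauchyWeight : ∫⁻ x, cauchyWeight x = ENNReal.ofReal Real.pi := by
  unfold cauchyWeight
  rw [← ofReal_integral_eq_lintegral_ofReal]
  · simp [integral_univ_inv_one_add_sq]
  · simpa using integrable_inv_one_add_sq
  · filter_upwards with x
    positivity

theorem lintegral_cauchyWeight_le : ∫⁻ x, cauchyWeight x ≤ 4 := by
  rw [lintegral_cauchyWeight]
  refine ENNReal.ofReal_le_of_le_toReal ?_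
  simpa using Real.pi_le_four

/-- Hölder's inequality against the weight `1 / (1 + x²)`. -/
theorem lintegral_cauchyWeight_mul_le {q : ℝ≥0∞} (hq : 1 ≤ q) {g : ℝ → ℂ}
    (hg : AEStronglyMeasurable g volume) (x : ℝ) :
    ∫⁻ y, cauchyWeight (x - y) * ‖g y‖ₑ ≤ 4 * eLpNorm g q volume := by
  rcases eq_or_ne q ∞ with rfl | hq'
  · calc ∫⁻ y, cauchyWeight (x - y) * ‖g y‖ₑ
        ≤ ∫⁻ y, cauchyWeight (x - y) * eLpNorm g ∞ volume := by
          refine lintegral_mono_ae ?_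
          filter_upwards [ae_le_eLpNormEssSup (f := g) (μ := volume)] with y hy
          rw [eLpNorm_exponent_top]
          gcongr
      _ = (∫⁻ y, cauchyWeight (x - y)) * eLpNorm g ∞ volume :=
          lintegral_mul_const _ (measurable_cauchyWeight.comp (by fun_prop))
      _ ≤ 4 * eLpNorm g ∞ volume := by
          rw [lintegral_sub_left_eq_self cauchyWeight x]
          gcongr
          exact lintegral_cauchyWeight_le
  have hr : 1 ≤ q.toReal := by
    have := ENNReal.toReal_mono hq' hq
    simpa using this
  have hr0 : 0 < q.toReal := by linarith
  have hq0 : q ≠ 0 := by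
    rintro rfl
    simp at hq
  rw [eLpNorm_eq_lintegral_rpow_enorm_toReal hq0 hq']
  set r := q.toReal
  rcases eq_or_lt_of_le hr with h1 | h1
  · rw [← h1]
    simp only [ENNReal.rpow_one, div_one]
    calc ∫⁻ y, cauchyWeight (x - y) * ‖g y‖ₑ ≤ ∫⁻ y, 1 * ‖g y‖ₑ := by
          gcongr
          exact cauchyWeight_le_one _
      _ ≤ 4 * ∫⁻ y, ‖g y‖ₑ := by
          simp only [one_mul]
          exact le_mul_of_one_le_left' (by norm_num)
  · have hc : (r / (r - 1)).HolderConjugate r := (Real.HolderConjugate.conjExponent h1).symm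
    refine (ENNReal.lintegral_mul_le_Lp_mul_Lq volume hc
      (f := fun y => cauchyWeight (x - y)) (g := fun y => ‖g y‖ₑ)
      (measurable_cauchyWeight.comp (by fun_prop)).aemeasurable hg.enorm).trans ?_
    gcongr
    -- The weight is at most 1, so its powers with exponent ≥ 1 lie below it and have mass at most π
    -- ≤ 4.
    calc (∫⁻ y, cauchyWeight (x - y) ^ (r / (r - 1))) ^ (1 / (r / (r - 1)))
        ≤ (4 : ℝ≥0∞) ^ (1 / (r / (r - 1))) := by
          refine ENNReal.rpow_le_rpow ?_ (by have := hc.pos; positivity)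
          calc ∫⁻ y, cauchyWeight (x - y) ^ (r / (r - 1)) ≤ ∫⁻ y, cauchyWeight (x - y) := by
                refine lintegral_mono fun y => ?_
                exact ENNReal.rpow_le_self_of_le_one (cauchyWeight_le_one _) hc.lt.le
            _ ≤ 4 := by
                rw [lintegral_sub_left_eq_self cauchyWeight x]
                exact lintegral_cauchyWeight_le
      _ ≤ (4 : ℝ≥0∞) ^ (1 : ℝ) := by
          refine ENNReal.rpow_le_rpow_of_exponent_le (by norm_num) ?_
          rw [div_le_one hc.pos]
          exact hc.lt.le
      _ = 4 := by simp

theorem enorm_le_cauchyWeight {κ : ℝ → ℂ} {B : ℝ} (hB : 0 ≤ B)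
    (hκ : ∀ x, ‖κ x‖ ≤ B / (1 + x ^ 2)) (x : ℝ) :
    ‖κ x‖ₑ ≤ ENNReal.ofReal B * cauchyWeight x := by
  rw [cauchyWeight, ← ENNReal.ofReal_mul hB, ← ofReal_norm]
  refine ENNReal.ofReal_le_ofReal ((hκ x).trans_eq ?_)
  ring

theorem enorm_conv_le {κ g : ℝ → ℂ} (x : ℝ) :
    ‖conv κ g x‖ₑ ≤ ∫⁻ y, ‖κ (x - y)‖ₑ * ‖g y‖ₑ := by
  refine (enorm_integral_le_lintegral_enorm _).trans_eq ?_
  simp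

theorem aestronglyMeasurable_conv {κ g : ℝ → ℂ} (hκ : Continuous κ)
    (hg : AEStronglyMeasurable g volume) : AEStronglyMeasurable (conv κ g) volume := by
  refine AEStronglyMeasurable.integral_prod_right'
    (f := fun z : ℝ × ℝ => κ (z.1 - z.2) * g z.2) ?_
  exact (hκ.comp (by fun_prop)).aestronglyMeasurable.mul hg.comp_snd

theorem enorm_conv_le_weight {κ g : ℝ → ℂ} {B : ℝ} (hB : 0 ≤ B)
    (hκ : ∀ x, ‖κ x‖ ≤ B / (1 + x ^ 2)) (x : ℝ) :
    ‖conv κ g x‖ₑ ≤ ENNReal.ofReal B * ∫⁻ y, cauchyWeight (x - y) * ‖g y‖ₑ := by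
  refine enorm_conv_le x |>.trans ?_
  rw [← lintegral_const_mul' _ _ ENNReal.ofReal_ne_top]
  refine lintegral_mono fun y => ?_
  rw [← mul_assoc]
  gcongr
  exact enorm_le_cauchyWeight hB hκ _

theorem enorm_conv_le_eLpNorm {q : ℝ≥0∞} (hq : 1 ≤ q) {κ g : ℝ → ℂ} {B : ℝ} (hB : 0 ≤ B)
    (hκ : ∀ x, ‖κ x‖ ≤ B / (1 + x ^ 2)) (hg : AEStronglyMeasurable g volume) (x : ℝ) :
    ‖conv κ g x‖ₑ ≤ ENNReal.ofReal (4 * B) * eLpNorm g q volume := by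
  refine (enorm_conv_le_weight hB hκ x).trans ?_
  rw [ENNReal.ofReal_mul (by norm_num), mul_comm (ENNReal.ofReal 4), mul_assoc]
  gcongr
  simpa using lintegral_cauchyWeight_mul_le hq hg x

theorem eLpNorm_conv_le {q : ℝ≥0∞} (hq : 1 ≤ q) {κ g : ℝ → ℂ} {B : ℝ} (hB : 0 ≤ B)
    (hκ : ∀ x, ‖κ x‖ ≤ B / (1 + x ^ 2)) (hg : AEStronglyMeasurable g volume) :
    eLpNorm (conv κ g) q volume ≤ ENNReal.ofReal (4 * B) * eLpNorm g q volume := by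
  rcases eq_or_ne q ∞ with rfl | hq'
  · rw [eLpNorm_exponent_top]
    refine eLpNormEssSup_le_of_ae_enorm_bound ?_
    filter_upwards with x
    exact enorm_conv_le_eLpNorm hq hB hκ hg x
  have hr : 1 ≤ q.toReal := by simpa using ENNReal.toReal_mono hq' hq
  have hr0 : 0 < q.toReal := by linarith
  have hq0 : q ≠ 0 := by
    rintro rfl
    simp at hq
  rw [eLpNorm_eq_lintegral_rpow_enorm_toReal hq0 hq', eLpNorm_eq_lintegral_rpow_enorm_toReal hq0 hq']
  set r := q.toReal
  have h := young_lintegral hr measurable_cauchyWeight hg.enorm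
  have h2 : ∫⁻ x, ‖conv κ g x‖ₑ ^ r ≤ ENNReal.ofReal (4 * B) ^ r * ∫⁻ y, ‖g y‖ₑ ^ r := by
    calc ∫⁻ x, ‖conv κ g x‖ₑ ^ r
        ≤ ∫⁻ x, ENNReal.ofReal B ^ r * (∫⁻ y, cauchyWeight (x - y) * ‖g y‖ₑ) ^ r := by
          refine lintegral_mono fun x => ?_
          rw [← ENNReal.mul_rpow_of_nonneg _ _ hr0.le]
          exact ENNReal.rpow_le_rpow (enorm_conv_le_weight hB hκ x) hr0.le
      _ = ENNReal.ofReal B ^ r * ∫⁻ x, (∫⁻ y, cauchyWeight (x - y) * ‖g y‖ₑ) ^ r := by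
          exact lintegral_const_mul' _ _ (by simp [hr0.le])
      _ ≤ ENNReal.ofReal B ^ r * ((4 : ℝ≥0∞) ^ r * ∫⁻ y, ‖g y‖ₑ ^ r) := by
          gcongr
          refine h.trans ?_
          gcongr
          exact lintegral_cauchyWeight_le
      _ = _ := by
          rw [← mul_assoc, ← ENNReal.mul_rpow_of_nonneg _ _ hr0.le, mul_comm 4 B,
            ENNReal.ofReal_mul hB]
          simp
  calc (∫⁻ x, ‖conv κ g x‖ₑ ^ r) ^ (1 / r)
      ≤ (ENNReal.ofReal (4 * B) ^ r * ∫⁻ y, ‖g y‖ₑ ^ r) ^ (1 / r) :=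
        ENNReal.rpow_le_rpow h2 (by positivity)
    _ = _ := by
        rw [ENNReal.mul_rpow_of_nonneg _ _ (by positivity), ← ENNReal.rpow_mul,
          mul_one_div_cancel hr0.ne', ENNReal.rpow_one]

/-- A function in `L^q ∩ L^∞` is in `L^{q₂}` for `q ≤ q₂`. -/
theorem eLpNorm_le_of_le_top {q q₂ : ℝ≥0∞} (hq : 1 ≤ q) (hqq : q ≤ q₂) {h : ℝ → ℂ} {a : ℝ≥0∞}
    (h₁ : eLpNorm h q volume ≤ a) (h₂ : ∀ᵐ x, ‖h x‖ₑ ≤ a) : eLpNorm h q₂ volume ≤ a := by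
  rcases eq_or_ne q₂ ∞ with rfl | hq2
  · rw [eLpNorm_exponent_top]
    exact eLpNormEssSup_le_of_ae_enorm_bound h₂
  have hq' : q ≠ ∞ := (hqq.trans_lt hq2.lt_top).ne
  have hr : 1 ≤ q.toReal := by simpa using ENNReal.toReal_mono hq' hq
  have hrr : q.toReal ≤ q₂.toReal := ENNReal.toReal_mono hq2 hqq
  have hq0 : q ≠ 0 := by
    rintro rfl
    simp at hq
  have hq20 : q₂ ≠ 0 := by
    rintro rfl
    simp at hqq
    exact hq0 hqq
  rw [eLpNorm_eq_lintegral_rpow_enorm_toReal hq0 hq'] at h₁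
  rw [eLpNorm_eq_lintegral_rpow_enorm_toReal hq20 hq2]
  set r := q.toReal
  set r₂ := q₂.toReal
  have h3 : ∫⁻ x, ‖h x‖ₑ ^ r ≤ a ^ r := by
    have := ENNReal.rpow_le_rpow h₁ (z := r) (by linarith)
    rwa [← ENNReal.rpow_mul, one_div_mul_cancel (by linarith), ENNReal.rpow_one] at this
  rcases eq_or_ne a ∞ with rfl | ha
  · exact le_top
  calc (∫⁻ x, ‖h x‖ₑ ^ r₂) ^ (1 / r₂) ≤ (a ^ (r₂ - r) * ∫⁻ x, ‖h x‖ₑ ^ r) ^ (1 / r₂) := by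
        refine ENNReal.rpow_le_rpow ?_ (by have : 0 < r₂ := by linarith
                                           positivity)
        rw [← lintegral_const_mul' _ _ (ENNReal.rpow_ne_top_of_nonneg (by linarith) ha)]
        refine lintegral_mono_ae ?_
        filter_upwards [h₂] with x hx
        calc ‖h x‖ₑ ^ r₂ = ‖h x‖ₑ ^ (r₂ - r) * ‖h x‖ₑ ^ r := by
              rw [← ENNReal.rpow_add_of_nonneg _ _ (by linarith) (by linarith)]
              simp
          _ ≤ _ := by
              gcongr
    _ ≤ (a ^ (r₂ - r) * a ^ r) ^ (1 / r₂) := by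
        gcongr
    _ = a := by
        rw [← ENNReal.rpow_add_of_nonneg _ _ (by linarith) (by linarith), ← ENNReal.rpow_mul]
        have : (r₂ - r + r) * (1 / r₂) = 1 := by
          have : r₂ ≠ 0 := by linarith
          field_simp
          ring
        rw [this, ENNReal.rpow_one]

theorem eLpNorm_conv_le_of_le {q q₂ : ℝ≥0∞} (hq : 1 ≤ q) (hqq : q ≤ q₂) {κ g : ℝ → ℂ} {B : ℝ}
    (hB : 0 ≤ B) (hκ : ∀ x, ‖κ x‖ ≤ B / (1 + x ^ 2)) (hg : AEStronglyMeasurable g volume) :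
    eLpNorm (conv κ g) q₂ volume ≤ ENNReal.ofReal (4 * B) * eLpNorm g q volume :=
  eLpNorm_le_of_le_top hq hqq (eLpNorm_conv_le hq hB hκ hg)
    (Eventually.of_forall fun x => enorm_conv_le_eLpNorm hq hB hκ hg x)

/-! ### Multipliers as convolutions -/

/-- Writing both transforms as integrals and exchanging them turns the transposed multiplier into
convolution with the reflected kernel, the form needed for testing a distribution. -/
theorem fourier_symbol_mul {m : ℝ → ℂ} (hm : IsSymbol m) (ψ : 𝓢(ℝ, ℂ)) (y : ℝ) :
    𝓕 (SchwartzMap.smulLeftCLM ℂ (fun y : ℝ => m (2 * Real.pi * y)) (𝓕⁻ ψ)) y =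
      ∫ x, kernel m (x - y) * ψ x := by
  have hM := hasTemperateGrowth_dilate hm.temperate
  set M := hm.toSchwartz
  have hint : Integrable (Function.uncurry fun (ξ x : ℝ) =>
      Complex.exp (2 * Real.pi * (ξ * (x - y)) * Complex.I) * (M ξ * ψ x)) (volume.prod volume) := by
    refine ((M.integrable (μ := volume)).mul_prod (ψ.integrable (μ := volume))).mono ?_ ?_
    · refine Continuous.aestronglyMeasurable ?_
      have h1 := M.continuous
      have h2 := ψ.continuous
      simp only [Function.uncurry_def]
      fun_prop
    · filter_upwards with z
      simp only [Function.uncurry_def]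
      rw [norm_mul]
      have : ‖Complex.exp (2 * Real.pi * (z.1 * (z.2 - y)) * Complex.I)‖ = 1 := by
        have := Complex.norm_exp_ofReal_mul_I (2 * Real.pi * (z.1 * (z.2 - y)))
        push_cast at this
        exact this
      rw [this, one_mul]
  calc 𝓕 (SchwartzMap.smulLeftCLM ℂ (fun y : ℝ => m (2 * Real.pi * y)) (𝓕⁻ ψ)) y
      = ∫ ξ : ℝ, ∫ x : ℝ, Complex.exp (2 * Real.pi * (ξ * (x - y)) * Complex.I) * (M ξ * ψ x) := by
        rw [SchwartzMap.fourier_coe, Real.fourier_eq']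
        refine integral_congr_ae (Eventually.of_forall fun ξ => ?_)
        simp only
        rw [SchwartzMap.smulLeftCLM_apply_apply hM, SchwartzMap.fourierInv_coe, Real.fourierInv_eq',
          smul_eq_mul, smul_eq_mul, ← integral_const_mul, ← integral_const_mul]
        refine integral_congr_ae (Eventually.of_forall fun x => ?_)
        simp only [smul_eq_mul]
        have : Complex.exp (2 * Real.pi * (ξ * (x - y)) * Complex.I) =
          Complex.exp (((-2 * Real.pi * inner ℝ ξ y : ℝ) : ℂ) * Complex.I) *
            Complex.exp (((2 * Real.pi * inner ℝ x ξ : ℝ) : ℂ) * Complex.I) := by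
          rw [← Complex.exp_add]
          congr 1
          simp
          ring
        rw [this, hm.toSchwartz_apply]
        ring
    _ = ∫ x : ℝ, ∫ ξ : ℝ, Complex.exp (2 * Real.pi * (ξ * (x - y)) * Complex.I) * (M ξ * ψ x) :=
        integral_integral_swap hint
    _ = _ := by
        refine integral_congr_ae (Eventually.of_forall fun x => ?_)
        simp only
        rw [kernel_apply, ← integral_mul_const]
        refine integral_congr_ae (Eventually.of_forall fun ξ => ?_)
        simp only
        rw [hm.toSchwartz_apply]
        push_cast
        ring

/-- Fubini; the double integral converges because the inner one is bounded uniformly in x by Hölder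
against the weight 1/(1+x²). -/
theorem integral_mul_conv {κ : ℝ → ℂ} (hκc : Continuous κ) {B : ℝ} (hB : 0 ≤ B)
    (hκ : ∀ x, ‖κ x‖ ≤ B / (1 + x ^ 2)) {ψ : ℝ → ℂ} (hψ : Integrable ψ) {q : ℝ≥0∞} (hq : 1 ≤ q)
    {g : ℝ → ℂ} (hg : MemLp g q volume) :
    ∫ x, ψ x * conv κ g x = ∫ y, (∫ x, κ (x - y) * ψ x) * g y := by
  have hmeas : AEStronglyMeasurable (Function.uncurry fun (x y : ℝ) =>
      ψ x * (κ (x - y) * g y)) (volume.prod volume) := by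
    have h2 : Continuous fun z : ℝ × ℝ => κ (z.1 - z.2) := hκc.comp (by fun_prop)
    exact hψ.1.comp_fst.mul (h2.aestronglyMeasurable.mul hg.1.comp_snd)
  have hint : Integrable (Function.uncurry fun (x y : ℝ) =>
      ψ x * (κ (x - y) * g y)) (volume.prod volume) := by
    refine ⟨hmeas, ?_⟩
    unfold HasFiniteIntegral
    rw [lintegral_prod _ hmeas.enorm]
    calc ∫⁻ x, ∫⁻ y, ‖ψ x * (κ (x - y) * g y)‖ₑ
        ≤ ∫⁻ x, ‖ψ x‖ₑ * (ENNReal.ofReal (4 * B) * eLpNorm g q volume) := by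
          refine lintegral_mono fun x => ?_
          simp_rw [enorm_mul]
          rw [lintegral_const_mul' _ _ enorm_ne_top]
          gcongr
          have h1 : ∫⁻ y, ‖κ (x - y)‖ₑ * ‖g y‖ₑ ≤
              ENNReal.ofReal B * ∫⁻ y, cauchyWeight (x - y) * ‖g y‖ₑ := by
            rw [← lintegral_const_mul' _ _ ENNReal.ofReal_ne_top]
            refine lintegral_mono fun y => ?_
            rw [← mul_assoc]
            gcongr
            exact enorm_le_cauchyWeight hB hκ _
          refine h1.trans ?_
          rw [ENNReal.ofReal_mul (by norm_num), mul_comm (ENNReal.ofReal 4), mul_assoc]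
          gcongr
          simpa using lintegral_cauchyWeight_mul_le hq hg.1 x
      _ = (∫⁻ x, ‖ψ x‖ₑ) * (ENNReal.ofReal (4 * B) * eLpNorm g q volume) :=
          lintegral_mul_const'' _ hψ.1.enorm
      _ < ∞ := by
          refine ENNReal.mul_lt_top hψ.2 (ENNReal.mul_lt_top ENNReal.ofReal_lt_top hg.2)
  calc ∫ x, ψ x * conv κ g x = ∫ x, ∫ y, ψ x * (κ (x - y) * g y) := by
        refine integral_congr_ae (Eventually.of_forall fun x => ?_)
        simp only [conv]
        rw [integral_const_mul]
    _ = ∫ y, ∫ x, ψ x * (κ (x - y) * g y) := integral_integral_swap hint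
    _ = _ := by
        refine integral_congr_ae (Eventually.of_forall fun y => ?_)
        simp only
        rw [← integral_mul_const]
        refine integral_congr_ae (Eventually.of_forall fun x => ?_)
        simp only
        ring

/-- `m(D) f` is given by the convolution with the kernel of `m`. -/
theorem isRep_multiplier {m : ℝ → ℂ} (hm : IsSymbol m) {q : ℝ≥0∞} (hq : 1 ≤ q) {f : 𝓢'(ℝ, ℂ)}
    {g : ℝ → ℂ} (hg : MemLp g q volume) (h : IsRep f g) :
    IsRep (multiplier m f) (conv (kernel m) g) := by
  intro ψ
  obtain ⟨B, hB, hκ⟩ := hm.kernel_decay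
  rw [multiplier_apply, h, integral_mul_conv hm.continuous_kernel hB hκ ψ.integrable hq hg]
  refine integral_congr_ae (Eventually.of_forall fun y => ?_)
  simp only
  rw [fourier_symbol_mul hm]

theorem memLp_conv {m : ℝ → ℂ} (hm : IsSymbol m) {q q₂ : ℝ≥0∞} (hq : 1 ≤ q) (hqq : q ≤ q₂)
    {g : ℝ → ℂ} (hg : MemLp g q volume) : MemLp (conv (kernel m) g) q₂ volume := by
  obtain ⟨B, hB, hκ⟩ := hm.kernel_decay
  exact ⟨aestronglyMeasurable_conv hm.continuous_kernel hg.1,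
    (eLpNorm_conv_le_of_le hq hqq hB hκ hg.1).trans_lt
      (ENNReal.mul_lt_top ENNReal.ofReal_lt_top hg.2)⟩

/-- Multipliers with decaying kernels act on `L^q`, and from `L^q` to `L^{q₂}`, `q ≤ q₂`. -/
theorem lpNorm_multiplier_le {m : ℝ → ℂ} (hm : IsSymbol m) {q q₂ : ℝ≥0∞} (hq : 1 ≤ q)
    (hqq : q ≤ q₂) {B : ℝ} (hB : 0 < B) (hκ : ∀ x, ‖kernel m x‖ ≤ B / (1 + x ^ 2))
    (f : 𝓢'(ℝ, ℂ)) :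
    lpNorm q₂ (multiplier m f) ≤ ENNReal.ofReal (4 * B) * lpNorm q f := by
  rcases eq_or_ne (lpNorm q f) ∞ with h | h
  · rw [h, ENNReal.mul_top]
    · exact le_top
    · simpa using hB
  obtain ⟨g, hg, hfg⟩ := exists_rep h.lt_top
  rw [lpNorm_eq hq hg hfg]
  exact (lpNorm_le (memLp_conv hm hq hqq hg) (isRep_multiplier hm hq hg hfg)).trans
    (eLpNorm_conv_le_of_le hq hqq hB.le hκ hg.1)

/-- Bounded symbols act on `L²`. -/
theorem lpNorm_two_multiplier_le {m : ℝ → ℂ} (hm : m.HasTemperateGrowth) {B : ℝ}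
    (hB : 0 < B) (hmB : ∀ ξ, ‖m ξ‖ ≤ B) (f : 𝓢'(ℝ, ℂ)) :
    lpNorm 2 (multiplier m f) ≤ ENNReal.ofReal B * lpNorm 2 f := by
  rcases eq_or_ne (lpNorm 2 f) ∞ with h | h
  · rw [h, ENNReal.mul_top]
    · exact le_top
    · simpa using hB
  have : Fact ((1 : ℝ≥0∞) ≤ 2) := ⟨by norm_num⟩
  obtain ⟨g, rfl⟩ := exists_coe_eq h.lt_top
  have hM := hasTemperateGrowth_dilate hm
  have hML : MemLp (fun y : ℝ => m (2 * Real.pi * y)) ∞ volume :=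
    memLp_top_of_bound hM.1.continuous.aestronglyMeasurable B
      (Eventually.of_forall fun x => hmB _)
  -- The Fourier transform on `Lp` conjugates the multiplier to multiplication by a bounded
  -- function, so Plancherel gives the bound.
  have key : multiplier m (g : 𝓢'(ℝ, ℂ)) =
      ((𝓕⁻ ((hML.toLp _) • (𝓕 g) : Lp ℂ 2 (volume : Measure ℝ)) : Lp ℂ 2 (volume : Measure ℝ)) :
        𝓢'(ℝ, ℂ)) := by
    unfold multiplier
    rw [TemperedDistribution.fourierMultiplierCLM_apply, Lp.fourier_toTemperedDistribution_eq,
      ← Lp.toTemperedDistribution_smul_eq (p := ∞) (q := 2) (r := 2) hM hML,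
      Lp.fourierInv_toTemperedDistribution_eq]
  rw [key, lpNorm_coe, lpNorm_coe]
  have h1 : ‖(𝓕⁻ ((hML.toLp _) • (𝓕 g) : Lp ℂ 2 (volume : Measure ℝ)) :
      Lp ℂ 2 (volume : Measure ℝ))‖ ≤ B * ‖g‖ := by
    calc ‖(𝓕⁻ ((hML.toLp _) • (𝓕 g) : Lp ℂ 2 (volume : Measure ℝ)) :
      Lp ℂ 2 (volume : Measure ℝ))‖ = ‖((hML.toLp _) • (𝓕 g) : Lp ℂ 2 (volume : Measure ℝ))‖ := by
          rw [← Lp.norm_fourier_eq, fourier_fourierInv_eq]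
      _ ≤ ‖hML.toLp _‖ * ‖𝓕 g‖ := Lp.norm_smul_le _ _
      _ ≤ B * ‖g‖ := by
          rw [Lp.norm_fourier_eq]
          gcongr
          rw [Lp.norm_toLp]
          refine ENNReal.toReal_le_of_le_ofReal hB.le ?_
          rw [eLpNorm_exponent_top]
          refine eLpNormEssSup_le_of_ae_enorm_bound (Eventually.of_forall fun x => ?_)
          rw [← ofReal_norm]
          exact ENNReal.ofReal_le_ofReal (hmB _)
  rw [← ofReal_norm, ← ofReal_norm, ← ENNReal.ofReal_mul hB.le]
  exact ENNReal.ofReal_le_ofReal h1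

theorem eLpNorm_two_conv_le {m : ℝ → ℂ} (hm : IsSymbol m) {B : ℝ} (hB : 0 < B)
    (hmB : ∀ ξ, ‖m ξ‖ ≤ B) {g : ℝ → ℂ} (hg : MemLp g 2 volume) :
    eLpNorm (conv (kernel m) g) 2 volume ≤ ENNReal.ofReal B * eLpNorm g 2 volume := by
  have : Fact ((1 : ℝ≥0∞) ≤ 2) := ⟨by norm_num⟩
  have h2 : (1 : ℝ≥0∞) ≤ 2 := by norm_num
  have hr := isRep_toLp hg
  rw [← lpNorm_eq h2 (memLp_conv hm h2 le_rfl hg) (isRep_multiplier hm h2 hg hr),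
    ← lpNorm_eq h2 hg hr]
  exact lpNorm_two_multiplier_le hm.temperate hB hmB _

/-! ### Interpolation between `L¹ → L^∞` and `L² → L²` -/

theorem integrable_conv_integrand {q : ℝ≥0∞} (hq : 1 ≤ q) {κ g : ℝ → ℂ} {B : ℝ} (hB : 0 ≤ B)
    (hκc : Continuous κ) (hκ : ∀ x, ‖κ x‖ ≤ B / (1 + x ^ 2)) (hg : MemLp g q volume) (x : ℝ) :
    Integrable fun y => κ (x - y) * g y := by
  have h2 : Continuous fun y : ℝ => κ (x - y) := hκc.comp (by fun_prop)
  refine ⟨h2.aestronglyMeasurable.mul hg.1, ?_⟩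
  unfold HasFiniteIntegral
  calc ∫⁻ y, ‖κ (x - y) * g y‖ₑ ≤ ∫⁻ y, ENNReal.ofReal B * (cauchyWeight (x - y) * ‖g y‖ₑ) := by
        refine lintegral_mono fun y => ?_
        rw [enorm_mul, ← mul_assoc]
        gcongr
        exact enorm_le_cauchyWeight hB hκ _
    _ = ENNReal.ofReal B * ∫⁻ y, cauchyWeight (x - y) * ‖g y‖ₑ :=
        lintegral_const_mul' _ _ ENNReal.ofReal_ne_top
    _ < ∞ := ENNReal.mul_lt_top ENNReal.ofReal_lt_top
        ((lintegral_cauchyWeight_mul_le hq hg.1 x).trans_lt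
          (ENNReal.mul_lt_top (by norm_num) hg.2))

theorem lintegral_Ioc_rpow {a c : ℝ} (ha : -1 < a) (hc : 0 ≤ c) :
    ∫⁻ s in Set.Ioc 0 c, ENNReal.ofReal (s ^ a) = ENNReal.ofReal (c ^ (a + 1) / (a + 1)) := by
  rw [← ofReal_integral_eq_lintegral_ofReal]
  · rw [← intervalIntegral.integral_of_le hc, integral_rpow (Or.inl ha)]
    rw [Real.zero_rpow (by linarith), sub_zero]
  · have := (intervalIntegral.intervalIntegrable_rpow' (a := 0) (b := c) ha)
    rwa [intervalIntegrable_iff_integrableOn_Ioc_of_le hc] at this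
  · filter_upwards [ae_restrict_mem measurableSet_Ioc] with s hs
    exact Real.rpow_nonneg hs.1.le _

/-- The measure of the superlevel sets in the interpolation argument. -/
theorem volume_superlevel_conv_le {κ g : ℝ → ℂ} {A B b I s a : ℝ} (hA : 0 < A) (hB : 0 < B)
    (hb : 0 ≤ b) (hκc : Continuous κ) (hκb : ∀ x, ‖κ x‖ ≤ b / (1 + x ^ 2))
    (hκA : ∀ x, ‖κ x‖ ≤ A)
    (hL2 : ∀ h : ℝ → ℂ, MemLp h 2 volume →
      eLpNorm (conv κ h) 2 volume ≤ ENNReal.ofReal B * eLpNorm h 2 volume)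
    (hgm : Measurable g) {q : ℝ≥0∞} (hq : 1 ≤ q) (hg : MemLp g q volume) (ha : 0 < a)
    (hI : ∫⁻ x, ENNReal.ofReal (‖g x‖ ^ (1 + a)) = ENNReal.ofReal I) (hI0 : 0 < I) (hs : 0 < s) :
    volume {x | s < ‖conv κ g x‖} ≤ ENNReal.ofReal (4 * B ^ 2 / s ^ 2) *
      ∫⁻ x, Set.indicator {x | ‖g x‖ ^ a * s ≤ 2 * A * I} (fun x => ‖g x‖ₑ ^ 2) x := by
  -- The function is cut at the height where |g|^a = 2AI/s. Above it A|g| ≤ s|g|^{1+a}/(2I), so that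
  -- part of the convolution never exceeds s/2; the part below is left to Chebyshev in L².
  set F : Set ℝ := {x | ‖g x‖ ^ a * s ≤ 2 * A * I} with hF
  have hFm : MeasurableSet F := measurableSet_le (by fun_prop) measurable_const
  have hq2 : MemLp (F.indicator g) q volume := hg.indicator hFm
  have hq1 : MemLp (Fᶜ.indicator g) q volume := hg.indicator hFm.compl
  have hsplit : ∀ x, conv κ g x = conv κ (Fᶜ.indicator g) x + conv κ (F.indicator g) x := by
    intro x
    unfold conv
    rw [← integral_add (integrable_conv_integrand hq hb hκc hκb hq1 x)
      (integrable_conv_integrand hq hb hκc hκb hq2 x)]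
    refine integral_congr_ae (Eventually.of_forall fun y => ?_)
    simp only
    rw [← mul_add]
    congr 1
    by_cases hy : y ∈ F <;> simp [hy]
  have h1 : ∀ x, ‖conv κ (Fᶜ.indicator g) x‖ ≤ s / 2 := by
    intro x
    have : ‖conv κ (Fᶜ.indicator g) x‖ₑ ≤ ENNReal.ofReal (s / 2) := by
      calc ‖conv κ (Fᶜ.indicator g) x‖ₑ ≤ ∫⁻ y, ‖κ (x - y)‖ₑ * ‖Fᶜ.indicator g y‖ₑ :=
            enorm_conv_le x
        _ ≤ ∫⁻ y, ENNReal.ofReal (s / (2 * I)) * ENNReal.ofReal (‖g y‖ ^ (1 + a)) := by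
            refine lintegral_mono fun y => ?_
            by_cases hy : y ∈ F
            · simp [hy]
            · have hy' : 2 * A * I < ‖g y‖ ^ a * s := by simpa [hF] using hy
              rw [Set.indicator_of_mem (by simpa using hy), ← ofReal_norm, ← ofReal_norm,
                ← ENNReal.ofReal_mul (by positivity), ← ENNReal.ofReal_mul (by positivity)]
              refine ENNReal.ofReal_le_ofReal ?_
              have hgy : 0 < ‖g y‖ := by
                rcases (norm_nonneg (g y)).eq_or_lt with h | h
                · rw [← h, Real.zero_rpow ha.ne'] at hy'
                  have : 0 < A * I := by positivity
                  nlinarith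
                · exact h
              rw [Real.rpow_add hgy, Real.rpow_one]
              calc ‖κ (x - y)‖ * ‖g y‖ ≤ A * ‖g y‖ := by
                    gcongr
                    exact hκA _
                _ ≤ s / (2 * I) * (‖g y‖ * ‖g y‖ ^ a) := by
                    rw [div_mul_eq_mul_div, le_div_iff₀ (by positivity)]
                    nlinarith
        _ = ENNReal.ofReal (s / 2) := by
            rw [lintegral_const_mul' _ _ ENNReal.ofReal_ne_top, hI,
              ← ENNReal.ofReal_mul (by positivity)]
            congr 1
            field_simp
    rw [← ofReal_norm] at this
    exact (ENNReal.ofReal_le_ofReal_iff (by positivity)).1 this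
  have hsub : {x | s < ‖conv κ g x‖} ⊆
      {x | ENNReal.ofReal (s ^ 2 / 4) ≤ ‖conv κ (F.indicator g) x‖ₑ ^ 2} := by
    intro x hx
    simp only [Set.mem_ofPred_eq] at hx ⊢
    rw [hsplit] at hx
    have h3 := norm_add_le (conv κ (Fᶜ.indicator g) x) (conv κ (F.indicator g) x)
    have h4 := h1 x
    have h5 : s / 2 ≤ ‖conv κ (F.indicator g) x‖ := by linarith
    rw [← ofReal_norm, ← ENNReal.ofReal_pow (norm_nonneg _)]
    refine ENNReal.ofReal_le_ofReal ?_
    nlinarith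
  have hpow : ∀ h : ℝ → ℂ, eLpNorm h 2 volume ^ 2 = ∫⁻ x, ‖h x‖ₑ ^ 2 := by
    intro h
    rw [eLpNorm_eq_lintegral_rpow_enorm_toReal (by norm_num) (by norm_num)]
    rw [← ENNReal.rpow_natCast, ← ENNReal.rpow_mul]
    simp
  have hind : ∫⁻ x, F.indicator (fun x => ‖g x‖ₑ ^ 2) x = ∫⁻ x, ‖F.indicator g x‖ₑ ^ 2 := by
    refine lintegral_congr fun x => ?_
    by_cases hx : x ∈ F <;> simp [hx]
  rw [hind]
  rcases eq_or_ne (∫⁻ x, ‖F.indicator g x‖ₑ ^ 2) ∞ with ht | ht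
  · rw [ht, ENNReal.mul_top]
    · exact le_top
    · simp only [ne_eq, ENNReal.ofReal_eq_zero, not_le]
      positivity
  have hmem : MemLp (F.indicator g) 2 volume := by
    refine ⟨hq2.1, ?_⟩
    have : eLpNorm (F.indicator g) 2 volume ^ 2 < ∞ := by
      rw [hpow]
      exact ht.lt_top
    simpa using this
  have h6 := hL2 _ hmem
  calc volume {x | s < ‖conv κ g x‖}
      ≤ volume {x | ENNReal.ofReal (s ^ 2 / 4) ≤ ‖conv κ (F.indicator g) x‖ₑ ^ 2} :=
        measure_mono hsub
    _ ≤ (∫⁻ x, ‖conv κ (F.indicator g) x‖ₑ ^ 2) / ENNReal.ofReal (s ^ 2 / 4) := by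
        refine meas_ge_le_lintegral_div ?_ ?_ ENNReal.ofReal_ne_top
        · exact (aestronglyMeasurable_conv hκc hq2.1).enorm.pow_const 2
        · simp only [ne_eq, ENNReal.ofReal_eq_zero, not_le]
          positivity
    _ ≤ (ENNReal.ofReal (B ^ 2) * ∫⁻ x, ‖F.indicator g x‖ₑ ^ 2) / ENNReal.ofReal (s ^ 2 / 4) := by
        gcongr
        rw [← hpow, ← hpow, ENNReal.ofReal_pow hB.le, ← mul_pow]
        gcongr
    _ = _ := by
        rw [mul_comm, mul_div_assoc, ← ENNReal.ofReal_div_of_pos (by positivity), mul_comm]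
        congr 2
        field_simp

/-- A Marcinkiewicz argument with a cut depending on the level s. After the layer-cake formula and
an exchange of integrals there remains ∫ s^{p-3} ds over 0 < s ≤ c/|g|^a, which converges since p >
2. The choice a = 1/(p-1) makes the resulting power of |g| equal to 2 - a(p-2) = p' = 1 + a. -/
theorem lintegral_conv_rpow_le {κ g : ℝ → ℂ} {A B b p : ℝ} (hA : 0 < A) (hB : 0 < B)
    (hb : 0 ≤ b) (hκc : Continuous κ) (hκb : ∀ x, ‖κ x‖ ≤ b / (1 + x ^ 2))
    (hκA : ∀ x, ‖κ x‖ ≤ A)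
    (hL2 : ∀ h : ℝ → ℂ, MemLp h 2 volume →
      eLpNorm (conv κ h) 2 volume ≤ ENNReal.ofReal B * eLpNorm h 2 volume)
    (hp : 2 < p) (hgm : Measurable g) (hg : MemLp g (ENNReal.ofReal (p / (p - 1))) volume) :
    ∫⁻ x, ‖conv κ g x‖ₑ ^ p ≤ ENNReal.ofReal (p * (4 * B ^ 2) * (2 * A) ^ (p - 2) / (p - 2)) *
      (∫⁻ x, ‖g x‖ₑ ^ (p / (p - 1))) ^ (p - 1) := by
  set a : ℝ := 1 / (p - 1) with ha_def
  have hp1 : 0 < p - 1 := by linarith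
  have ha : 0 < a := by positivity
  have hpa : p / (p - 1) = 1 + a := by
    rw [ha_def]
    field_simp
    ring
  have hq : 1 ≤ ENNReal.ofReal (p / (p - 1)) := by
    rw [hpa, ENNReal.one_le_ofReal]
    linarith
  have hgI : ∀ x, ‖g x‖ₑ ^ (1 + a) = ENNReal.ofReal (‖g x‖ ^ (1 + a)) := by
    intro x
    rw [← ofReal_norm, ENNReal.ofReal_rpow_of_nonneg (norm_nonneg _) (by linarith)]
  have hIfin : ∫⁻ x, ‖g x‖ₑ ^ (1 + a) ≠ ∞ := by
    have h := hg.2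
    rw [eLpNorm_eq_lintegral_rpow_enorm_toReal (by simp; positivity) ENNReal.ofReal_ne_top,
      ENNReal.toReal_ofReal (by positivity), hpa] at h
    intro htop
    rw [htop, ENNReal.top_rpow_of_pos (by positivity)] at h
    exact lt_irrefl _ h
  rw [hpa]
  set I : ℝ := (∫⁻ x, ‖g x‖ₑ ^ (1 + a)).toReal with hI_def
  have hI : ∫⁻ x, ENNReal.ofReal (‖g x‖ ^ (1 + a)) = ENNReal.ofReal I := by
    rw [hI_def, ENNReal.ofReal_toReal hIfin]
    exact lintegral_congr fun x => (hgI x).symm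
  have hI' : ∫⁻ x, ‖g x‖ₑ ^ (1 + a) = ENNReal.ofReal I := (ENNReal.ofReal_toReal hIfin).symm
  rcases (ENNReal.toReal_nonneg : 0 ≤ I).eq_or_lt with h0 | hI0
  · have hz : g =ᵐ[volume] 0 := by
      have h0' : I = 0 := h0.symm
      rw [h0', ENNReal.ofReal_zero, lintegral_eq_zero_iff (by fun_prop)] at hI'
      filter_upwards [hI'] with x hx
      simpa [(by linarith : (0 : ℝ) < 1 + a), (by linarith : ¬ (1 + a < 0))] using hx
    have hc : ∀ x, conv κ g x = 0 := by
      intro x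
      unfold conv
      refine integral_eq_zero_of_ae ?_
      filter_upwards [hz] with y hy
      simp [hy]
    simp [hc, (by linarith : 0 < p)]
  rw [hI']
  have hcm : AEMeasurable (fun x => ‖conv κ g x‖) volume :=
    (aestronglyMeasurable_conv hκc hg.1).norm.aemeasurable
  have hlayer := lintegral_rpow_eq_lintegral_meas_lt_mul volume (f := fun x => ‖conv κ g x‖)
    (Eventually.of_forall fun x => norm_nonneg _) hcm (by linarith : 0 < p)
  have hL : ∫⁻ x, ‖conv κ g x‖ₑ ^ p = ∫⁻ x, ENNReal.ofReal (‖conv κ g x‖ ^ p) := by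
    refine lintegral_congr fun x => ?_
    rw [← ofReal_norm, ENNReal.ofReal_rpow_of_nonneg (norm_nonneg _) (by linarith)]
  rw [hL, hlayer]
  set c : ℝ := 2 * A * I with hc
  have hc0 : 0 < c := by positivity
  set Φ : ℝ → ℝ → ℝ≥0∞ := fun s x => ENNReal.ofReal (4 * B ^ 2 * s ^ (p - 3)) *
    Set.indicator {x | ‖g x‖ ^ a * s ≤ c} (fun x => ‖g x‖ₑ ^ 2) x with hΦ
  have hΦm : Measurable (Function.uncurry Φ) := by
    simp only [hΦ, Function.uncurry_def]
    refine Measurable.mul (by fun_prop) ?_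
    have : (fun z : ℝ × ℝ => Set.indicator {x | ‖g x‖ ^ a * z.1 ≤ c} (fun x => ‖g x‖ₑ ^ 2) z.2) =
      Set.indicator {z : ℝ × ℝ | ‖g z.2‖ ^ a * z.1 ≤ c} (fun z => ‖g z.2‖ₑ ^ 2) := by
      ext z
      simp [Set.indicator]
    rw [this]
    refine Measurable.indicator (by fun_prop) ?_
    exact measurableSet_le (by fun_prop) measurable_const
  have hstep1 : ∫⁻ s in Set.Ioi 0, volume {x | s < ‖conv κ g x‖} * ENNReal.ofReal (s ^ (p - 1)) ≤
      ∫⁻ s in Set.Ioi 0, ∫⁻ x, Φ s x := by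
    refine setLIntegral_mono' measurableSet_Ioi fun s hs => ?_
    have hs' : 0 < s := hs
    simp only [hΦ]
    rw [lintegral_const_mul' _ _ ENNReal.ofReal_ne_top]
    calc volume {x | s < ‖conv κ g x‖} * ENNReal.ofReal (s ^ (p - 1))
        ≤ _ := mul_le_mul_left (volume_superlevel_conv_le hA hB hb hκc hκb hκA hL2 hgm hq hg ha hI hI0 hs')
          (ENNReal.ofReal (s ^ (p - 1)))
      _ = _ := by
        rw [mul_right_comm, ← ENNReal.ofReal_mul (by positivity)]
        congr 2
        have : s ^ (p - 1) = s ^ (p - 3) * s ^ 2 := by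
          rw [← Real.rpow_natCast, ← Real.rpow_add hs']
          congr 1
          push_cast
          ring
        rw [this]
        field_simp
  have hstep2 : ∀ x, ∫⁻ s in Set.Ioi 0, Φ s x ≤
      ENNReal.ofReal (4 * B ^ 2 * (c ^ (p - 2) / (p - 2))) * ‖g x‖ₑ ^ (1 + a) := by
    intro x
    rcases (norm_nonneg (g x)).eq_or_lt with h0 | h0
    · have : g x = 0 := by simpa using h0.symm
      have h1 : ∀ s, Φ s x = 0 := by
        intro s
        simp only [hΦ]
        by_cases h : x ∈ {x | ‖g x‖ ^ a * s ≤ c}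
        · rw [Set.indicator_of_mem h, this]; simp
        · rw [Set.indicator_of_notMem h]; simp
      simp [h1]
    have hya : 0 < ‖g x‖ ^ a := Real.rpow_pos_of_pos h0 _
    have h1 : ∀ s ∈ Set.Ioi (0 : ℝ), Φ s x = Set.indicator (Set.Ioc 0 (c / ‖g x‖ ^ a))
        (fun s => ENNReal.ofReal (4 * B ^ 2) * ‖g x‖ₑ ^ 2 * ENNReal.ofReal (s ^ (p - 3))) s := by
      intro s hs
      simp only [hΦ]
      by_cases h : ‖g x‖ ^ a * s ≤ c
      · have hm : s ∈ Set.Ioc 0 (c / ‖g x‖ ^ a) := ⟨hs, by rw [le_div_iff₀ hya]; linarith⟩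
        rw [Set.indicator_of_mem hm, Set.indicator_of_mem (by exact h),
          ENNReal.ofReal_mul (by positivity)]
        ring
      · have hm : s ∉ Set.Ioc 0 (c / ‖g x‖ ^ a) := by
          rintro ⟨-, h2⟩
          rw [le_div_iff₀ hya] at h2
          exact h (by linarith)
        rw [Set.indicator_of_notMem hm, Set.indicator_of_notMem (by exact h), mul_zero]
    rw [setLIntegral_congr_fun measurableSet_Ioi h1, setLIntegral_indicator measurableSet_Ioc]
    have hset : Set.Ioc 0 (c / ‖g x‖ ^ a) ∩ Set.Ioi 0 = Set.Ioc 0 (c / ‖g x‖ ^ a) := by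
      ext s
      simp only [Set.mem_inter_iff, Set.mem_Ioc, Set.mem_Ioi]
      tauto
    rw [hset, lintegral_const_mul' _ _ (ENNReal.mul_ne_top ENNReal.ofReal_ne_top (by simp)),
      lintegral_Ioc_rpow (by linarith) (by positivity), hgI]
    rw [← ofReal_norm, ← ENNReal.ofReal_pow (norm_nonneg _), ← ENNReal.ofReal_mul (by positivity),
      ← ENNReal.ofReal_mul (by positivity), ← ENNReal.ofReal_mul]
    · refine ENNReal.ofReal_le_ofReal (le_of_eq ?_)
      have e1 : p - 3 + 1 = p - 2 := by ring
      rw [e1, Real.div_rpow hc0.le hya.le, ← Real.rpow_mul h0.le]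
      have e2 : ‖g x‖ ^ (1 + a) = ‖g x‖ ^ 2 / ‖g x‖ ^ (a * (p - 2)) := by
        rw [← Real.rpow_natCast, ← Real.rpow_sub h0]
        congr 1
        rw [ha_def]
        push_cast
        field_simp
        ring
      rw [e2]
      ring
    · have : 0 ≤ c ^ (p - 2) := by positivity
      have : 0 < p - 2 := by linarith
      positivity
  calc ENNReal.ofReal p * ∫⁻ s in Set.Ioi 0, volume {x | s < ‖conv κ g x‖} *
        ENNReal.ofReal (s ^ (p - 1))
      ≤ ENNReal.ofReal p * ∫⁻ s in Set.Ioi 0, ∫⁻ x, Φ s x := by gcongr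
    _ = ENNReal.ofReal p * ∫⁻ x, ∫⁻ s in Set.Ioi 0, Φ s x := by
        rw [lintegral_lintegral_swap hΦm.aemeasurable]
    _ ≤ ENNReal.ofReal p * ∫⁻ x, ENNReal.ofReal (4 * B ^ 2 * (c ^ (p - 2) / (p - 2))) *
          ‖g x‖ₑ ^ (1 + a) := by
        gcongr with x
        exact hstep2 x
    _ = _ := by
        have hp2 : 0 < p - 2 := by linarith
        rw [lintegral_const_mul' _ _ ENNReal.ofReal_ne_top, hI',
          ENNReal.ofReal_rpow_of_pos hI0, ← ENNReal.ofReal_mul (by positivity),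
          ← ENNReal.ofReal_mul (by linarith), ← ENNReal.ofReal_mul (by positivity)]
        congr 1
        have : I ^ (p - 1) = I ^ (p - 2) * I := by
          rw [← Real.rpow_add_one hI0.ne']
          congr 1
          ring
        rw [hc, Real.mul_rpow (by positivity) hI0.le, this]
        ring

/-- The `L^{p'} → L^p` bound for a multiplier with symbol bounded by `B` and kernel bounded by
`A`. -/
theorem lpNorm_multiplier_le_interp {p : ℝ} (hp : 2 < p) : ∃ C : ℝ, 0 < C ∧
    ∀ (m : ℝ → ℂ), IsSymbol m → ∀ A B : ℝ, 0 < A → 0 < B → (∀ x, ‖kernel m x‖ ≤ A) →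
      (∀ ξ, ‖m ξ‖ ≤ B) → ∀ f : 𝓢'(ℝ, ℂ),
        lpNorm (ENNReal.ofReal p) (multiplier m f) ≤
          ENNReal.ofReal (C * A ^ (1 - 2 / p) * B ^ (2 / p)) *
            lpNorm (ENNReal.ofReal (p / (p - 1))) f := by
  have hp0 : 0 < p := by linarith
  have hp1 : 0 < p - 1 := by linarith
  have hp2 : 0 < p - 2 := by linarith
  refine ⟨(p * 4 * 2 ^ (p - 2) / (p - 2)) ^ (1 / p), by positivity,
    fun m hm A B hA hB hκA hmB f => ?_⟩
  set q : ℝ := p / (p - 1) with hqdef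
  have hq1 : 1 < q := by
    rw [hqdef, one_lt_div hp1]
    linarith
  have hq : 1 ≤ ENNReal.ofReal q := by
    rw [ENNReal.one_le_ofReal]
    exact hq1.le
  have hqp : ENNReal.ofReal q ≤ ENNReal.ofReal p := by
    refine ENNReal.ofReal_le_ofReal ?_
    rw [hqdef, div_le_iff₀ hp1]
    nlinarith
  rcases eq_or_ne (lpNorm (ENNReal.ofReal q) f) ∞ with h | h
  · rw [h, ENNReal.mul_top]
    · exact le_top
    · simp only [ne_eq, ENNReal.ofReal_eq_zero, not_le]
      positivity
  obtain ⟨g₀, hg₀, hfg₀⟩ := exists_rep h.lt_top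
  -- A genuinely measurable representative, because the superlevel argument cuts along sets defined
  -- by the values of g.
  obtain ⟨g, hgm, hgg⟩ := hg₀.1.aemeasurable
  have hg : MemLp g (ENNReal.ofReal q) volume := hg₀.ae_eq hgg
  have hfg : IsRep f g := hfg₀.congr hgg
  obtain ⟨b, hb, hκb⟩ := hm.kernel_decay
  rw [lpNorm_eq hq hg hfg]
  refine (lpNorm_le (memLp_conv hm hq hqp hg) (isRep_multiplier hm hq hg hfg)).trans ?_
  rw [eLpNorm_eq_lintegral_rpow_enorm_toReal (by simpa using hp0) ENNReal.ofReal_ne_top,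
    eLpNorm_eq_lintegral_rpow_enorm_toReal (by simp; linarith) ENNReal.ofReal_ne_top,
    ENNReal.toReal_ofReal hp0.le, ENNReal.toReal_ofReal (by linarith)]
  have key := lintegral_conv_rpow_le hA hB hb hm.continuous_kernel hκb hκA
    (fun h hh => eLpNorm_two_conv_le hm hB hmB hh) hp hgm hg
  refine (ENNReal.rpow_le_rpow key (by positivity : 0 ≤ 1 / p)).trans (le_of_eq ?_)
  rw [ENNReal.mul_rpow_of_nonneg _ _ (by positivity), ← ENNReal.rpow_mul,
    ENNReal.ofReal_rpow_of_nonneg (by positivity) (by positivity)]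
  congr 1
  · congr 1
    have e : p * (4 * B ^ 2) * (2 * A) ^ (p - 2) / (p - 2) =
        (p * 4 * 2 ^ (p - 2) / (p - 2)) * (A ^ (p - 2) * B ^ (2 : ℝ)) := by
      rw [Real.mul_rpow (by norm_num) hA.le]
      norm_cast
      ring
    rw [e, Real.mul_rpow (by positivity) (by positivity),
      Real.mul_rpow (by positivity) (by positivity), ← Real.rpow_mul hA.le, ← Real.rpow_mul hB.le]
    have e1 : (p - 2) * (1 / p) = 1 - 2 / p := by field_simp
    have e2 : 2 * (1 / p) = 2 / p := by ring
    rw [e1, e2]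
    ring
  · congr 1
    rw [hqdef]
    field_simp

/-! ### The frequency-uniform partition of unity -/

/-- Makes the sum of bumps over ℤ one fixed finite sum near each point, from which smoothness can be
read off. -/
theorem mem_Icc_of_abs_sub_lt {ξ₀ ξ : ℝ} (hξ : |ξ - ξ₀| < 1) (l : ℤ) (hl : |ξ - l| < 1) :
    l ∈ Finset.Icc (⌊ξ₀⌋ - 2) (⌊ξ₀⌋ + 2) := by
  rw [abs_lt] at hξ hl
  have h1 := Int.floor_le ξ₀
  have h2 := Int.lt_floor_add_one ξ₀
  rw [Finset.mem_Icc]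
  constructor
  · have : ((⌊ξ₀⌋ - 2 : ℤ) : ℝ) < l := by push_cast; linarith
    exact (Int.cast_lt.1 this).le
  · have : (l : ℝ) < ((⌊ξ₀⌋ + 3 : ℤ) : ℝ) := by push_cast; linarith
    have := Int.cast_lt.1 this
    omega

theorem cutoff_eq_shift (ρ : ℝ → ℝ) (k : ℤ) (ξ : ℝ) : cutoff ρ k ξ = cutoff ρ 0 (ξ - k) := by
  unfold cutoff
  congr 1
  · simp
  · rw [← (Equiv.addLeft k).tsum_eq]
    refine tsum_congr fun l => ?_
    simp
    ring_nf

section Cutoff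

variable {ρ : ℝ → ℝ} (hρ : IsBump ρ)

include hρ

theorem tsum_bump_eq (ξ : ℝ) (s : Finset ℤ) (hs : ∀ l : ℤ, |ξ - l| < 1 → l ∈ s) :
    ∑' l : ℤ, ρ (ξ - l) = ∑ l ∈ s, ρ (ξ - l) := by
  refine tsum_eq_sum fun l hl => hρ.eq_zero _ ?_
  by_contra h
  exact hl (hs l (not_le.1 h))

theorem contDiff_tsum_bump : ContDiff ℝ (⊤ : ℕ∞) fun ξ : ℝ => ∑' l : ℤ, ρ (ξ - l) := by
  rw [contDiff_iff_contDiffAt]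
  intro ξ₀
  have hs : ContDiffAt ℝ (⊤ : ℕ∞)
      (fun ξ : ℝ => ∑ l ∈ Finset.Icc (⌊ξ₀⌋ - 2) (⌊ξ₀⌋ + 2), ρ (ξ - l)) ξ₀ := by
    refine ContDiffAt.sum fun l _ => ?_
    exact (hρ.smooth.comp (contDiff_id.sub contDiff_const)).contDiffAt
  refine hs.congr_of_eventuallyEq ?_
  filter_upwards [Metric.ball_mem_nhds ξ₀ one_pos] with ξ hξ
  exact tsum_bump_eq hρ ξ _ fun l hl => mem_Icc_of_abs_sub_lt (by simpa [Real.dist_eq] using hξ) l hl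

/-- The nearest integer already contributes 1. -/
theorem one_le_tsum_bump (ξ : ℝ) : 1 ≤ ∑' l : ℤ, ρ (ξ - l) := by
  rw [tsum_bump_eq hρ ξ _ fun l hl => mem_Icc_of_abs_sub_lt (ξ₀ := ξ) (by simp) l hl]
  have h1 : ρ (ξ - round ξ) = 1 := hρ.eq_one _ (abs_sub_round ξ)
  rw [← h1]
  refine Finset.single_le_sum (f := fun l : ℤ => ρ (ξ - l)) (fun l _ => hρ.nonneg _) ?_
  refine mem_Icc_of_abs_sub_lt (ξ₀ := ξ) (ξ := ξ) (by simp) _ ?_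
  exact (abs_sub_round ξ).trans_lt (by norm_num)

theorem contDiff_cutoff (k : ℤ) : ContDiff ℝ (⊤ : ℕ∞) (cutoff ρ k) := by
  unfold cutoff
  refine ContDiff.div (hρ.smooth.comp (contDiff_id.sub contDiff_const)) (contDiff_tsum_bump hρ) ?_
  intro ξ
  have := one_le_tsum_bump hρ ξ
  positivity

theorem cutoff_eq_zero {k : ℤ} {ξ : ℝ} (h : 1 ≤ |ξ - k|) : cutoff ρ k ξ = 0 := by
  unfold cutoff
  rw [hρ.eq_zero _ h, zero_div]

theorem sum_cutoff (ξ : ℝ) (s : Finset ℤ) (hs : ∀ l : ℤ, |ξ - l| < 1 → l ∈ s) :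
    ∑ k ∈ s, cutoff ρ k ξ = 1 := by
  unfold cutoff
  rw [← Finset.sum_div, ← tsum_bump_eq hρ ξ s hs, div_self]
  have := one_le_tsum_bump hρ ξ
  positivity

end Cutoff

/-- The symbol of `□_k`. -/
def sig (ρ : ℝ → ℝ) (k : ℤ) (ξ : ℝ) : ℂ := (cutoff ρ k ξ : ℂ)

/-- The symbol of `□_{k-1} + □_k + □_{k+1}`. -/
def fat (ρ : ℝ → ℝ) (k : ℤ) (ξ : ℝ) : ℂ := ∑ l ∈ Finset.Icc (k - 1) (k + 1), sig ρ l ξ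

theorem box_eq (ρ : ℝ → ℝ) (k : ℤ) (f : 𝓢'(ℝ, ℂ)) : box ρ k f = multiplier (sig ρ k) f := rfl

theorem hasCompactSupport_of_abs_sub {E : Type*} [Zero E] {m : ℝ → E} (c R : ℝ)
    (h : ∀ ξ, R ≤ |ξ - c| → m ξ = 0) : HasCompactSupport m := by
  refine HasCompactSupport.intro (isCompact_closedBall c R) fun ξ hξ => h ξ ?_
  rw [Metric.mem_closedBall, Real.dist_eq, not_le] at hξ
  exact hξ.le

theorem sig_eq_shift (ρ : ℝ → ℝ) (k : ℤ) (ξ : ℝ) : sig ρ k ξ = sig ρ 0 (ξ - k) := by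
  simp [sig, cutoff_eq_shift ρ k ξ]

theorem fat_eq_shift (ρ : ℝ → ℝ) (k : ℤ) (ξ : ℝ) : fat ρ k ξ = fat ρ 0 (ξ - k) := by
  unfold fat
  refine Finset.sum_bij (fun l _ => l - k) ?_ ?_ ?_ ?_
  · intro l hl
    simp only [Finset.mem_Icc] at hl ⊢
    omega
  · intro a _ b _ h
    simpa using h
  · intro b hb
    refine ⟨b + k, ?_, by ring⟩
    simp only [Finset.mem_Icc] at hb ⊢
    omega
  · intro l _
    rw [sig_eq_shift ρ l ξ, sig_eq_shift ρ (l - k) (ξ - k)]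
    congr 1
    push_cast
    ring

section Sig

variable {ρ : ℝ → ℝ} (hρ : IsBump ρ)

include hρ

theorem isSymbol_sig (k : ℤ) : IsSymbol (sig ρ k) := by
  refine ⟨Complex.ofRealCLM.contDiff.comp (contDiff_cutoff hρ k), ?_⟩
  exact hasCompactSupport_of_abs_sub k 1 fun ξ h => by simp [sig, cutoff_eq_zero hρ h]

theorem isSymbol_fat (k : ℤ) : IsSymbol (fat ρ k) := by
  refine ⟨ContDiff.sum fun l _ => (isSymbol_sig hρ l).smooth, ?_⟩
  refine hasCompactSupport_of_abs_sub k 2 fun ξ h => ?_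
  refine Finset.sum_eq_zero fun l hl => ?_
  rw [Finset.mem_Icc] at hl
  have h1 : |(l : ℝ) - k| ≤ 1 := by
    rw [abs_le]
    have a : ((k - 1 : ℤ) : ℝ) ≤ l := Int.cast_le.2 hl.1
    have b : (l : ℝ) ≤ ((k + 1 : ℤ) : ℝ) := Int.cast_le.2 hl.2
    push_cast at a b
    constructor <;> linarith
  have h2 : 1 ≤ |ξ - l| := by
    have := abs_sub_le ξ l k
    linarith
  simp [sig, cutoff_eq_zero hρ h2]

theorem sig_eq_zero {k : ℤ} {ξ : ℝ} (h : 1 ≤ |ξ - k|) : sig ρ k ξ = 0 := by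
  simp [sig, cutoff_eq_zero hρ h]

/-- If |ξ-k| < 1, every l with |ξ-l| < 1 is k-1, k or k+1, so these three cutoffs exhaust the
partition of unity at ξ. -/
theorem fat_mul_sig (k : ℤ) (ξ : ℝ) : fat ρ k ξ * sig ρ k ξ = sig ρ k ξ := by
  by_cases h : 1 ≤ |ξ - k|
  · rw [sig_eq_zero hρ h, mul_zero]
  have h1 : fat ρ k ξ = 1 := by
    unfold fat sig
    rw [← Complex.ofReal_sum, sum_cutoff hρ ξ]
    · simp
    · intro l hl
      rw [not_le, abs_lt] at h
      rw [abs_lt] at hl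
      rw [Finset.mem_Icc]
      constructor
      · have : ((k - 2 : ℤ) : ℝ) < l := by push_cast; linarith
        have := Int.cast_lt.1 this
        omega
      · have : (l : ℝ) < ((k + 2 : ℤ) : ℝ) := by push_cast; linarith
        have := Int.cast_lt.1 this
        omega
  rw [h1, one_mul]

/-- Inserting the wider cutoff replaces a symbol without decay by a compactly supported one, whose
kernel can be estimated. -/
theorem box_multiplier {a : ℝ → ℂ} (ha : a.HasTemperateGrowth) (k : ℤ) (f : 𝓢'(ℝ, ℂ)) :
    box ρ k (multiplier a f) = multiplier (fun ξ => fat ρ k ξ * a ξ) (box ρ k f) := by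
  have h1 := (isSymbol_sig hρ k).temperate
  have h2 := (isSymbol_fat hρ k).temperate
  have h3 : (fun ξ => fat ρ k ξ * a ξ).HasTemperateGrowth := h2.mul ha
  rw [box_eq, box_eq, multiplier_multiplier h1 ha, multiplier_multiplier h3 h1]
  congr 1
  ext ξ
  rw [mul_right_comm, fat_mul_sig hρ]

end Sig

/-! ### Kernel bounds for frequency-localized symbols -/

theorem kernel_eq_integral (m : ℝ → ℂ) (x : ℝ) :
    kernel m x = (1 / (2 * Real.pi) : ℝ) * ∫ ξ : ℝ, Complex.exp (ξ * x * Complex.I) * m ξ := by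
  rw [kernel_apply]
  have := Measure.integral_comp_mul_left (fun ξ : ℝ => Complex.exp (ξ * x * Complex.I) * m ξ)
    (2 * Real.pi)
  rw [abs_of_pos (by positivity), Complex.real_smul] at this
  simp only [one_div]
  rw [← this]
  refine integral_congr_ae (Eventually.of_forall fun y => ?_)
  simp only
  push_cast
  ring_nf

theorem norm_integral_le_of_support {m : ℝ → ℂ} {c R B : ℝ} (hR : 0 ≤ R)
    (hsupp : ∀ ξ, R ≤ |ξ - c| → m ξ = 0) (hB : ∀ ξ, ‖m ξ‖ ≤ B) (x : ℝ) :
    ‖∫ ξ : ℝ, Complex.exp (ξ * x * Complex.I) * m ξ‖ ≤ 2 * R * B := by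
  have h1 : ∫ ξ : ℝ, Complex.exp (ξ * x * Complex.I) * m ξ =
      ∫ ξ in Metric.closedBall c R, Complex.exp (ξ * x * Complex.I) * m ξ := by
    refine (setIntegral_eq_integral_of_forall_compl_eq_zero fun ξ hξ => ?_).symm
    rw [Metric.mem_closedBall, Real.dist_eq, not_le] at hξ
    rw [hsupp ξ hξ.le, mul_zero]
  rw [h1]
  refine (norm_setIntegral_le_of_norm_le_const (C := B) ?_ fun ξ _ => ?_).trans (le_of_eq ?_)
  · exact (isCompact_closedBall c R).measure_lt_top
  · rw [norm_mul]
    have := Complex.norm_exp_ofReal_mul_I (ξ * x)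
    push_cast at this
    rw [this, one_mul]
    exact hB ξ
  · rw [Measure.real, Real.volume_closedBall, ENNReal.toReal_ofReal (by positivity)]
    ring

theorem norm_kernel_le_of_support {m : ℝ → ℂ} {c R B : ℝ} (hR : 0 ≤ R)
    (hsupp : ∀ ξ, R ≤ |ξ - c| → m ξ = 0) (hB : ∀ ξ, ‖m ξ‖ ≤ B) (x : ℝ) :
    ‖kernel m x‖ ≤ R * B := by
  have hB0 : 0 ≤ B := (norm_nonneg _).trans (hB 0)
  rw [kernel_eq_integral, norm_mul, Complex.norm_real, Real.norm_of_nonneg (by positivity)]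
  have := norm_integral_le_of_support hR hsupp hB x
  have hpi := Real.pi_gt_three
  calc 1 / (2 * Real.pi) * ‖∫ ξ : ℝ, Complex.exp (ξ * x * Complex.I) * m ξ‖
      ≤ 1 / 2 * (2 * R * B) := by
        gcongr
        linarith
    _ = _ := by ring

theorem IsSymbol.deriv {m : ℝ → ℂ} (h : IsSymbol m) : IsSymbol (deriv m) := by
  refine ⟨?_, h.compact.deriv⟩
  exact ((contDiff_infty_iff_deriv (𝕜 := ℝ)).1 h.smooth).2

theorem IsSymbol.integrable {m : ℝ → ℂ} (h : IsSymbol m) : Integrable m :=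
  h.smooth.continuous.integrable_of_hasCompactSupport h.compact

theorem integral_exp_mul_deriv {m : ℝ → ℂ} (h : IsSymbol m) (x : ℝ) :
    ∫ ξ : ℝ, Complex.exp (ξ * x * Complex.I) * deriv m ξ =
      -(x * Complex.I) * ∫ ξ : ℝ, Complex.exp (ξ * x * Complex.I) * m ξ := by
  have hexp : ∀ ξ : ℝ, HasDerivAt (fun ξ : ℝ => Complex.exp (ξ * x * Complex.I))
      (x * Complex.I * Complex.exp (ξ * x * Complex.I)) ξ := by
    intro ξ
    have h1 : HasDerivAt (fun ξ : ℝ => (ξ : ℂ) * x * Complex.I) (1 * x * Complex.I) ξ :=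
      ((Complex.ofRealCLM.hasDerivAt (x := ξ)).mul_const _).mul_const _
    convert h1.cexp using 1
    ring
  have hm : ∀ ξ : ℝ, HasDerivAt m (deriv m ξ) ξ := fun ξ =>
    (h.smooth.differentiable (by simp) ξ).hasDerivAt
  have hc : Continuous fun ξ : ℝ => Complex.exp (ξ * x * Complex.I) := by fun_prop
  have i1 : Integrable ((fun ξ : ℝ => Complex.exp (ξ * x * Complex.I)) * deriv m) :=
    (hc.mul h.deriv.smooth.continuous).integrable_of_hasCompactSupport h.deriv.compact.mul_left
  have i2 : Integrable ((fun ξ : ℝ => x * Complex.I * Complex.exp (ξ * x * Complex.I)) * m) :=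
    ((continuous_const.mul hc).mul h.smooth.continuous).integrable_of_hasCompactSupport
      h.compact.mul_left
  have i3 : Integrable ((fun ξ : ℝ => Complex.exp (ξ * x * Complex.I)) * m) :=
    (hc.mul h.smooth.continuous).integrable_of_hasCompactSupport h.compact.mul_left
  rw [integral_mul_deriv_eq_deriv_mul_of_integrable (fun ξ _ => hexp ξ) (fun ξ _ => hm ξ) i1 i2 i3,
    neg_mul, ← integral_const_mul]
  congr 2
  ext ξ
  ring

/-- Two integrations by parts turn the second derivative into the factor x²; adding the trivial
bound produces the integrable decay 1/(1+x²). -/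
theorem norm_kernel_le {m : ℝ → ℂ} (h : IsSymbol m) {c R B : ℝ} (hR : 0 ≤ R)
    (hsupp : ∀ ξ, R ≤ |ξ - c| → m ξ = 0) (hsupp2 : ∀ ξ, R ≤ |ξ - c| → deriv (deriv m) ξ = 0)
    (hB : ∀ ξ, ‖m ξ‖ ≤ B)
    (hB2 : ∀ ξ, ‖deriv (deriv m) ξ‖ ≤ B) (x : ℝ) :
    ‖kernel m x‖ ≤ 2 * R * B / (1 + x ^ 2) := by
  have h0 := norm_integral_le_of_support hR hsupp hB x
  have h2 := norm_integral_le_of_support hR hsupp2 hB2 x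
  have hB0 : 0 ≤ B := (norm_nonneg _).trans (hB 0)
  rw [integral_exp_mul_deriv h.deriv, integral_exp_mul_deriv h, ← mul_assoc, norm_mul] at h2
  have h3 : ‖-(x * Complex.I) * -(x * Complex.I)‖ = x ^ 2 := by
    simp [sq]
  rw [h3] at h2
  rw [kernel_eq_integral, norm_mul, Complex.norm_real, Real.norm_of_nonneg (by positivity),
    le_div_iff₀ (by positivity)]
  have hpi := Real.pi_gt_three
  set n := ‖∫ ξ : ℝ, Complex.exp (ξ * x * Complex.I) * m ξ‖
  have hn : 0 ≤ n := norm_nonneg _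
  calc 1 / (2 * Real.pi) * n * (1 + x ^ 2) ≤ 1 / 2 * n * (1 + x ^ 2) := by
        gcongr
        linarith
    _ ≤ 2 * R * B := by nlinarith

/-- Symbols with two bounded derivatives. -/
structure Bdd2 (a : ℝ → ℂ) (B : ℝ) : Prop where
  smooth : ContDiff ℝ (⊤ : ℕ∞) a
  zero : ∀ ξ, ‖a ξ‖ ≤ B
  one : ∀ ξ, ‖deriv a ξ‖ ≤ B
  two : ∀ ξ, ‖deriv (deriv a) ξ‖ ≤ B

theorem IsSymbol.exists_bdd2 {m : ℝ → ℂ} (h : IsSymbol m) : ∃ D : ℝ, 0 < D ∧ Bdd2 m D := by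
  have aux : ∀ n : ℝ → ℂ, IsSymbol n → ∃ C : ℝ, ∀ ξ, ‖n ξ‖ ≤ C := fun n hn =>
    hn.compact.exists_bound_of_continuous hn.smooth.continuous
  obtain ⟨C₀, h₀⟩ := aux m h
  obtain ⟨C₁, h₁⟩ := aux _ h.deriv
  obtain ⟨C₂, h₂⟩ := aux _ h.deriv.deriv
  refine ⟨max 1 (max C₀ (max C₁ C₂)), by positivity, h.smooth, fun ξ => (h₀ ξ).trans ?_,
    fun ξ => (h₁ ξ).trans ?_, fun ξ => (h₂ ξ).trans ?_⟩
  · exact (le_max_left _ _).trans (le_max_right _ _)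
  · exact (le_max_left _ _).trans ((le_max_right _ _).trans (le_max_right _ _))
  · exact (le_max_right _ _).trans ((le_max_right _ _).trans (le_max_right _ _))

theorem Bdd2.mul {a b : ℝ → ℂ} {A B : ℝ} (ha : Bdd2 a A) (hb : Bdd2 b B) :
    Bdd2 (fun ξ => a ξ * b ξ) (4 * (A * B)) := by
  have hA : 0 ≤ A := (norm_nonneg _).trans (ha.zero 0)
  have hB : 0 ≤ B := (norm_nonneg _).trans (hb.zero 0)
  have hAB := mul_nonneg hA hB
  have da : ∀ ξ, HasDerivAt a (deriv a ξ) ξ := fun ξ =>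
    (ha.smooth.differentiable (by simp) ξ).hasDerivAt
  have db : ∀ ξ, HasDerivAt b (deriv b ξ) ξ := fun ξ =>
    (hb.smooth.differentiable (by simp) ξ).hasDerivAt
  have sa := ((contDiff_infty_iff_deriv (𝕜 := ℝ)).1 ha.smooth).2
  have sb := ((contDiff_infty_iff_deriv (𝕜 := ℝ)).1 hb.smooth).2
  have da' : ∀ ξ, HasDerivAt (deriv a) (deriv (deriv a) ξ) ξ := fun ξ =>
    (sa.differentiable (by simp) ξ).hasDerivAt
  have db' : ∀ ξ, HasDerivAt (deriv b) (deriv (deriv b) ξ) ξ := fun ξ =>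
    (sb.differentiable (by simp) ξ).hasDerivAt
  have e1 : deriv (fun ξ => a ξ * b ξ) = fun ξ => deriv a ξ * b ξ + a ξ * deriv b ξ :=
    funext fun ξ => ((da ξ).mul (db ξ)).deriv
  have e2 : deriv (deriv (fun ξ => a ξ * b ξ)) = fun ξ =>
      (deriv (deriv a) ξ * b ξ + deriv a ξ * deriv b ξ) +
        (deriv a ξ * deriv b ξ + a ξ * deriv (deriv b) ξ) := by
    rw [e1]
    exact funext fun ξ => (((da' ξ).mul (db ξ)).add ((da ξ).mul (db' ξ))).deriv
  have mulb : ∀ x y : ℂ, ‖x‖ ≤ A → ‖y‖ ≤ B → ‖x * y‖ ≤ A * B := fun x y hx hy => by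
    rw [norm_mul]
    gcongr
  refine ⟨ha.smooth.mul hb.smooth, fun ξ => ?_, fun ξ => ?_, fun ξ => ?_⟩
  · have := mulb _ _ (ha.zero ξ) (hb.zero ξ)
    linarith
  · rw [e1]
    have h1 := mulb _ _ (ha.one ξ) (hb.zero ξ)
    have h2 := mulb _ _ (ha.zero ξ) (hb.one ξ)
    have := norm_add_le (deriv a ξ * b ξ) (a ξ * deriv b ξ)
    simp only
    linarith
  · rw [e2]
    have h1 := mulb _ _ (ha.two ξ) (hb.zero ξ)
    have h2 := mulb _ _ (ha.one ξ) (hb.one ξ)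
    have h3 := mulb _ _ (ha.zero ξ) (hb.two ξ)
    have h4 := norm_add_le (deriv (deriv a) ξ * b ξ) (deriv a ξ * deriv b ξ)
    have h5 := norm_add_le (deriv a ξ * deriv b ξ) (a ξ * deriv (deriv b) ξ)
    have := norm_add_le (deriv (deriv a) ξ * b ξ + deriv a ξ * deriv b ξ)
      (deriv a ξ * deriv b ξ + a ξ * deriv (deriv b) ξ)
    simp only
    linarith

theorem Bdd2.shift {a : ℝ → ℂ} {B : ℝ} (ha : Bdd2 a B) (c : ℝ) : Bdd2 (fun ξ => a (ξ - c)) B := by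
  have e1 : deriv (fun ξ => a (ξ - c)) = fun ξ => deriv a (ξ - c) :=
    funext fun ξ => deriv_comp_sub_const ..
  have e2 : deriv (deriv (fun ξ => a (ξ - c))) = fun ξ => deriv (deriv a) (ξ - c) := by
    rw [e1]
    exact funext fun ξ => deriv_comp_sub_const ..
  refine ⟨ha.smooth.comp (contDiff_id.sub contDiff_const), fun ξ => ha.zero _, fun ξ => ?_,
    fun ξ => ?_⟩
  · rw [e1]; exact ha.one _
  · rw [e2]; exact ha.two _

theorem deriv_eq_zero_of_support {m : ℝ → ℂ} {c R : ℝ} (hsupp : ∀ ξ, R ≤ |ξ - c| → m ξ = 0)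
    (ξ : ℝ) (h : R < |ξ - c|) : deriv m ξ = 0 := by
  have : m =ᶠ[𝓝 ξ] fun _ => 0 := by
    have : ∀ᶠ η in 𝓝 ξ, R < |η - c| :=
      (by fun_prop : Continuous fun η : ℝ => |η - c|).continuousAt.eventually_const_lt h
    filter_upwards [this] with η hη
    exact hsupp η hη.le
  rw [this.deriv_eq]
  simp

/-- Kernel bound for symbols supported in an interval of radius `R`. -/
theorem norm_kernel_le_of_bdd2 {m : ℝ → ℂ} (h : IsSymbol m) {c R B : ℝ} (hR : 0 ≤ R)
    (hsupp : ∀ ξ, R ≤ |ξ - c| → m ξ = 0) (hB : Bdd2 m B) (x : ℝ) :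
    ‖kernel m x‖ ≤ 2 * (R + 1) * B / (1 + x ^ 2) := by
  refine norm_kernel_le h (c := c) (by linarith) (fun ξ hξ => hsupp ξ (by linarith)) (fun ξ hξ => ?_)
    hB.zero hB.two x
  -- Each differentiation is known to preserve the vanishing only strictly outside the radius, so
  -- the radius grows by 1/2 twice; hence R+1.
  refine deriv_eq_zero_of_support (c := c) (R := R + 1 / 2) (fun η hη => ?_) ξ (by linarith)
  exact deriv_eq_zero_of_support (c := c) (R := R) hsupp η (by linarith)

theorem bdd2_one : Bdd2 (fun _ => 1) 1 := by
  refine ⟨contDiff_const, fun ξ => by simp, fun ξ => by simp, fun ξ => by simp⟩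

section Block

variable {ρ : ℝ → ℝ} (hρ : IsBump ρ)

include hρ

/-- Uniform in k because all the wide cutoffs are translates of one function. -/
theorem exists_norm_kernel_fat_le : ∃ C : ℝ, 0 < C ∧ ∀ (a : ℝ → ℂ) (B : ℝ), Bdd2 a B →
    ∀ (k : ℤ) (x : ℝ), ‖kernel (fun ξ => fat ρ k ξ * a ξ) x‖ ≤ C * B / (1 + x ^ 2) := by
  obtain ⟨D, hD, hfat⟩ := (isSymbol_fat hρ 0).exists_bdd2
  refine ⟨2 * (2 + 1) * (4 * D), by positivity, fun a B ha k x => ?_⟩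
  have h1 : Bdd2 (fat ρ k) D := by
    have : fat ρ k = fun ξ => fat ρ 0 (ξ - k) := funext fun ξ => fat_eq_shift ρ k ξ
    rw [this]
    exact hfat.shift k
  have h2 := h1.mul ha
  refine (norm_kernel_le_of_bdd2 ((isSymbol_fat hρ k).mul ha.smooth) (c := k) (R := 2)
    (by norm_num) (fun ξ hξ => ?_) h2 x).trans (le_of_eq ?_)
  · have : fat ρ k ξ = 0 := by
      refine Finset.sum_eq_zero fun l hl => sig_eq_zero hρ ?_
      rw [Finset.mem_Icc] at hl
      have h1 : |(l : ℝ) - k| ≤ 1 := by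
        rw [abs_le]
        have a : ((k - 1 : ℤ) : ℝ) ≤ l := Int.cast_le.2 hl.1
        have b : (l : ℝ) ≤ ((k + 1 : ℤ) : ℝ) := Int.cast_le.2 hl.2
        push_cast at a b
        constructor <;> linarith
      have := abs_sub_le ξ l k
      linarith
    rw [this, zero_mul]
  · ring

/-- Multipliers with two bounded derivatives act on each block, uniformly. -/
theorem exists_lpNorm_box_multiplier_le : ∃ C : ℝ, 0 < C ∧ ∀ (a : ℝ → ℂ) (B : ℝ), 0 < B →
    a.HasTemperateGrowth → Bdd2 a B → ∀ (q q₂ : ℝ≥0∞), 1 ≤ q → q ≤ q₂ →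
    ∀ (k : ℤ) (f : 𝓢'(ℝ, ℂ)),
      lpNorm q₂ (box ρ k (multiplier a f)) ≤ ENNReal.ofReal (C * B) * lpNorm q (box ρ k f) := by
  obtain ⟨C, hC, h⟩ := exists_norm_kernel_fat_le hρ
  refine ⟨4 * C, by positivity, fun a B hB hat ha q q₂ hq hqq k f => ?_⟩
  rw [box_multiplier hρ hat, mul_assoc]
  exact lpNorm_multiplier_le ((isSymbol_fat hρ k).mul ha.smooth) hq hqq (by positivity)
    (h a B ha k) _

/-- `□_k` is bounded from `L^q` to `L^{q₂}`, uniformly. -/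
theorem exists_lpNorm_box_le : ∃ C : ℝ, 0 < C ∧ ∀ (q q₂ : ℝ≥0∞), 1 ≤ q → q ≤ q₂ →
    ∀ (k : ℤ) (f : 𝓢'(ℝ, ℂ)), lpNorm q₂ (box ρ k f) ≤ ENNReal.ofReal C * lpNorm q f := by
  obtain ⟨D, hD, hsig⟩ := (isSymbol_sig hρ 0).exists_bdd2
  refine ⟨4 * (2 * (1 + 1) * D), by positivity, fun q q₂ hq hqq k f => ?_⟩
  have h1 : Bdd2 (sig ρ k) D := by
    have : sig ρ k = fun ξ => sig ρ 0 (ξ - k) := funext fun ξ => sig_eq_shift ρ k ξ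
    rw [this]
    exact hsig.shift k
  exact lpNorm_multiplier_le (isSymbol_sig hρ k) hq hqq (by positivity)
    (norm_kernel_le_of_bdd2 (isSymbol_sig hρ k) (c := k) (by norm_num)
      (fun ξ hξ => sig_eq_zero hρ hξ) h1) f

/-- Bernstein's inequality on a block. -/
theorem exists_lpNorm_box_bernstein : ∃ C : ℝ, 0 < C ∧ ∀ (q q₂ : ℝ≥0∞), 1 ≤ q → q ≤ q₂ →
    ∀ (k : ℤ) (f : 𝓢'(ℝ, ℂ)),
      lpNorm q₂ (box ρ k f) ≤ ENNReal.ofReal C * lpNorm q (box ρ k f) := by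
  obtain ⟨C, hC, h⟩ := exists_lpNorm_box_multiplier_le hρ
  refine ⟨C, hC, fun q q₂ hq hqq k f => ?_⟩
  have := h (fun _ => 1) 1 one_pos (by fun_prop) (bdd2_one) q q₂ hq hqq k f
  rwa [multiplier_one, mul_one] at this

end Block

/-! ### A distribution is determined by its blocks -/

section Injective

variable {ρ : ℝ → ℝ} (hρ : IsBump ρ)

include hρ

theorem isSymbol_bump {c : ℝ} (hc : 0 < c) : IsSymbol fun ξ => (ρ (c * ξ) : ℂ) := by
  refine ⟨Complex.ofRealCLM.contDiff.comp (hρ.smooth.comp (by fun_prop)), ?_⟩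
  refine HasCompactSupport.intro (isCompact_closedBall 0 c⁻¹) fun ξ hξ => ?_
  rw [Metric.mem_closedBall, Real.dist_eq, sub_zero, not_le] at hξ
  rw [hρ.eq_zero, Complex.ofReal_zero]
  rw [abs_mul, abs_of_pos hc]
  calc (1 : ℝ) = c * c⁻¹ := (mul_inv_cancel₀ hc.ne').symm
    _ ≤ c * |ξ| := by gcongr

/-- All derivatives are bounded and vanish for |x| < 1/2, where 2|x| < 1. The factor |x| becomes
smallness once the bump is dilated. -/
theorem exists_norm_iteratedDeriv_one_sub_bump_le (i : ℕ) : ∃ C : ℝ, 0 ≤ C ∧ ∀ x : ℝ,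
    ‖iteratedDeriv i (fun ξ => (1 : ℂ) - ρ ξ) x‖ ≤ C * (2 * |x|) := by
  have hsm : IsSymbol fun ξ => (ρ ξ : ℂ) := by simpa using isSymbol_bump hρ one_pos
  have hb : ∃ C : ℝ, ∀ x : ℝ, ‖iteratedDeriv i (fun ξ => (1 : ℂ) - ρ ξ) x‖ ≤ C := by
    rcases i.eq_zero_or_pos with rfl | hi
    · refine ⟨1, fun x => ?_⟩
      rw [iteratedDeriv_zero, ← Complex.ofReal_one, ← Complex.ofReal_sub, Complex.norm_real,
        Real.norm_eq_abs, abs_le]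
      have h1 := hρ.nonneg x
      have h2 := hρ.le_one x
      constructor <;> linarith
    · have h1 := (hsm.compact.comp_left (g := fun z : ℂ => -z) neg_zero).iteratedFDeriv (𝕜 := ℝ) i
      have h2 : Continuous (iteratedFDeriv ℝ i (-fun ξ => (ρ ξ : ℂ))) :=
        hsm.smooth.neg.continuous_iteratedFDeriv (by exact_mod_cast le_top)
      obtain ⟨C, hC⟩ := h1.exists_bound_of_continuous h2
      refine ⟨C, fun x => ?_⟩
      rw [iteratedDeriv_const_sub hi, ← norm_iteratedFDeriv_eq_norm_iteratedDeriv]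
      exact hC x
  obtain ⟨C, hC⟩ := hb
  have hC0 : 0 ≤ C := (norm_nonneg _).trans (hC 0)
  refine ⟨C, hC0, fun x => ?_⟩
  rcases lt_or_ge |x| (1 / 2) with hx | hx
  · have h0 : (fun ξ => (1 : ℂ) - ρ ξ) =ᶠ[𝓝 x] fun _ => 0 := by
      have : {y : ℝ | |y| < 1 / 2} ∈ 𝓝 x := (isOpen_lt continuous_abs continuous_const).mem_nhds hx
      filter_upwards [this] with y hy
      rw [hρ.eq_one y (le_of_lt hy)]
      simp
    rw [h0.iteratedDeriv_eq]
    simp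
    positivity
  · calc _ ≤ C * 1 := by simpa using hC x
      _ ≤ _ := by gcongr; linarith

/-- By Leibniz, each derivative of 1 - ρ(c·) is O(c|x|); the additional |x| is absorbed by a
Schwartz seminorm of higher weight and the factor c → 0 remains. -/
theorem tendsto_smulLeft_one_sub_bump (h : 𝓢(ℝ, ℂ)) {c : ℕ → ℝ} (hc : Tendsto c atTop (𝓝 0))
    (hc0 : ∀ n, 0 < c n) (hc1 : ∀ n, c n ≤ 1) :
    Tendsto (fun n => SchwartzMap.smulLeftCLM ℂ (fun y : ℝ => (1 : ℂ) - ρ (c n * y)) h) atTop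
      (𝓝 0) := by
  have hsm : IsSymbol fun ξ => (ρ ξ : ℂ) := by simpa using isSymbol_bump hρ one_pos
  have hbs : ContDiff ℝ (⊤ : ℕ∞) fun ξ => (1 : ℂ) - ρ ξ := contDiff_const.sub hsm.smooth
  choose C hC0 hC using exists_norm_iteratedDeriv_one_sub_bump_le hρ
  rw [(schwartz_withSeminorms ℝ ℝ ℂ).tendsto_nhds]
  rintro ⟨k, n⟩ ε hε
  set M : ℝ := ∑ i ∈ Finset.range (n + 1), (n.choose i : ℝ) * (C i * 2) *
    SchwartzMap.seminorm ℝ (k + 1) (n - i) h with hM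
  have hM0 : 0 ≤ M := Finset.sum_nonneg fun i _ => by have := hC0 i; positivity
  have hle : ∀ N, SchwartzMap.seminorm ℝ k n
      (SchwartzMap.smulLeftCLM ℂ (fun y : ℝ => (1 : ℂ) - ρ (c N * y)) h) ≤ c N * M := by
    intro N
    refine SchwartzMap.seminorm_le_bound ℝ k n _ (mul_nonneg (hc0 N).le hM0) fun x => ?_
    have hcs : ContDiff ℝ (⊤ : ℕ∞) fun y : ℝ => (1 : ℂ) - ρ (c N * y) :=
      hbs.comp (contDiff_const.mul contDiff_id)
    have htg : (fun y : ℝ => (1 : ℂ) - ρ (c N * y)).HasTemperateGrowth := by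
      have h1 := (isSymbol_bump hρ (hc0 N)).temperate
      fun_prop
    have heq : ((SchwartzMap.smulLeftCLM ℂ (fun y : ℝ => (1 : ℂ) - ρ (c N * y)) h : 𝓢(ℝ, ℂ)) :
        ℝ → ℂ) = fun y => ((1 : ℂ) - ρ (c N * y)) * h y := by
      ext y
      rw [SchwartzMap.smulLeftCLM_apply_apply htg, smul_eq_mul]
    rw [heq]
    have h1 := norm_iteratedFDeriv_mul_le (n := n) hcs (h.smooth ⊤) x (by exact_mod_cast le_top)
    refine (mul_le_mul_of_nonneg_left h1 (by positivity)).trans ?_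
    rw [Finset.mul_sum, hM, Finset.mul_sum]
    refine Finset.sum_le_sum fun i _ => ?_
    have h2 : ‖iteratedFDeriv ℝ i (fun y : ℝ => (1 : ℂ) - ρ (c N * y)) x‖ ≤
        C i * 2 * (c N * |x|) := by
      rw [norm_iteratedFDeriv_eq_norm_iteratedDeriv,
        iteratedDeriv_comp_const_smul (f := fun ξ => (1 : ℂ) - ρ ξ)
          (hbs.of_le (by exact_mod_cast le_top)) (c N), norm_smul, norm_pow,
        Real.norm_of_nonneg (hc0 N).le]
      have h3 := hC i (c N * x)
      rw [abs_mul, abs_of_pos (hc0 N)] at h3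
      calc c N ^ i * _ ≤ 1 * (C i * (2 * (c N * |x|))) := by
            gcongr
            exact pow_le_one₀ (hc0 N).le (hc1 N)
        _ = _ := by ring
    have h4 := SchwartzMap.le_seminorm ℝ (k + 1) (n - i) h x
    have h5 := hC0 i
    have h6 := hc0 N
    calc ‖x‖ ^ k * ((n.choose i : ℝ) * ‖iteratedFDeriv ℝ i (fun y : ℝ => (1 : ℂ) - ρ (c N * y)) x‖ *
          ‖iteratedFDeriv ℝ (n - i) h x‖)
        ≤ ‖x‖ ^ k * ((n.choose i : ℝ) * (C i * 2 * (c N * |x|)) *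
          ‖iteratedFDeriv ℝ (n - i) h x‖) := by gcongr
      _ = c N * ((n.choose i : ℝ) * (C i * 2) * (‖x‖ ^ (k + 1) * ‖iteratedFDeriv ℝ (n - i) h x‖)) := by
          rw [Real.norm_eq_abs]; ring
      _ ≤ _ := by gcongr
  have h1 : Tendsto (fun N => c N * M) atTop (𝓝 0) := by simpa using hc.mul_const M
  filter_upwards [h1.eventually_lt_const hε] with N hN
  rw [sub_zero]
  exact (hle N).trans_lt hN

/-- A dilated bump is a finite sum of its products with the σ_k, so it annihilates f; dilated bumps
tend to 1 as multipliers of 𝓢, hence f itself is 0. -/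
theorem eq_zero_of_box {f : 𝓢'(ℝ, ℂ)} (hf : ∀ k, box ρ k f = 0) : f = 0 := by
  have key : ∀ N : ℕ, multiplier (fun ξ => (ρ (1 / (N + 1 : ℝ) * ξ) : ℂ)) f = 0 := by
    intro N
    have hN : (0 : ℝ) < 1 / (N + 1) := by positivity
    set χ : ℝ → ℂ := fun ξ => (ρ (1 / (N + 1 : ℝ) * ξ) : ℂ) with hχ
    have hs : IsSymbol χ := isSymbol_bump hρ hN
    have h1 : χ = fun ξ => ∑ k ∈ Finset.Icc (-(N + 3) : ℤ) (N + 3), χ ξ * sig ρ k ξ := by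
      ext ξ
      rw [← Finset.mul_sum]
      by_cases h : N + 1 ≤ |ξ|
      · have : χ ξ = 0 := by
          rw [hχ]
          simp only
          rw [hρ.eq_zero, Complex.ofReal_zero]
          rw [abs_mul, abs_of_pos hN, one_div, inv_mul_eq_div, le_div_iff₀ (by positivity)]
          simpa using h
        rw [this, zero_mul]
      · unfold sig
        rw [← Complex.ofReal_sum, sum_cutoff hρ ξ]
        · simp
        · intro l hl
          rw [not_le, abs_lt] at h
          rw [abs_lt] at hl
          rw [Finset.mem_Icc]
          constructor
          · have : ((-(N + 3) : ℤ) : ℝ) < l := by push_cast; linarith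
            exact (Int.cast_lt.1 this).le
          · have : (l : ℝ) < ((N + 3 : ℤ) : ℝ) := by push_cast; linarith
            exact (Int.cast_lt.1 this).le
    rw [h1, multiplier_fun_sum fun k _ => (hs.mul (isSymbol_sig hρ k).smooth).temperate]
    refine Finset.sum_eq_zero fun k _ => ?_
    rw [← multiplier_multiplier hs.temperate (isSymbol_sig hρ k).temperate, ← box_eq, hf k,
      multiplier_zero]
  ext ψ
  -- The dilation 1/(N+7) in angular frequency becomes 2π/(N+7) in the frequency used by 𝓕; the
  -- shift by 7 > 2π keeps it at most 1.
  set c : ℕ → ℝ := fun N => 2 * Real.pi / (N + 7) with hcdef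
  have hpi := Real.pi_lt_d2
  have hpi0 := Real.pi_pos
  have hc0 : ∀ N, 0 < c N := fun N => by positivity
  have hc1 : ∀ N, c N ≤ 1 := fun N => by
    rw [hcdef]
    simp only
    rw [div_le_one (by positivity)]
    have : (0 : ℝ) ≤ N := N.cast_nonneg
    linarith
  have hc : Tendsto c atTop (𝓝 0) := by
    have := tendsto_const_div_atTop_nhds_zero_nat (2 * Real.pi)
    have h7 := (tendsto_add_atTop_iff_nat 7).2 this
    simpa [hcdef] using h7
  have h1 := tendsto_smulLeft_one_sub_bump hρ (𝓕⁻ ψ) hc hc0 hc1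
  have h2 : Tendsto (fun N => f (𝓕 (SchwartzMap.smulLeftCLM ℂ
      (fun y : ℝ => (1 : ℂ) - ρ (c N * y)) (𝓕⁻ ψ)))) atTop (𝓝 (f (𝓕 (0 : 𝓢(ℝ, ℂ))))) :=
    ((f.continuous.comp (FourierTransform.fourierCLM ℂ 𝓢(ℝ, ℂ)).continuous).tendsto 0).comp h1
  have h3 : ∀ N, f (𝓕 (SchwartzMap.smulLeftCLM ℂ
      (fun y : ℝ => (1 : ℂ) - ρ (c N * y)) (𝓕⁻ ψ))) = f ψ := by
    intro N
    have hs : IsSymbol fun ξ => (ρ (1 / ((N + 6 : ℕ) + 1 : ℝ) * ξ) : ℂ) :=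
      isSymbol_bump hρ (by positivity)
    have e := multiplier_fun_sub (m₁ := fun _ => 1) (by fun_prop) hs.temperate f
    rw [key, multiplier_one, sub_zero] at e
    have e2 := congrArg (fun g : 𝓢'(ℝ, ℂ) => g ψ) e
    rw [multiplier_apply] at e2
    have hy : ∀ y : ℝ, c N * y = 1 / ((N + 6 : ℕ) + 1 : ℝ) * (2 * Real.pi * y) := fun y => by
      rw [hcdef]
      push_cast
      field_simp
      ring
    simp only [hy]
    exact e2
  simp only [h3] at h2
  have h4 := tendsto_nhds_unique tendsto_const_nhds h2
  rw [h4]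
  simp

end Injective

/-! ### The modulation norm -/

/-- The weight `(1 + |k|)^s`. -/
def wt (s : ℝ) (k : ℤ) : ℝ≥0∞ := ENNReal.ofReal ((1 + |(k : ℝ)|) ^ s)

theorem one_le_wt {s : ℝ} (hs : 0 ≤ s) (k : ℤ) : 1 ≤ wt s k := by
  unfold wt
  rw [ENNReal.one_le_ofReal]
  exact Real.one_le_rpow (by have := abs_nonneg (k : ℝ); linarith) hs

theorem modNorm_one (ρ : ℝ → ℝ) (s : ℝ) (p : ℝ≥0∞) (f : 𝓢'(ℝ, ℂ)) :
    modNorm ρ s p 1 f = ∑' k : ℤ, wt s k * lpNorm p (box ρ k f) := by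
  simp [modNorm, wt]

section ModNorm

variable {ρ : ℝ → ℝ} {s : ℝ} {p : ℝ≥0∞}

theorem modNorm_zero (hp : 1 ≤ p) : modNorm ρ s p 1 0 = 0 := by
  rw [modNorm_one]
  simp [box, multiplier_zero, lpNorm_zero hp]

theorem modNorm_add_le (hp : 1 ≤ p) (f g : 𝓢'(ℝ, ℂ)) :
    modNorm ρ s p 1 (f + g) ≤ modNorm ρ s p 1 f + modNorm ρ s p 1 g := by
  simp only [modNorm_one]
  rw [← ENNReal.tsum_add]
  refine ENNReal.tsum_le_tsum fun k => ?_
  rw [← mul_add]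
  gcongr
  rw [box, multiplier_add]
  exact lpNorm_add_le hp _ _

theorem modNorm_smul (hp : 1 ≤ p) (c : ℂ) (f : 𝓢'(ℝ, ℂ)) :
    modNorm ρ s p 1 (c • f) = ‖c‖ₑ * modNorm ρ s p 1 f := by
  simp only [modNorm_one]
  rw [← ENNReal.tsum_mul_left]
  refine tsum_congr fun k => ?_
  rw [box, multiplier_smul, lpNorm_smul hp]
  exact mul_left_comm _ _ _

theorem modNorm_neg (hp : 1 ≤ p) (f : 𝓢'(ℝ, ℂ)) :
    modNorm ρ s p 1 (-f) = modNorm ρ s p 1 f := by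
  rw [← neg_one_smul ℂ f, modNorm_smul hp]
  simp

theorem modNorm_sub_le (hp : 1 ≤ p) (f g : 𝓢'(ℝ, ℂ)) :
    modNorm ρ s p 1 (f - g) ≤ modNorm ρ s p 1 f + modNorm ρ s p 1 g := by
  rw [sub_eq_add_neg, ← modNorm_neg hp g]
  exact modNorm_add_le hp _ _

theorem sum_apply {ι : Type*} (t : Finset ι) (h : ι → 𝓢'(ℝ, ℂ)) (ψ : 𝓢(ℝ, ℂ)) :
    (∑ i ∈ t, h i) ψ = ∑ i ∈ t, h i ψ := by
  classical
  induction t using Finset.induction_on with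
  | empty => rfl
  | insert a t ha ih =>
    rw [Finset.sum_insert ha, Finset.sum_insert ha, ← ih]
    rfl

theorem hasSum_multiplier {ι : Type*} (m : ℝ → ℂ) {h : ι → 𝓢'(ℝ, ℂ)} {H : 𝓢'(ℝ, ℂ)}
    (hH : ∀ ψ : 𝓢(ℝ, ℂ), HasSum (fun i => h i ψ) (H ψ)) (ψ : 𝓢(ℝ, ℂ)) :
    HasSum (fun i => multiplier m (h i) ψ) (multiplier m H ψ) :=
  hH _

theorem modNorm_hasSum_le {ι : Type*} (hp : 1 ≤ p) (h : ι → 𝓢'(ℝ, ℂ)) (H : 𝓢'(ℝ, ℂ))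
    (hH : ∀ ψ : 𝓢(ℝ, ℂ), HasSum (fun i => h i ψ) (H ψ)) :
    modNorm ρ s p 1 H ≤ ∑' i, modNorm ρ s p 1 (h i) := by
  simp only [modNorm_one]
  rw [ENNReal.tsum_comm]
  refine ENNReal.tsum_le_tsum fun k => ?_
  rw [ENNReal.tsum_mul_left]
  gcongr
  exact lpNorm_hasSum_le hp _ _ (hasSum_multiplier _ hH)

theorem lpNorm_box_le_modNorm (hs : 0 ≤ s) (k : ℤ) (f : 𝓢'(ℝ, ℂ)) :
    lpNorm p (box ρ k f) ≤ modNorm ρ s p 1 f := by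
  rw [modNorm_one]
  refine le_trans ?_ (ENNReal.le_tsum k)
  exact le_mul_of_one_le_left zero_le (one_le_wt hs k)

theorem tsum_lpNorm_box_le_modNorm (hs : 0 ≤ s) (f : 𝓢'(ℝ, ℂ)) :
    ∑' k, lpNorm p (box ρ k f) ≤ modNorm ρ s p 1 f := by
  rw [modNorm_one]
  exact ENNReal.tsum_le_tsum fun k => le_mul_of_one_le_left zero_le (one_le_wt hs k)

theorem modNorm_multiplier_le {q : ℝ≥0∞} {c : ℝ≥0∞} {m : ℝ → ℂ} {f : 𝓢'(ℝ, ℂ)}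
    (h : ∀ k, lpNorm p (box ρ k (multiplier m f)) ≤ c * lpNorm q (box ρ k f)) :
    modNorm ρ s p 1 (multiplier m f) ≤ c * modNorm ρ s q 1 f := by
  simp only [modNorm_one]
  rw [← ENNReal.tsum_mul_left]
  refine ENNReal.tsum_le_tsum fun k => ?_
  rw [mul_left_comm]
  gcongr
  exact h k

theorem box_box_eq_zero (hρ : IsBump ρ) {j k : ℤ} (h : k ∉ Finset.Icc (j - 1) (j + 1))
    (f : 𝓢'(ℝ, ℂ)) : box ρ j (box ρ k f) = 0 := by
  rw [box_eq, box_eq, multiplier_multiplier (isSymbol_sig hρ j).temperate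
    (isSymbol_sig hρ k).temperate, ← multiplier_fun_zero f]
  congr 1
  ext ξ
  by_cases h1 : 1 ≤ |ξ - j|
  · rw [sig_eq_zero hρ h1, zero_mul]
  by_cases h2 : 1 ≤ |ξ - k|
  · rw [sig_eq_zero hρ h2, mul_zero]
  exfalso
  apply h
  rw [not_le, abs_lt] at h1 h2
  rw [Finset.mem_Icc]
  constructor
  · have : ((j - 2 : ℤ) : ℝ) < k := by push_cast; linarith
    have := Int.cast_lt.1 this
    omega
  · have : (k : ℝ) < ((j + 2 : ℤ) : ℝ) := by push_cast; linarith
    have := Int.cast_lt.1 this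
    omega

theorem sum_box_box (hρ : IsBump ρ) (j : ℤ) (f : 𝓢'(ℝ, ℂ)) :
    ∑ k ∈ Finset.Icc (j - 1) (j + 1), box ρ j (box ρ k f) = box ρ j f := by
  have h1 : ∀ k, box ρ j (box ρ k f) = multiplier (fun ξ => sig ρ k ξ * sig ρ j ξ) f := by
    intro k
    rw [box_eq, box_eq, multiplier_multiplier (isSymbol_sig hρ j).temperate
      (isSymbol_sig hρ k).temperate]
    simp only [mul_comm]
  simp only [h1]
  rw [← multiplier_fun_sum fun k _ => ((isSymbol_sig hρ k).mul (isSymbol_sig hρ j).smooth).temperate,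
    box_eq]
  congr 1
  ext ξ
  rw [← Finset.sum_mul]
  exact fat_mul_sig hρ j ξ

/-- Elements of the modulation space are the sums of their blocks. -/
theorem hasSum_box (hρ : IsBump ρ) (hs : 0 ≤ s) (hp : 1 ≤ p) {f : 𝓢'(ℝ, ℂ)}
    (hf : modNorm ρ s p 1 f < ∞) (ψ : 𝓢(ℝ, ℂ)) : HasSum (fun k => box ρ k f ψ) (f ψ) := by
  have : Fact (1 ≤ p) := ⟨hp⟩
  have ht : ∑' k, lpNorm p (box ρ k f) ≠ ∞ := ((tsum_lpNorm_box_le_modNorm hs f).trans_lt hf).ne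
  choose g hg using fun k => exists_coe_eq (p := p) (f := box ρ k f)
    (ENNReal.ne_top_of_tsum_ne_top ht k).lt_top
  have hsum : Summable fun k => ‖g k‖ := by
    have : ∀ k, lpNorm p (box ρ k f) = ‖g k‖ₑ := fun k => by rw [← hg k, lpNorm_coe]
    simp_rw [this] at ht
    simpa using ENNReal.summable_toReal ht
  have hs : HasSum g (∑' k, g k) := hsum.of_norm.hasSum
  set F : 𝓢'(ℝ, ℂ) := ((∑' k, g k : Lp ℂ p (volume : Measure ℝ)) : 𝓢'(ℝ, ℂ)) with hF
  have h1 : ∀ ψ : 𝓢(ℝ, ℂ), HasSum (fun k => box ρ k f ψ) (F ψ) := by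
    intro ψ
    have h1 := hs.mapL (Lp.toTemperedDistributionCLM ℂ volume p)
    have h2 := h1.mapL (PointwiseConvergenceCLM.evalCLM (RingHom.id ℂ) ℂ ψ)
    have h3 : (fun k => box ρ k f ψ) = fun k => Lp.toTemperedDistribution (g k) ψ :=
      funext fun k => by rw [hg k]
    rw [h3]
    exact h2
  -- The blocks sum in L^p to some F, which has the same blocks as f because only neighbouring
  -- blocks interact.
  have h2 : F - f = 0 := by
    refine eq_zero_of_box hρ fun j => ?_
    rw [box, multiplier_sub, sub_eq_zero]
    change box ρ j F = box ρ j f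
    ext ψ
    have h3 : HasSum (fun k => box ρ j (box ρ k f) ψ) (box ρ j F ψ) := hasSum_multiplier _ h1 ψ
    have h4 : HasSum (fun k => box ρ j (box ρ k f) ψ)
        (∑ k ∈ Finset.Icc (j - 1) (j + 1), box ρ j (box ρ k f) ψ) :=
      hasSum_sum_of_ne_finset_zero fun k hk => by
        rw [box_box_eq_zero hρ hk]
        rfl
    rw [h3.unique h4, ← sum_box_box hρ j f]
    rw [sum_apply]
  rw [sub_eq_zero] at h2
  rw [← h2]
  rw [h2]
  have := h1 ψ
  rwa [h2] at this

/-- Bernstein on each block and the triangle inequality; the ℓ¹ summation over blocks is what allows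
every q ≥ p, in particular q = ∞. -/
theorem exists_lpNorm_le_modNorm (hρ : IsBump ρ) : ∃ C : ℝ, 0 < C ∧
    ∀ (s : ℝ) (p q : ℝ≥0∞), 0 ≤ s → 1 ≤ p → p ≤ q → ∀ f : 𝓢'(ℝ, ℂ), modNorm ρ s p 1 f < ∞ →
      lpNorm q f ≤ ENNReal.ofReal C * modNorm ρ s p 1 f := by
  obtain ⟨C, hC, h⟩ := exists_lpNorm_box_bernstein hρ
  refine ⟨C, hC, fun s p q hs hp hpq f hf => ?_⟩
  calc lpNorm q f ≤ ∑' k, lpNorm q (box ρ k f) :=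
        lpNorm_hasSum_le (hp.trans hpq) _ _ (hasSum_box hρ hs hp hf)
    _ ≤ ∑' k, ENNReal.ofReal C * lpNorm p (box ρ k f) :=
        ENNReal.tsum_le_tsum fun k => h p q hp hpq k f
    _ ≤ ENNReal.ofReal C * modNorm ρ s p 1 f := by
        rw [ENNReal.tsum_mul_left]
        gcongr
        exact tsum_lpNorm_box_le_modNorm hs f

theorem exists_modNorm_multiplier_le (hρ : IsBump ρ) : ∃ C : ℝ, 0 < C ∧
    ∀ (a : ℝ → ℂ) (B : ℝ), 0 < B → a.HasTemperateGrowth → Bdd2 a B →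
    ∀ (s : ℝ) (p q : ℝ≥0∞), 1 ≤ p → p ≤ q → ∀ f : 𝓢'(ℝ, ℂ),
      modNorm ρ s q 1 (multiplier a f) ≤ ENNReal.ofReal (C * B) * modNorm ρ s p 1 f := by
  obtain ⟨C, hC, h⟩ := exists_lpNorm_box_multiplier_le hρ
  refine ⟨C, hC, fun a B hB hat ha s p q hp hpq f => ?_⟩
  exact modNorm_multiplier_le fun k => h a B hB hat ha p q hp hpq k f

theorem eq_zero_of_modNorm (hρ : IsBump ρ) (hs : 0 ≤ s) (hp : 1 ≤ p) {f : 𝓢'(ℝ, ℂ)}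
    (hf : modNorm ρ s p 1 f = 0) : f = 0 := by
  refine eq_zero_of_box hρ fun k => eq_zero_of_lpNorm hp ?_
  exact le_antisymm ((lpNorm_box_le_modNorm hs k f).trans hf.le) zero_le

end ModNorm

/-! ### The modulation space as a Banach space -/

/-- The parameters of a modulation space `M^s_{p,1}`. -/
structure ModParams where
  ρ : ℝ → ℝ
  s : ℝ
  p : ℝ≥0∞
  isBump : IsBump ρ
  hs : 0 ≤ s
  hp : 1 ≤ p

variable (P : ModParams)

instance : Fact (1 ≤ P.p) := ⟨P.hp⟩

/-- `M^s_{p,1}` as a subspace of the space of tempered distributions. -/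
def modSubmodule : Submodule ℂ 𝓢'(ℝ, ℂ) where
  carrier := {f | modNorm P.ρ P.s P.p 1 f < ∞}
  add_mem' := fun hf hg => (modNorm_add_le P.hp _ _).trans_lt (ENNReal.add_lt_top.2 ⟨hf, hg⟩)
  zero_mem' := by
    rw [Set.mem_ofPred_eq, modNorm_zero P.hp]
    exact ENNReal.zero_lt_top
  smul_mem' := fun c f hf => by
    rw [Set.mem_ofPred_eq, modNorm_smul P.hp]
    exact ENNReal.mul_lt_top enorm_lt_top hf

/-- `M^s_{p,1}`, with its own norm. -/
def ModSpace : Type := modSubmodule P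

namespace ModSpace

variable {P}

/-- The underlying distribution. -/
def dist (e : ModSpace P) : 𝓢'(ℝ, ℂ) := e.1

/-- An element of the modulation space from a distribution of finite norm. -/
def mk (f : 𝓢'(ℝ, ℂ)) (hf : modNorm P.ρ P.s P.p 1 f < ∞) : ModSpace P := ⟨f, hf⟩

@[simp] theorem dist_mk (f : 𝓢'(ℝ, ℂ)) (hf : modNorm P.ρ P.s P.p 1 f < ∞) :
    dist (mk f hf) = f := rfl

theorem modNorm_dist_lt (e : ModSpace P) : modNorm P.ρ P.s P.p 1 e.dist < ∞ := e.2

theorem dist_injective : Function.Injective (dist : ModSpace P → 𝓢'(ℝ, ℂ)) :=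
  Subtype.val_injective

instance : AddCommGroup (ModSpace P) := inferInstanceAs (AddCommGroup (modSubmodule P))

instance : Module ℂ (ModSpace P) := inferInstanceAs (Module ℂ (modSubmodule P))

theorem dist_add (e e' : ModSpace P) : (e + e').dist = e.dist + e'.dist := rfl
theorem dist_sub (e e' : ModSpace P) : (e - e').dist = e.dist - e'.dist := rfl
theorem dist_neg (e : ModSpace P) : (-e).dist = -e.dist := rfl
theorem dist_zero : (0 : ModSpace P).dist = 0 := rfl
theorem dist_smul (c : ℂ) (e : ModSpace P) : (c • e).dist = c • e.dist := rfl

instance : NormedAddCommGroup (ModSpace P) :=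
  AddGroupNorm.toNormedAddCommGroup
    { toFun := fun e => (modNorm P.ρ P.s P.p 1 e.dist).toReal
      map_zero' := by rw [dist_zero, modNorm_zero P.hp]; rfl
      add_le' := fun e e' => by
        rw [dist_add, ← ENNReal.toReal_add e.modNorm_dist_lt.ne e'.modNorm_dist_lt.ne]
        exact ENNReal.toReal_mono
          (ENNReal.add_lt_top.2 ⟨e.modNorm_dist_lt, e'.modNorm_dist_lt⟩).ne (modNorm_add_le P.hp _ _)
      neg' := fun e => by rw [dist_neg, modNorm_neg P.hp]
      eq_zero_of_map_eq_zero' := fun e he => by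
        rw [ENNReal.toReal_eq_zero_iff] at he
        exact dist_injective
          (eq_zero_of_modNorm P.isBump P.hs P.hp (he.resolve_right e.modNorm_dist_lt.ne)) }

theorem norm_eq (e : ModSpace P) : ‖e‖ = (modNorm P.ρ P.s P.p 1 e.dist).toReal := rfl

theorem enorm_eq (e : ModSpace P) : ‖e‖ₑ = modNorm P.ρ P.s P.p 1 e.dist := by
  rw [← ofReal_norm, norm_eq, ENNReal.ofReal_toReal e.modNorm_dist_lt.ne]

instance : NormedSpace ℂ (ModSpace P) where
  norm_smul_le := fun c e => by
    rw [norm_eq, norm_eq, dist_smul, modNorm_smul P.hp, ENNReal.toReal_mul]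
    simp

theorem norm_le_of_modNorm_le {e : ModSpace P} {a : ℝ} (ha : 0 ≤ a)
    (h : modNorm P.ρ P.s P.p 1 e.dist ≤ ENNReal.ofReal a) : ‖e‖ ≤ a :=
  ENNReal.toReal_le_of_le_ofReal ha h

theorem modNorm_dist (e : ModSpace P) : modNorm P.ρ P.s P.p 1 e.dist = ENNReal.ofReal ‖e‖ := by
  rw [← enorm_eq, ofReal_norm]

theorem exists_lpNorm_dist_le (P : ModParams) : ∃ C : ℝ, 0 < C ∧ ∀ (q : ℝ≥0∞), P.p ≤ q →
    ∀ e : ModSpace P, lpNorm q e.dist ≤ ENNReal.ofReal (C * ‖e‖) := by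
  obtain ⟨C, hC, h⟩ := exists_lpNorm_le_modNorm P.isBump
  refine ⟨C, hC, fun q hq e => ?_⟩
  rw [ENNReal.ofReal_mul hC.le, ← modNorm_dist]
  exact h P.s P.p q P.hs P.hp hq e.dist e.modNorm_dist_lt

theorem exists_toLp (P : ModParams) : ∃ C : ℝ, 0 < C ∧ ∀ e : ModSpace P,
    ∃ g : Lp ℂ P.p (volume : Measure ℝ), (g : 𝓢'(ℝ, ℂ)) = e.dist ∧ ‖g‖ ≤ C * ‖e‖ := by
  obtain ⟨C, hC, h⟩ := exists_lpNorm_dist_le P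
  refine ⟨C, hC, fun e => ?_⟩
  have h1 := h P.p le_rfl e
  obtain ⟨g, hg⟩ := exists_coe_eq (h1.trans_lt ENNReal.ofReal_lt_top)
  refine ⟨g, hg, ?_⟩
  rw [← hg, lpNorm_coe, ← ofReal_norm] at h1
  exact (ENNReal.ofReal_le_ofReal_iff (by positivity)).1 h1

theorem sum_dist {ι : Type*} (t : Finset ι) (e : ι → ModSpace P) :
    (∑ i ∈ t, e i).dist = ∑ i ∈ t, (e i).dist := by
  classical
  induction t using Finset.induction_on with
  | empty => rfl
  | insert a t ha ih =>
    rw [Finset.sum_insert ha, Finset.sum_insert ha, ← ih, dist_add]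

/-- An absolutely convergent series converges in L^p; countable subadditivity of the modulation norm
shows that its sum lies in the space and that the tails tend to 0. -/
instance : CompleteSpace (ModSpace P) := by
  refine NormedAddCommGroup.completeSpace_of_summable_imp_tendsto fun e he => ?_
  obtain ⟨C, hC, h⟩ := exists_toLp P
  choose g hg hgn using fun n => h (e n)
  have hs : HasSum g (∑' n, g n) :=
    (Summable.of_norm_bounded (he.mul_left C) hgn).hasSum
  set F : 𝓢'(ℝ, ℂ) := ((∑' n, g n : Lp ℂ P.p (volume : Measure ℝ)) : 𝓢'(ℝ, ℂ)) with hF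
  have h1 : ∀ ψ : 𝓢(ℝ, ℂ), HasSum (fun n => (e n).dist ψ) (F ψ) := by
    intro ψ
    have h1 := hs.mapL (Lp.toTemperedDistributionCLM ℂ volume P.p)
    have h2 := h1.mapL (PointwiseConvergenceCLM.evalCLM (RingHom.id ℂ) ℂ ψ)
    have h3 : (fun n => (e n).dist ψ) = fun n => Lp.toTemperedDistribution (g n) ψ :=
      funext fun n => by rw [hg n]
    rw [h3]
    exact h2
  have ht : ∑' n, ‖e n‖ₑ ≠ ∞ := by
    simp_rw [← ofReal_norm]
    exact he.tsum_ofReal_ne_top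
  have hFn : modNorm P.ρ P.s P.p 1 F < ∞ := by
    refine (modNorm_hasSum_le P.hp _ _ h1).trans_lt ?_
    simp_rw [← enorm_eq]
    exact ht.lt_top
  refine ⟨mk F hFn, ?_⟩
  rw [tendsto_iff_edist_tendsto_0]
  refine tendsto_of_tendsto_of_tendsto_of_le_of_le tendsto_const_nhds
    (ENNReal.tendsto_sum_nat_add _ ht) (fun n => zero_le) fun n => ?_
  simp only
  rw [edist_comm, edist_eq_enorm_sub, enorm_eq, dist_sub, dist_mk, sum_dist]
  simp_rw [enorm_eq]
  refine modNorm_hasSum_le P.hp _ _ fun ψ => ?_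
  have h2 := (hasSum_nat_add_iff' n).2 (h1 ψ)
  rw [← sum_apply] at h2
  exact h2

end ModSpace

/-- The summand 1 keeps the constant positive, so that the case of infinite norm is covered even for
ψ = 0. -/
theorem enorm_apply_le (f : 𝓢'(ℝ, ℂ)) (ψ : 𝓢(ℝ, ℂ)) :
    ‖f ψ‖ₑ ≤ (1 + ∫⁻ x, ‖ψ x‖ₑ) * lpNorm ∞ f := by
  rcases eq_or_ne (lpNorm ∞ f) ∞ with h | h
  · rw [h, ENNReal.mul_top (by simp)]
    exact le_top
  obtain ⟨g, hg, hfg⟩ := exists_rep h.lt_top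
  rw [hfg ψ, lpNorm_eq le_top hg hfg]
  refine (enorm_integral_le_lintegral_enorm _).trans ?_
  calc ∫⁻ x, ‖ψ x * g x‖ₑ ≤ ∫⁻ x, ‖ψ x‖ₑ * eLpNorm g ∞ volume := by
        refine lintegral_mono_ae ?_
        filter_upwards [ae_le_eLpNormEssSup (f := g) (μ := volume)] with x hx
        rw [enorm_mul, eLpNorm_exponent_top]
        gcongr
    _ = (∫⁻ x, ‖ψ x‖ₑ) * eLpNorm g ∞ volume := by
        rw [lintegral_mul_const _ (by fun_prop)]
    _ ≤ _ := by gcongr; exact le_add_self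

namespace ModSpace

variable {P}

/-- Testing against a Schwartz function is continuous on the modulation space. -/
theorem exists_evalCLM (ψ : 𝓢(ℝ, ℂ)) : ∃ T : ModSpace P →L[ℂ] ℂ, ∀ e, T e = e.dist ψ := by
  obtain ⟨C, hC, h⟩ := exists_lpNorm_dist_le P
  have hψ : ∫⁻ x, ‖ψ x‖ₑ ≠ ∞ := (ψ.integrable (μ := volume)).2.ne
  refine ⟨LinearMap.mkContinuous
    { toFun := fun e => e.dist ψ
      map_add' := fun e e' => by rw [dist_add]; rfl
      map_smul' := fun c e => by rw [dist_smul]; rfl }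
    ((1 + ∫⁻ x, ‖ψ x‖ₑ).toReal * C) fun e => ?_, fun e => rfl⟩
  have h1 := (enorm_apply_le e.dist ψ).trans (mul_le_mul_right (h ∞ le_top e) _)
  rw [← ENNReal.ofReal_toReal (ENNReal.add_ne_top.2 ⟨ENNReal.one_ne_top, hψ⟩),
    ← ENNReal.ofReal_mul ENNReal.toReal_nonneg, ← ofReal_norm,
    ENNReal.ofReal_le_ofReal_iff (by positivity)] at h1
  rw [mul_assoc]
  exact h1

/-- Testing against a Schwartz function. -/
def evalCLM (ψ : 𝓢(ℝ, ℂ)) : ModSpace P →L[ℂ] ℂ := (exists_evalCLM ψ).choose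

@[simp] theorem evalCLM_apply (ψ : 𝓢(ℝ, ℂ)) (e : ModSpace P) : evalCLM ψ e = e.dist ψ :=
  (exists_evalCLM ψ).choose_spec e

/-- A Fourier multiplier as an operator on the modulation space. -/
def multCLM (m : ℝ → ℂ) (C : ℝ) (hC : 0 ≤ C) (h : ∀ f, modNorm P.ρ P.s P.p 1 (multiplier m f) ≤
    ENNReal.ofReal C * modNorm P.ρ P.s P.p 1 f) : ModSpace P →L[ℂ] ModSpace P :=
  LinearMap.mkContinuous
    { toFun := fun e => mk (multiplier m e.dist) ((h e.dist).trans_lt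
        (ENNReal.mul_lt_top ENNReal.ofReal_lt_top e.modNorm_dist_lt))
      map_add' := fun e e' => dist_injective (multiplier_add _ _ _)
      map_smul' := fun c e => dist_injective (multiplier_smul _ _ _) } C fun e => by
    refine norm_le_of_modNorm_le (by positivity) ?_
    rw [ENNReal.ofReal_mul hC, ← modNorm_dist]
    exact h e.dist

end ModSpace

/-! ### Frequency support of products -/

theorem iteratedDeriv_cexp_mul_I (n : ℕ) :
    iteratedDeriv n (fun x : ℝ => Complex.exp (x * Complex.I)) =
      fun x : ℝ => Complex.I ^ n * Complex.exp (x * Complex.I) := by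
  induction n with
  | zero => simp
  | succ n ih =>
    rw [iteratedDeriv_succ, ih]
    ext x
    have h1 : HasDerivAt (fun x : ℝ => (x : ℂ) * Complex.I) (1 * Complex.I) x :=
      (Complex.ofRealCLM.hasDerivAt (x := x)).mul_const _
    rw [(h1.cexp.const_mul (Complex.I ^ n)).deriv]
    ring

theorem hasTemperateGrowth_cexp_mul_I :
    (fun x : ℝ => Complex.exp (x * Complex.I)).HasTemperateGrowth := by
  refine ⟨(Complex.ofRealCLM.contDiff.mul contDiff_const).cexp, fun n => ⟨0, 1, fun x => ?_⟩⟩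
  rw [norm_iteratedFDeriv_eq_norm_iteratedDeriv, iteratedDeriv_cexp_mul_I]
  simp [Complex.norm_exp_ofReal_mul_I]

/-- Modulation of a Schwartz function shifts its inverse Fourier transform. -/
theorem fourierInv_modulate (Φ : 𝓢(ℝ, ℂ)) (z w : ℝ) :
    𝓕⁻ (SchwartzMap.smulLeftCLM ℂ
      (fun x : ℝ => Complex.exp (((2 * Real.pi * z * x : ℝ) : ℂ) * Complex.I)) Φ) w =
      𝓕⁻ Φ (w + z) := by
  have ht : (fun x : ℝ => Complex.exp (((2 * Real.pi * z * x : ℝ) : ℂ) *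
      Complex.I)).HasTemperateGrowth :=
    hasTemperateGrowth_cexp_mul_I.comp (f := fun x : ℝ => 2 * Real.pi * z * x) (by fun_prop)
  rw [SchwartzMap.fourierInv_coe, SchwartzMap.fourierInv_coe, Real.fourierInv_eq',
    Real.fourierInv_eq']
  refine integral_congr_ae (Eventually.of_forall fun x => ?_)
  simp only [SchwartzMap.smulLeftCLM_apply_apply ht, smul_eq_mul]
  rw [← mul_assoc, ← Complex.exp_add]
  congr 2
  simp
  ring

/-- The frequency support of a product, obtained by duality. With Φ the transpose of c(D) applied to
ψ, Fubini reduces the claim to ∫ κ_b(x-y) Φ(x) G(x) dx = 0 for each y, which is a(D)f tested on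
κ_b(·-y)Φ. The inverse transform of that test function at z is a superposition over w of terms
containing b(w) c(w+z), and a(z) kills each of them. -/
theorem multiplier_mul_eq_zero {a b c : ℝ → ℂ} (ha : IsSymbol a) (hb : IsSymbol b)
    (hc : IsSymbol c) (habc : ∀ z w, a z * (b w * c (w + z)) = 0) {f F : 𝓢'(ℝ, ℂ)} {G g : ℝ → ℂ}
    (hG : IsRep (multiplier a f) G) (hGb : MemLp G ∞ volume) (hg : MemLp g ∞ volume)
    (hF : IsRep F fun x => G x * conv (kernel b) g x) : multiplier c F = 0 := by
  ext ψ
  obtain ⟨B, hB, hκ⟩ := hb.kernel_decay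
  set Φ : 𝓢(ℝ, ℂ) := 𝓕 (SchwartzMap.smulLeftCLM ℂ (fun y : ℝ => c (2 * Real.pi * y)) (𝓕⁻ ψ))
    with hΦ
  have hΦG : Integrable fun x => Φ x * G x :=
    (Φ.integrable (μ := volume)).mul_bdd (c := (eLpNorm G ∞ volume).toReal) hGb.1 (by
      filter_upwards [ae_le_eLpNormEssSup (f := G) (μ := volume)] with x hx
      rw [← eLpNorm_exponent_top, ← ENNReal.ofReal_toReal hGb.2.ne, ← ofReal_norm] at hx
      exact (ENNReal.ofReal_le_ofReal_iff ENNReal.toReal_nonneg).1 hx)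
  have key : ∀ y, ∫ x, kernel b (x - y) * (Φ x * G x) = 0 := by
    intro y
    set κ : 𝓢(ℝ, ℂ) := SchwartzMap.compSubConstCLM ℂ y (𝓕⁻ hb.toSchwartz) with hκdef
    have hκx : ∀ x, κ x = kernel b (x - y) := fun x => by
      rw [hb.kernel_eq, hκdef, SchwartzMap.compSubConstCLM_apply]
    set Θ : 𝓢(ℝ, ℂ) := SchwartzMap.smulLeftCLM ℂ κ Φ with hΘ
    have hΘx : ∀ x, Θ x = kernel b (x - y) * Φ x := fun x => by
      rw [hΘ, SchwartzMap.smulLeftCLM_apply_apply κ.hasTemperateGrowth, hκx, smul_eq_mul]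
    have h1 : ∀ z, a (2 * Real.pi * z) * 𝓕⁻ Θ z = 0 := by
      intro z
      set E : 𝓢(ℝ, ℂ) := SchwartzMap.smulLeftCLM ℂ
        (fun x : ℝ => Complex.exp (((2 * Real.pi * z * x : ℝ) : ℂ) * Complex.I)) Φ with hE
      have ht : (fun x : ℝ => Complex.exp (((2 * Real.pi * z * x : ℝ) : ℂ) *
          Complex.I)).HasTemperateGrowth :=
        hasTemperateGrowth_cexp_mul_I.comp (f := fun x : ℝ => 2 * Real.pi * z * x) (by fun_prop)
      have h2 : 𝓕⁻ Θ z = ∫ x, kernel b (x - y) * E x := by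
        rw [SchwartzMap.fourierInv_coe, Real.fourierInv_eq']
        refine integral_congr_ae (Eventually.of_forall fun x => ?_)
        simp only [hΘx, hE, SchwartzMap.smulLeftCLM_apply_apply ht, smul_eq_mul]
        simp
        ring_nf
      rw [h2, ← fourier_symbol_mul hb E y, SchwartzMap.fourier_coe, Real.fourier_eq',
        ← integral_const_mul]
      refine integral_eq_zero_of_ae (Eventually.of_forall fun w => ?_)
      simp only [SchwartzMap.smulLeftCLM_apply_apply (hasTemperateGrowth_dilate hb.temperate),
        smul_eq_mul, Pi.zero_apply]
      rw [hE, fourierInv_modulate, hΦ, FourierTransform.fourierInv_fourier_eq,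
        SchwartzMap.smulLeftCLM_apply_apply (hasTemperateGrowth_dilate hc.temperate), smul_eq_mul]
      have h3 := habc (2 * Real.pi * z) (2 * Real.pi * w)
      rw [← mul_add] at h3
      linear_combination (Complex.exp (((-2 * Real.pi * inner ℝ w y : ℝ) : ℂ) * Complex.I) *
        (𝓕⁻ ψ) (w + z)) * h3
    have h4 : multiplier a f Θ = 0 := by
      rw [multiplier_apply]
      have : SchwartzMap.smulLeftCLM ℂ (fun y : ℝ => a (2 * Real.pi * y)) (𝓕⁻ Θ) = 0 := by
        ext z
        rw [SchwartzMap.smulLeftCLM_apply_apply (hasTemperateGrowth_dilate ha.temperate),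
          smul_eq_mul, h1 z]
        rfl
      rw [this]
      simp
    rw [hG Θ] at h4
    rw [← h4]
    refine integral_congr_ae (Eventually.of_forall fun x => ?_)
    simp only [hΘx]
    ring
  rw [multiplier_apply, hF]
  have h5 := integral_mul_conv hb.continuous_kernel hB hκ hΦG le_top hg
  simp only [key, zero_mul, integral_zero] at h5
  rw [← hΦ]
  calc ∫ x, Φ x * (G x * conv (kernel b) g x) = ∫ x, Φ x * G x * conv (kernel b) g x := by
        simp only [mul_assoc]
    _ = 0 := h5
    _ = _ := rfl

/-! ### The product estimate -/

/-- From |k| ≤ 2 + |i| + |j| one gets 1+|k| ≤ 3(1+|i|)(1+|j|), and s ≥ 0 preserves the inequality.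
-/
theorem wt_le {s : ℝ} (hs : 0 ≤ s) {i j k : ℤ} (h : |k - (i + j)| ≤ 2) :
    wt s k ≤ ENNReal.ofReal (3 ^ s) * (wt s i * wt s j) := by
  unfold wt
  rw [← ENNReal.ofReal_mul (by positivity), ← ENNReal.ofReal_mul (by positivity),
    ← Real.mul_rpow (by positivity) (by positivity),
    ← Real.mul_rpow (by norm_num) (by positivity)]
  refine ENNReal.ofReal_le_ofReal (Real.rpow_le_rpow (by positivity) ?_ hs)
  have h1 : |(k : ℝ)| ≤ 2 + (|(i : ℝ)| + |(j : ℝ)|) := by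
    have h2 : |(k : ℝ) - (i + j)| ≤ 2 := by exact_mod_cast h
    have h3 := abs_add_le (i : ℝ) j
    have h4 := abs_sub_abs_le_abs_sub (k : ℝ) (i + j)
    linarith
  have h2 := abs_nonneg (i : ℝ)
  have h3 := abs_nonneg (j : ℝ)
  nlinarith [mul_nonneg h2 h3]

section Product

variable {ρ : ℝ → ℝ} (hρ : IsBump ρ)

include hρ

/-- Frequencies within 1 of i and of j add up to one within 2 of i+j, and it would have to lie
within 1 of k. -/
theorem box_mul_eq_zero {i j k : ℤ} (h : 2 < |k - (i + j)|) {f f' F : 𝓢'(ℝ, ℂ)} {G G' g' : ℝ → ℂ}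
    (hG : IsRep (box ρ i f) G) (hGb : MemLp G ∞ volume) (hg' : MemLp g' ∞ volume)
    (hf' : IsRep f' g') (hG' : IsRep (box ρ j f') G') (hGb' : MemLp G' ∞ volume)
    (hF : IsRep F fun x => G x * G' x) : box ρ k F = 0 := by
  have h1 : IsRep (box ρ j f') (conv (kernel (sig ρ j)) g') :=
    isRep_multiplier (isSymbol_sig hρ j) le_top hg' hf'
  have h2 := hG'.ae_eq_of_memLp le_top le_top h1 hGb' (memLp_conv (isSymbol_sig hρ j) le_top le_rfl hg')
  have h3 : IsRep F fun x => G x * conv (kernel (sig ρ j)) g' x := by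
    refine hF.congr ?_
    filter_upwards [h2] with x hx
    rw [hx]
  refine multiplier_mul_eq_zero (isSymbol_sig hρ i) (isSymbol_sig hρ j) (isSymbol_sig hρ k)
    (fun z w => ?_) hG hGb hg' h3
  by_cases hz : 1 ≤ |z - i|
  · rw [sig_eq_zero hρ hz, zero_mul]
  by_cases hw : 1 ≤ |w - j|
  · rw [sig_eq_zero hρ hw, zero_mul, mul_zero]
  by_cases hwz : 1 ≤ |w + z - k|
  · rw [sig_eq_zero hρ hwz, mul_zero, mul_zero]
  exfalso
  rw [not_le, abs_lt] at hz hw hwz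
  have h4 : |(k : ℝ) - (i + j)| < 3 := by
    rw [abs_lt]
    constructor <;> linarith
  have h5 : |k - (i + j)| < 3 := by exact_mod_cast h4
  omega

/-- Only the five blocks with |k-(i+j)| ≤ 2 survive, and `wt_le` distributes the weight of each over
i and j. -/
theorem exists_modNorm_block_mul_le : ∃ C : ℝ, 0 < C ∧ ∀ (s : ℝ), 0 ≤ s →
    ∀ (q : ℝ≥0∞), 1 ≤ q → ∀ (i j : ℤ) (F : 𝓢'(ℝ, ℂ)),
      (∀ k : ℤ, 2 < |k - (i + j)| → box ρ k F = 0) →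
      modNorm ρ s q 1 F ≤ ENNReal.ofReal (C * 3 ^ s) * (wt s i * wt s j) * lpNorm q F := by
  obtain ⟨C, hC, h⟩ := exists_lpNorm_box_le hρ
  refine ⟨5 * C, by positivity, fun s hs q hq i j F hF => ?_⟩
  rw [modNorm_one, tsum_eq_sum (s := Finset.Icc (i + j - 2) (i + j + 2))]
  · have hb : ∀ k ∈ Finset.Icc (i + j - 2) (i + j + 2), wt s k * lpNorm q (box ρ k F) ≤
        ENNReal.ofReal (3 ^ s) * (wt s i * wt s j) * (ENNReal.ofReal C * lpNorm q F) := by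
      intro k hk
      gcongr
      · refine wt_le hs ?_
        rw [Finset.mem_Icc] at hk
        rw [abs_le]
        constructor <;> linarith
      · exact h q q hq le_rfl k F
    refine (Finset.sum_le_card_nsmul _ _ _ hb).trans (le_of_eq ?_)
    have hcard : (Finset.Icc (i + j - 2) (i + j + 2)).card = 5 := by
      rw [Int.card_Icc]
      omega
    rw [hcard, nsmul_eq_mul, mul_assoc 5 C, ENNReal.ofReal_mul (by norm_num), ENNReal.ofReal_mul hC.le]
    simp
    ring
  · intro k hk
    rw [hF k, lpNorm_zero hq, mul_zero]
    by_contra hcon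
    apply hk
    rw [not_lt, abs_le] at hcon
    rw [Finset.mem_Icc]
    constructor <;> linarith

/-- The series of the blocks converges in `L^q`. -/
theorem exists_hasSum_blocks {s : ℝ} (hs : 0 ≤ s) {q : ℝ≥0∞} [Fact (1 ≤ q)] {f : 𝓢'(ℝ, ℂ)}
    (hf : modNorm ρ s q 1 f < ∞) : ∃ (g : ℤ → Lp ℂ q (volume : Measure ℝ))
      (Γ : Lp ℂ q (volume : Measure ℝ)), (∀ k, (g k : 𝓢'(ℝ, ℂ)) = box ρ k f) ∧
      (Γ : 𝓢'(ℝ, ℂ)) = f ∧ HasSum g Γ ∧ ∀ k, MemLp (g k) ∞ volume := by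
  have hq : 1 ≤ q := Fact.out
  obtain ⟨C, hC, hbern⟩ := exists_lpNorm_box_bernstein hρ
  have ht : ∑' k, lpNorm q (box ρ k f) ≠ ∞ := ((tsum_lpNorm_box_le_modNorm hs f).trans_lt hf).ne
  have hlt : ∀ k, lpNorm q (box ρ k f) < ∞ := fun k => (ENNReal.ne_top_of_tsum_ne_top ht k).lt_top
  choose g hg using fun k => exists_coe_eq (p := q) (f := box ρ k f) (hlt k)
  have hsum : Summable fun k => ‖g k‖ := by
    have : ∀ k, lpNorm q (box ρ k f) = ‖g k‖ₑ := fun k => by rw [← hg k, lpNorm_coe]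
    simp_rw [this] at ht
    simpa using ENNReal.summable_toReal ht
  have hsg : HasSum g (∑' k, g k) := hsum.of_norm.hasSum
  refine ⟨g, ∑' k, g k, hg, ?_, hsg, fun k => ?_⟩
  · ext ψ
    have h1 := hsg.mapL (Lp.toTemperedDistributionCLM ℂ volume q)
    have h2 := h1.mapL (PointwiseConvergenceCLM.evalCLM (RingHom.id ℂ) ℂ ψ)
    have h3 : (fun k => box ρ k f ψ) = fun k => Lp.toTemperedDistribution (g k) ψ :=
      funext fun k => by rw [hg k]
    have h4 := hasSum_box hρ hs hq hf ψ
    rw [h3] at h4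
    exact h2.unique h4
  · have h1 := (hbern q ∞ hq le_top k f).trans_lt (ENNReal.mul_lt_top ENNReal.ofReal_lt_top (hlt k))
    obtain ⟨g', hg', hr⟩ := exists_rep h1
    refine (memLp_congr_ae ?_).1 hg'
    have h2 := isRep_coe (g k)
    rw [hg k] at h2
    exact hr.ae_eq_of_memLp le_top hq h2 hg' (Lp.memLp _)

/-- Products of elements of `M^s_{q₁,1}` and `M^s_{q₂,1}`. -/
theorem exists_modNorm_mul_le : ∃ C : ℝ, 0 < C ∧ ∀ (s : ℝ), 0 ≤ s → ∀ (q₁ q₂ q : ℝ≥0∞),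
    1 ≤ q₁ → 1 ≤ q₂ → 1 ≤ q → ENNReal.HolderTriple q₁ q₂ q → ∀ (f₁ f₂ F : 𝓢'(ℝ, ℂ)) (g₁ g₂ : ℝ → ℂ),
      modNorm ρ s q₁ 1 f₁ < ∞ → modNorm ρ s q₂ 1 f₂ < ∞ → IsRep f₁ g₁ → IsRep f₂ g₂ →
      MemLp g₁ ∞ volume → MemLp g₂ ∞ volume → IsRep F (fun x => g₁ x * g₂ x) →
      modNorm ρ s q 1 F ≤ ENNReal.ofReal (C * 3 ^ s) * (modNorm ρ s q₁ 1 f₁ * modNorm ρ s q₂ 1 f₂) := by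
  obtain ⟨C, hC, hblock⟩ := exists_modNorm_block_mul_le hρ
  refine ⟨C, hC, fun s hs q₁ q₂ q h₁ h₂ h₀ hH f₁ f₂ F g₁ g₂ hf₁ hf₂ hg₁ hg₂ hb₁ hb₂ hF => ?_⟩
  have : Fact (1 ≤ q₁) := ⟨h₁⟩
  have : Fact (1 ≤ q₂) := ⟨h₂⟩
  have : Fact (1 ≤ q) := ⟨h₀⟩
  obtain ⟨G, Γ, hG, hΓ, hGs, hGb⟩ := exists_hasSum_blocks hρ hs hf₁
  obtain ⟨K, Λ, hK, hΛ, hKs, hKb⟩ := exists_hasSum_blocks hρ hs hf₂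
  set M := ContinuousLinearMap.mul ℂ ℂ with hM
  -- The pointwise product is a continuous bilinear map L^{q₁} × L^{q₂} → L^q, so both block series
  -- can be summed inside it.
  have hFeq : ((M.holder q Γ Λ : Lp ℂ q (volume : Measure ℝ)) : 𝓢'(ℝ, ℂ)) = F := by
    ext ψ
    rw [isRep_coe, hF]
    refine integral_congr_ae ?_
    have e1 : g₁ =ᵐ[volume] Γ := hg₁.ae_eq_of_memLp le_top h₁ (hΓ ▸ isRep_coe Γ) hb₁ (Lp.memLp _)
    have e2 : g₂ =ᵐ[volume] Λ := hg₂.ae_eq_of_memLp le_top h₂ (hΛ ▸ isRep_coe Λ) hb₂ (Lp.memLp _)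
    filter_upwards [e1, e2, M.coeFn_holder (r := q) Γ Λ] with x hx1 hx2 hx3
    rw [hx3, hx1, hx2]
    rfl
  have hconv : ∀ {A : ℤ → Lp ℂ q (volume : Measure ℝ)} {B : Lp ℂ q (volume : Measure ℝ)},
      HasSum A B → ∀ ψ : 𝓢(ℝ, ℂ), HasSum (fun i => Lp.toTemperedDistribution (A i) ψ)
        (Lp.toTemperedDistribution B ψ) := fun hAB ψ =>
    (hAB.mapL (Lp.toTemperedDistributionCLM ℂ volume q)).mapL
      (PointwiseConvergenceCLM.evalCLM (RingHom.id ℂ) ℂ ψ)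
  have hs1 : HasSum (fun i => M.holder q (G i) Λ) (M.holder q Γ Λ) :=
    hGs.mapL ((M.holderL volume q₁ q₂ q).flip Λ)
  have hs2 : ∀ i, HasSum (fun j => M.holder q (G i) (K j)) (M.holder q (G i) Λ) := fun i =>
    hKs.mapL (M.holderL volume q₁ q₂ q (G i))
  have hpt : ∀ i j, modNorm ρ s q 1 (M.holder q (G i) (K j) : Lp ℂ q (volume : Measure ℝ)) ≤
      ENNReal.ofReal (C * 3 ^ s) * ((wt s i * lpNorm q₁ (box ρ i f₁)) *
        (wt s j * lpNorm q₂ (box ρ j f₂))) := by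
    intro i j
    have hrep : IsRep (M.holder q (G i) (K j) : Lp ℂ q (volume : Measure ℝ))
        fun x => G i x * K j x := (isRep_coe _).congr (M.coeFn_holder _ _)
    refine (hblock s hs q h₀ i j _ fun k hk => ?_).trans ?_
    · exact box_mul_eq_zero hρ hk (hG i ▸ isRep_coe (G i)) (hGb i) hb₂ hg₂
        (hK j ▸ isRep_coe (K j)) (hKb j) hrep
    · rw [mul_assoc, mul_mul_mul_comm (wt s i) (lpNorm q₁ _)]
      gcongr
      rw [lpNorm_coe, ← hG i, ← hK j, lpNorm_coe, lpNorm_coe]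
      have h1 := M.norm_holder_apply_apply_le (r := q) (G i) (K j)
      have h2 : ‖M‖ ≤ 1 := ContinuousLinearMap.opNorm_mul_le ℂ ℂ
      have h3 : ‖M.holder q (G i) (K j)‖ ≤ ‖G i‖ * ‖K j‖ := by
        refine h1.trans ?_
        rw [mul_assoc]
        exact mul_le_of_le_one_left (by positivity) h2
      rw [← ofReal_norm, ← ofReal_norm, ← ofReal_norm, ← ENNReal.ofReal_mul (norm_nonneg _)]
      exact ENNReal.ofReal_le_ofReal h3
  calc modNorm ρ s q 1 F ≤ ∑' i, modNorm ρ s q 1 (M.holder q (G i) Λ : Lp ℂ q (volume : Measure ℝ)) := by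
        rw [← hFeq]
        exact modNorm_hasSum_le h₀ _ _ (hconv hs1)
    _ ≤ ∑' i, ∑' j, modNorm ρ s q 1 (M.holder q (G i) (K j) : Lp ℂ q (volume : Measure ℝ)) :=
        ENNReal.tsum_le_tsum fun i => modNorm_hasSum_le h₀ _ _ (hconv (hs2 i))
    _ ≤ ∑' i, ∑' j, ENNReal.ofReal (C * 3 ^ s) * ((wt s i * lpNorm q₁ (box ρ i f₁)) *
        (wt s j * lpNorm q₂ (box ρ j f₂))) :=
        ENNReal.tsum_le_tsum fun i => ENNReal.tsum_le_tsum fun j => hpt i j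
    _ = _ := by
        simp_rw [ENNReal.tsum_mul_left, ENNReal.tsum_mul_right]
        rw [modNorm_one, modNorm_one]

end Product

/-! ### Powers -/

/-- `distPow` chooses an arbitrary bounded representative; almost everywhere uniqueness makes the
power independent of that choice. -/
theorem isRep_distPow {f : 𝓢'(ℝ, ℂ)} {g : ℝ → ℂ} (hg : MemLp g ∞ volume) (h : IsRep f g) (m : ℕ) :
    IsRep (distPow m f) fun x => g x ^ m := by
  have hex : ∃ g : ℝ → ℂ, MemLp g ∞ volume ∧ IsRep f g := ⟨g, hg, h⟩
  have hd : distPow m f = Lp.toTemperedDistribution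
      ((memLp_top_pow hex.choose_spec.1 m).toLp (fun x => hex.choose x ^ m)) := by
    rw [distPow, dif_pos hex]
  rw [hd]
  refine (isRep_toLp _).congr ?_
  filter_upwards [hex.choose_spec.2.ae_eq_of_memLp le_top le_top h hex.choose_spec.1 hg] with x hx
  rw [hx]

theorem IsRep.unique {f f' : 𝓢'(ℝ, ℂ)} {g : ℝ → ℂ} (h : IsRep f g) (h' : IsRep f' g) : f = f' := by
  ext ψ
  rw [h, h']

theorem isRep_add_of_memLp_top {f f' : 𝓢'(ℝ, ℂ)} {g g' : ℝ → ℂ} (h : IsRep f g) (h' : IsRep f' g')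
    (hg : MemLp g ∞ volume) (hg' : MemLp g' ∞ volume) : IsRep (f + f') fun x => g x + g' x := by
  have e1 := h.eq_coe hg
  have e2 := h'.eq_coe hg'
  rw [e1, e2, ← coe_add, ← MemLp.toLp_add]
  exact isRep_toLp _

theorem isRep_neg {f : 𝓢'(ℝ, ℂ)} {g : ℝ → ℂ} (h : IsRep f g) : IsRep (-f) fun x => -g x := by
  intro ψ
  have : (-f) ψ = -(f ψ) := rfl
  rw [this, h ψ, ← integral_neg]
  simp

theorem isRep_sub_of_memLp_top {f f' : 𝓢'(ℝ, ℂ)} {g g' : ℝ → ℂ} (h : IsRep f g) (h' : IsRep f' g')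
    (hg : MemLp g ∞ volume) (hg' : MemLp g' ∞ volume) : IsRep (f - f') fun x => g x - g' x := by
  have := isRep_add_of_memLp_top h (isRep_neg h') hg hg'.neg
  simpa [sub_eq_add_neg] using this

theorem distPow_one {f : 𝓢'(ℝ, ℂ)} {g : ℝ → ℂ} (hg : MemLp g ∞ volume) (h : IsRep f g) :
    distPow 1 f = f := by
  refine (isRep_distPow hg h 1).unique ?_
  simpa using h

theorem holderTriple_div {p : ℝ≥0∞} (n : ℕ) (hn : n ≠ 0) :
    ENNReal.HolderTriple (p / n) p (p / (n + 1 : ℕ)) := by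
  constructor
  rw [ENNReal.inv_div (by simp) (by simp [hn]), ENNReal.inv_div (by simp) (by simp),
    ← one_div p, ENNReal.div_add_div_same]
  push_cast
  rfl

theorem one_le_div_nat {p : ℝ≥0∞} {n : ℕ} (hn : n ≠ 0) (h : (n : ℝ≥0∞) ≤ p) : 1 ≤ p / n := by
  rw [ENNReal.le_div_iff_mul_le (by simp [hn]) (by simp), one_mul]
  exact h

section Power

variable {ρ : ℝ → ℝ} (hρ : IsBump ρ)

include hρ

theorem exists_rep_top {s : ℝ} (hs : 0 ≤ s) {p : ℝ≥0∞} (hp : 1 ≤ p) {f : 𝓢'(ℝ, ℂ)}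
    (hf : modNorm ρ s p 1 f < ∞) : ∃ g : ℝ → ℂ, MemLp g ∞ volume ∧ IsRep f g := by
  obtain ⟨C, hC, h⟩ := exists_lpNorm_le_modNorm hρ
  exact exists_rep ((h s p ∞ hs hp le_top f hf).trans_lt (ENNReal.mul_lt_top ENNReal.ofReal_lt_top hf))

/-- Induction on the power: the exponents p/(n+1) and p combine by Hölder to p/(n+2), and bounded
representatives are available because M^s_{p,1} embeds into L^∞. -/
theorem exists_modNorm_distPow_le {s : ℝ} (hs : 0 ≤ s) (n : ℕ) : ∃ C : ℝ, 0 < C ∧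
    ∀ p : ℝ≥0∞, p ≠ ∞ → ((n + 1 : ℕ) : ℝ≥0∞) ≤ p → ∀ f : 𝓢'(ℝ, ℂ), modNorm ρ s p 1 f < ∞ →
      modNorm ρ s (p / (n + 1 : ℕ)) 1 (distPow (n + 1) f) ≤
        ENNReal.ofReal C * modNorm ρ s p 1 f ^ (n + 1) := by
  obtain ⟨C₀, hC₀, hmul⟩ := exists_modNorm_mul_le hρ
  induction n with
  | zero =>
    refine ⟨1, one_pos, fun p hp hp1 f hf => ?_⟩
    simp only [zero_add, Nat.cast_one] at hp1
    obtain ⟨g, hg, h⟩ := exists_rep_top hρ hs hp1 hf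
    simp [distPow_one hg h]
  | succ n ih =>
    obtain ⟨C, hC, h⟩ := ih
    refine ⟨C₀ * 3 ^ s * C, by positivity, fun p hp hp1 f hf => ?_⟩
    have hn : ((n + 1 : ℕ) : ℝ≥0∞) ≤ p := le_trans (by exact_mod_cast Nat.le_succ _) hp1
    have h1p : 1 ≤ p := le_trans (by exact_mod_cast Nat.succ_le_succ (Nat.zero_le _)) hn
    obtain ⟨g, hg, hr⟩ := exists_rep_top hρ hs h1p hf
    have h1 := h p hp hn f hf
    have hlt := h1.trans_lt (ENNReal.mul_lt_top ENNReal.ofReal_lt_top (ENNReal.pow_lt_top hf))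
    have h2 := hmul s hs (p / (n + 1 : ℕ)) p (p / (n + 1 + 1 : ℕ))
      (one_le_div_nat (by simp) hn) h1p (one_le_div_nat (by simp) hp1)
      (holderTriple_div (n + 1) (by simp)) (distPow (n + 1) f) f (distPow (n + 1 + 1) f)
      (fun x => g x ^ (n + 1)) g hlt hf (isRep_distPow hg hr _) hr (memLp_top_pow hg _) hg
      (isRep_distPow hg hr (n + 1 + 1))
    calc _ ≤ _ := h2
      _ ≤ ENNReal.ofReal (C₀ * 3 ^ s) *
          ((ENNReal.ofReal C * modNorm ρ s p 1 f ^ (n + 1)) * modNorm ρ s p 1 f) := by gcongr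
      _ = _ := by
        rw [ENNReal.ofReal_mul (p := C₀ * 3 ^ s) (by positivity)]
        ring

theorem exists_modNorm_distPow_sub_le {s : ℝ} (hs : 0 ≤ s) (n : ℕ) : ∃ C : ℝ, 0 < C ∧
    ∀ p : ℝ≥0∞, p ≠ ∞ → ((n + 1 : ℕ) : ℝ≥0∞) ≤ p → ∀ f f' : 𝓢'(ℝ, ℂ), modNorm ρ s p 1 f < ∞ →
      modNorm ρ s p 1 f' < ∞ →
      modNorm ρ s (p / (n + 1 : ℕ)) 1 (distPow (n + 1) f - distPow (n + 1) f') ≤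
        ENNReal.ofReal C * (modNorm ρ s p 1 f + modNorm ρ s p 1 f') ^ n * modNorm ρ s p 1 (f - f') := by
  obtain ⟨C₀, hC₀, hmul⟩ := exists_modNorm_mul_le hρ
  induction n with
  | zero =>
    refine ⟨1, one_pos, fun p hp hp1 f f' hf hf' => ?_⟩
    simp only [zero_add, Nat.cast_one] at hp1
    obtain ⟨g, hg, h⟩ := exists_rep_top hρ hs hp1 hf
    obtain ⟨g', hg', h'⟩ := exists_rep_top hρ hs hp1 hf'
    simp [distPow_one hg h, distPow_one hg' h']
  | succ n ih =>
    obtain ⟨C, hC, h⟩ := ih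
    obtain ⟨C₁, hC₁, hpow⟩ := exists_modNorm_distPow_le hρ hs n
    refine ⟨C₀ * 3 ^ s * (C + C₁), by positivity, fun p hp hp1 f f' hf hf' => ?_⟩
    have hn : ((n + 1 : ℕ) : ℝ≥0∞) ≤ p := le_trans (by exact_mod_cast Nat.le_succ _) hp1
    have h1p : 1 ≤ p := le_trans (by exact_mod_cast Nat.succ_le_succ (Nat.zero_le _)) hn
    obtain ⟨g, hg, hr⟩ := exists_rep_top hρ hs h1p hf
    obtain ⟨g', hg', hr'⟩ := exists_rep_top hρ hs h1p hf'
    set a := modNorm ρ s p 1 f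
    set a' := modNorm ρ s p 1 f'
    set d := modNorm ρ s p 1 (f - f')
    have hd : d < ∞ := (modNorm_sub_le h1p f f').trans_lt (ENNReal.add_lt_top.2 ⟨hf, hf'⟩)
    have h1 := h p hp hn f f' hf hf'
    have h2 := hpow p hp hn f' hf'
    have hlt1 := h1.trans_lt (ENNReal.mul_lt_top (ENNReal.mul_lt_top ENNReal.ofReal_lt_top
      (ENNReal.pow_lt_top (ENNReal.add_lt_top.2 ⟨hf, hf'⟩))) hd)
    have hlt2 := h2.trans_lt (ENNReal.mul_lt_top ENNReal.ofReal_lt_top (ENNReal.pow_lt_top hf'))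
    have hb := memLp_top_pow hg (n + 1)
    have hb' := memLp_top_pow hg' (n + 1)
    have r1 := isRep_sub_of_memLp_top (isRep_distPow hg hr (n + 1)) (isRep_distPow hg' hr' (n + 1))
      hb hb'
    have r2 := isRep_sub_of_memLp_top hr hr' hg hg'
    have m1 : MemLp (fun x => (g x ^ (n + 1) - g' x ^ (n + 1)) * g x) ∞ volume :=
      hg.mul (hb.sub hb')
    have m2 : MemLp (fun x => g' x ^ (n + 1) * (g x - g' x)) ∞ volume := (hg.sub hg').mul hb'
    have hT := holderTriple_div (p := p) (n + 1) (by simp)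
    have k1 := hmul s hs (p / (n + 1 : ℕ)) p (p / (n + 1 + 1 : ℕ))
      (one_le_div_nat (by simp) hn) h1p (one_le_div_nat (by simp) hp1) hT _ f
      (Lp.toTemperedDistribution (m1.toLp _)) _ g hlt1 hf r1 hr (hb.sub hb') hg (isRep_toLp m1)
    have k2 := hmul s hs (p / (n + 1 : ℕ)) p (p / (n + 1 + 1 : ℕ))
      (one_le_div_nat (by simp) hn) h1p (one_le_div_nat (by simp) hp1) hT _ (f - f')
      (Lp.toTemperedDistribution (m2.toLp _)) _ _ hlt2 hd (isRep_distPow hg' hr' (n + 1)) r2 hb'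
      (hg.sub hg') (isRep_toLp m2)
    -- Telescoping: g^{n+2} - g'^{n+2} = (g^{n+1} - g'^{n+1}) g + g'^{n+1} (g - g').
    have heq : distPow (n + 1 + 1) f - distPow (n + 1 + 1) f' =
        Lp.toTemperedDistribution (m1.toLp _) + Lp.toTemperedDistribution (m2.toLp _) := by
      refine (isRep_sub_of_memLp_top (isRep_distPow hg hr (n + 1 + 1))
        (isRep_distPow hg' hr' (n + 1 + 1)) (memLp_top_pow hg _) (memLp_top_pow hg' _)).unique ?_
      refine (isRep_add_of_memLp_top (isRep_toLp m1) (isRep_toLp m2) m1 m2).congr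
        (Eventually.of_forall fun x => ?_)
      simp only
      ring
    rw [heq]
    calc _ ≤ _ := modNorm_add_le (one_le_div_nat (by simp) hp1) _ _
      _ ≤ ENNReal.ofReal (C₀ * 3 ^ s) * ((ENNReal.ofReal C * (a + a') ^ n * d) * a) +
          ENNReal.ofReal (C₀ * 3 ^ s) * ((ENNReal.ofReal C₁ * a' ^ (n + 1)) * d) := by
          refine add_le_add (k1.trans ?_) (k2.trans ?_)
          · gcongr
          · gcongr
      _ ≤ ENNReal.ofReal (C₀ * 3 ^ s) * ((ENNReal.ofReal C * (a + a') ^ n * d) * (a + a')) +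
          ENNReal.ofReal (C₀ * 3 ^ s) * ((ENNReal.ofReal C₁ * (a + a') ^ (n + 1)) * d) := by
          gcongr
          · exact le_self_add
          · exact le_add_self
      _ = _ := by
        rw [ENNReal.ofReal_mul (p := C₀ * 3 ^ s) (by positivity), ENNReal.ofReal_add hC.le hC₁.le]
        ring

end Power

/-! ### Convolution in time with decaying kernels -/

/-- The kernel `(1 + |t|)^{-κ}`. -/
def timeDecay (κ t : ℝ) : ℝ≥0∞ := ENNReal.ofReal ((1 + |t|) ^ (-κ))

theorem measurable_timeDecay (κ : ℝ) : Measurable (timeDecay κ) := by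
  unfold timeDecay
  fun_prop

theorem timeDecay_rpow (κ t : ℝ) {m : ℝ} (hm : 0 ≤ m) : timeDecay κ t ^ m = timeDecay (κ * m) t := by
  unfold timeDecay
  rw [ENNReal.ofReal_rpow_of_nonneg (by positivity) hm, ← Real.rpow_mul (by positivity)]
  ring_nf

theorem lintegral_timeDecay_lt_top {κ : ℝ} (hκ : 1 < κ) : ∫⁻ t, timeDecay κ t < ∞ := by
  have := finite_integral_one_add_norm (E := ℝ) (μ := volume) (r := κ) (by simpa using hκ)
  simpa [timeDecay] using this

theorem lintegral_timeDecay_sub (κ t : ℝ) : ∫⁻ τ, timeDecay κ (t - τ) = ∫⁻ τ, timeDecay κ τ :=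
  lintegral_sub_left_eq_self _ t

/-- Hölder's inequality for the convolution with a decaying kernel. -/
theorem exists_lintegral_timeDecay_mul_le {κ l r : ℝ} (hl : 0 < l) (hlr : l < r)
    (hκ : 1 - l / r < κ) : ∃ A : ℝ, 0 < A ∧ ∀ a : ℝ → ℝ≥0∞, AEMeasurable a → ∀ t : ℝ,
      ∫⁻ τ, timeDecay κ (t - τ) * a τ ^ l ≤ ENNReal.ofReal A * (∫⁻ τ, a τ ^ r) ^ (l / r) := by
  have hr : 0 < r := hl.trans hlr
  have h1 : 0 < 1 - l / r := by
    rw [sub_pos, div_lt_one hr]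
    exact hlr
  -- The conjugate exponent of r/l; the hypothesis on κ says exactly that the kernel lies in L^m.
  set m : ℝ := (1 - l / r)⁻¹ with hm
  have hm0 : 0 < m := inv_pos.2 h1
  have hconj : m.HolderConjugate (r / l) := by
    refine ⟨?_, hm0, by positivity⟩
    rw [hm, inv_inv, inv_div]
    ring
  have hκm : 1 < κ * m := by
    rw [hm, ← div_eq_mul_inv, one_lt_div h1]
    exact hκ
  have hfin := lintegral_timeDecay_lt_top hκm
  refine ⟨1 + ((∫⁻ τ, timeDecay (κ * m) τ) ^ (1 / m)).toReal, by positivity, fun a ha t => ?_⟩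
  have h2 := ENNReal.lintegral_mul_le_Lp_mul_Lq volume hconj
    (f := fun τ => timeDecay κ (t - τ)) (g := fun τ => a τ ^ l)
    ((measurable_timeDecay κ).comp (measurable_const.sub measurable_id)).aemeasurable (ha.pow_const l)
  refine h2.trans ?_
  have h3 : ∀ τ, (a τ ^ l) ^ (r / l) = a τ ^ r := fun τ => by
    rw [← ENNReal.rpow_mul, mul_div_cancel₀ _ hl.ne']
  simp only [h3, timeDecay_rpow κ _ hm0.le, lintegral_timeDecay_sub]
  rw [one_div_div]
  gcongr
  rw [ENNReal.ofReal_add (by positivity) (by positivity), ENNReal.ofReal_toReal]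
  · exact le_add_self
  · exact (ENNReal.rpow_lt_top_of_nonneg (by positivity) hfin.ne).ne

/-- Young's inequality for the convolution of a decaying kernel with a power. -/
theorem exists_lintegral_timeDecay_young {κ b r : ℝ} (hb : 1 < b) (hbr : b ≤ r)
    (hκ : 1 - (b - 1) / r < κ) : ∃ A : ℝ, 0 < A ∧ ∀ a : ℝ → ℝ≥0∞, AEMeasurable a →
      ∫⁻ t, (∫⁻ τ, timeDecay κ (t - τ) * a τ ^ b) ^ r ≤
        ENNReal.ofReal A * (∫⁻ τ, a τ ^ r) ^ b := by
  have hr : 0 < r := by linarith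
  have h1 : 0 < 1 - (b - 1) / r := by
    rw [sub_pos, div_lt_one hr]
    linarith
  -- Young's relation 1 + 1/r = 1/m + b/r for a convolution L^m * L^{r/b} → L^r.
  set m : ℝ := (1 - (b - 1) / r)⁻¹ with hm
  have hm0 : 0 < m := inv_pos.2 h1
  have hminv : m⁻¹ = 1 - (b - 1) / r := by rw [hm, inv_inv]
  have hκm : 1 < κ * m := by
    rw [hm, ← div_eq_mul_inv, one_lt_div h1]
    exact hκ
  have hfin := lintegral_timeDecay_lt_top hκm
  have hx : 0 ≤ m⁻¹ - 1 / r := by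
    rw [hminv]
    have : (b - 1) / r + 1 / r ≤ 1 := by
      rw [← add_div, div_le_one hr]
      linarith
    linarith
  set J := ∫⁻ τ, timeDecay (κ * m) τ with hJ
  have hJt : J * J ^ ((m⁻¹ - 1 / r) * r) ≠ ∞ := by
    refine ENNReal.mul_ne_top hfin.ne ?_
    exact (ENNReal.rpow_lt_top_of_nonneg (by positivity) hfin.ne).ne
  refine ⟨1 + (J * J ^ ((m⁻¹ - 1 / r) * r)).toReal, by positivity, fun a ha => ?_⟩
  set I := ∫⁻ τ, a τ ^ r with hI
  have hmeas : ∀ t, AEMeasurable fun τ => timeDecay (κ * m) (t - τ) := fun t =>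
    ((measurable_timeDecay _).comp (measurable_const.sub measurable_id)).aemeasurable
  have hpt : ∀ t, (∫⁻ τ, timeDecay κ (t - τ) * a τ ^ b) ^ r ≤
      (∫⁻ τ, timeDecay (κ * m) (t - τ) * a τ ^ r) * (J ^ ((m⁻¹ - 1 / r) * r) * I ^ (b - 1)) := by
    intro t
    -- Hölder with three factors: the exponents 1/r, 1/m - 1/r and (b-1)/r add up to 1, and the
    -- middle one is nonnegative because b ≤ r.
    have h := ENNReal.lintegral_prod_norm_pow_le (μ := (volume : Measure ℝ)) (Finset.univ : Finset (Fin 3))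
      (f := ![fun τ => timeDecay (κ * m) (t - τ) * a τ ^ r, fun τ => timeDecay (κ * m) (t - τ),
        fun τ => a τ ^ r]) (p := ![1 / r, m⁻¹ - 1 / r, (b - 1) / r]) ?_ ?_ ?_
    · simp only [Fin.prod_univ_three, Matrix.cons_val_zero, Matrix.cons_val_one,
        Matrix.cons_val_two, Matrix.tail_cons, Matrix.head_cons] at h
      rw [lintegral_timeDecay_sub] at h
      have h2 : ∀ τ, timeDecay κ (t - τ) * a τ ^ b =
          (timeDecay (κ * m) (t - τ) * a τ ^ r) ^ (1 / r) *
            timeDecay (κ * m) (t - τ) ^ (m⁻¹ - 1 / r) * (a τ ^ r) ^ ((b - 1) / r) := by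
        intro τ
        rw [← timeDecay_rpow κ _ hm0.le, ENNReal.mul_rpow_of_nonneg _ _ (by positivity),
          ← ENNReal.rpow_mul, ← ENNReal.rpow_mul, ← ENNReal.rpow_mul, ← ENNReal.rpow_mul]
        set x := timeDecay κ (t - τ)
        set y := a τ
        calc x * y ^ b = x ^ (m * (1 / r) + m * (m⁻¹ - 1 / r)) *
              y ^ (r * (1 / r) + r * ((b - 1) / r)) := by
              congr 1
              · rw [← mul_add]
                simp [hm0.ne']
              · congr 1
                field_simp
                ring
          _ = _ := by
              rw [ENNReal.rpow_add_of_nonneg _ _ (by positivity) (by positivity),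
                ENNReal.rpow_add_of_nonneg _ _ (by positivity)
                  (mul_nonneg hr.le (div_nonneg (by linarith) hr.le))]
              ring
      simp_rw [h2]
      refine (ENNReal.rpow_le_rpow h hr.le).trans (le_of_eq ?_)
      rw [ENNReal.mul_rpow_of_nonneg _ _ hr.le, ENNReal.mul_rpow_of_nonneg _ _ hr.le,
        ← ENNReal.rpow_mul, ← ENNReal.rpow_mul, ← ENNReal.rpow_mul, one_div_mul_cancel hr.ne',
        ENNReal.rpow_one, div_mul_cancel₀ _ hr.ne', mul_assoc]
    · intro i _
      fin_cases i
      · exact (hmeas t).mul (ha.pow_const r)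
      · exact hmeas t
      · exact ha.pow_const r
    · simp [Fin.sum_univ_three, hminv]
    · intro i _
      fin_cases i
      · simp [hr.le]
      · exact hx
      · exact div_nonneg (by linarith) hr.le
  have hTon : ∫⁻ t, ∫⁻ τ, timeDecay (κ * m) (t - τ) * a τ ^ r = J * I := by
    rw [lintegral_lintegral_swap]
    · have : ∀ τ, ∫⁻ t, timeDecay (κ * m) (t - τ) * a τ ^ r = J * a τ ^ r := by
        intro τ
        have hm' : Measurable fun t => timeDecay (κ * m) (t - τ) :=
          (measurable_timeDecay _).comp (measurable_id.sub measurable_const)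
        rw [lintegral_mul_const _ hm']
        congr 1
        exact lintegral_sub_right_eq_self (fun t => timeDecay (κ * m) t) τ
      simp_rw [this]
      rw [lintegral_const_mul' _ _ hfin.ne]
    · refine AEMeasurable.mul ?_ (ha.pow_const r).comp_snd
      exact ((measurable_timeDecay _).comp (measurable_fst.sub measurable_snd)).aemeasurable
  calc ∫⁻ t, (∫⁻ τ, timeDecay κ (t - τ) * a τ ^ b) ^ r
      ≤ ∫⁻ t, (∫⁻ τ, timeDecay (κ * m) (t - τ) * a τ ^ r) *
          (J ^ ((m⁻¹ - 1 / r) * r) * I ^ (b - 1)) := lintegral_mono hpt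
    _ = J * I * (J ^ ((m⁻¹ - 1 / r) * r) * I ^ (b - 1)) := by
        rw [lintegral_mul_const'', hTon]
        refine AEMeasurable.lintegral_prod_right' (f := fun z : ℝ × ℝ => timeDecay (κ * m) (z.1 - z.2) * a z.2 ^ r) ?_
        refine AEMeasurable.mul ?_ (ha.pow_const r).comp_snd
        exact ((measurable_timeDecay _).comp (measurable_fst.sub measurable_snd)).aemeasurable
    _ = (J * J ^ ((m⁻¹ - 1 / r) * r)) * I ^ b := by
        have : I ^ b = I * I ^ (b - 1) := by
          conv_lhs => rw [show b = 1 + (b - 1) by ring]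
          rw [ENNReal.rpow_add_of_nonneg _ _ zero_le_one (by linarith), ENNReal.rpow_one]
        rw [this]
        ring
    _ ≤ _ := by
        gcongr
        rw [ENNReal.ofReal_add (by positivity) (by positivity), ENNReal.ofReal_toReal hJt]
        exact le_add_self

/-! ### The fixed point argument -/

section FixedPoint

variable {E : Type*} [NormedAddCommGroup E] [NormedSpace ℝ E]

/-- The right hand side of the integral equation `u(t) = v(t) + ∫₀ᵗ F(t - τ, u(τ)) dτ`. -/
def picard (F : ℝ → E → E) (v u : ℝ → E) (t : ℝ) : E := v t + ∫ τ in (0 : ℝ)..t, F (t - τ) (u τ)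

theorem continuous_picard {F : ℝ → E → E} (hF : Continuous (Function.uncurry F)) {v u : ℝ → E}
    (hv : Continuous v) (hu : Continuous u) : Continuous (picard F v u) := by
  unfold picard
  refine hv.add (intervalIntegral.continuous_parametric_intervalIntegral_of_continuous
    (f := fun t τ => F (t - τ) (u τ)) ?_ continuous_id)
  exact hF.comp ((continuous_fst.sub continuous_snd).prodMk (hu.comp continuous_snd))

theorem enorm_intervalIntegral_le (f : ℝ → E) (t : ℝ) :
    ‖∫ τ in (0 : ℝ)..t, f τ‖ₑ ≤ ∫⁻ τ, ‖f τ‖ₑ := by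
  rw [← ofReal_norm, intervalIntegral.norm_intervalIntegral_eq, ofReal_norm]
  exact (enorm_integral_le_lintegral_enorm _).trans (setLIntegral_le_lintegral _ _)

/-- The difference u - u' enters only through its sup norm; (‖u‖+‖u'‖)^l is placed in L^{r/l} of
time and paired with the kernel. A small R therefore gives a contraction for uniform convergence. -/
theorem enorm_picard_sub_le {F : ℝ → E → E} (hF : Continuous (Function.uncurry F)) {M κ r : ℝ}
    (hM : 0 < M) {l : ℕ} (hl : 0 < l) (hlr : (l : ℝ) < r) {A : ℝ} (hA : 0 < A)
    (hAbound : ∀ a : ℝ → ℝ≥0∞, AEMeasurable a → ∀ t : ℝ,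
      ∫⁻ τ, timeDecay κ (t - τ) * a τ ^ (l : ℝ) ≤
        ENNReal.ofReal A * (∫⁻ τ, a τ ^ r) ^ ((l : ℝ) / r))
    (hLip : ∀ t e e', ‖F t e - F t e'‖ ≤ M * (1 + |t|) ^ (-κ) * (‖e‖ + ‖e'‖) ^ l * ‖e - e'‖)
    {v u u' : ℝ → E} (hu : Continuous u) (hu' : Continuous u') {R d : ℝ} (hR : 0 ≤ R) (hd : 0 ≤ d)
    (hr : eLpNorm u (ENNReal.ofReal r) volume ≤ ENNReal.ofReal R)
    (hr' : eLpNorm u' (ENNReal.ofReal r) volume ≤ ENNReal.ofReal R)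
    (hdist : ∀ τ, ‖u τ - u' τ‖ ≤ d) (t : ℝ) :
    ‖picard F v u t - picard F v u' t‖ ≤ M * A * (2 * R) ^ l * d := by
  have hr1 : 1 ≤ r := by
    have : (1 : ℝ) ≤ l := by exact_mod_cast hl
    linarith
  have hr0 : 0 < r := by linarith
  have hc : ∀ {w : ℝ → E}, Continuous w → Continuous fun τ => F (t - τ) (w τ) := fun hw =>
    hF.comp ((continuous_const.sub continuous_id).prodMk hw)
  have heq : picard F v u t - picard F v u' t =
      ∫ τ in (0 : ℝ)..t, (F (t - τ) (u τ) - F (t - τ) (u' τ)) := by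
    unfold picard
    rw [intervalIntegral.integral_sub ((hc hu).intervalIntegrable _ _)
      ((hc hu').intervalIntegrable _ _)]
    abel
  set a : ℝ → ℝ≥0∞ := fun τ => ‖u τ‖ₑ + ‖u' τ‖ₑ with ha
  have hasum : (∫⁻ τ, a τ ^ r) ^ (1 / r) ≤ ENNReal.ofReal (2 * R) := by
    refine (ENNReal.lintegral_Lp_add_le hu.enorm.aemeasurable hu'.enorm.aemeasurable hr1).trans ?_
    rw [eLpNorm_eq_lintegral_rpow_enorm_toReal (by simpa using hr0) ENNReal.ofReal_ne_top,
      ENNReal.toReal_ofReal hr0.le] at hr hr'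
    rw [two_mul, ENNReal.ofReal_add hR hR]
    exact add_le_add hr hr'
  have ham : AEMeasurable a := (hu.enorm.add hu'.enorm).aemeasurable
  have key : ‖picard F v u t - picard F v u' t‖ₑ ≤ ENNReal.ofReal (M * A * (2 * R) ^ l * d) := by
    rw [heq]
    refine (enorm_intervalIntegral_le _ _).trans ?_
    calc ∫⁻ τ, ‖F (t - τ) (u τ) - F (t - τ) (u' τ)‖ₑ
        ≤ ∫⁻ τ, ENNReal.ofReal (M * d) * (timeDecay κ (t - τ) * a τ ^ (l : ℝ)) := by
          refine lintegral_mono fun τ => ?_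
          have h1 := hLip (t - τ) (u τ) (u' τ)
          have h2 : a τ ^ (l : ℝ) = ENNReal.ofReal ((‖u τ‖ + ‖u' τ‖) ^ l) := by
            rw [ha]
            simp only
            rw [← ofReal_norm, ← ofReal_norm, ← ENNReal.ofReal_add (norm_nonneg _) (norm_nonneg _),
              ENNReal.rpow_natCast, ENNReal.ofReal_pow (by positivity)]
          rw [h2, timeDecay, ← ENNReal.ofReal_mul (by positivity), ← ENNReal.ofReal_mul (by positivity),
            ← ofReal_norm]
          refine ENNReal.ofReal_le_ofReal (h1.trans ?_)
          calc M * (1 + |t - τ|) ^ (-κ) * (‖u τ‖ + ‖u' τ‖) ^ l * ‖u τ - u' τ‖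
              ≤ M * (1 + |t - τ|) ^ (-κ) * (‖u τ‖ + ‖u' τ‖) ^ l * d := by
                gcongr
                exact hdist τ
            _ = _ := by ring
      _ = ENNReal.ofReal (M * d) * ∫⁻ τ, timeDecay κ (t - τ) * a τ ^ (l : ℝ) :=
          lintegral_const_mul' _ _ ENNReal.ofReal_ne_top
      _ ≤ ENNReal.ofReal (M * d) * (ENNReal.ofReal A * (∫⁻ τ, a τ ^ r) ^ ((l : ℝ) / r)) := by
          gcongr
          exact hAbound a ham t
      _ ≤ ENNReal.ofReal (M * d) * (ENNReal.ofReal A * ENNReal.ofReal ((2 * R) ^ l)) := by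
          gcongr
          rw [div_eq_mul_one_div, mul_comm, ENNReal.rpow_mul, ENNReal.ofReal_pow (by positivity),
            ENNReal.rpow_natCast]
          gcongr
      _ = _ := by
          rw [← ENNReal.ofReal_mul hA.le, ← ENNReal.ofReal_mul (by positivity)]
          ring_nf
  rw [← ofReal_norm] at key
  exact (ENNReal.ofReal_le_ofReal_iff (by positivity)).1 key

/-- The set in which the fixed point is found. -/
def fixedPointSet (r η : ℝ) (Z : ℝ → Set E) : Set (ℝ → E) :=
  {u | Continuous u ∧ (∀ t, ‖u t‖ ≤ 2 * η) ∧
    eLpNorm u (ENNReal.ofReal r) volume ≤ ENNReal.ofReal (2 * η) ∧ ∀ t, u t ∈ Z t}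

/-- Banach's theorem in the bounded continuous functions. The L^r bound is closed under uniform
limits by Fatou, so the contraction need not see it; its preservation is a hypothesis, to be
verified by different means for different λ. The sets `Z t` carry further closed constraints. -/
theorem exists_fixedPoint [CompleteSpace E] {F : ℝ → E → E} (hF : Continuous (Function.uncurry F))
    (hF0 : ∀ t, F t 0 = 0) {M κ r : ℝ}
    (hM : 0 < M) {l : ℕ} (hl : 0 < l) (hlr : (l : ℝ) < r) (hκ : 1 - (l : ℝ) / r < κ)
    (hLip : ∀ t e e', ‖F t e - F t e'‖ ≤ M * (1 + |t|) ^ (-κ) * (‖e‖ + ‖e'‖) ^ l * ‖e - e'‖) :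
    ∃ η₀ : ℝ, 0 < η₀ ∧ ∀ η : ℝ, 0 < η → η ≤ η₀ → ∀ v : ℝ → E, Continuous v → (∀ t, ‖v t‖ ≤ η) →
      eLpNorm v (ENNReal.ofReal r) volume ≤ ENNReal.ofReal η → ∀ Z : ℝ → Set E,
      (∀ t, IsClosed (Z t)) → (∀ t, v t ∈ Z t) →
      (∀ u ∈ fixedPointSet r η Z, (∀ t, picard F v u t ∈ Z t) ∧
        eLpNorm (fun t => picard F v u t - v t) (ENNReal.ofReal r) volume ≤ ENNReal.ofReal η) →
      ∃ u ∈ fixedPointSet r η Z, ∀ t, u t = picard F v u t := by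
  have hr1 : 1 ≤ r := by
    have : (1 : ℝ) ≤ l := by exact_mod_cast hl
    linarith
  have hl0 : (0 : ℝ) < l := by exact_mod_cast hl
  obtain ⟨A, hA, hAbound⟩ := exists_lintegral_timeDecay_mul_le hl0 hlr hκ
  -- The radius is chosen so that the Lipschitz constant on the ball of radius 2η₀ is at most 1/2.
  obtain ⟨η₀, hη₀, hsmall⟩ : ∃ η₀ : ℝ, 0 < η₀ ∧ M * A * (2 * (2 * η₀)) ^ l ≤ 1 / 2 := by
    have ht : Tendsto (fun x : ℝ => M * A * (2 * (2 * x)) ^ l) (𝓝[>] 0) (𝓝 0) := by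
      have hc : Continuous fun x : ℝ => M * A * (2 * (2 * x)) ^ l := by fun_prop
      have h0 := (hc.tendsto 0).mono_left (nhdsWithin_le_nhds (s := Set.Ioi 0))
      simpa [hl.ne'] using h0
    have h1 := (ht.eventually_le_const (u := 1 / 2) (by norm_num)).and self_mem_nhdsWithin
    obtain ⟨x, hx, hx0⟩ := h1.exists
    exact ⟨x, hx0, hx⟩
  refine ⟨η₀, hη₀, fun η hη hηη v hv hvb hvr Z hZ hvZ hself => ?_⟩
  have hsm : M * A * (2 * (2 * η)) ^ l ≤ 1 / 2 := le_trans (by gcongr) hsmall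
  have hdiff : ∀ {u u' : ℝ → E}, u ∈ fixedPointSet r η Z → u' ∈ fixedPointSet r η Z →
      ∀ {d : ℝ}, 0 ≤ d → (∀ τ, ‖u τ - u' τ‖ ≤ d) → ∀ t,
      ‖picard F v u t - picard F v u' t‖ ≤ 1 / 2 * d := by
    intro u u' hu hu' d hd hdist t
    refine (enorm_picard_sub_le hF hM hl hlr hA hAbound hLip hu.1 hu'.1 (by positivity) hd
      hu.2.2.1 hu'.2.2.1 hdist t).trans ?_
    gcongr
  -- The difference estimate against the zero function, which `picard` sends to v, yields half of
  -- 2η.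
  have hpv : ∀ {u : ℝ → E}, u ∈ fixedPointSet r η Z → ∀ t, ‖picard F v u t - v t‖ ≤ η := by
    intro u hu t
    have h0 : picard F v (fun _ => 0) t = v t := by simp [picard, hF0]
    have := enorm_picard_sub_le hF hM hl hlr hA hAbound hLip (v := v) (R := 2 * η) (d := 2 * η) hu.1
      (continuous_const (y := (0 : E))) (by positivity) (by positivity) hu.2.2.1 (by
        have : eLpNorm (fun _ : ℝ => (0 : E)) (ENNReal.ofReal r) volume = 0 := eLpNorm_zero
        rw [this]
        exact zero_le) (fun τ => by
        rw [sub_zero]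
        exact hu.2.1 τ) t
    rw [h0] at this
    calc _ ≤ _ := this
      _ ≤ 1 / 2 * (2 * η) := by gcongr
      _ = η := by ring
  have hmaps : ∀ {u : ℝ → E}, u ∈ fixedPointSet r η Z → picard F v u ∈ fixedPointSet r η Z := by
    intro u hu
    have hcont := continuous_picard hF hv hu.1
    refine ⟨hcont, fun t => ?_, ?_, (hself u hu).1⟩
    · have h1 := hpv hu t
      have h2 := hvb t
      have h3 := norm_le_norm_sub_add (picard F v u t) (v t)
      linarith
    · have h1 : picard F v u = (fun t => picard F v u t - v t) + v := by
        ext t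
        simp
      rw [h1]
      refine (eLpNorm_add_le (hcont.sub hv).aestronglyMeasurable hv.aestronglyMeasurable
        (by simpa using hr1)).trans ?_
      rw [two_mul, ENNReal.ofReal_add hη.le hη.le]
      exact add_le_add (hself u hu).2 hvr
  have hvmem : v ∈ fixedPointSet r η Z := by
    refine ⟨hv, fun t => (hvb t).trans (by linarith), hvr.trans ?_, hvZ⟩
    exact ENNReal.ofReal_le_ofReal (by linarith)
  set X : Set (BoundedContinuousFunction ℝ E) := {u | (u : ℝ → E) ∈ fixedPointSet r η Z} with hX
  have hbcf : ∀ {u : ℝ → E}, u ∈ fixedPointSet r η Z →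
      ∃ w : BoundedContinuousFunction ℝ E, (w : ℝ → E) = u := fun hu =>
    ⟨BoundedContinuousFunction.ofNormedAddCommGroup _ hu.1 _ hu.2.1, rfl⟩
  have hXcl : IsClosed X := by
    refine IsSeqClosed.isClosed fun w u hw hlim => ?_
    have hpt : ∀ t, Tendsto (fun n => w n t) atTop (𝓝 (u t)) := fun t =>
      ((BoundedContinuousFunction.lipschitz_eval_const t).continuous.tendsto u).comp hlim
    refine ⟨u.continuous, fun t => ?_, ?_, fun t => ?_⟩
    · exact le_of_tendsto (hpt t).norm (Eventually.of_forall fun n => (hw n).2.1 t)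
    · refine (Lp.eLpNorm_lim_le_liminf_eLpNorm (f := fun n => (w n : ℝ → E))
        (fun n => (w n).continuous.aestronglyMeasurable) u (Eventually.of_forall hpt)).trans ?_
      refine liminf_le_of_le (by isBoundedDefault) fun b hb => ?_
      obtain ⟨n, hn⟩ := hb.exists
      exact hn.trans (hw n).2.2.1
    · exact (hZ t).mem_of_tendsto (hpt t) (Eventually.of_forall fun n => (hw n).2.2.2 t)
  choose! Φ hΦ using fun (u : BoundedContinuousFunction ℝ E) (hu : u ∈ X) => hbcf (hmaps hu)
  have hmapsTo : Set.MapsTo Φ X X := fun u hu => by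
    have := hmaps hu
    rw [← hΦ u hu] at this
    exact this
  have hcontr : ContractingWith (1 / 2) (hmapsTo.restrict Φ X X) := by
    refine ⟨by norm_num [← NNReal.coe_lt_coe], LipschitzWith.of_dist_le_mul fun u u' => ?_⟩
    rw [Subtype.dist_eq, Subtype.dist_eq, Set.MapsTo.val_restrict_apply,
      Set.MapsTo.val_restrict_apply]
    refine (BoundedContinuousFunction.dist_le (by positivity)).2 fun t => ?_
    rw [hΦ u u.2, hΦ u' u'.2, dist_eq_norm]
    have := hdiff u.2 u'.2 (d := dist (u : BoundedContinuousFunction ℝ E) u') dist_nonneg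
      (fun τ => by
        rw [← dist_eq_norm]
        exact BoundedContinuousFunction.dist_coe_le_dist τ) t
    simpa using this
  obtain ⟨v', hv'⟩ := hbcf hvmem
  have hv'X : v' ∈ X := by
    rw [hX, Set.mem_ofPred_eq, hv']
    exact hvmem
  obtain ⟨u, huX, hfix, -⟩ := hcontr.exists_fixedPoint' hXcl.isComplete hmapsTo hv'X
    (edist_ne_top _ _)
  refine ⟨u, huX, fun t => ?_⟩
  have h1 := hΦ u huX
  rw [hfix] at h1
  exact congrFun h1 t

theorem exists_eLpNorm_picard_sub_le {κ b r : ℝ} (hb : 1 < b) (hbr : b ≤ r)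
    (hκ : 1 - (b - 1) / r < κ) : ∃ C : ℝ, 0 < C ∧ ∀ (F : ℝ → E → E) (v u : ℝ → E) (M R : ℝ),
      0 < M → 0 ≤ R → Continuous u → eLpNorm u (ENNReal.ofReal r) volume ≤ ENNReal.ofReal R →
      (∀ t τ, ‖F t (u τ)‖ ≤ M * (1 + |t|) ^ (-κ) * ‖u τ‖ ^ b) →
      eLpNorm (fun t => picard F v u t - v t) (ENNReal.ofReal r) volume ≤
        ENNReal.ofReal (C * M * R ^ b) := by
  have hr0 : 0 < r := by linarith
  have hb0 : 0 < b := by linarith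
  obtain ⟨A, hA, hy⟩ := exists_lintegral_timeDecay_young hb hbr hκ
  refine ⟨A ^ (1 / r), by positivity, fun F v u M R hM hR hu hur hF => ?_⟩
  rw [eLpNorm_eq_lintegral_rpow_enorm_toReal (by simpa using hr0) ENNReal.ofReal_ne_top,
    ENNReal.toReal_ofReal hr0.le] at hur ⊢
  have hpt : ∀ t, ‖picard F v u t - v t‖ₑ ≤
      ENNReal.ofReal M * ∫⁻ τ, timeDecay κ (t - τ) * ‖u τ‖ₑ ^ b := by
    intro t
    rw [picard, add_sub_cancel_left, ← lintegral_const_mul' _ _ ENNReal.ofReal_ne_top]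
    refine (enorm_intervalIntegral_le _ _).trans (lintegral_mono fun τ => ?_)
    rw [← ofReal_norm, ← ofReal_norm, ENNReal.ofReal_rpow_of_nonneg (norm_nonneg _) hb0.le,
      timeDecay, ← ENNReal.ofReal_mul (by positivity), ← ENNReal.ofReal_mul (by positivity),
      ← mul_assoc]
    exact ENNReal.ofReal_le_ofReal (hF _ _)
  have hI : (∫⁻ τ, ‖u τ‖ₑ ^ r) ≤ ENNReal.ofReal (R ^ r) := by
    have := ENNReal.rpow_le_rpow hur hr0.le
    rwa [← ENNReal.rpow_mul, one_div_mul_cancel hr0.ne', ENNReal.rpow_one,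
      ENNReal.ofReal_rpow_of_nonneg hR hr0.le] at this
  calc (∫⁻ t, ‖picard F v u t - v t‖ₑ ^ r) ^ (1 / r)
      ≤ (∫⁻ t, ENNReal.ofReal M ^ r * (∫⁻ τ, timeDecay κ (t - τ) * ‖u τ‖ₑ ^ b) ^ r) ^ (1 / r) := by
        gcongr with t
        rw [← ENNReal.mul_rpow_of_nonneg _ _ hr0.le]
        gcongr
        exact hpt t
    _ = (ENNReal.ofReal M ^ r * ∫⁻ t, (∫⁻ τ, timeDecay κ (t - τ) * ‖u τ‖ₑ ^ b) ^ r) ^ (1 / r) := by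
        rw [lintegral_const_mul' _ _ (ENNReal.rpow_ne_top_of_nonneg hr0.le ENNReal.ofReal_ne_top)]
    _ ≤ (ENNReal.ofReal M ^ r * (ENNReal.ofReal A * ENNReal.ofReal (R ^ r) ^ b)) ^ (1 / r) := by
        gcongr
        refine (hy _ hu.enorm.aemeasurable).trans ?_
        gcongr
    _ = _ := by
        rw [ENNReal.ofReal_rpow_of_nonneg hM.le hr0.le,
          ENNReal.ofReal_rpow_of_nonneg (by positivity) hb0.le, ← ENNReal.ofReal_mul hA.le,
          ← ENNReal.ofReal_mul (by positivity),
          ENNReal.ofReal_rpow_of_nonneg (by positivity) (by positivity)]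
        congr 1
        rw [Real.mul_rpow (by positivity) (by positivity), Real.mul_rpow (by positivity) (by positivity),
          ← Real.rpow_mul hM.le, ← Real.rpow_mul hR, ← Real.rpow_mul hR, mul_one_div_cancel hr0.ne',
          Real.rpow_one]
        have : r * b * (1 / r) = b := by field_simp
        rw [this]
        ring

/-- Uniqueness of continuous solutions, forward in time. -/
theorem picard_unique_of_nonneg {F : ℝ → E → E} (hF : Continuous (Function.uncurry F)) {M : ℝ}
    (hM : 0 ≤ M) {l : ℕ} (hLip : ∀ t e e', ‖F t e - F t e'‖ ≤ M * (‖e‖ + ‖e'‖) ^ l * ‖e - e'‖)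
    {v u u' : ℝ → E} (hu : Continuous u) (hu' : Continuous u') (h : ∀ t, u t = picard F v u t)
    (h' : ∀ t, u' t = picard F v u' t) {T : ℝ} (hT : 0 ≤ T) : u T = u' T := by
  obtain ⟨R, hR⟩ := (isCompact_Icc (a := (0 : ℝ)) (b := T)).exists_bound_of_continuousOn
    (f := fun t => ‖u t‖ + ‖u' t‖) (hu.norm.add hu'.norm).continuousOn
  have hc : ∀ {w : ℝ → E}, Continuous w → ∀ t, Continuous fun τ => F (t - τ) (w τ) := fun hw t =>
    hF.comp ((continuous_const.sub continuous_id).prodMk hw)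
  set k : ℝ → ℝ := fun t => ‖u t - u' t‖ with hk
  have hkc : Continuous k := (hu.sub hu').norm
  set L : ℝ := M * R ^ l with hL
  have hR0 : 0 ≤ R := (norm_nonneg _).trans (hR 0 ⟨le_rfl, hT⟩)
  have hbound : ∀ t ∈ Set.Icc (0 : ℝ) T, k t ≤ L * ∫ τ in (0 : ℝ)..t, k τ := by
    intro t ht
    have e1 : u t - u' t = ∫ τ in (0 : ℝ)..t, (F (t - τ) (u τ) - F (t - τ) (u' τ)) := by
      rw [intervalIntegral.integral_sub ((hc hu t).intervalIntegrable _ _)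
        ((hc hu' t).intervalIntegrable _ _)]
      conv_lhs => rw [h t, h' t]
      unfold picard
      abel
    rw [hk]
    simp only
    rw [e1, ← intervalIntegral.integral_const_mul]
    refine intervalIntegral.norm_integral_le_of_norm_le ht.1 (Eventually.of_forall fun τ hτ => ?_)
      ((continuous_const.mul hkc).intervalIntegrable _ _)
    refine (hLip _ _ _).trans ?_
    have h1 := hR τ ⟨hτ.1.le, hτ.2.trans ht.2⟩
    rw [Real.norm_of_nonneg (by positivity)] at h1
    rw [hL]
    gcongr
  have hder : ∀ t, HasDerivAt (fun t => ∫ τ in (0 : ℝ)..t, k τ) (k t) t := fun t =>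
    intervalIntegral.integral_hasDerivAt_right (hkc.intervalIntegrable _ _)
      (hkc.stronglyMeasurableAtFilter _ _) hkc.continuousAt
  have hK : ∀ t ∈ Set.Icc (0 : ℝ) T, 0 ≤ ∫ τ in (0 : ℝ)..t, k τ := fun t ht =>
    intervalIntegral.integral_nonneg ht.1 fun τ _ => norm_nonneg _
  -- Grönwall is applied to the primitive K of k = ‖u - u'‖, which satisfies K' = k ≤ L·K and K(0) =
  -- 0.
  have hg := norm_le_gronwallBound_of_norm_deriv_right_le (a := 0) (b := T) (δ := 0) (K := L) (ε := 0)
    (f := fun t => ∫ τ in (0 : ℝ)..t, k τ) (f' := k)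
    (fun t _ => (hder t).continuousAt.continuousWithinAt) (fun t _ => (hder t).hasDerivWithinAt)
    (by simp) (fun t ht => by
      have ht' : t ∈ Set.Icc (0 : ℝ) T := ⟨ht.1, ht.2.le⟩
      rw [add_zero, Real.norm_of_nonneg (norm_nonneg _), Real.norm_of_nonneg (hK t ht')]
      exact hbound t ht') T ⟨hT, le_rfl⟩
  have h0 : gronwallBound 0 L 0 (T - 0) = 0 := by simp [gronwallBound_ε0_δ0]
  rw [h0] at hg
  have hz : ∫ τ in (0 : ℝ)..T, k τ = 0 := norm_le_zero_iff.1 hg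
  have h2 := hbound T ⟨hT, le_rfl⟩
  rw [hz, mul_zero] at h2
  exact sub_eq_zero.1 (norm_le_zero_iff.1 h2)

/-- Time reversal: the backward equation is a forward one for -F(-t, ·), so uniqueness need only be
shown for t ≥ 0. -/
theorem picard_reflect {F : ℝ → E → E} {v u : ℝ → E} (t : ℝ) :
    picard F v u (-t) = picard (fun t e => -F (-t) e) (fun t => v (-t)) (fun t => u (-t)) t := by
  unfold picard
  congr 1
  have := intervalIntegral.integral_comp_neg (a := (0 : ℝ)) (b := t) (fun τ => F (-t - τ) (u τ))
  rw [neg_zero] at this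
  rw [intervalIntegral.integral_symm, ← this, intervalIntegral.integral_neg]
  simp only [neg_sub]
  congr 2
  ext τ
  congr 1
  ring

theorem picard_unique {F : ℝ → E → E} (hF : Continuous (Function.uncurry F)) {M : ℝ}
    (hM : 0 ≤ M) {l : ℕ} (hLip : ∀ t e e', ‖F t e - F t e'‖ ≤ M * (‖e‖ + ‖e'‖) ^ l * ‖e - e'‖)
    {v u u' : ℝ → E} (hu : Continuous u) (hu' : Continuous u') (h : ∀ t, u t = picard F v u t)
    (h' : ∀ t, u' t = picard F v u' t) : u = u' := by
  ext t
  rcases le_total 0 t with ht | ht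
  · exact picard_unique_of_nonneg hF hM hLip hu hu' h h' ht
  · have hF' : Continuous (Function.uncurry fun t e => -F (-t) e) :=
      (hF.comp (continuous_fst.neg.prodMk continuous_snd)).neg
    have := picard_unique_of_nonneg hF' hM (l := l) (v := fun t => v (-t))
      (fun t e e' => by
        rw [neg_sub_neg, norm_sub_rev]
        exact hLip _ _ _)
      (hu.comp continuous_neg) (hu'.comp continuous_neg)
      (fun t => (h (-t)).trans (picard_reflect t)) (fun t => (h' (-t)).trans (picard_reflect t))
      (T := -t) (by linarith)
    simpa using this

end FixedPoint

/-! ### The symbols `φ` and `e^{-itφ}` -/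

theorem hasTemperateGrowth_phi : (fun ξ => (phi ξ : ℂ)).HasTemperateGrowth := by
  have h1 := Function.hasTemperateGrowth_one_add_norm_sq_rpow ℝ (-1)
  have h2 : phi.HasTemperateGrowth := by
    have h3 : (fun ξ : ℝ => ξ * (1 + ‖ξ‖ ^ 2) ^ (-1 : ℝ)).HasTemperateGrowth := by fun_prop
    convert h3 using 2 with ξ
    rw [Real.rpow_neg_one, phi, div_eq_mul_inv, Real.norm_eq_abs, sq_abs]
  fun_prop

theorem contDiff_phi : ContDiff ℝ (⊤ : ℕ∞) phi := by
  unfold phi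
  refine contDiff_id.div (by fun_prop) fun ξ => ?_
  positivity

/-- The derivative of `φ`. -/
def phi₁ (ξ : ℝ) : ℝ := (1 - ξ ^ 2) / (1 + ξ ^ 2) ^ 2

/-- The second derivative of `φ`. -/
def phi₂ (ξ : ℝ) : ℝ := 2 * ξ * (ξ ^ 2 - 3) / (1 + ξ ^ 2) ^ 3

theorem hasDerivAt_phi (ξ : ℝ) : HasDerivAt phi (phi₁ ξ) ξ := by
  have h1 : HasDerivAt (fun ξ : ℝ => 1 + ξ ^ 2) (2 * ξ) ξ := by
    simpa using (hasDerivAt_pow 2 ξ).const_add 1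
  have h0 : 1 + ξ ^ 2 ≠ 0 := by positivity
  refine HasDerivAt.congr_deriv (f := phi) ((hasDerivAt_id' ξ).fun_div h1 h0) ?_
  unfold phi₁
  ring

theorem hasDerivAt_phi₁ (ξ : ℝ) : HasDerivAt phi₁ (phi₂ ξ) ξ := by
  have h1 : HasDerivAt (fun ξ : ℝ => 1 + ξ ^ 2) (2 * ξ) ξ := by
    simpa using (hasDerivAt_pow 2 ξ).const_add 1
  have h2 : HasDerivAt (fun ξ : ℝ => 1 - ξ ^ 2) (-(2 * ξ)) ξ := by
    simpa using (hasDerivAt_pow 2 ξ).const_sub 1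
  have h3 : HasDerivAt (fun ξ : ℝ => (1 + ξ ^ 2) ^ 2) (2 * (1 + ξ ^ 2) * (2 * ξ)) ξ := by
    simpa using h1.fun_pow 2
  have h0 : (1 + ξ ^ 2) ^ 2 ≠ 0 := by positivity
  refine HasDerivAt.congr_deriv (f := phi₁) (h2.fun_div h3 h0) ?_
  unfold phi₂
  have h4 : 1 + ξ ^ 2 ≠ 0 := by positivity
  field_simp
  ring

theorem abs_phi_le (ξ : ℝ) : |phi ξ| ≤ 1 := by
  unfold phi
  rw [abs_div, abs_of_pos (by positivity : (0 : ℝ) < 1 + ξ ^ 2), div_le_one (by positivity)]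
  nlinarith [sq_nonneg (|ξ| - 1), sq_abs ξ]

theorem abs_phi₁_le (ξ : ℝ) : |phi₁ ξ| ≤ 1 := by
  unfold phi₁
  rw [abs_div, abs_of_pos (by positivity : (0 : ℝ) < (1 + ξ ^ 2) ^ 2), div_le_one (by positivity),
    abs_le]
  constructor <;> nlinarith [sq_nonneg ξ]

theorem abs_phi₂_le (ξ : ℝ) : |phi₂ ξ| ≤ 3 := by
  unfold phi₂
  rw [abs_div, abs_of_pos (by positivity : (0 : ℝ) < (1 + ξ ^ 2) ^ 3), div_le_iff₀ (by positivity),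
    abs_mul, abs_mul, abs_two]
  have h1 : 2 * |ξ| ≤ 1 + ξ ^ 2 := by nlinarith [sq_nonneg (|ξ| - 1), sq_abs ξ]
  have h2 : |ξ ^ 2 - 3| ≤ 3 * (1 + ξ ^ 2) := by
    rw [abs_le]
    constructor <;> nlinarith [sq_nonneg ξ]
  have h3 : 1 ≤ 1 + ξ ^ 2 := by nlinarith [sq_nonneg ξ]
  calc 2 * |ξ| * |ξ ^ 2 - 3| ≤ (1 + ξ ^ 2) * (3 * (1 + ξ ^ 2)) := by gcongr
    _ = 3 * (1 + ξ ^ 2) ^ 2 := by ring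
    _ ≤ 3 * (1 + ξ ^ 2) ^ 3 := by
      gcongr ?_ * ?_
      exact pow_le_pow_right₀ h3 (by norm_num)

theorem Bdd2.of_hasDerivAt {a a₁ a₂ : ℝ → ℂ} {B : ℝ} (hs : ContDiff ℝ (⊤ : ℕ∞) a)
    (h1 : ∀ ξ, HasDerivAt a (a₁ ξ) ξ) (h2 : ∀ ξ, HasDerivAt a₁ (a₂ ξ) ξ) (b0 : ∀ ξ, ‖a ξ‖ ≤ B)
    (b1 : ∀ ξ, ‖a₁ ξ‖ ≤ B) (b2 : ∀ ξ, ‖a₂ ξ‖ ≤ B) : Bdd2 a B := by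
  have e1 : deriv a = a₁ := funext fun ξ => (h1 ξ).deriv
  have e2 : deriv a₁ = a₂ := funext fun ξ => (h2 ξ).deriv
  refine ⟨hs, b0, fun ξ => ?_, fun ξ => ?_⟩
  · rw [e1]
    exact b1 ξ
  · rw [e1, e2]
    exact b2 ξ

/-- The symbol `e^{-itφ}` of `S(t)`. -/
def grp (t ξ : ℝ) : ℂ := Complex.exp (-Complex.I * t * phi ξ)

theorem S_eq (t : ℝ) (f : 𝓢'(ℝ, ℂ)) : S t f = multiplier (grp t) f := rfl

theorem phiD_eq (f : 𝓢'(ℝ, ℂ)) : phiD f = multiplier (fun ξ => (phi ξ : ℂ)) f := rfl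

theorem grp_eq (t ξ : ℝ) : grp t ξ = Complex.exp (((-t * phi ξ : ℝ) : ℂ) * Complex.I) := by
  unfold grp
  congr 1
  push_cast
  ring

theorem norm_grp (t ξ : ℝ) : ‖grp t ξ‖ = 1 := by rw [grp_eq, Complex.norm_exp_ofReal_mul_I]

theorem grp_add (t t' ξ : ℝ) : grp (t + t') ξ = grp t ξ * grp t' ξ := by
  unfold grp
  rw [← Complex.exp_add]
  congr 1
  push_cast
  ring

theorem grp_zero (ξ : ℝ) : grp 0 ξ = 1 := by simp [grp]

theorem hasTemperateGrowth_grp (t : ℝ) : (grp t).HasTemperateGrowth := by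
  have h1 : (fun ξ : ℝ => -t * phi ξ).HasTemperateGrowth := by
    have h2 := Function.hasTemperateGrowth_one_add_norm_sq_rpow ℝ (-1)
    have h3 : (fun ξ : ℝ => -t * (ξ * (1 + ‖ξ‖ ^ 2) ^ (-1 : ℝ))).HasTemperateGrowth := by fun_prop
    convert h3 using 2 with ξ
    rw [Real.rpow_neg_one, phi, div_eq_mul_inv, Real.norm_eq_abs, sq_abs]
  have h2 := hasTemperateGrowth_cexp_mul_I.comp h1
  convert h2 using 1
  ext ξ
  rw [grp_eq]
  rfl

theorem hasDerivAt_grp (t ξ : ℝ) : HasDerivAt (grp t) (-Complex.I * t * phi₁ ξ * grp t ξ) ξ := by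
  have h1 := ((hasDerivAt_phi ξ).ofReal_comp.const_mul (-Complex.I * (t : ℂ))).cexp
  refine HasDerivAt.congr_deriv (f := grp t) h1 ?_
  unfold grp
  ring

theorem hasDerivAt_grp₁ (t ξ : ℝ) : HasDerivAt (fun ξ => -Complex.I * t * phi₁ ξ * grp t ξ)
    ((-Complex.I * t * phi₂ ξ + (-Complex.I * t * phi₁ ξ) ^ 2) * grp t ξ) ξ := by
  refine HasDerivAt.congr_deriv (((hasDerivAt_phi₁ ξ).ofReal_comp.const_mul
    (-Complex.I * (t : ℂ))).fun_mul (hasDerivAt_grp t ξ)) ?_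
  ring

theorem norm_grp₁_le (t ξ : ℝ) : ‖-Complex.I * t * phi₁ ξ * grp t ξ‖ ≤ |t| := by
  rw [norm_mul, norm_grp, norm_mul, norm_mul, norm_neg, Complex.norm_I, Complex.norm_real,
    Complex.norm_real, Real.norm_eq_abs, Real.norm_eq_abs, one_mul, mul_one]
  exact mul_le_of_le_one_right (abs_nonneg _) (abs_phi₁_le ξ)

theorem norm_grp₂_le (t ξ : ℝ) :
    ‖(-Complex.I * t * phi₂ ξ + (-Complex.I * t * phi₁ ξ) ^ 2) * grp t ξ‖ ≤ 3 * |t| + t ^ 2 := by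
  have h1 := norm_grp₁_le t ξ
  rw [norm_mul, norm_grp, mul_one] at h1 ⊢
  refine (norm_add_le _ _).trans (add_le_add ?_ ?_)
  · rw [norm_mul, norm_mul, norm_neg, Complex.norm_I, Complex.norm_real,
      Complex.norm_real, Real.norm_eq_abs, Real.norm_eq_abs, one_mul, mul_comm]
    gcongr
    exact abs_phi₂_le ξ
  · rw [norm_pow, ← sq_abs t]
    gcongr

theorem contDiff_grp (t : ℝ) : ContDiff ℝ (⊤ : ℕ∞) (grp t) :=
  (contDiff_const.mul (Complex.ofRealCLM.contDiff.comp contDiff_phi)).cexp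

/-- The quadratic growth in t is harmless: it serves only to let S(t) act on the modulation space,
while decay comes from oscillation. -/
theorem bdd2_grp (t : ℝ) : Bdd2 (grp t) (3 * (1 + |t|) ^ 2) := by
  have ht := abs_nonneg t
  refine Bdd2.of_hasDerivAt (contDiff_grp t) (hasDerivAt_grp t) (hasDerivAt_grp₁ t)
    (fun ξ => ?_) (fun ξ => (norm_grp₁_le t ξ).trans ?_) fun ξ => (norm_grp₂_le t ξ).trans ?_
  · rw [norm_grp]
    nlinarith
  · nlinarith
  · rw [← sq_abs t]
    nlinarith

theorem norm_exp_sub_one_le (x : ℝ) : ‖Complex.exp (x * Complex.I) - 1‖ ≤ |x| := by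
  have := Real.norm_exp_I_mul_ofReal_sub_one_le (x := x)
  rwa [mul_comm, Real.norm_eq_abs] at this

/-- As φ and its first two derivatives are bounded, the symbol minus 1 is O(|t|) with two
derivatives; this is norm continuity of the group at 0. -/
theorem bdd2_grp_sub_one {t : ℝ} (ht : |t| ≤ 1) : Bdd2 (fun ξ => grp t ξ - 1) (4 * |t|) := by
  have h0 := abs_nonneg t
  refine Bdd2.of_hasDerivAt ((contDiff_grp t).sub contDiff_const)
    (fun ξ => (hasDerivAt_grp t ξ).sub_const 1) (hasDerivAt_grp₁ t)
    (fun ξ => ?_) (fun ξ => (norm_grp₁_le t ξ).trans ?_) fun ξ => (norm_grp₂_le t ξ).trans ?_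
  · rw [grp_eq]
    refine (norm_exp_sub_one_le _).trans ?_
    rw [abs_mul, abs_neg]
    nlinarith [abs_phi_le ξ, abs_nonneg (phi ξ)]
  · linarith
  · rw [← sq_abs t]
    nlinarith

theorem S_add (t t' : ℝ) (f : 𝓢'(ℝ, ℂ)) : S (t + t') f = S t (S t' f) := by
  rw [S_eq, S_eq, S_eq, multiplier_multiplier (hasTemperateGrowth_grp t) (hasTemperateGrowth_grp t')]
  simp only [← grp_add]

theorem S_zero (f : 𝓢'(ℝ, ℂ)) : S 0 f = f := by
  rw [S_eq]
  have : grp 0 = fun _ => 1 := funext grp_zero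
  rw [this, multiplier_one]

/-! ### The group on the modulation space -/

namespace ModSpace

variable (P : ModParams)

/-- The group is continuous in operator norm, since φ(D) has a bounded symbol; by the group law it
suffices to look at t = 0. -/
theorem exists_group : ∃ U : ℝ → ModSpace P →L[ℂ] ModSpace P,
    (∀ t e, (U t e).dist = S t e.dist) ∧ Continuous U := by
  obtain ⟨C, hC, h⟩ := exists_modNorm_multiplier_le P.isBump
  have hU : ∀ t f, modNorm P.ρ P.s P.p 1 (multiplier (grp t) f) ≤
      ENNReal.ofReal (C * (3 * (1 + |t|) ^ 2)) * modNorm P.ρ P.s P.p 1 f := fun t f =>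
    h _ _ (by positivity) (hasTemperateGrowth_grp t) (bdd2_grp t) P.s P.p P.p P.hp le_rfl f
  set U : ℝ → ModSpace P →L[ℂ] ModSpace P := fun t =>
    multCLM (grp t) (C * (3 * (1 + |t|) ^ 2)) (by positivity) (hU t) with hUdef
  have hUd : ∀ t e, (U t e).dist = S t e.dist := fun t e => rfl
  refine ⟨U, hUd, ?_⟩
  have hadd : ∀ t t', U (t + t') = (U t).comp (U t') := fun t t' => by
    ext e
    refine dist_injective ?_
    rw [hUd, S_add]
    rfl
  have hone : ∀ t, |t| ≤ 1 → ‖U t - ContinuousLinearMap.id ℂ _‖ ≤ C * (4 * |t|) := by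
    intro t ht
    refine ContinuousLinearMap.opNorm_le_bound _ (by positivity) fun e => ?_
    rcases eq_or_ne t 0 with rfl | h0
    · have : (U 0 - ContinuousLinearMap.id ℂ (ModSpace P)) e = 0 := by
        refine dist_injective ?_
        change S 0 e.dist - e.dist = 0
        rw [S_zero, sub_self]
      rw [this]
      simp
    refine norm_le_of_modNorm_le (by positivity) ?_
    have h1 : ((U t - ContinuousLinearMap.id ℂ (ModSpace P)) e).dist =
        multiplier (fun ξ => grp t ξ - 1) e.dist := by
      rw [multiplier_fun_sub (hasTemperateGrowth_grp t) (by fun_prop), multiplier_one]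
      rfl
    rw [h1, ENNReal.ofReal_mul (by positivity), ← modNorm_dist]
    refine h _ _ (by positivity) ?_ (bdd2_grp_sub_one ht) P.s P.p P.p P.hp le_rfl e.dist
    have := hasTemperateGrowth_grp t
    fun_prop
  rw [continuous_iff_continuousAt]
  intro t₀
  rw [ContinuousAt, tendsto_iff_norm_sub_tendsto_zero]
  have hlim : Tendsto (fun t => ‖U t₀‖ * (C * (4 * |t - t₀|))) (𝓝 t₀) (𝓝 0) := by
    have hc : Continuous fun t => ‖U t₀‖ * (C * (4 * |t - t₀|)) := by fun_prop
    simpa using hc.tendsto t₀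
  refine squeeze_zero' (Eventually.of_forall fun t => norm_nonneg _) ?_ hlim
  filter_upwards [Metric.ball_mem_nhds t₀ one_pos] with t ht
  rw [Metric.mem_ball, Real.dist_eq] at ht
  have h1 : U t - U t₀ = (U t₀).comp (U (t - t₀) - ContinuousLinearMap.id ℂ _) := by
    rw [ContinuousLinearMap.comp_sub, ← hadd, ContinuousLinearMap.comp_id, add_sub_cancel]
  rw [h1]
  refine (ContinuousLinearMap.opNorm_comp_le _ _).trans ?_
  gcongr
  exact hone _ ht.le

/-- The group `S(t)` on the modulation space. -/
def group (t : ℝ) : ModSpace P →L[ℂ] ModSpace P := (exists_group P).choose t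

variable {P}

@[simp] theorem dist_group (t : ℝ) (e : ModSpace P) : (group P t e).dist = S t e.dist :=
  (exists_group P).choose_spec.1 t e

theorem continuous_group : Continuous (group P) := (exists_group P).choose_spec.2

theorem group_add (t t' : ℝ) (e : ModSpace P) : group P (t + t') e = group P t (group P t' e) := by
  refine dist_injective ?_
  simp [S_add]

theorem group_zero (e : ModSpace P) : group P 0 e = e := by
  refine dist_injective ?_
  simp [S_zero]

end ModSpace

/-! ### Oscillatory integrals -/

/-- On an interval where h is monotone, arctan(h/κ)/κ is a primitive up to sign, and arctan varies
by at most π. -/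
theorem integral_abs_deriv_div_le {h h' : ℝ → ℝ} {a b κ : ℝ} (hab : a ≤ b) (hκ : 0 < κ)
    (hd : ∀ ξ, HasDerivAt h (h' ξ) ξ) (hc : Continuous h')
    (hs : (∀ ξ ∈ Set.Icc a b, 0 ≤ h' ξ) ∨ ∀ ξ ∈ Set.Icc a b, h' ξ ≤ 0) :
    ∫ ξ in a..b, |h' ξ| / (κ ^ 2 + h ξ ^ 2) ≤ Real.pi / κ := by
  have hhc : Continuous h := continuous_iff_continuousAt.2 fun ξ => (hd ξ).continuousAt
  have hder : ∀ ξ, HasDerivAt (fun ξ => Real.arctan (h ξ / κ) / κ) (h' ξ / (κ ^ 2 + h ξ ^ 2)) ξ := by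
    intro ξ
    refine HasDerivAt.congr_deriv (((hd ξ).div_const κ).arctan.div_const κ) ?_
    have : (0 : ℝ) < κ ^ 2 + h ξ ^ 2 := by positivity
    have : (0 : ℝ) < 1 + (h ξ / κ) ^ 2 := by positivity
    field_simp
  have hpos : ∀ ξ, 0 < κ ^ 2 + h ξ ^ 2 := fun ξ => by positivity
  have hint : ∫ ξ in a..b, h' ξ / (κ ^ 2 + h ξ ^ 2) =
      Real.arctan (h b / κ) / κ - Real.arctan (h a / κ) / κ := by
    refine intervalIntegral.integral_eq_sub_of_hasDerivAt (fun ξ _ => hder ξ) ?_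
    refine Continuous.intervalIntegrable ?_ _ _
    exact hc.div (by fun_prop) fun ξ => (hpos ξ).ne'
  have b1 := Real.arctan_lt_pi_div_two (h b / κ)
  have b2 := Real.neg_pi_div_two_lt_arctan (h b / κ)
  have b3 := Real.arctan_lt_pi_div_two (h a / κ)
  have b4 := Real.neg_pi_div_two_lt_arctan (h a / κ)
  rcases hs with hs | hs
  · have : ∫ ξ in a..b, |h' ξ| / (κ ^ 2 + h ξ ^ 2) = ∫ ξ in a..b, h' ξ / (κ ^ 2 + h ξ ^ 2) := by
      refine intervalIntegral.integral_congr fun ξ hξ => ?_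
      rw [Set.uIcc_of_le hab] at hξ
      rw [abs_of_nonneg (hs ξ hξ)]
    rw [this, hint, ← sub_div]
    gcongr
    linarith
  · have : ∫ ξ in a..b, |h' ξ| / (κ ^ 2 + h ξ ^ 2) = -∫ ξ in a..b, h' ξ / (κ ^ 2 + h ξ ^ 2) := by
      rw [← intervalIntegral.integral_neg]
      refine intervalIntegral.integral_congr fun ξ hξ => ?_
      rw [Set.uIcc_of_le hab] at hξ
      rw [abs_of_nonpos (hs ξ hξ)]
      ring
    rw [this, hint, ← sub_div, ← neg_div]
    gcongr
    linarith

/-- The derivative of the phase `xξ - tφ(ξ)`. -/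
def phase₁ (x t ξ : ℝ) : ℝ := x - t * phi₁ ξ

theorem hasDerivAt_phase₁ (x t ξ : ℝ) : HasDerivAt (phase₁ x t) (-(t * phi₂ ξ)) ξ :=
  HasDerivAt.congr_deriv (((hasDerivAt_phi₁ ξ).const_mul t).const_sub x) rfl

theorem continuous_phi₂ : Continuous phi₂ := by
  unfold phi₂
  refine Continuous.div (by fun_prop) (by fun_prop) fun ξ => ?_
  positivity

theorem phi₂_sign (ξ : ℝ) : (ξ ≤ -√3 → phi₂ ξ ≤ 0) ∧ (-√3 ≤ ξ → ξ ≤ 0 → 0 ≤ phi₂ ξ) ∧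
    (0 ≤ ξ → ξ ≤ √3 → phi₂ ξ ≤ 0) ∧ (√3 ≤ ξ → 0 ≤ phi₂ ξ) := by
  have h3 : √3 ^ 2 = 3 := Real.sq_sqrt (by norm_num)
  have h0 : 0 ≤ √3 := Real.sqrt_nonneg 3
  have hden : 0 < (1 + ξ ^ 2) ^ 3 := by positivity
  unfold phi₂
  refine ⟨fun h => ?_, fun h h' => ?_, fun h h' => ?_, fun h => ?_⟩
  · refine div_nonpos_of_nonpos_of_nonneg ?_ hden.le
    exact mul_nonpos_of_nonpos_of_nonneg (by linarith) (by nlinarith)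
  · exact div_nonneg (mul_nonneg_of_nonpos_of_nonpos (by linarith) (by nlinarith)) hden.le
  · refine div_nonpos_of_nonpos_of_nonneg ?_ hden.le
    exact mul_nonpos_of_nonneg_of_nonpos (by linarith) (by nlinarith)
  · exact div_nonneg (mul_nonneg (by linarith) (by nlinarith)) hden.le

/-- φ'' has constant sign on each of the four intervals cut out by -√3, 0, √3. The bound is
independent of x, t and R. -/
theorem integral_phase₂_div_le {x t κ R : ℝ} (hκ : 0 < κ) (hR : √3 ≤ R) :
    ∫ ξ in -R..R, |-(t * phi₂ ξ)| / (κ ^ 2 + phase₁ x t ξ ^ 2) ≤ 4 * Real.pi / κ := by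
  have h0 : 0 ≤ √3 := Real.sqrt_nonneg 3
  have hcont : Continuous (phase₁ x t) :=
    continuous_iff_continuousAt.2 fun ξ => (hasDerivAt_phase₁ x t ξ).continuousAt
  have hc2 : Continuous fun ξ => -(t * phi₂ ξ) := (continuous_const.mul continuous_phi₂).neg
  have hc : Continuous fun ξ => |-(t * phi₂ ξ)| / (κ ^ 2 + phase₁ x t ξ ^ 2) := by
    refine hc2.abs.div (by fun_prop) fun ξ => ?_
    positivity
  have hi : ∀ a b, IntervalIntegrable (fun ξ => |-(t * phi₂ ξ)| / (κ ^ 2 + phase₁ x t ξ ^ 2))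
      volume a b := fun a b => hc.intervalIntegrable _ _
  have key : ∀ {a b : ℝ}, a ≤ b → ((∀ ξ ∈ Set.Icc a b, 0 ≤ phi₂ ξ) ∨ ∀ ξ ∈ Set.Icc a b, phi₂ ξ ≤ 0) →
      ∫ ξ in a..b, |-(t * phi₂ ξ)| / (κ ^ 2 + phase₁ x t ξ ^ 2) ≤ Real.pi / κ := by
    intro a b hab hs
    refine integral_abs_deriv_div_le hab hκ (hasDerivAt_phase₁ x t) hc2 ?_
    rcases le_total 0 t with ht | ht
    · rcases hs with hs | hs
      · right
        intro ξ hξ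
        have := mul_nonneg ht (hs ξ hξ)
        linarith
      · left
        intro ξ hξ
        have := mul_nonpos_of_nonneg_of_nonpos ht (hs ξ hξ)
        linarith
    · rcases hs with hs | hs
      · left
        intro ξ hξ
        have := mul_nonpos_of_nonpos_of_nonneg ht (hs ξ hξ)
        linarith
      · right
        intro ξ hξ
        have := mul_nonneg_of_nonpos_of_nonpos ht (hs ξ hξ)
        linarith
  rw [← intervalIntegral.integral_add_adjacent_intervals (hi (-R) (-√3)) (hi _ R),
    ← intervalIntegral.integral_add_adjacent_intervals (hi (-√3) 0) (hi _ R),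
    ← intervalIntegral.integral_add_adjacent_intervals (hi 0 (√3)) (hi _ R)]
  have k1 := key (a := -R) (b := -√3) (by linarith) (Or.inr fun ξ hξ => (phi₂_sign ξ).1 hξ.2)
  have k2 := key (a := -√3) (b := 0) (by linarith) (Or.inl fun ξ hξ => (phi₂_sign ξ).2.1 hξ.1 hξ.2)
  have k3 := key (a := 0) (b := √3) h0 (Or.inr fun ξ hξ => (phi₂_sign ξ).2.2.1 hξ.1 hξ.2)
  have k4 := key (a := √3) (b := R) hR (Or.inl fun ξ hξ => (phi₂_sign ξ).2.2.2 hξ.1)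
  calc _ ≤ Real.pi / κ + (Real.pi / κ + (Real.pi / κ + Real.pi / κ)) := by gcongr
    _ = _ := by ring

theorem integral_norm_mul_phase₂_le {A : ℝ → ℂ} (hA : IsSymbol A) {x t κ M : ℝ} (hκ : 0 < κ)
    (hM : ∀ ξ, ‖A ξ‖ ≤ M) :
    ∫ ξ, ‖A ξ‖ * (|-(t * phi₂ ξ)| / (κ ^ 2 + phase₁ x t ξ ^ 2)) ≤ M * (4 * Real.pi / κ) := by
  have hM0 : 0 ≤ M := (norm_nonneg _).trans (hM 0)
  have hcont : Continuous (phase₁ x t) :=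
    continuous_iff_continuousAt.2 fun ξ => (hasDerivAt_phase₁ x t ξ).continuousAt
  have hc2 : Continuous fun ξ => -(t * phi₂ ξ) := (continuous_const.mul continuous_phi₂).neg
  have hpos : ∀ ξ, 0 < κ ^ 2 + phase₁ x t ξ ^ 2 := fun ξ => by positivity
  have hAc := hA.smooth.continuous
  have hG : Continuous fun ξ => |-(t * phi₂ ξ)| / (κ ^ 2 + phase₁ x t ξ ^ 2) :=
    hc2.abs.div (by fun_prop) fun ξ => (hpos ξ).ne'
  obtain ⟨R₀, hR₀⟩ := hA.compact.isCompact.isBounded.subset_closedBall 0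
  set R := max R₀ (√3) + 1 with hRdef
  have hsupp : Function.support (fun ξ => ‖A ξ‖ * (|-(t * phi₂ ξ)| / (κ ^ 2 + phase₁ x t ξ ^ 2))) ⊆
      Set.Ioc (-R) R := by
    intro ξ hξ
    have h1 : A ξ ≠ 0 := by
      intro h0
      simp [h0] at hξ
    have h2 := hR₀ (subset_tsupport _ h1)
    rw [Metric.mem_closedBall, Real.dist_eq, sub_zero] at h2
    have h3 := le_max_left R₀ (√3)
    have h4 := abs_le.1 h2
    constructor <;> linarith
  rw [← intervalIntegral.integral_eq_integral_of_support_subset hsupp]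
  have hRR : -R ≤ R := by
    have := le_max_right R₀ (√3)
    have := Real.sqrt_nonneg 3
    linarith
  calc ∫ ξ in -R..R, ‖A ξ‖ * (|-(t * phi₂ ξ)| / (κ ^ 2 + phase₁ x t ξ ^ 2))
      ≤ ∫ ξ in -R..R, M * (|-(t * phi₂ ξ)| / (κ ^ 2 + phase₁ x t ξ ^ 2)) := by
        refine intervalIntegral.integral_mono_on hRR ?_ ?_ fun ξ _ => ?_
        · exact (hAc.norm.mul hG).intervalIntegrable _ _
        · exact (continuous_const.mul hG).intervalIntegrable _ _
        · have := hpos ξ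
          gcongr
          exact hM ξ
    _ ≤ _ := by
        rw [intervalIntegral.integral_const_mul]
        gcongr
        refine integral_phase₂_div_le hκ ?_
        have := le_max_right R₀ (√3)
        linarith

/-- With h the derivative of the phase and u' = ihu, integrate by parts against g = -ih/(κ²+h²), a
regularisation of 1/(ih) which needs no excision of stationary points. The identity 1 = κ²/(κ²+h²) +
ihg leaves the first term as remainder, while |g| ≤ 1/κ and |g'| ≤ |h'|/(κ²+h²) control the rest
through the arctan integral. -/
theorem norm_integral_osc_le {A : ℝ → ℂ} (hA : IsSymbol A) {x t κ M V : ℝ} (hκ : 0 < κ)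
    (hM : ∀ ξ, ‖A ξ‖ ≤ M) (hV : ∫ ξ, ‖deriv A ξ‖ ≤ V) :
    ‖∫ ξ : ℝ, Complex.exp (ξ * x * Complex.I) * (A ξ * grp t ξ)‖ ≤
      (∫ ξ, ‖A ξ‖ * (κ ^ 2 / (κ ^ 2 + phase₁ x t ξ ^ 2))) + (V / κ + M * (4 * Real.pi / κ)) := by
  set h := phase₁ x t with hh
  have hM0 : 0 ≤ M := (norm_nonneg _).trans (hM 0)
  have hcont : Continuous h :=
    continuous_iff_continuousAt.2 fun ξ => (hasDerivAt_phase₁ x t ξ).continuousAt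
  have hc2 : Continuous fun ξ => -(t * phi₂ ξ) := (continuous_const.mul continuous_phi₂).neg
  have hpos : ∀ ξ, 0 < κ ^ 2 + h ξ ^ 2 := fun ξ => by positivity
  set u : ℝ → ℂ := fun ξ => Complex.exp (ξ * x * Complex.I) * grp t ξ with hu
  have hunorm : ∀ ξ, ‖u ξ‖ = 1 := fun ξ => by
    rw [hu]
    simp only
    rw [norm_mul, norm_grp, mul_one]
    have := Complex.norm_exp_ofReal_mul_I (ξ * x)
    push_cast at this
    exact this
  have hud : ∀ ξ, HasDerivAt u (Complex.I * h ξ * u ξ) ξ := by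
    intro ξ
    have h1 : HasDerivAt (fun ξ : ℝ => (ξ : ℂ) * x * Complex.I) (1 * x * Complex.I) ξ :=
      ((Complex.ofRealCLM.hasDerivAt (x := ξ)).mul_const _).mul_const _
    refine HasDerivAt.congr_deriv (h1.cexp.fun_mul (hasDerivAt_grp t ξ)) ?_
    rw [hu, hh, phase₁]
    push_cast
    ring
  have huc : Continuous u := continuous_iff_continuousAt.2 fun ξ => (hud ξ).continuousAt
  set g : ℝ → ℂ := fun ξ => -Complex.I * ((h ξ / (κ ^ 2 + h ξ ^ 2) : ℝ) : ℂ) with hg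
  set g' : ℝ → ℂ := fun ξ => -Complex.I *
    ((-(t * phi₂ ξ) * (κ ^ 2 - h ξ ^ 2) / (κ ^ 2 + h ξ ^ 2) ^ 2 : ℝ) : ℂ) with hg'
  have hgd : ∀ ξ, HasDerivAt g (g' ξ) ξ := by
    intro ξ
    have e1 := hasDerivAt_phase₁ x t ξ
    have e2 : HasDerivAt (fun ξ => κ ^ 2 + h ξ ^ 2) (2 * h ξ * -(t * phi₂ ξ)) ξ := by
      simpa using (e1.fun_pow 2).const_add (κ ^ 2)
    have e3 := (e1.fun_div e2 (hpos ξ).ne').ofReal_comp.const_mul (-Complex.I)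
    refine HasDerivAt.congr_deriv e3 ?_
    rw [hg']
    simp only
    congr 3
    rw [← hh]
    ring
  have hgc : Continuous g := continuous_iff_continuousAt.2 fun ξ => (hgd ξ).continuousAt
  have hgc' : Continuous g' := by
    refine continuous_const.mul (Complex.continuous_ofReal.comp ?_)
    exact (hc2.mul (by fun_prop)).div (by fun_prop) fun ξ => by have := hpos ξ; positivity
  have hAd : ∀ ξ, HasDerivAt A (deriv A ξ) ξ := fun ξ =>
    (hA.smooth.differentiable (by simp) ξ).hasDerivAt
  have hAc := hA.smooth.continuous
  have hAc' := hA.deriv.smooth.continuous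
  have hvd : ∀ ξ, HasDerivAt (fun ξ => A ξ * g ξ) (deriv A ξ * g ξ + A ξ * g' ξ) ξ := fun ξ =>
    (hAd ξ).fun_mul (hgd ξ)
  have cA : ∀ {w : ℝ → ℂ}, Continuous w → Integrable fun ξ => A ξ * w ξ := fun hw =>
    (hAc.mul hw).integrable_of_hasCompactSupport hA.compact.mul_right
  have cA' : ∀ {w : ℝ → ℂ}, Continuous w → Integrable fun ξ => deriv A ξ * w ξ := fun hw =>
    (hAc'.mul hw).integrable_of_hasCompactSupport hA.deriv.compact.mul_right
  have hibp : ∫ ξ, (Complex.I * h ξ * u ξ) * (A ξ * g ξ) =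
      -∫ ξ, u ξ * (deriv A ξ * g ξ + A ξ * g' ξ) := by
    have := integral_mul_deriv_eq_deriv_mul_of_integrable (fun ξ _ => hud ξ) (fun ξ _ => hvd ξ)
      ?_ ?_ ?_
    · rw [this, neg_neg]
    · refine ((cA' (huc.mul hgc)).add (cA (huc.mul hgc'))).congr (Eventually.of_forall fun ξ => ?_)
      simp only [Pi.mul_apply, Pi.add_apply]
      ring
    · refine (cA (w := fun ξ => Complex.I * h ξ * u ξ * g ξ) (by fun_prop)).congr
        (Eventually.of_forall fun ξ => ?_)
      simp only [Pi.mul_apply]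
      ring
    · refine (cA (huc.mul hgc)).congr (Eventually.of_forall fun ξ => ?_)
      simp only [Pi.mul_apply]
      ring
  set q : ℝ → ℝ := fun ξ => κ ^ 2 / (κ ^ 2 + h ξ ^ 2) with hq
  have hqc : Continuous q := continuous_const.div (by fun_prop) fun ξ => (hpos ξ).ne'
  have hsplit : ∫ ξ : ℝ, Complex.exp (ξ * x * Complex.I) * (A ξ * grp t ξ) =
      (∫ ξ, A ξ * (q ξ * u ξ)) - ∫ ξ, u ξ * (deriv A ξ * g ξ + A ξ * g' ξ) := by
    rw [sub_eq_add_neg, ← hibp, ← integral_add (cA (by fun_prop))]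
    · refine integral_congr_ae (Eventually.of_forall fun ξ => ?_)
      simp only
      have e : (q ξ : ℂ) + Complex.I * h ξ * g ξ = 1 := by
        rw [hq, hg]
        simp only
        rw [show Complex.I * (h ξ : ℂ) * (-Complex.I * ((h ξ / (κ ^ 2 + h ξ ^ 2) : ℝ) : ℂ)) =
          ((h ξ * (h ξ / (κ ^ 2 + h ξ ^ 2)) : ℝ) : ℂ) by
            push_cast
            linear_combination (-(h ξ : ℂ) * (h ξ / (κ ^ 2 + h ξ ^ 2))) * Complex.I_mul_I,
          ← Complex.ofReal_add, ← Complex.ofReal_one]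
        congr 1
        have := hpos ξ
        field_simp
      have e2 : Complex.exp (ξ * x * Complex.I) * (A ξ * grp t ξ) = A ξ * u ξ := by
        rw [hu]
        ring
      rw [e2]
      linear_combination (-(A ξ * u ξ)) * e
    · refine (cA (w := fun ξ => Complex.I * h ξ * u ξ * g ξ) (by fun_prop)).congr
        (Eventually.of_forall fun ξ => ?_)
      simp only
      ring
  have hgn : ∀ ξ, ‖g ξ‖ ≤ 1 / κ := by
    intro ξ
    rw [hg]
    simp only
    rw [norm_mul, norm_neg, Complex.norm_I, one_mul, Complex.norm_real, Real.norm_eq_abs, abs_div,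
      abs_of_pos (hpos ξ), div_le_div_iff₀ (hpos ξ) hκ]
    nlinarith [sq_nonneg (|h ξ| - κ), sq_abs (h ξ), abs_nonneg (h ξ)]
  have hgn' : ∀ ξ, ‖g' ξ‖ ≤ |-(t * phi₂ ξ)| / (κ ^ 2 + h ξ ^ 2) := by
    intro ξ
    rw [hg']
    simp only
    rw [norm_mul, norm_neg, Complex.norm_I, one_mul, Complex.norm_real, Real.norm_eq_abs, abs_div,
      abs_mul, abs_of_pos (pow_pos (hpos ξ) 2), div_le_div_iff₀ (pow_pos (hpos ξ) 2) (hpos ξ)]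
    have e : |κ ^ 2 - h ξ ^ 2| ≤ κ ^ 2 + h ξ ^ 2 := by
      rw [abs_le]
      constructor <;> nlinarith [sq_nonneg κ, sq_nonneg (h ξ)]
    have e2 := hpos ξ
    calc |-(t * phi₂ ξ)| * |κ ^ 2 - h ξ ^ 2| * (κ ^ 2 + h ξ ^ 2)
        ≤ |-(t * phi₂ ξ)| * (κ ^ 2 + h ξ ^ 2) * (κ ^ 2 + h ξ ^ 2) := by gcongr
      _ = _ := by ring
  rw [hsplit]
  refine (norm_sub_le _ _).trans (add_le_add ?_ ?_)
  · refine (norm_integral_le_integral_norm _).trans (le_of_eq ?_)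
    refine integral_congr_ae (Eventually.of_forall fun ξ => ?_)
    simp only
    rw [norm_mul, norm_mul, hunorm, mul_one, Complex.norm_real, Real.norm_of_nonneg]
    have := hpos ξ
    positivity
  · have hG : Continuous fun ξ => |-(t * phi₂ ξ)| / (κ ^ 2 + h ξ ^ 2) :=
      hc2.abs.div (by fun_prop) fun ξ => (hpos ξ).ne'
    have i1 : Integrable fun ξ => ‖deriv A ξ‖ * (1 / κ) := hA.deriv.integrable.norm.mul_const _
    have i2 : Integrable fun ξ => ‖A ξ‖ * (|-(t * phi₂ ξ)| / (κ ^ 2 + h ξ ^ 2)) :=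
      (hAc.norm.mul hG).integrable_of_hasCompactSupport hA.compact.norm.mul_right
    have hle : ‖∫ ξ, u ξ * (deriv A ξ * g ξ + A ξ * g' ξ)‖ ≤
        ∫ ξ, (‖deriv A ξ‖ * (1 / κ) + ‖A ξ‖ * (|-(t * phi₂ ξ)| / (κ ^ 2 + h ξ ^ 2))) := by
      refine norm_integral_le_of_norm_le (i1.add i2) (Eventually.of_forall fun ξ => ?_)
      rw [norm_mul, hunorm, one_mul]
      refine (norm_add_le _ _).trans ?_
      rw [norm_mul (deriv A ξ), norm_mul (A ξ)]
      exact add_le_add (mul_le_mul_of_nonneg_left (hgn ξ) (norm_nonneg _))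
        (mul_le_mul_of_nonneg_left (hgn' ξ) (norm_nonneg _))
    refine hle.trans ?_
    rw [integral_add i1 i2, integral_mul_const, mul_one_div]
    gcongr
    exact integral_norm_mul_phase₂_le hA hκ hM

/-- The second derivative test, with an exceptional set. -/
theorem norm_kernel_grp_le {A : ℝ → ℂ} (hA : IsSymbol A) {x t μ M V w : ℝ} (hμ : 0 < μ)
    (hM : ∀ ξ, ‖A ξ‖ ≤ M) (hV : ∫ ξ, ‖deriv A ξ‖ ≤ V) {N : Set ℝ} (hN : MeasurableSet N)
    (hw : 0 ≤ w) (hNw : volume N ≤ ENNReal.ofReal w)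
    (hμN : ∀ ξ, ξ ∉ N → A ξ ≠ 0 → μ ≤ |t * phi₂ ξ|) :
    ‖kernel (fun ξ => A ξ * grp t ξ) x‖ ≤ M * w + (V + 8 * Real.pi * M) / √μ := by
  have hκ : 0 < √μ := Real.sqrt_pos.2 hμ
  have hκ2 : √μ ^ 2 = μ := Real.sq_sqrt hμ.le
  have hM0 : 0 ≤ M := (norm_nonneg _).trans (hM 0)
  have hcont : Continuous (phase₁ x t) :=
    continuous_iff_continuousAt.2 fun ξ => (hasDerivAt_phase₁ x t ξ).continuousAt
  have hc2 : Continuous fun ξ => -(t * phi₂ ξ) := (continuous_const.mul continuous_phi₂).neg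
  have hpos : ∀ ξ, 0 < √μ ^ 2 + phase₁ x t ξ ^ 2 := fun ξ => by positivity
  have hAc := hA.smooth.continuous
  have hG : Continuous fun ξ => |-(t * phi₂ ξ)| / (√μ ^ 2 + phase₁ x t ξ ^ 2) :=
    hc2.abs.div (by fun_prop) fun ξ => (hpos ξ).ne'
  have hNfin : volume N < ∞ := hNw.trans_lt ENNReal.ofReal_lt_top
  have i1 : Integrable (N.indicator fun _ => M) :=
    (integrable_indicator_iff hN).2 (integrableOn_const hNfin.ne)
  have i2 : Integrable fun ξ => ‖A ξ‖ * (|-(t * phi₂ ξ)| / (√μ ^ 2 + phase₁ x t ξ ^ 2)) :=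
    (hAc.norm.mul hG).integrable_of_hasCompactSupport hA.compact.norm.mul_right
  have i3 : Integrable fun ξ => ‖A ξ‖ * (√μ ^ 2 / (√μ ^ 2 + phase₁ x t ξ ^ 2)) := by
    refine (hAc.norm.mul (continuous_const.div (by fun_prop) fun ξ => (hpos ξ).ne')
      ).integrable_of_hasCompactSupport hA.compact.norm.mul_right
  -- With κ² = μ ≤ |h'| off N, the remainder is again dominated by the arctan integral; on N its
  -- integrand is at most M.
  have hJ : ∫ ξ, ‖A ξ‖ * (√μ ^ 2 / (√μ ^ 2 + phase₁ x t ξ ^ 2)) ≤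
      M * w + M * (4 * Real.pi / √μ) := by
    calc _ ≤ ∫ ξ, (N.indicator (fun _ => M) ξ +
          ‖A ξ‖ * (|-(t * phi₂ ξ)| / (√μ ^ 2 + phase₁ x t ξ ^ 2))) := by
          refine integral_mono i3 (i1.add i2) fun ξ => ?_
          simp only
          have h0 := hpos ξ
          by_cases hξ : ξ ∈ N
          · rw [Set.indicator_of_mem hξ]
            have h1 : √μ ^ 2 / (√μ ^ 2 + phase₁ x t ξ ^ 2) ≤ 1 := by
              rw [div_le_one h0]
              nlinarith [sq_nonneg (phase₁ x t ξ)]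
            have h2 : ‖A ξ‖ * (√μ ^ 2 / (√μ ^ 2 + phase₁ x t ξ ^ 2)) ≤ M * 1 :=
              mul_le_mul (hM ξ) h1 (by positivity) hM0
            have h3 : 0 ≤ ‖A ξ‖ * (|-(t * phi₂ ξ)| / (√μ ^ 2 + phase₁ x t ξ ^ 2)) := by positivity
            linarith
          · rw [Set.indicator_of_notMem hξ, zero_add]
            rcases eq_or_ne (A ξ) 0 with hA0 | hA0
            · simp [hA0]
            · have := hμN ξ hξ hA0
              gcongr
              rw [hκ2, abs_neg]
              exact this
      _ = (∫ ξ, N.indicator (fun _ => M) ξ) +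
          ∫ ξ, ‖A ξ‖ * (|-(t * phi₂ ξ)| / (√μ ^ 2 + phase₁ x t ξ ^ 2)) := integral_add i1 i2
      _ ≤ _ := by
          gcongr
          · rw [integral_indicator hN, setIntegral_const, smul_eq_mul, mul_comm]
            gcongr
            rw [Measure.real]
            exact ENNReal.toReal_le_of_le_ofReal hw hNw
          · exact integral_norm_mul_phase₂_le hA hκ hM
  have h1 := norm_integral_osc_le (x := x) (t := t) hA hκ hM hV
  rw [kernel_eq_integral, norm_mul, Complex.norm_real, Real.norm_of_nonneg (by positivity)]
  have h2 : 1 / (2 * Real.pi) ≤ 1 := by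
    rw [div_le_one (by positivity)]
    linarith [Real.pi_gt_three]
  calc 1 / (2 * Real.pi) * ‖∫ ξ : ℝ, Complex.exp (ξ * x * Complex.I) * (A ξ * grp t ξ)‖
      ≤ 1 * ‖∫ ξ : ℝ, Complex.exp (ξ * x * Complex.I) * (A ξ * grp t ξ)‖ := by gcongr
    _ ≤ M * w + M * (4 * Real.pi / √μ) + (V / √μ + M * (4 * Real.pi / √μ)) := by
        rw [one_mul]
        linarith
    _ = _ := by ring

/-! ### Decay of the blocks -/

/-- |φ''| equals 2|ξ||ξ²-3|/(1+ξ²)³, with simple zeros at 0, ±√3 and decay |ξ|^{-3}. The ranges |ξ|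
≤ √3/2, √3/2 ≤ |ξ| ≤ 3 and |ξ| ≥ 3 meet at most one zero of the product each. -/
theorem phi₂_lower {δ ξ : ℝ} (hδ : δ ≤ 1) (h0 : δ ≤ |ξ|) (h1 : δ ≤ |ξ - √3|)
    (h2 : δ ≤ |ξ + √3|) : δ / (10 * (1 + |ξ|) ^ 3) ≤ |phi₂ ξ| := by
  have h3 : √3 ^ 2 = 3 := Real.sq_sqrt (by norm_num)
  have ha : (1.7 : ℝ) ≤ √3 := Real.le_sqrt_of_sq_le (by norm_num)
  have hb : √3 ≤ 1.8 := Real.sqrt_le_iff.2 ⟨by norm_num, by norm_num⟩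
  set y := |ξ| with hy
  have hy0 : 0 ≤ y := abs_nonneg ξ
  have h4 : δ ≤ |y - √3| := by
    rcases le_total 0 ξ with h | h
    · rwa [hy, abs_of_nonneg h]
    · rw [hy, abs_of_nonpos h, ← neg_add', abs_neg]
      exact h2
  have hy2 : ξ ^ 2 = y ^ 2 := (sq_abs ξ).symm
  have hprod : δ * (1 + y) ^ 2 / 20 ≤ y * |y - √3| := by
    rcases le_total y (√3 / 2) with hc | hc
    · rw [abs_of_nonpos (by linarith)] at h4 ⊢
      have e1 : (1 + y) ^ 2 ≤ 4 := by nlinarith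
      have e2 : (0.8 : ℝ) ≤ -(y - √3) := by linarith
      rcases le_total δ 0 with hd | hd
      · have : δ * (1 + y) ^ 2 ≤ 0 := mul_nonpos_of_nonpos_of_nonneg hd (by positivity)
        have : 0 ≤ y * -(y - √3) := mul_nonneg hy0 (by linarith)
        linarith
      · calc δ * (1 + y) ^ 2 / 20 ≤ δ * 4 / 20 := by gcongr
          _ ≤ δ * 0.8 := by linarith
          _ ≤ y * -(y - √3) := by gcongr
    · rcases le_total y 3 with hc' | hc'
      · have e1 : (1 + y) ^ 2 ≤ 16 := by nlinarith
        have e2 : (0.8 : ℝ) ≤ y := by linarith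
        have e3 := abs_nonneg (y - √3)
        rcases le_total δ 0 with hd | hd
        · have : δ * (1 + y) ^ 2 ≤ 0 := mul_nonpos_of_nonpos_of_nonneg hd (by positivity)
          have : 0 ≤ y * |y - √3| := by positivity
          linarith
        · calc δ * (1 + y) ^ 2 / 20 ≤ δ * 16 / 20 := by gcongr
            _ = 0.8 * δ := by ring
            _ ≤ y * |y - √3| := by gcongr
      · rw [abs_of_nonneg (by linarith)]
        nlinarith [mul_nonneg (sub_nonneg.2 hδ) (sq_nonneg (1 + y))]
  have hsq : |ξ ^ 2 - 3| = |y - √3| * (y + √3) := by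
    rw [hy2, ← abs_of_nonneg (by linarith : 0 ≤ y + √3), ← abs_mul]
    congr 1
    nlinarith
  have hphi : |phi₂ ξ| = 2 * (y * |y - √3| * (y + √3)) / (1 + y ^ 2) ^ 3 := by
    unfold phi₂
    rw [abs_div, abs_mul, abs_mul, abs_two, hsq, hy2,
      abs_of_pos (by positivity : (0 : ℝ) < (1 + y ^ 2) ^ 3), ← hy]
    ring
  rw [hphi, div_le_div_iff₀ (by positivity) (by positivity)]
  have e5 : 0 ≤ y * |y - √3| := by positivity
  have e6 : 1 + y ≤ y + √3 := by linarith
  have e7 : 1 + y ^ 2 ≤ (1 + y) ^ 2 := by nlinarith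
  rcases le_total δ 0 with hd | hd
  · have k1 : δ * (1 + y ^ 2) ^ 3 ≤ 0 := mul_nonpos_of_nonpos_of_nonneg hd (by positivity)
    have k2 : 0 ≤ 2 * (y * |y - √3| * (y + √3)) * (10 * (1 + y) ^ 3) := by positivity
    linarith
  · calc δ * (1 + y ^ 2) ^ 3 ≤ δ * ((1 + y) ^ 2) ^ 3 := by gcongr
      _ = 2 * (δ * (1 + y) ^ 2 / 20 * (1 + y)) * (10 * (1 + y) ^ 3) := by ring
      _ ≤ _ := by gcongr

theorem abs_phi_le_div (ξ : ℝ) : |phi ξ| ≤ 2 / (1 + |ξ|) := by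
  unfold phi
  rw [abs_div, abs_of_pos (by positivity : (0 : ℝ) < 1 + ξ ^ 2),
    div_le_div_iff₀ (by positivity) (by positivity)]
  nlinarith [sq_nonneg (|ξ| - 1), sq_abs ξ, abs_nonneg ξ]

theorem abs_phi₁_le_div (ξ : ℝ) : |phi₁ ξ| ≤ 2 / (1 + |ξ|) := by
  unfold phi₁
  have h1 : |1 - ξ ^ 2| ≤ 1 + ξ ^ 2 := by
    rw [abs_le]
    constructor <;> nlinarith [sq_nonneg ξ]
  rw [abs_div, abs_of_pos (by positivity : (0 : ℝ) < (1 + ξ ^ 2) ^ 2),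
    div_le_div_iff₀ (by positivity) (by positivity)]
  have h2 : 1 + |ξ| ≤ 2 * (1 + ξ ^ 2) := by nlinarith [sq_nonneg (|ξ| - 1), sq_abs ξ]
  calc |1 - ξ ^ 2| * (1 + |ξ|) ≤ (1 + ξ ^ 2) * (2 * (1 + ξ ^ 2)) := by gcongr
    _ = _ := by ring

theorem div_one_add_le {ξ : ℝ} {k : ℤ} (h : |ξ - k| ≤ 2) : 2 / (1 + |ξ|) ≤ 6 / (1 + |(k : ℝ)|) := by
  rw [div_le_div_iff₀ (by positivity) (by positivity)]
  have := abs_sub_abs_le_abs_sub (k : ℝ) ξ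
  rw [abs_sub_comm] at this
  have := abs_nonneg ξ
  linarith

section Amplitude

variable {ρ : ℝ → ℝ} (hρ : IsBump ρ)

include hρ

theorem fat_eq_zero {k : ℤ} {ξ : ℝ} (h : 2 ≤ |ξ - k|) : fat ρ k ξ = 0 := by
  refine Finset.sum_eq_zero fun l hl => sig_eq_zero hρ ?_
  rw [Finset.mem_Icc] at hl
  have h1 : |(l : ℝ) - k| ≤ 1 := by
    rw [abs_le]
    have a : ((k - 1 : ℤ) : ℝ) ≤ l := Int.cast_le.2 hl.1
    have b : (l : ℝ) ≤ ((k + 1 : ℤ) : ℝ) := Int.cast_le.2 hl.2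
    push_cast at a b
    constructor <;> linarith
  have := abs_sub_le ξ l k
  linarith

/-- The amplitude of the `k`-th block of `φ(D)`. -/
theorem exists_amplitude_bound : ∃ C : ℝ, 0 < C ∧ ∀ k : ℤ,
    IsSymbol (fun ξ => fat ρ k ξ * (phi ξ : ℂ)) ∧
    (∀ ξ, ‖fat ρ k ξ * (phi ξ : ℂ)‖ ≤ C / (1 + |(k : ℝ)|)) ∧
    (∀ ξ, ‖deriv (fun ξ => fat ρ k ξ * (phi ξ : ℂ)) ξ‖ ≤ C / (1 + |(k : ℝ)|)) ∧
    ∀ ξ : ℝ, 2 ≤ |ξ - k| → deriv (fun ξ => fat ρ k ξ * (phi ξ : ℂ)) ξ = 0 := by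
  obtain ⟨D, hD, hfat⟩ := (isSymbol_fat hρ 0).exists_bdd2
  have hb : ∀ k, Bdd2 (fat ρ k) D := fun k => by
    have : fat ρ k = fun ξ => fat ρ 0 (ξ - k) := funext fun ξ => fat_eq_shift ρ k ξ
    rw [this]
    exact hfat.shift k
  refine ⟨12 * D, by positivity, fun k => ?_⟩
  have hs : IsSymbol (fun ξ => fat ρ k ξ * (phi ξ : ℂ)) :=
    (isSymbol_fat hρ k).mul (Complex.ofRealCLM.contDiff.comp contDiff_phi)
  have hd : ∀ ξ, HasDerivAt (fun ξ => fat ρ k ξ * (phi ξ : ℂ))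
      (deriv (fat ρ k) ξ * phi ξ + fat ρ k ξ * phi₁ ξ) ξ := fun ξ =>
    (((isSymbol_fat hρ k).smooth.differentiable (by simp) ξ).hasDerivAt).fun_mul
      (hasDerivAt_phi ξ).ofReal_comp
  have hdz : ∀ ξ : ℝ, 2 < |ξ - k| → deriv (fat ρ k) ξ = 0 := fun ξ hξ =>
    deriv_eq_zero_of_support (c := k) (R := 2) (fun η hη => fat_eq_zero hρ hη) ξ hξ
  have hzero : ∀ ξ : ℝ, 2 ≤ |ξ - k| → deriv (fun ξ => fat ρ k ξ * (phi ξ : ℂ)) ξ = 0 := by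
    intro ξ hξ
    have hcl : IsClosed {ξ : ℝ | deriv (fun ξ => fat ρ k ξ * (phi ξ : ℂ)) ξ = 0} :=
      isClosed_eq hs.deriv.smooth.continuous continuous_const
    have hsub : {ξ : ℝ | 2 < |ξ - k|} ⊆ {ξ : ℝ | deriv (fun ξ => fat ρ k ξ * (phi ξ : ℂ)) ξ = 0} := by
      intro η hη
      rw [Set.mem_ofPred_eq] at hη ⊢
      rw [(hd η).deriv, hdz η hη, fat_eq_zero hρ hη.le, zero_mul, zero_mul, add_zero]
    rcases hξ.lt_or_eq with h | h
    · exact hsub h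
    · have hmem : ξ ∈ closure {ξ : ℝ | 2 < |ξ - k|} := by
        rw [Metric.mem_closure_iff]
        intro ε hε
        rcases le_total 0 (ξ - k) with h0 | h0
        · refine ⟨ξ + ε / 2, ?_, ?_⟩
          · rw [Set.mem_ofPred_eq]
            rw [abs_of_nonneg h0] at h
            rw [abs_of_nonneg (by linarith)]
            linarith
          · rw [Real.dist_eq, show ξ - (ξ + ε / 2) = -(ε / 2) by ring, abs_neg, abs_of_pos (by linarith)]
            linarith
        · refine ⟨ξ - ε / 2, ?_, ?_⟩
          · rw [Set.mem_ofPred_eq]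
            rw [abs_of_nonpos h0] at h
            rw [abs_of_nonpos (by linarith)]
            linarith
          · rw [Real.dist_eq, show ξ - (ξ - ε / 2) = ε / 2 by ring, abs_of_pos (by linarith)]
            linarith
      exact closure_minimal hsub hcl hmem
  refine ⟨hs, fun ξ => ?_, fun ξ => ?_, hzero⟩
  · rcases lt_or_ge |ξ - k| 2 with h | h
    · rw [norm_mul, Complex.norm_real, Real.norm_eq_abs]
      calc ‖fat ρ k ξ‖ * |phi ξ| ≤ D * (6 / (1 + |(k : ℝ)|)) := by
            gcongr
            · exact (hb k).zero ξ
            · exact (abs_phi_le_div ξ).trans (div_one_add_le h.le)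
        _ ≤ 12 * D / (1 + |(k : ℝ)|) := by
            rw [mul_div_assoc']
            exact div_le_div_of_nonneg_right (by linarith) (by positivity)
    · rw [fat_eq_zero hρ h, zero_mul, norm_zero]
      positivity
  · rcases lt_or_ge |ξ - k| 2 with h | h
    · rw [(hd ξ).deriv]
      refine (norm_add_le _ _).trans ?_
      rw [norm_mul, norm_mul, Complex.norm_real, Complex.norm_real, Real.norm_eq_abs,
        Real.norm_eq_abs]
      calc _ ≤ D * (6 / (1 + |(k : ℝ)|)) + D * (6 / (1 + |(k : ℝ)|)) := by
            gcongr
            · exact (hb k).one ξ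
            · exact (abs_phi_le_div ξ).trans (div_one_add_le h.le)
            · exact (hb k).zero ξ
            · exact (abs_phi₁_le_div ξ).trans (div_one_add_le h.le)
        _ = _ := by ring
    · rw [hzero ξ h, norm_zero]
      positivity

end Amplitude

/-- An amplitude supported near `k` and, up to an exceptional set, away from the degenerate
frequencies. -/
theorem norm_kernel_grp_le_of_dist {A : ℝ → ℂ} (hA : IsSymbol A) {k : ℤ} {x t δ M V w : ℝ}
    (ht : t ≠ 0) (hδ : 0 < δ) (hδ1 : δ ≤ 1) (hsupp : ∀ ξ : ℝ, 2 ≤ |ξ - k| → A ξ = 0)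
    (hM : ∀ ξ, ‖A ξ‖ ≤ M) (hV : ∫ ξ, ‖deriv A ξ‖ ≤ V) {N : Set ℝ} (hN : MeasurableSet N)
    (hw : 0 ≤ w) (hNw : volume N ≤ ENNReal.ofReal w)
    (hμN : ∀ ξ, ξ ∉ N → A ξ ≠ 0 → δ ≤ |ξ| ∧ δ ≤ |ξ - √3| ∧ δ ≤ |ξ + √3|) :
    ‖kernel (fun ξ => A ξ * grp t ξ) x‖ ≤
      M * w + (V + 8 * Real.pi * M) * √(270 * (1 + |(k : ℝ)|) ^ 3 / (|t| * δ)) := by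
  have ht0 : 0 < |t| := abs_pos.2 ht
  have hμ : 0 < |t| * (δ / (270 * (1 + |(k : ℝ)|) ^ 3)) := by positivity
  have h := norm_kernel_grp_le (x := x) (t := t) hA hμ hM hV hN hw hNw fun ξ hξ hAξ => ?_
  · refine h.trans (le_of_eq ?_)
    rw [div_eq_mul_inv _ (√_), ← Real.sqrt_inv, mul_div_assoc', inv_div]
  · obtain ⟨h0, h1, h2⟩ := hμN ξ hξ hAξ
    have h3 := phi₂_lower hδ1 h0 h1 h2
    have h4 : |ξ - k| < 2 := by
      by_contra hc
      exact hAξ (hsupp ξ (not_lt.1 hc))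
    -- The support has |ξ-k| < 2; the cube of this factor 3 turns the 10 of `phi₂_lower` into 270.
    have h5 : 1 + |ξ| ≤ 3 * (1 + |(k : ℝ)|) := by
      have := abs_sub_abs_le_abs_sub ξ (k : ℝ)
      have := abs_nonneg (k : ℝ)
      linarith
    rw [abs_mul]
    refine mul_le_mul_of_nonneg_left (le_trans ?_ h3) (abs_nonneg t)
    refine div_le_div_of_nonneg_left hδ.le (by positivity) ?_
    calc 10 * (1 + |ξ|) ^ 3 ≤ 10 * (3 * (1 + |(k : ℝ)|)) ^ 3 := by gcongr
      _ = _ := by ring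

/-- The `δ`-neighbourhood of the degenerate frequencies. -/
def degenerate (δ : ℝ) : Set ℝ := Metric.ball 0 δ ∪ Metric.ball (√3) δ ∪ Metric.ball (-√3) δ

theorem measurableSet_degenerate (δ : ℝ) : MeasurableSet (degenerate δ) :=
  (measurableSet_ball.union measurableSet_ball).union measurableSet_ball

theorem volume_degenerate_le {δ : ℝ} (hδ : 0 ≤ δ) : volume (degenerate δ) ≤ ENNReal.ofReal (6 * δ) := by
  refine (measure_union_le _ _).trans ((add_le_add_left (measure_union_le _ _) _).trans ?_)
  rw [Real.volume_ball, Real.volume_ball, Real.volume_ball,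
    ← ENNReal.ofReal_add (by positivity) (by positivity),
    ← ENNReal.ofReal_add (by positivity) (by positivity)]
  exact ENNReal.ofReal_le_ofReal (by linarith)

theorem of_notMem_degenerate {δ ξ : ℝ} (h : ξ ∉ degenerate δ) :
    δ ≤ |ξ| ∧ δ ≤ |ξ - √3| ∧ δ ≤ |ξ + √3| := by
  simp only [degenerate, Set.mem_union, Metric.mem_ball, Real.dist_eq, not_or, not_lt, sub_zero,
    sub_neg_eq_add] at h
  exact ⟨h.1.1, h.1.2, h.2⟩

theorem integral_norm_le_of_support {f : ℝ → ℂ} {c B : ℝ} (hB : ∀ ξ, ‖f ξ‖ ≤ B)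
    (hsupp : ∀ ξ, 2 ≤ |ξ - c| → f ξ = 0) : ∫ ξ, ‖f ξ‖ ≤ 4 * B := by
  have h1 : ∫ ξ, ‖f ξ‖ = ∫ ξ in Metric.closedBall c 2, ‖f ξ‖ := by
    refine (setIntegral_eq_integral_of_forall_compl_eq_zero fun ξ hξ => ?_).symm
    rw [Metric.mem_closedBall, Real.dist_eq, not_le] at hξ
    rw [hsupp ξ hξ.le, norm_zero]
  rw [h1]
  refine (Real.le_norm_self _).trans ((norm_setIntegral_le_of_norm_le_const (C := B) ?_ fun ξ _ => ?_).trans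
    (le_of_eq ?_))
  · exact (isCompact_closedBall c 2).measure_lt_top
  · rw [norm_norm]
    exact hB ξ
  · rw [Measure.real, Real.volume_closedBall, ENNReal.toReal_ofReal (by norm_num)]
    ring

/-! ### Decay of the group -/

theorem rpow_neg_le_two_mul {T κ : ℝ} (hT : 1 ≤ T) (hκ : 0 ≤ κ) (hκ1 : κ ≤ 1) :
    T ^ (-κ) ≤ 2 * (1 + T) ^ (-κ) := by
  have h2 : (1 + T) ^ κ ≤ 2 * T ^ κ := by
    calc (1 + T) ^ κ ≤ (2 * T) ^ κ := by
          refine Real.rpow_le_rpow (by linarith) (by linarith) hκ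
      _ = 2 ^ κ * T ^ κ := Real.mul_rpow (by norm_num) (by linarith)
      _ ≤ 2 ^ (1 : ℝ) * T ^ κ := by
          gcongr
          norm_num
      _ = _ := by rw [Real.rpow_one]
  rw [Real.rpow_neg (by linarith), Real.rpow_neg (by linarith), ← div_eq_mul_inv,
    inv_eq_one_div, div_le_div_iff₀ (by positivity) (by positivity)]
  linarith

theorem one_le_two_mul_rpow_neg {T κ : ℝ} (hT0 : 0 ≤ T) (hT : T ≤ 1) (hκ : 0 ≤ κ) (hκ1 : κ ≤ 1) :
    1 ≤ 2 * (1 + T) ^ (-κ) := by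
  have h2 : (1 + T) ^ κ ≤ 2 := by
    calc (1 + T) ^ κ ≤ 2 ^ κ := by
          refine Real.rpow_le_rpow (by linarith) (by linarith) hκ
      _ ≤ 2 ^ (1 : ℝ) := by
          gcongr
          norm_num
      _ = _ := by rw [Real.rpow_one]
  rw [Real.rpow_neg (by linarith), ← div_eq_mul_inv, le_div_iff₀ (by positivity)]
  linarith

theorem four_add_eight_pi_le : 4 + 8 * Real.pi ≤ 36 := by linarith [Real.pi_le_four]

theorem S_phiD_eq (t : ℝ) (f : 𝓢'(ℝ, ℂ)) :
    S t (phiD f) = multiplier (fun ξ => (phi ξ : ℂ) * grp t ξ) f := by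
  rw [S_eq, phiD_eq, multiplier_multiplier (hasTemperateGrowth_grp t) hasTemperateGrowth_phi]
  simp only [mul_comm]

section Decay

variable {ρ : ℝ → ℝ} (hρ : IsBump ρ)

include hρ

theorem exists_norm_kernel_block_le : ∃ C : ℝ, 0 < C ∧ ∀ (k : ℤ) (t x : ℝ),
    ‖kernel (fun ξ => fat ρ k ξ * (phi ξ : ℂ) * grp t ξ) x‖ ≤ C * (1 + |t|) ^ (-(1 / 3) : ℝ) ∧
    (6 ≤ |(k : ℝ)| → t ≠ 0 → ‖kernel (fun ξ => fat ρ k ξ * (phi ξ : ℂ) * grp t ξ) x‖ ≤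
      C * √((1 + |(k : ℝ)|) / |t|)) ∧
    ∀ ξ, ‖fat ρ k ξ * (phi ξ : ℂ) * grp t ξ‖ ≤ C / (1 + |(k : ℝ)|) := by
  obtain ⟨C, hC, h⟩ := exists_amplitude_bound hρ
  refine ⟨1300 * C, by positivity, fun k t x => ?_⟩
  obtain ⟨hs, hM, hd, hdz⟩ := h k
  have hn : 1 ≤ 1 + |(k : ℝ)| := by linarith [abs_nonneg (k : ℝ)]
  set n := 1 + |(k : ℝ)| with hndef
  have hsupp : ∀ ξ : ℝ, 2 ≤ |ξ - k| → fat ρ k ξ * (phi ξ : ℂ) = 0 := fun ξ hξ => by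
    rw [fat_eq_zero hρ hξ, zero_mul]
  have hV := integral_norm_le_of_support hd hdz
  have hM' : ∀ ξ, ‖fat ρ k ξ * (phi ξ : ℂ) * grp t ξ‖ ≤ C / n := fun ξ => by
    rw [norm_mul, norm_grp, mul_one]
    exact hM ξ
  have htriv : ‖kernel (fun ξ => fat ρ k ξ * (phi ξ : ℂ) * grp t ξ) x‖ ≤ 2 * (C / n) :=
    norm_kernel_le_of_support (c := k) (by norm_num) (fun ξ hξ => by rw [hsupp ξ hξ, zero_mul]) hM' x
  have hamp : 4 * (C / n) + 8 * Real.pi * (C / n) ≤ 36 * (C / n) := by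
    rw [← add_mul]
    exact mul_le_mul_of_nonneg_right four_add_eight_pi_le (by positivity)
  have h270 : √270 ≤ 17 := Real.sqrt_le_iff.2 ⟨by norm_num, by norm_num⟩
  refine ⟨?_, fun hk ht => ?_, fun ξ => (hM' ξ).trans ?_⟩
  · rcases le_total |t| 1 with ht | ht
    · have h1 := one_le_two_mul_rpow_neg (abs_nonneg t) ht (κ := 1 / 3) (by norm_num) (by norm_num)
      have h2 : C / n ≤ C := div_le_self hC.le hn
      nlinarith
    · have ht0 : t ≠ 0 := by
        rintro rfl
        norm_num at ht
      have h1 := rpow_neg_le_two_mul ht (κ := 1 / 3) (by norm_num) (by norm_num)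
      have hT : 0 < |t| := by linarith
      have hτ : 0 < |t| ^ (-(1 / 3) : ℝ) := by positivity
      have hτ3 : (|t| ^ (-(1 / 3) : ℝ)) ^ 3 * |t| = 1 := by
        rw [← Real.rpow_natCast, ← Real.rpow_mul hT.le]
        norm_num
        rw [Real.rpow_neg_one]
        exact inv_mul_cancel₀ hT.ne'
      set τ := |t| ^ (-(1 / 3) : ℝ) with hτdef
      refine le_trans ?_ (show 650 * C * τ ≤ _ by nlinarith)
      -- Here δ = nτ with τ = |t|^{-1/3}. If nτ ≥ 1, the trivial bound 2C/n is already at most 2Cτ.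
      rcases le_total (n * τ) 1 with hδ | hδ
      · have h3 := norm_kernel_grp_le_of_dist (x := x) hs ht0 (by positivity : 0 < n * τ) hδ hsupp hM hV
          (measurableSet_degenerate _) (by positivity : 0 ≤ 6 * (n * τ))
          (volume_degenerate_le (by positivity)) fun ξ hξ _ => of_notMem_degenerate hξ
        refine h3.trans ?_
        have e1 : 270 * n ^ 3 / (|t| * (n * τ)) = 270 * (n * τ) ^ 2 := by
          rw [div_eq_iff (by positivity)]
          linear_combination (-270 * n ^ 3) * hτ3
        rw [← hndef, e1, Real.sqrt_mul (by norm_num), Real.sqrt_sq (by positivity)]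
        calc _ ≤ C / n * (6 * (n * τ)) + 36 * (C / n) * (17 * (n * τ)) := by gcongr
          _ = 618 * C * τ := by
            field_simp
            ring
          _ ≤ _ := by nlinarith [mul_pos hC hτ]
      · refine htriv.trans ?_
        rw [mul_div_assoc', div_le_iff₀ (by positivity)]
        nlinarith
  -- For |k| ≥ 6 the amplitude lives on |ξ| > 4, at distance at least 1 from 0 and ±√3, so the
  -- exceptional set is empty.
  · have h3 := norm_kernel_grp_le_of_dist (x := x) (w := 0) hs ht one_pos le_rfl hsupp hM hV
      MeasurableSet.empty le_rfl (by simp) fun ξ _ hξ => ?_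
    · refine h3.trans ?_
      have hT : 0 < |t| := abs_pos.2 ht
      have e1 : 270 * n ^ 3 / (|t| * 1) = 270 * (n ^ 2 * (n / |t|)) := by
        field_simp
      rw [← hndef, e1, Real.sqrt_mul (by norm_num), Real.sqrt_mul (by positivity),
        Real.sqrt_sq (by positivity), mul_zero, zero_add]
      calc _ ≤ 36 * (C / n) * (17 * (n * √(n / |t|))) := by gcongr
        _ = 612 * C * √(n / |t|) := by
          field_simp
          ring
        _ ≤ _ := by gcongr; norm_num
    · have h4 : |ξ - k| < 2 := by
        by_contra hc
        exact hξ (hsupp ξ (not_lt.1 hc))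
      have h5 : 4 ≤ |ξ| := by
        have := abs_sub_abs_le_abs_sub (k : ℝ) ξ
        rw [abs_sub_comm] at this
        linarith
      have hb : √3 ≤ 1.8 := Real.sqrt_le_iff.2 ⟨by norm_num, by norm_num⟩
      have hb0 : 0 ≤ √3 := Real.sqrt_nonneg 3
      refine ⟨by linarith, ?_, ?_⟩
      · have := abs_sub_abs_le_abs_sub ξ (√3)
        rw [abs_of_nonneg hb0] at this
        linarith
      · have := abs_sub_abs_le_abs_sub ξ (-√3)
        rw [abs_neg, abs_of_nonneg hb0, sub_neg_eq_add] at this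
        linarith
  · gcongr
    linarith

theorem box_S_phiD (t : ℝ) (k : ℤ) (f : 𝓢'(ℝ, ℂ)) :
    box ρ k (S t (phiD f)) =
      multiplier (fun ξ => fat ρ k ξ * (phi ξ : ℂ) * grp t ξ) (box ρ k f) := by
  have h : (fun ξ => (phi ξ : ℂ) * grp t ξ).HasTemperateGrowth :=
    hasTemperateGrowth_phi.mul (hasTemperateGrowth_grp t)
  rw [S_phiD_eq, box_multiplier hρ h]
  simp only [mul_assoc]

theorem isSymbol_block (t : ℝ) (k : ℤ) :
    IsSymbol fun ξ => fat ρ k ξ * (phi ξ : ℂ) * grp t ξ :=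
  ((isSymbol_fat hρ k).mul (Complex.ofRealCLM.contDiff.comp contDiff_phi)).mul (contDiff_grp t)

theorem exists_lpNorm_box_decay {p : ℝ} (hp : 2 < p) : ∃ C : ℝ, 0 < C ∧ ∀ (k : ℤ) (t : ℝ)
    (f : 𝓢'(ℝ, ℂ)), lpNorm (ENNReal.ofReal p) (multiplier
      (fun ξ => fat ρ k ξ * (phi ξ : ℂ) * grp t ξ) f) ≤
      ENNReal.ofReal (C * (1 + |t|) ^ (-((1 - 2 / p) / 3))) *
        lpNorm (ENNReal.ofReal (p / (p - 1))) f := by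
  obtain ⟨C₁, hC₁, h₁⟩ := lpNorm_multiplier_le_interp hp
  obtain ⟨C₂, hC₂, h₂⟩ := exists_norm_kernel_block_le hρ
  refine ⟨C₁ * C₂ ^ (1 - 2 / p) * C₂ ^ (2 / p), by positivity, fun k t f => ?_⟩
  refine (h₁ _ (isSymbol_block hρ t k) (C₂ * (1 + |t|) ^ (-(1 / 3) : ℝ)) C₂ (by positivity) hC₂
    (fun x => (h₂ k t x).1) (fun ξ => ((h₂ k t 0).2.2 ξ).trans ?_) f).trans (le_of_eq ?_)
  · exact div_le_self hC₂.le (by linarith [abs_nonneg (k : ℝ)])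
  · congr 2
    rw [Real.mul_rpow hC₂.le (by positivity), ← Real.rpow_mul (by positivity)]
    ring_nf

/-- The decay of `S(t)φ(D)` from `M^s_{p',1}` to `M^s_{p,1}`. -/
theorem exists_modNorm_decay {p : ℝ} (hp : 2 < p) : ∃ C : ℝ, 0 < C ∧ ∀ (s t : ℝ) (f : 𝓢'(ℝ, ℂ)),
    modNorm ρ s (ENNReal.ofReal p) 1 (S t (phiD f)) ≤
      ENNReal.ofReal (C * (1 + |t|) ^ (-((1 - 2 / p) / 3))) *
        modNorm ρ s (ENNReal.ofReal (p / (p - 1))) 1 f := by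
  obtain ⟨C, hC, h⟩ := exists_lpNorm_box_decay hρ hp
  refine ⟨C, hC, fun s t f => ?_⟩
  rw [S_phiD_eq]
  refine modNorm_multiplier_le fun k => ?_
  rw [← S_phiD_eq, box_S_phiD hρ]
  exact h k t _

/-- The better decay of the high-frequency blocks. -/
theorem exists_lpNorm_box_decay_high : ∃ C : ℝ, 0 < C ∧ ∀ (k : ℤ) (t : ℝ), 6 ≤ |(k : ℝ)| →
    ∀ f : 𝓢'(ℝ, ℂ), lpNorm (ENNReal.ofReal 6) (multiplier
      (fun ξ => fat ρ k ξ * (phi ξ : ℂ) * grp t ξ) f) ≤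
      ENNReal.ofReal (C * (1 + |t|) ^ (-(1 / 3) : ℝ)) * lpNorm (ENNReal.ofReal (6 / (6 - 1))) f := by
  obtain ⟨C₀, hC₀, h₀⟩ := exists_lpNorm_box_decay hρ (p := 6) (by norm_num)
  obtain ⟨C₁, hC₁, h₁⟩ := lpNorm_multiplier_le_interp (p := 6) (by norm_num)
  obtain ⟨C₂, hC₂, h₂⟩ := exists_norm_kernel_block_le hρ
  refine ⟨2 * C₀ + 2 * (C₁ * C₂), by positivity, fun k t hk f => ?_⟩
  rcases le_total |t| 1 with ht | ht
  · refine (h₀ k t f).trans ?_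
    refine mul_le_mul_left (ENNReal.ofReal_le_ofReal ?_) _
    have h1 := one_le_two_mul_rpow_neg (abs_nonneg t) ht (κ := 1 / 3) (by norm_num) (by norm_num)
    have h2 : (1 + |t|) ^ (-((1 - 2 / 6) / 3) : ℝ) ≤ 1 :=
      Real.rpow_le_one_of_one_le_of_nonpos (by linarith [abs_nonneg t]) (by norm_num)
    have h3 : 0 < (1 + |t|) ^ (-(1 / 3) : ℝ) := by positivity
    calc C₀ * (1 + |t|) ^ (-((1 - 2 / 6) / 3) : ℝ) ≤ C₀ * (2 * (1 + |t|) ^ (-(1 / 3) : ℝ)) := by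
          gcongr
          linarith
      _ ≤ _ := by nlinarith [mul_pos (mul_pos hC₁ hC₂) h3]
  · have ht0 : t ≠ 0 := by
      rintro rfl
      norm_num at ht
    have hT : 0 < |t| := by linarith
    have hn : 0 < 1 + |(k : ℝ)| := by positivity
    refine (h₁ _ (isSymbol_block hρ t k) (C₂ * √((1 + |(k : ℝ)|) / |t|)) (C₂ / (1 + |(k : ℝ)|))
      (by positivity) (by positivity) (fun x => (h₂ k t x).2.1 hk ht0) (h₂ k t 0).2.2 f).trans ?_
    refine mul_le_mul_left (ENNReal.ofReal_le_ofReal ?_) _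
    set n := 1 + |(k : ℝ)|
    -- For p = 6 the kernel bound enters with power 2/3 and the symbol bound C₂/n with power 1/3, so
    -- the powers of n cancel.
    have e1 : (C₂ * √(n / |t|)) ^ (1 - 2 / 6 : ℝ) * (C₂ / n) ^ (2 / 6 : ℝ) =
        C₂ * |t| ^ (-(1 / 3) : ℝ) := by
      rw [Real.sqrt_eq_rpow, Real.mul_rpow hC₂.le (by positivity), ← Real.rpow_mul (by positivity),
        Real.div_rpow hn.le hT.le, Real.div_rpow hC₂.le hn.le, Real.rpow_neg hT.le]
      have a1 : C₂ ^ (1 - 2 / 6 : ℝ) * C₂ ^ (2 / 6 : ℝ) = C₂ := by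
        rw [← Real.rpow_add hC₂]
        norm_num
      have a2 : (1 / 2 * (1 - 2 / 6) : ℝ) = 1 / 3 := by norm_num
      have a3 : (2 / 6 : ℝ) = 1 / 3 := by norm_num
      rw [a2]
      rw [a3] at a1 ⊢
      have a4 : n ^ (1 / 3 : ℝ) ≠ 0 := by positivity
      calc _ = (C₂ ^ (1 - 1 / 3 : ℝ) * C₂ ^ (1 / 3 : ℝ)) * (|t| ^ (1 / 3 : ℝ))⁻¹ := by
            field_simp
        _ = _ := by rw [a1]
    rw [mul_assoc, e1]
    have h1 := rpow_neg_le_two_mul ht (κ := 1 / 3) (by norm_num) (by norm_num)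
    have h3 : 0 < (1 + |t|) ^ (-(1 / 3) : ℝ) := by positivity
    calc C₁ * (C₂ * |t| ^ (-(1 / 3) : ℝ)) ≤ C₁ * (C₂ * (2 * (1 + |t|) ^ (-(1 / 3) : ℝ))) := by gcongr
      _ ≤ _ := by nlinarith [mul_pos hC₀ h3]

end Decay

/-! ### Localization to the degenerate frequencies -/

/-- The bump `ρ` at scale `δ` around the frequency `c`. -/
def bumpAt (ρ : ℝ → ℝ) (δ c ξ : ℝ) : ℂ := (ρ (δ⁻¹ * (ξ - c)) : ℂ)

/-- A cutoff to the `δ`-neighbourhood of the degenerate frequencies. -/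
def degenerateCutoff (ρ : ℝ → ℝ) (δ ξ : ℝ) : ℂ :=
  bumpAt ρ δ 0 ξ + bumpAt ρ δ (√3) ξ + bumpAt ρ δ (-√3) ξ

/-- Translating the bump only multiplies its kernel by a unimodular factor, and dilating it rescales
the kernel. -/
theorem norm_kernel_bumpAt (ρ : ℝ → ℝ) {δ : ℝ} (hδ : 0 < δ) (c x : ℝ) :
    ‖kernel (bumpAt ρ δ c) x‖ = δ * ‖kernel (bumpAt ρ 1 0) (δ * x)‖ := by
  have h1 : ∫ ξ : ℝ, Complex.exp (ξ * x * Complex.I) * bumpAt ρ δ c ξ =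
      ∫ ξ : ℝ, Complex.exp (c * x * Complex.I) *
        (Complex.exp (ξ * x * Complex.I) * bumpAt ρ δ 0 ξ) := by
    rw [← integral_add_right_eq_self (fun ξ : ℝ => Complex.exp (ξ * x * Complex.I) * bumpAt ρ δ c ξ) c]
    refine integral_congr_ae (Eventually.of_forall fun ξ => ?_)
    simp only [bumpAt, sub_zero, add_sub_cancel_right]
    rw [← mul_assoc, ← Complex.exp_add]
    congr 2
    push_cast
    ring
  have h2 : ∫ ξ : ℝ, Complex.exp (ξ * x * Complex.I) * bumpAt ρ δ 0 ξ =
      δ * ∫ ξ : ℝ, Complex.exp (ξ * (δ * x : ℝ) * Complex.I) * bumpAt ρ 1 0 ξ := by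
    have := Measure.integral_comp_mul_left (fun ξ : ℝ =>
      Complex.exp (ξ * (δ * x : ℝ) * Complex.I) * bumpAt ρ 1 0 ξ) δ⁻¹
    rw [inv_inv, abs_of_pos hδ, Complex.real_smul] at this
    rw [← this]
    refine integral_congr_ae (Eventually.of_forall fun ξ => ?_)
    have hδ' : (δ : ℂ) ≠ 0 := Complex.ofReal_ne_zero.2 hδ.ne'
    simp only [bumpAt, sub_zero, inv_one, one_mul]
    congr 2
    push_cast
    field_simp
  have h3 : ‖Complex.exp (c * x * Complex.I)‖ = 1 := by
    have := Complex.norm_exp_ofReal_mul_I (c * x)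
    push_cast at this
    exact this
  rw [kernel_eq_integral, kernel_eq_integral, h1, integral_const_mul, h2, norm_mul, norm_mul,
    norm_mul, norm_mul, h3, Complex.norm_real δ, Real.norm_of_nonneg hδ.le]
  ring

section Bump

variable {ρ : ℝ → ℝ} (hρ : IsBump ρ)

include hρ

theorem isSymbol_bumpAt {δ : ℝ} (hδ : 0 < δ) (c : ℝ) : IsSymbol (bumpAt ρ δ c) := by
  have h := isSymbol_bump hρ (inv_pos.2 hδ)
  exact ⟨h.smooth.comp (g := fun ξ => (ρ (δ⁻¹ * ξ) : ℂ)) (contDiff_id.sub contDiff_const),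
    h.compact.comp_homeomorph (Homeomorph.subRight c)⟩

theorem isSymbol_degenerateCutoff {δ : ℝ} (hδ : 0 < δ) : IsSymbol (degenerateCutoff ρ δ) := by
  have h := isSymbol_bumpAt hρ hδ
  exact ⟨((h _).smooth.add (h _).smooth).add (h _).smooth,
    ((h _).compact.add (h _).compact).add (h _).compact⟩

theorem exists_norm_kernel_degenerateCutoff_le : ∃ C : ℝ, 0 < C ∧ ∀ δ x : ℝ, 0 < δ →
    ‖kernel (degenerateCutoff ρ δ) x‖ ≤ C * (δ / (1 + (δ * x) ^ 2)) := by
  obtain ⟨B, hB, h⟩ := (isSymbol_bumpAt hρ one_pos 0).kernel_decay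
  refine ⟨3 * B + 1, by positivity, fun δ x hδ => ?_⟩
  have hk : ∀ c, ‖kernel (bumpAt ρ δ c) x‖ ≤ B * (δ / (1 + (δ * x) ^ 2)) := fun c => by
    rw [norm_kernel_bumpAt ρ hδ]
    calc δ * ‖kernel (bumpAt ρ 1 0) (δ * x)‖ ≤ δ * (B / (1 + (δ * x) ^ 2)) := by
          gcongr
          exact h _
      _ = _ := by ring
  have hi : ∀ c, Integrable fun ξ : ℝ => Complex.exp (ξ * x * Complex.I) * bumpAt ρ δ c ξ := by
    intro c
    refine (isSymbol_bumpAt hρ hδ c).integrable.bdd_mul (c := 1) ?_ ?_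
    · exact (by fun_prop : Continuous fun ξ : ℝ =>
        Complex.exp (ξ * x * Complex.I)).aestronglyMeasurable
    · refine Eventually.of_forall fun ξ => ?_
      have := Complex.norm_exp_ofReal_mul_I (ξ * x)
      push_cast at this
      exact this.le
  have hsum : kernel (degenerateCutoff ρ δ) x = kernel (bumpAt ρ δ 0) x +
      kernel (bumpAt ρ δ (√3)) x + kernel (bumpAt ρ δ (-√3)) x := by
    simp only [kernel_eq_integral, degenerateCutoff, mul_add]
    rw [integral_add ((hi _).fun_add (hi _)) (hi _), integral_add (hi _) (hi _)]
    ring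
  rw [hsum]
  have hnn : 0 ≤ δ / (1 + (δ * x) ^ 2) := by positivity
  calc _ ≤ B * (δ / (1 + (δ * x) ^ 2)) + B * (δ / (1 + (δ * x) ^ 2)) + B * (δ / (1 + (δ * x) ^ 2)) :=
        (norm_add₃_le).trans (add_le_add (add_le_add (hk _) (hk _)) (hk _))
    _ ≤ _ := by nlinarith

theorem norm_bumpAt_le (δ c ξ : ℝ) : ‖bumpAt ρ δ c ξ‖ ≤ 1 := by
  rw [bumpAt, Complex.norm_real, Real.norm_of_nonneg (hρ.nonneg _)]
  exact hρ.le_one _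

theorem bumpAt_eq_one {δ c ξ : ℝ} (hδ : 0 < δ) (h : |ξ - c| < δ / 2) : bumpAt ρ δ c ξ = 1 := by
  rw [bumpAt, hρ.eq_one, Complex.ofReal_one]
  rw [abs_mul, abs_inv, abs_of_pos hδ, inv_mul_eq_div, div_le_iff₀ hδ]
  linarith

theorem bumpAt_eq_zero {δ c ξ : ℝ} (hδ : 0 < δ) (h : δ ≤ |ξ - c|) : bumpAt ρ δ c ξ = 0 := by
  rw [bumpAt, hρ.eq_zero, Complex.ofReal_zero]
  rw [abs_mul, abs_inv, abs_of_pos hδ, inv_mul_eq_div, one_le_div hδ]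
  exact h

theorem norm_one_sub_degenerateCutoff_le (δ ξ : ℝ) : ‖1 - degenerateCutoff ρ δ ξ‖ ≤ 4 := by
  refine (norm_sub_le _ _).trans ?_
  have h := norm_bumpAt_le hρ δ
  have := (norm_add₃_le (a := bumpAt ρ δ 0 ξ) (b := bumpAt ρ δ (√3) ξ) (c := bumpAt ρ δ (-√3) ξ))
  rw [norm_one, degenerateCutoff]
  linarith [h 0 ξ, h (√3) ξ, h (-√3) ξ]

/-- The degenerate frequencies are at least 1.7 apart, so for δ ≤ 1/2 near one of them the other two
bumps vanish and the cutoff equals 1. -/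
theorem dist_of_degenerateCutoff_ne_one {δ ξ : ℝ} (hδ : 0 < δ) (hδ1 : δ ≤ 1 / 2)
    (h : degenerateCutoff ρ δ ξ ≠ 1) :
    δ / 2 ≤ |ξ| ∧ δ / 2 ≤ |ξ - √3| ∧ δ / 2 ≤ |ξ + √3| := by
  have ha : (1.7 : ℝ) ≤ √3 := Real.le_sqrt_of_sq_le (by norm_num)
  have far : ∀ {c c'}, |ξ - c| < δ / 2 → 1.7 ≤ |c - c'| → bumpAt ρ δ c' ξ = 0 := by
    intro c c' h1 h2
    refine bumpAt_eq_zero hρ hδ ?_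
    have := abs_sub_le c ξ c'
    rw [abs_sub_comm c ξ] at this
    linarith
  have a1 : (1.7 : ℝ) ≤ |0 - √3| := by rw [zero_sub, abs_neg, abs_of_nonneg (by linarith)]; exact ha
  have a2 : (1.7 : ℝ) ≤ |0 - -√3| := by rw [zero_sub, neg_neg, abs_of_nonneg (by linarith)]; exact ha
  have a3 : (1.7 : ℝ) ≤ |√3 - -√3| := by
    rw [sub_neg_eq_add, abs_of_nonneg (by linarith)]
    linarith
  refine ⟨?_, ?_, ?_⟩ <;> by_contra! hc <;> refine h ?_
  · rw [← sub_zero ξ] at hc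
    rw [degenerateCutoff, bumpAt_eq_one hρ hδ hc, far hc a1, far hc a2, add_zero, add_zero]
  · rw [degenerateCutoff, bumpAt_eq_one hρ hδ hc, far hc (by rwa [abs_sub_comm] at a1), far hc a3,
      zero_add, add_zero]
  · rw [← sub_neg_eq_add] at hc
    rw [degenerateCutoff, bumpAt_eq_one hρ hδ hc, far hc (by rwa [abs_sub_comm] at a2),
      far hc (by rwa [abs_sub_comm] at a3), zero_add, zero_add]

theorem deriv_bumpAt (δ c ξ : ℝ) :
    deriv (bumpAt ρ δ c) ξ = δ⁻¹ * deriv (bumpAt ρ 1 0) (δ⁻¹ * (ξ - c)) := by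
  have h1 := ((isSymbol_bumpAt hρ one_pos 0).smooth.differentiable (by simp)
    (δ⁻¹ * (ξ - c))).hasDerivAt
  have h2 : HasDerivAt (fun ξ => δ⁻¹ * (ξ - c)) δ⁻¹ ξ := by
    simpa using ((hasDerivAt_id ξ).sub_const c).const_mul δ⁻¹
  have h3 := h1.scomp ξ h2
  have h4 : bumpAt ρ 1 0 ∘ (fun ξ => δ⁻¹ * (ξ - c)) = bumpAt ρ δ c := by
    ext ξ
    simp [bumpAt]
  rw [h4] at h3
  rw [h3.deriv, Complex.real_smul]

/-- Total variation is invariant under scaling: excising a shrinking neighbourhood does not spoil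
the constant V of the second derivative test. -/
theorem integral_norm_deriv_bumpAt {δ : ℝ} (hδ : 0 < δ) (c : ℝ) :
    ∫ ξ, ‖deriv (bumpAt ρ δ c) ξ‖ = ∫ ξ, ‖deriv (bumpAt ρ 1 0) ξ‖ := by
  simp_rw [deriv_bumpAt hρ δ c, norm_mul]
  rw [integral_const_mul,
    integral_sub_right_eq_self (fun ξ => ‖deriv (bumpAt ρ 1 0) (δ⁻¹ * ξ)‖) c,
    Measure.integral_comp_mul_left (fun ξ => ‖deriv (bumpAt ρ 1 0) ξ‖) δ⁻¹, smul_eq_mul, inv_inv,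
    Complex.norm_real, Real.norm_eq_abs, abs_inv, ← mul_assoc, inv_mul_cancel₀ (by positivity),
    one_mul]

/-- The better decay of the low-frequency blocks away from the degenerate frequencies. -/
theorem exists_lpNorm_box_decay_low : ∃ C : ℝ, 0 < C ∧ ∀ (k : ℤ) (t δ : ℝ), |(k : ℝ)| < 6 →
    t ≠ 0 → 0 < δ → δ ≤ 1 / 2 → ∀ f : 𝓢'(ℝ, ℂ), lpNorm (ENNReal.ofReal 6) (multiplier
      (fun ξ => fat ρ k ξ * (phi ξ : ℂ) * (1 - degenerateCutoff ρ δ ξ) * grp t ξ) f) ≤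
      ENNReal.ofReal (C * (|t| * δ) ^ (-(1 / 3) : ℝ)) * lpNorm (ENNReal.ofReal (6 / (6 - 1))) f := by
  obtain ⟨C₀, hC₀, h₀⟩ := exists_amplitude_bound hρ
  obtain ⟨C₁, hC₁, h₁⟩ := lpNorm_multiplier_le_interp (p := 6) (by norm_num)
  set V₀ := ∫ ξ, ‖deriv (bumpAt ρ 1 0) ξ‖ with hV₀
  have hV₀0 : 0 ≤ V₀ := integral_nonneg fun ξ => norm_nonneg _
  -- The product rule: 4 bounds 1 minus the cutoff and 4C₀ the variation of the block amplitude, and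
  -- each of the three bumps contributes C₀V₀.
  set V := 16 * C₀ + 3 * C₀ * V₀ with hVdef
  have hVpos : 0 < V := by positivity
  -- The 7 comes from 1+|k| < 7, the last factor 2 from the distance δ/2 to the degenerate
  -- frequencies.
  set D := (V + 8 * Real.pi * (4 * C₀)) * √(270 * 7 ^ 3 * 2) with hD
  have hDpos : 0 < D := by positivity
  refine ⟨C₁ * D ^ (1 - 2 / 6 : ℝ) * (4 * C₀) ^ (2 / 6 : ℝ), by positivity,
    fun k t δ hk ht hδ hδ1 f => ?_⟩
  obtain ⟨hs, hM, hd, hdz⟩ := h₀ k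
  have hT : 0 < |t| := abs_pos.2 ht
  have hn : 1 ≤ 1 + |(k : ℝ)| := by linarith [abs_nonneg (k : ℝ)]
  have hle : C₀ / (1 + |(k : ℝ)|) ≤ C₀ := div_le_self hC₀.le hn
  have hχ := isSymbol_degenerateCutoff hρ hδ
  have hA : IsSymbol fun ξ => fat ρ k ξ * (phi ξ : ℂ) * (1 - degenerateCutoff ρ δ ξ) :=
    hs.mul (contDiff_const.sub hχ.smooth)
  have hAM : ∀ ξ, ‖fat ρ k ξ * (phi ξ : ℂ) * (1 - degenerateCutoff ρ δ ξ)‖ ≤ 4 * C₀ := fun ξ => by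
    rw [norm_mul, mul_comm 4]
    exact mul_le_mul ((hM ξ).trans hle) (norm_one_sub_degenerateCutoff_le hρ δ ξ) (norm_nonneg _) hC₀.le
  have hb := fun c => ((isSymbol_bumpAt hρ hδ c).smooth.differentiable (by simp))
  have hder : ∀ ξ, ‖deriv (fun ξ => fat ρ k ξ * (phi ξ : ℂ) * (1 - degenerateCutoff ρ δ ξ)) ξ‖ ≤
      4 * ‖deriv (fun ξ => fat ρ k ξ * (phi ξ : ℂ)) ξ‖ + C₀ * (‖deriv (bumpAt ρ δ 0) ξ‖ +
        ‖deriv (bumpAt ρ δ (√3)) ξ‖ + ‖deriv (bumpAt ρ δ (-√3)) ξ‖) := by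
    intro ξ
    have d1 := (hs.smooth.differentiable (by simp) ξ).hasDerivAt
    have d2 : HasDerivAt (degenerateCutoff ρ δ) (deriv (bumpAt ρ δ 0) ξ +
        deriv (bumpAt ρ δ (√3)) ξ + deriv (bumpAt ρ δ (-√3)) ξ) ξ :=
      ((hb _ ξ).hasDerivAt.add (hb _ ξ).hasDerivAt).add (hb _ ξ).hasDerivAt
    rw [(d1.fun_mul (d2.const_sub 1)).deriv]
    refine (norm_add_le _ _).trans (add_le_add ?_ ?_)
    · rw [norm_mul, mul_comm 4]
      exact mul_le_mul_of_nonneg_left (norm_one_sub_degenerateCutoff_le hρ δ ξ) (norm_nonneg _)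
    · rw [norm_mul, norm_neg]
      exact mul_le_mul ((hM ξ).trans hle) norm_add₃_le (norm_nonneg _) hC₀.le
  have hi1 := hs.deriv.integrable.norm
  have hi2 := fun c => (isSymbol_bumpAt hρ hδ c).deriv.integrable.norm
  have hAV : ∫ ξ, ‖deriv (fun ξ => fat ρ k ξ * (phi ξ : ℂ) * (1 - degenerateCutoff ρ δ ξ)) ξ‖ ≤ V := by
    have hi3 := ((hi2 0).add (hi2 (√3))).add (hi2 (-√3))
    refine (integral_mono hA.deriv.integrable.norm ((hi1.const_mul 4).add (hi3.const_mul C₀))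
      hder).trans ?_
    rw [integral_add' (hi1.const_mul 4) (hi3.const_mul C₀), integral_const_mul, integral_const_mul,
      integral_add' ((hi2 0).add (hi2 (√3))) (hi2 (-√3)), integral_add' (hi2 0) (hi2 (√3)),
      integral_norm_deriv_bumpAt hρ hδ, integral_norm_deriv_bumpAt hρ hδ,
      integral_norm_deriv_bumpAt hρ hδ]
    have := integral_norm_le_of_support hd hdz
    linarith
  have hsupp : ∀ ξ : ℝ, 2 ≤ |ξ - k| →
      fat ρ k ξ * (phi ξ : ℂ) * (1 - degenerateCutoff ρ δ ξ) = 0 := fun ξ hξ => by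
    rw [fat_eq_zero hρ hξ, zero_mul, zero_mul]
  have hker : ∀ x, ‖kernel (fun ξ => fat ρ k ξ * (phi ξ : ℂ) * (1 - degenerateCutoff ρ δ ξ) *
      grp t ξ) x‖ ≤ D * (|t| * δ) ^ (-(1 / 2) : ℝ) := by
    intro x
    refine (norm_kernel_grp_le_of_dist (w := 0) (N := ∅) hA ht (half_pos hδ) (by linarith) hsupp hAM hAV
      MeasurableSet.empty le_rfl (by simp) fun ξ _ hξ =>
        dist_of_degenerateCutoff_ne_one hρ hδ hδ1 fun hc => hξ (by simp [hc])).trans ?_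
    rw [mul_zero, zero_add, hD, mul_assoc (V + _)]
    have hVM : 0 ≤ V + 8 * Real.pi * (4 * C₀) := by positivity
    refine mul_le_mul_of_nonneg_left ?_ hVM
    rw [Real.rpow_neg (by positivity), ← Real.sqrt_eq_rpow, ← Real.sqrt_inv,
      ← Real.sqrt_mul (by positivity)]
    refine Real.sqrt_le_sqrt ?_
    have h7 : (1 + |(k : ℝ)|) ^ 3 ≤ 7 ^ 3 := by
      gcongr
      linarith
    calc _ ≤ 270 * 7 ^ 3 / (|t| * (δ / 2)) := by gcongr
      _ = _ := by
        field_simp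
  refine (h₁ _ (hA.mul (contDiff_grp t)) _ _ (by positivity) (by positivity : 0 < 4 * C₀) hker
    (fun ξ => ?_) f).trans (le_of_eq ?_)
  · rw [norm_mul, norm_grp, mul_one]
    exact hAM ξ
  · congr 2
    rw [Real.mul_rpow hDpos.le (by positivity), ← Real.rpow_mul (by positivity)]
    norm_num
    ring

end Bump

theorem multiplier_comm {m₁ m₂ : ℝ → ℂ} (h₁ : m₁.HasTemperateGrowth)
    (h₂ : m₂.HasTemperateGrowth) (f : 𝓢'(ℝ, ℂ)) :
    multiplier m₁ (multiplier m₂ f) = multiplier m₂ (multiplier m₁ f) := by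
  rw [multiplier_multiplier h₁ h₂, multiplier_multiplier h₂ h₁]
  simp only [mul_comm]

section Gain

variable {ρ : ℝ → ℝ} (hρ : IsBump ρ)

include hρ

theorem multiplier_block_eq {δ : ℝ} (hδ : 0 < δ) (k : ℤ) (t : ℝ) (f : 𝓢'(ℝ, ℂ)) :
    multiplier (fun ξ => fat ρ k ξ * (phi ξ : ℂ) * grp t ξ) (box ρ k f) =
      multiplier (fun ξ => fat ρ k ξ * (phi ξ : ℂ) * (1 - degenerateCutoff ρ δ ξ) * grp t ξ)
        (box ρ k f) +
      multiplier (fun ξ => fat ρ k ξ * (phi ξ : ℂ) * grp t ξ)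
        (box ρ k (multiplier (degenerateCutoff ρ δ) f)) := by
  have hχ := isSymbol_degenerateCutoff hρ hδ
  have hm := isSymbol_block hρ t k
  have h1 : IsSymbol fun ξ => fat ρ k ξ * (phi ξ : ℂ) * (1 - degenerateCutoff ρ δ ξ) * grp t ξ :=
    (((isSymbol_fat hρ k).mul (Complex.ofRealCLM.contDiff.comp contDiff_phi)).mul
      (contDiff_const.sub hχ.smooth)).mul (contDiff_grp t)
  have h2 := hm.mul hχ.smooth
  rw [box_eq ρ k (multiplier _ f), multiplier_comm (isSymbol_sig hρ k).temperate hχ.temperate,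
    ← box_eq, multiplier_multiplier hm.temperate hχ.temperate,
    ← multiplier_fun_add h1.temperate h2.temperate]
  congr 1
  ext ξ
  ring

/-- The decay of `S(t)φ(D)` in the case `p = 6`, with the contribution of the degenerate
frequencies split off. -/
theorem exists_modNorm_decay_split {s : ℝ} (hs : 0 ≤ s) : ∃ C : ℝ, 0 < C ∧ ∀ (t : ℝ), 16 ≤ |t| →
    ∀ F : 𝓢'(ℝ, ℂ), modNorm ρ s (ENNReal.ofReal 6) 1 (S t (phiD F)) ≤
      ENNReal.ofReal (C * |t| ^ (-(1 / 4) : ℝ)) * modNorm ρ s (ENNReal.ofReal (6 / (6 - 1))) 1 F +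
      ENNReal.ofReal (C * |t| ^ (-(2 / 9) : ℝ)) * lpNorm (ENNReal.ofReal (6 / (6 - 1)))
        (multiplier (degenerateCutoff ρ (|t| ^ (-(1 / 4) : ℝ))) F) := by
  obtain ⟨C₁, hC₁, h₁⟩ := exists_lpNorm_box_decay hρ (p := 6) (by norm_num)
  obtain ⟨C₂, hC₂, h₂⟩ := exists_lpNorm_box_decay_high hρ
  obtain ⟨C₃, hC₃, h₃⟩ := exists_lpNorm_box_decay_low hρ
  obtain ⟨C₄, hC₄, h₄⟩ := exists_lpNorm_box_le hρ
  refine ⟨C₂ + C₃ + 11 * (7 ^ s * (C₁ * C₄)), by positivity, fun t ht F => ?_⟩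
  have hT : 0 < |t| := by linarith
  have ht0 : t ≠ 0 := abs_pos.1 hT
  have hT1 : 1 ≤ |t| := by linarith
  have h6 : (1 : ℝ≥0∞) ≤ ENNReal.ofReal 6 := by
    rw [ENNReal.one_le_ofReal]
    norm_num
  have hq : (1 : ℝ≥0∞) ≤ ENNReal.ofReal (6 / (6 - 1)) := by
    rw [ENNReal.one_le_ofReal]
    norm_num
  have hδ : 0 < |t| ^ (-(1 / 4) : ℝ) := by positivity
  -- The threshold 16 on |t| is what makes the bumps narrow enough to be disjoint.
  have hδ1 : |t| ^ (-(1 / 4) : ℝ) ≤ 1 / 2 := by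
    calc |t| ^ (-(1 / 4) : ℝ) ≤ 16 ^ (-(1 / 4) : ℝ) :=
          Real.rpow_le_rpow_of_nonpos (by norm_num) ht (by norm_num)
      _ = 1 / 2 := by
          rw [show (16 : ℝ) = 2 ^ (4 : ℝ) by norm_num, ← Real.rpow_mul (by norm_num)]
          norm_num
  -- The scale δ = |t|^{-1/4} is chosen for this identity: off the degenerate set the decay is
  -- exactly |t|^{-1/4}.
  have hTδ : (|t| * |t| ^ (-(1 / 4) : ℝ)) ^ (-(1 / 3) : ℝ) = |t| ^ (-(1 / 4) : ℝ) := by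
    rw [← Real.rpow_one_add' hT.le (by norm_num), ← Real.rpow_mul hT.le]
    norm_num
  set δ := |t| ^ (-(1 / 4) : ℝ) with hδdef
  have hlow : (1 + |t|) ^ (-((1 - 2 / 6) / 3) : ℝ) ≤ |t| ^ (-(2 / 9) : ℝ) := by
    rw [show (-((1 - 2 / 6) / 3) : ℝ) = -(2 / 9) by norm_num]
    exact Real.rpow_le_rpow_of_nonpos hT (by linarith) (by norm_num)
  have hhigh : (1 + |t|) ^ (-(1 / 3) : ℝ) ≤ δ :=
    (Real.rpow_le_rpow_of_nonpos hT (by linarith) (by norm_num)).trans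
      (Real.rpow_le_rpow_of_exponent_le hT1 (by norm_num))
  set Y := lpNorm (ENNReal.ofReal (6 / (6 - 1))) (multiplier (degenerateCutoff ρ δ) F)
  set X := ENNReal.ofReal (7 ^ s * (C₁ * C₄) * |t| ^ (-(2 / 9) : ℝ)) * Y with hX
  have hC0 : ENNReal.ofReal ((C₂ + C₃) * δ) ≤
      ENNReal.ofReal ((C₂ + C₃ + 11 * (7 ^ s * (C₁ * C₄))) * δ) := by
    refine ENNReal.ofReal_le_ofReal (mul_le_mul_of_nonneg_right ?_ hδ.le)
    have : 0 < 11 * (7 ^ s * (C₁ * C₄)) := by positivity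
    linarith
  -- Blocks with |k| ≥ 6 decay like |t|^{-1/3} by themselves; only the eleven blocks with |k| ≤ 5
  -- produce the degenerate term, and there the weight is at most 7^s.
  have hterm : ∀ k : ℤ, wt s k * lpNorm (ENNReal.ofReal 6) (box ρ k (S t (phiD F))) ≤
      ENNReal.ofReal ((C₂ + C₃) * δ) *
        (wt s k * lpNorm (ENNReal.ofReal (6 / (6 - 1))) (box ρ k F)) +
      if k ∈ Finset.Icc (-5 : ℤ) 5 then X else 0 := by
    intro k
    rw [box_S_phiD hρ]
    rcases le_or_gt 6 |(k : ℝ)| with hk | hk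
    · refine le_add_right ?_
      rw [mul_left_comm]
      refine mul_le_mul_right ((h₂ k t hk _).trans (mul_le_mul_left (ENNReal.ofReal_le_ofReal ?_) _)) _
      calc C₂ * (1 + |t|) ^ (-(1 / 3) : ℝ) ≤ C₂ * δ := by gcongr
        _ ≤ (C₂ + C₃) * δ := by nlinarith [mul_pos hC₃ hδ]
    · have hk5 : k ∈ Finset.Icc (-5 : ℤ) 5 := by
        have h6 : |k| < 6 := by exact_mod_cast hk
        rw [abs_lt] at h6
        rw [Finset.mem_Icc]
        omega
      rw [if_pos hk5, multiplier_block_eq hρ hδ]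
      refine (mul_le_mul_right (lpNorm_add_le h6 _ _) _).trans ?_
      rw [mul_add]
      refine add_le_add ?_ ?_
      · rw [mul_left_comm]
        refine mul_le_mul_right ((h₃ k t δ hk ht0 hδ hδ1 _).trans
          (mul_le_mul_left (ENNReal.ofReal_le_ofReal ?_) _)) _
        rw [hTδ]
        nlinarith [mul_pos hC₂ hδ]
      · have hw : wt s k ≤ ENNReal.ofReal (7 ^ s) :=
          ENNReal.ofReal_le_ofReal (Real.rpow_le_rpow (by positivity) (by linarith) hs)
        calc wt s k * _ ≤ ENNReal.ofReal (7 ^ s) * (ENNReal.ofReal (C₁ * |t| ^ (-(2 / 9) : ℝ)) *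
              (ENNReal.ofReal C₄ * Y)) := by
              refine mul_le_mul' hw ((h₁ k t _).trans (mul_le_mul' (ENNReal.ofReal_le_ofReal ?_)
                (h₄ _ _ hq le_rfl k _)))
              exact mul_le_mul_of_nonneg_left hlow hC₁.le
          _ = X := by
              rw [hX, ← mul_assoc, ← mul_assoc, ← ENNReal.ofReal_mul (by positivity),
                ← ENNReal.ofReal_mul (by positivity)]
              congr 2
              ring
  rw [modNorm_one, modNorm_one]
  refine (ENNReal.tsum_le_tsum hterm).trans ?_
  rw [ENNReal.tsum_add, ENNReal.tsum_mul_left]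
  refine add_le_add (mul_le_mul_left hC0 _) ?_
  rw [tsum_eq_sum (s := Finset.Icc (-5 : ℤ) 5) fun k hk => if_neg hk,
    Finset.sum_congr rfl fun k hk => if_pos hk, Finset.sum_const, nsmul_eq_mul, hX, ← mul_assoc]
  refine mul_le_mul_left ?_ _
  rw [show (Finset.Icc (-5 : ℤ) 5).card = 11 from rfl, show ((11 : ℕ) : ℝ≥0∞) = ENNReal.ofReal 11 by simp,
    ← ENNReal.ofReal_mul (by norm_num)]
  refine ENNReal.ofReal_le_ofReal ?_
  have hpos : 0 < |t| ^ (-(2 / 9) : ℝ) := by positivity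
  rw [← mul_assoc]
  refine mul_le_mul_of_nonneg_right ?_ hpos.le
  linarith

end Gain

/-! ### Convolution with a weight at scale `1/δ` -/

/-- The integrable weight at scale `1/δ`. -/
def scaledWeight (δ x : ℝ) : ℝ≥0∞ := ENNReal.ofReal δ * cauchyWeight (δ * x)

theorem measurable_scaledWeight (δ : ℝ) : Measurable (scaledWeight δ) :=
  (measurable_cauchyWeight.comp (measurable_const_mul δ)).const_mul _

theorem lintegral_scaledWeight_le {δ : ℝ} (hδ : 0 < δ) : ∫⁻ x, scaledWeight δ x ≤ 4 := by
  unfold scaledWeight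
  rw [lintegral_const_mul' _ _ ENNReal.ofReal_ne_top]
  have h := Real.map_volume_mul_left hδ.ne'
  have h1 : ∫⁻ x, cauchyWeight (δ * x) = ENNReal.ofReal |δ⁻¹| * ∫⁻ x, cauchyWeight x := by
    rw [← lintegral_map (μ := volume) measurable_cauchyWeight (measurable_const_mul δ), h,
      lintegral_smul_measure, smul_eq_mul]
  rw [h1, ← mul_assoc, ← ENNReal.ofReal_mul hδ.le, abs_of_pos (inv_pos.2 hδ),
    mul_inv_cancel₀ hδ.ne', ENNReal.ofReal_one, one_mul]
  exact lintegral_cauchyWeight_le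

theorem lintegral_scaledWeight_conv {δ : ℝ} (hδ : 0 < δ) {g : ℝ → ℝ≥0∞} (hg : AEMeasurable g) :
    ∫⁻ x, ∫⁻ y, scaledWeight δ (x - y) * g y ≤ 4 * ∫⁻ y, g y := by
  have hm : AEMeasurable (Function.uncurry fun x y => scaledWeight δ (x - y) * g y)
      (volume.prod volume) :=
    ((measurable_scaledWeight δ).comp (measurable_fst.sub measurable_snd)).aemeasurable.mul hg.comp_snd
  rw [lintegral_lintegral_swap hm]
  calc ∫⁻ y, ∫⁻ x, scaledWeight δ (x - y) * g y = ∫⁻ y, (∫⁻ x, scaledWeight δ x) * g y := by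
        refine lintegral_congr fun y => ?_
        have hmy : Measurable fun x => scaledWeight δ (x - y) :=
          (measurable_scaledWeight δ).comp (measurable_id.sub_const y)
        rw [lintegral_mul_const _ hmy,
          lintegral_sub_right_eq_self (scaledWeight δ) y]
    _ ≤ ∫⁻ y, 4 * g y := lintegral_mono fun y => mul_le_mul_left (lintegral_scaledWeight_le hδ) _
    _ = _ := lintegral_const_mul' _ _ (by norm_num)

/-- The interpolation inequality which extracts the local `L²` average. -/
theorem lintegral_scaledWeight_pow_le {δ : ℝ} (hδ : 0 < δ) {g : ℝ → ℝ≥0∞} (hg : AEMeasurable g) :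
    ∫⁻ x, (∫⁻ y, scaledWeight δ (x - y) * g y ^ (5 : ℝ)) ^ (6 / 5 : ℝ) ≤
      (∫⁻ x, (∫⁻ y, scaledWeight δ (x - y) * g y ^ (2 : ℝ)) ^ (3 : ℝ)) ^ (1 / 10 : ℝ) *
        (4 * ∫⁻ y, g y ^ (6 : ℝ)) ^ (9 / 10 : ℝ) := by
  have hm : ∀ (a : ℝ), AEMeasurable (Function.uncurry fun x y => scaledWeight δ (x - y) * g y ^ a)
      (volume.prod volume) := fun a =>
    ((measurable_scaledWeight δ).comp (measurable_fst.sub measurable_snd)).aemeasurable.mul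
      (hg.pow_const a).comp_snd
  have hcm : ∀ a x, AEMeasurable fun y => scaledWeight δ (x - y) * g y ^ (a : ℝ) := fun a x =>
    ((measurable_scaledWeight δ).comp (measurable_const.sub measurable_id)).aemeasurable.mul
      (hg.pow_const a)
  have hc : ∀ a : ℝ, AEMeasurable fun x => ∫⁻ y, scaledWeight δ (x - y) * g y ^ a := fun a =>
    (hm a).lintegral_prod_right'
  -- Hölder for 5 = 2·(1/4) + 6·(3/4) at each x; a second Hölder in x with weights 1/10 and 9/10
  -- follows.
  have hpt : ∀ x, ∫⁻ y, scaledWeight δ (x - y) * g y ^ (5 : ℝ) ≤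
      (∫⁻ y, scaledWeight δ (x - y) * g y ^ (2 : ℝ)) ^ (1 / 4 : ℝ) *
        (∫⁻ y, scaledWeight δ (x - y) * g y ^ (6 : ℝ)) ^ (3 / 4 : ℝ) := by
    intro x
    refine le_trans (le_of_eq ?_) (ENNReal.lintegral_mul_norm_pow_le (hcm 2 x) (hcm 6 x)
      (p := 1 / 4) (q := 3 / 4) (by norm_num) (by norm_num) (by norm_num))
    refine lintegral_congr fun y => ?_
    rw [ENNReal.mul_rpow_of_nonneg _ _ (by norm_num), ENNReal.mul_rpow_of_nonneg _ _ (by norm_num),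
      mul_mul_mul_comm, ← ENNReal.rpow_add_of_nonneg _ _ (by norm_num) (by norm_num),
      ← ENNReal.rpow_mul, ← ENNReal.rpow_mul,
      ← ENNReal.rpow_add_of_nonneg _ _ (by norm_num) (by norm_num)]
    norm_num
  calc _ ≤ ∫⁻ x, ((∫⁻ y, scaledWeight δ (x - y) * g y ^ (2 : ℝ)) ^ (3 : ℝ)) ^ (1 / 10 : ℝ) *
        (∫⁻ y, scaledWeight δ (x - y) * g y ^ (6 : ℝ)) ^ (9 / 10 : ℝ) := by
        refine lintegral_mono fun x => (ENNReal.rpow_le_rpow (hpt x) (by norm_num)).trans (le_of_eq ?_)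
        rw [ENNReal.mul_rpow_of_nonneg _ _ (by norm_num), ← ENNReal.rpow_mul, ← ENNReal.rpow_mul,
          ← ENNReal.rpow_mul]
        norm_num
    _ ≤ _ := ENNReal.lintegral_mul_norm_pow_le ((hc 2).pow_const 3) (hc 6)
        (p := 1 / 10) (q := 9 / 10) (by norm_num) (by norm_num) (by norm_num)
    _ ≤ _ := by
        refine mul_le_mul_right (ENNReal.rpow_le_rpow ?_ (by norm_num)) _
        exact lintegral_scaledWeight_conv hδ (hg.pow_const 6)

end GBBM

end

open scoped SchwartzMap ENNReal FourierTransform LineDeriv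

noncomputable section

namespace GBBM

/-! ### Local energy estimate -/

/-- The product rule on the Fourier side: multiplication by x is differentiation in frequency, so
its commutator with m(D) is a multiple of m'(D). The factors 2π of the dilation cancel. -/
theorem fourier_symbol_mul_id {m m₁ : ℝ → ℂ} (hm : m.HasTemperateGrowth)
    (hm₁ : m₁.HasTemperateGrowth) (hd : ∀ ξ, HasDerivAt m (m₁ ξ) ξ) {ψ ψx : 𝓢(ℝ, ℂ)}
    (hψ : ∀ x : ℝ, ψx x = x * ψ x) (x : ℝ) :
    𝓕 (SchwartzMap.smulLeftCLM ℂ (fun y : ℝ => m (2 * Real.pi * y)) (𝓕⁻ ψx)) x =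
      x * 𝓕 (SchwartzMap.smulLeftCLM ℂ (fun y : ℝ => m (2 * Real.pi * y)) (𝓕⁻ ψ)) x +
        Complex.I * 𝓕 (SchwartzMap.smulLeftCLM ℂ (fun y : ℝ => m₁ (2 * Real.pi * y)) (𝓕⁻ ψ)) x := by
  have hM := hasTemperateGrowth_dilate hm
  have hM₁ := hasTemperateGrowth_dilate hm₁
  have ht : (fun x : ℝ => inner ℝ x (1 : ℝ)).HasTemperateGrowth := by fun_prop
  have h1 : ∂_{(1 : ℝ)} (𝓕⁻ ψ) = (2 * Real.pi * Complex.I) • 𝓕⁻ ψx := by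
    rw [SchwartzMap.lineDerivOp_fourierInv_eq, FourierTransform.fourierInv_smul]
    congr 2
    ext x
    rw [SchwartzMap.smulLeftCLM_apply_apply ht, hψ]
    simp
  set Ψ := SchwartzMap.smulLeftCLM ℂ (fun y : ℝ => m (2 * Real.pi * y)) (𝓕⁻ ψ)
  have h2 : ∂_{(1 : ℝ)} Ψ = (2 * Real.pi : ℂ) •
      SchwartzMap.smulLeftCLM ℂ (fun y : ℝ => m₁ (2 * Real.pi * y)) (𝓕⁻ ψ) +
      (2 * Real.pi * Complex.I) •
        SchwartzMap.smulLeftCLM ℂ (fun y : ℝ => m (2 * Real.pi * y)) (𝓕⁻ ψx) := by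
    ext y
    have d1 : HasDerivAt (fun y : ℝ => m (2 * Real.pi * y)) (2 * Real.pi * m₁ (2 * Real.pi * y)) y := by
      have := (hd (2 * Real.pi * y)).scomp y ((hasDerivAt_id y).const_mul (2 * Real.pi))
      refine HasDerivAt.congr_deriv (f := fun y : ℝ => m (2 * Real.pi * y)) this ?_
      rw [Complex.real_smul]
      push_cast
      ring
    have d2 : HasDerivAt (𝓕⁻ ψ : 𝓢(ℝ, ℂ)) ((2 * Real.pi * Complex.I) * 𝓕⁻ ψx y) y := by
      have := (𝓕⁻ ψ : 𝓢(ℝ, ℂ)).hasDerivAt y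
      rw [← fderiv_apply_one_eq_deriv, ← SchwartzMap.lineDerivOp_apply_eq_fderiv, h1] at this
      exact this
    have d3 : HasDerivAt Ψ (2 * Real.pi * m₁ (2 * Real.pi * y) * 𝓕⁻ ψ y +
        m (2 * Real.pi * y) * ((2 * Real.pi * Complex.I) * 𝓕⁻ ψx y)) y := by
      refine (d1.mul d2).congr_of_eventuallyEq (Eventually.of_forall fun z => ?_)
      rw [SchwartzMap.smulLeftCLM_apply_apply hM]
      rfl
    rw [SchwartzMap.lineDerivOp_apply_eq_fderiv, fderiv_apply_one_eq_deriv, d3.deriv]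
    have e : ∀ (a b : 𝓢(ℝ, ℂ)) (c d : ℂ), (c • a + d • b) y = c * a y + d * b y := fun _ _ _ _ => rfl
    rw [e, SchwartzMap.smulLeftCLM_apply_apply hM, SchwartzMap.smulLeftCLM_apply_apply hM₁]
    simp only [smul_eq_mul]
    ring
  have h3 := SchwartzMap.fourier_lineDerivOp_eq Ψ (1 : ℝ)
  rw [h2, FourierTransform.fourier_add, FourierTransform.fourier_smul,
    FourierTransform.fourier_smul] at h3
  have h4 := congrArg (fun Φ : 𝓢(ℝ, ℂ) => Φ x) h3
  have e : ∀ (a b : 𝓢(ℝ, ℂ)) (c d : ℂ), (c • a + d • b) x = c * a x + d * b x := fun _ _ _ _ => rfl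
  have e' : ∀ (a : 𝓢(ℝ, ℂ)) (c : ℂ), (c • a) x = c * a x := fun _ _ => rfl
  simp only [e, e', SchwartzMap.smulLeftCLM_apply_apply ht] at h4
  have h5 : (2 * Real.pi : ℂ) ≠ 0 := by
    exact_mod_cast (by positivity : (2 * Real.pi : ℝ) ≠ 0)
  have h6 : (inner ℝ x (1 : ℝ) • (𝓕 Ψ) x : ℂ) = x * 𝓕 Ψ x := by simp
  rw [h6] at h4
  have hI : Complex.I ^ 2 = -1 := Complex.I_sq
  refine mul_left_cancel₀ (mul_ne_zero h5 Complex.I_ne_zero) ?_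
  linear_combination h4 - (2 * Real.pi) * 𝓕 (SchwartzMap.smulLeftCLM ℂ (fun y : ℝ => m₁ (2 * Real.pi * y)) (𝓕⁻ ψ)) x * hI

/-- The commutator of a multiplier with an affine weight. -/
theorem isRep_multiplier_affine_mul {m m₁ : ℝ → ℂ} (hm : m.HasTemperateGrowth)
    (hm₁ : m₁.HasTemperateGrowth) (hd : ∀ ξ, HasDerivAt m (m₁ ξ) ξ) (a b : ℂ) {f H : 𝓢'(ℝ, ℂ)}
    {h k l : ℝ → ℂ} (hk2 : MemLp k 2 volume) (hl2 : MemLp l 2 volume)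
    (hH : IsRep H h) (hf : IsRep f fun x => (a + b * x) * h x) (hk : IsRep (multiplier m H) k)
    (hl : IsRep (multiplier m₁ H) l) :
    IsRep (multiplier m f) fun x => (a + b * x) * k x - Complex.I * b * l x := by
  intro ψ
  have ht : (fun x : ℝ => (x : ℂ)).HasTemperateGrowth := by fun_prop
  set ψx : 𝓢(ℝ, ℂ) := SchwartzMap.smulLeftCLM ℂ (fun x : ℝ => (x : ℂ)) ψ
  have hψx : ∀ x : ℝ, ψx x = x * ψ x := fun x => SchwartzMap.smulLeftCLM_apply_apply ht ψ x
  have key : multiplier m f ψ = multiplier m H (a • ψ + b • ψx) -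
      Complex.I * b * multiplier m₁ H ψ := by
    have hsub : ∀ (u v : 𝓢(ℝ, ℂ)) (c : ℂ), H u - c * H v = H (u - c • v) := fun u v c => by
      rw [map_sub, map_smul, smul_eq_mul]
    rw [multiplier_apply, multiplier_apply, multiplier_apply, hf, hsub, hH]
    refine integral_congr_ae (Eventually.of_forall fun x => ?_)
    have e : ∀ (u v w : 𝓢(ℝ, ℂ)) (c : ℂ), (u + v - c • w) x = u x + v x - c * w x :=
      fun _ _ _ _ => rfl
    have e' : ∀ (u : 𝓢(ℝ, ℂ)) (c : ℂ), (c • u) x = c * u x := fun _ _ => rfl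
    simp only [FourierTransform.fourierInv_add, FourierTransform.fourierInv_smul, map_add, map_smul,
      FourierTransform.fourier_add, FourierTransform.fourier_smul]
    rw [e, e', e', fourier_symbol_mul_id hm hm₁ hd hψx]
    ring
  have hi1 : Integrable fun x => (a • ψ + b • ψx) x * k x :=
    MemLp.integrable_mul ((a • ψ + b • ψx).memLp 2 volume) hk2
  have hi2 : Integrable fun x => ψ x * l x := MemLp.integrable_mul (ψ.memLp 2 volume) hl2
  rw [key, hk, hl, ← integral_const_mul, ← integral_sub hi1 (hi2.const_mul _)]
  refine integral_congr_ae (Eventually.of_forall fun x => ?_)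
  have e : (a • ψ + b • ψx) x = a * ψ x + b * ψx x := rfl
  simp only
  rw [e, hψx]
  ring

theorem hasTemperateGrowth_phi₁ : (fun ξ => (phi₁ ξ : ℂ)).HasTemperateGrowth := by
  have h1 := Function.hasTemperateGrowth_one_add_norm_sq_rpow ℝ (-2)
  have h2 : phi₁.HasTemperateGrowth := by
    have h3 : (fun ξ : ℝ => (1 - ξ ^ 2) * (1 + ‖ξ‖ ^ 2) ^ (-2 : ℝ)).HasTemperateGrowth := by fun_prop
    convert h3 using 2 with ξ
    rw [Real.rpow_neg (by positivity), phi₁, div_eq_mul_inv, Real.norm_eq_abs, sq_abs, Real.rpow_two]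
  fun_prop

/-- Finite speed with a smooth weight. For the affine function A(y) = 1 + iδ(y-x), the quantity
δ|A|^{-2} is exactly the weight, and h = g/A lies in L². Since S(t)(Ah) = A·S(t)h - iδi·m'(D)h with
|m'| = |tφ'| ≤ |t|, dividing by A, where |A| ≥ 1, gives an L² bound with constant 1 + δ|t|. -/
theorem local_energy {f : 𝓢'(ℝ, ℂ)} {g gt : ℝ → ℂ} {t : ℝ} (hg : MemLp g ∞ volume)
    (hgt : MemLp gt ∞ volume) (h : IsRep f g) (ht : IsRep (S t f) gt) {δ : ℝ} (hδ : 0 < δ) (x : ℝ) :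
    ∫⁻ y, scaledWeight δ (x - y) * ‖gt y‖ₑ ^ (2 : ℝ) ≤
      ENNReal.ofReal ((1 + δ * |t|) ^ 2) * ∫⁻ y, scaledWeight δ (x - y) * ‖g y‖ₑ ^ (2 : ℝ) := by
  rcases eq_or_ne t 0 with rfl | ht0
  · rw [S_zero] at ht
    rw [abs_zero, mul_zero, add_zero, one_pow, ENNReal.ofReal_one, one_mul]
    refine le_of_eq (lintegral_congr_ae ?_)
    filter_upwards [h.ae_eq_of_memLp le_top le_top ht hg hgt] with y hy
    rw [hy]
  have h2 : (1 : ℝ≥0∞) ≤ 2 := by norm_num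
  have : Fact ((1 : ℝ≥0∞) ≤ 2) := ⟨h2⟩
  set a : ℂ := 1 - Complex.I * δ * x with ha
  set b : ℂ := Complex.I * δ with hb
  set A : ℝ → ℂ := fun y => a + b * y with hA
  have hAeq : ∀ y, A y = 1 + (δ * (y - x) : ℝ) * Complex.I := fun y => by
    simp only [hA, ha, hb]
    push_cast
    ring
  have hAsq : ∀ y, Complex.normSq (A y) = 1 + (δ * (x - y)) ^ 2 := fun y => by
    rw [hAeq, ← Complex.ofReal_one, Complex.normSq_add_mul_I]
    ring
  have hA0 : ∀ y, A y ≠ 0 := fun y hy => by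
    have := hAsq y
    rw [hy, map_zero] at this
    nlinarith [sq_nonneg (δ * (x - y))]
  have hAc : Continuous A := by fun_prop
  have hωsq : ∀ y, ENNReal.ofReal δ * ‖(A y)⁻¹‖ₑ ^ (2 : ℝ) = scaledWeight δ (x - y) := fun y => by
    rw [scaledWeight, cauchyWeight, ← hAsq, ← ofReal_norm, ENNReal.ofReal_rpow_of_nonneg (norm_nonneg _)
      (by norm_num), Real.rpow_two, norm_inv, inv_pow, ← Complex.normSq_eq_norm_sq, one_div]
  have hω1 : ∀ y, ‖(A y)⁻¹‖ ≤ 1 := fun y => by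
    rw [norm_inv]
    refine inv_le_one_of_one_le₀ ?_
    rw [← Real.sqrt_one, Complex.norm_def]
    refine Real.sqrt_le_sqrt ?_
    rw [hAsq]
    nlinarith [sq_nonneg (δ * (x - y))]
  have hωc : Continuous fun y => (A y)⁻¹ := hAc.inv₀ hA0
  have hint : ∀ u : ℝ → ℂ, ∫⁻ y, scaledWeight δ (x - y) * ‖u y‖ₑ ^ (2 : ℝ) =
      ENNReal.ofReal δ * eLpNorm (fun y => (A y)⁻¹ * u y) 2 volume ^ (2 : ℝ) := fun u => by
    rw [eLpNorm_eq_lintegral_rpow_enorm_toReal (by norm_num) (by norm_num), ENNReal.toReal_ofNat,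
      ← ENNReal.rpow_mul, one_div_mul_cancel two_ne_zero, ENNReal.rpow_one,
      ← lintegral_const_mul' _ _ ENNReal.ofReal_ne_top]
    refine lintegral_congr fun y => ?_
    rw [← hωsq, enorm_mul, ENNReal.mul_rpow_of_nonneg _ _ (by norm_num), mul_assoc]
  have hω2 : MemLp (fun y => (A y)⁻¹) 2 volume := by
    refine ⟨hωc.aestronglyMeasurable, ?_⟩
    have h1 := hint fun _ => 1
    simp only [enorm_one, ENNReal.one_rpow, mul_one] at h1
    by_contra hc
    rw [not_lt, top_le_iff] at hc
    rw [hc, ENNReal.top_rpow_of_pos (by norm_num), ENNReal.mul_top (by simpa using hδ),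
      lintegral_sub_left_eq_self (scaledWeight δ) x] at h1
    have := lintegral_scaledWeight_le hδ
    rw [h1] at this
    norm_num at this
  set hh : ℝ → ℂ := fun y => (A y)⁻¹ * g y with hhdef
  have hh2 : MemLp hh 2 volume := hg.mul hω2
  set H : 𝓢'(ℝ, ℂ) := ((hh2.toLp hh : Lp ℂ 2 (volume : Measure ℝ)) : 𝓢'(ℝ, ℂ))
  have hH : IsRep H hh := isRep_toLp hh2
  set m₁ : ℝ → ℂ := fun ξ => -Complex.I * t * phi₁ ξ * grp t ξ with hm₁
  have hm := hasTemperateGrowth_grp t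
  have hphi₁ := hasTemperateGrowth_phi₁
  have hm₁t : m₁.HasTemperateGrowth := by fun_prop
  have hn1 := lpNorm_two_multiplier_le hm one_pos (fun ξ => (norm_grp t ξ).le) H
  have hn2 := lpNorm_two_multiplier_le hm₁t (abs_pos.2 ht0) (norm_grp₁_le t) H
  have hHn : lpNorm 2 H = eLpNorm hh 2 volume := lpNorm_eq h2 hh2 hH
  obtain ⟨k, hk2, hk⟩ := exists_rep (hn1.trans_lt
    (ENNReal.mul_lt_top ENNReal.ofReal_lt_top (hHn ▸ hh2.2)))
  obtain ⟨l, hl2, hl⟩ := exists_rep (hn2.trans_lt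
    (ENNReal.mul_lt_top ENNReal.ofReal_lt_top (hHn ▸ hh2.2)))
  rw [lpNorm_eq h2 hk2 hk, hHn] at hn1
  rw [lpNorm_eq h2 hl2 hl, hHn] at hn2
  have hf : IsRep f fun y => (a + b * y) * hh y := by
    refine h.congr (Eventually.of_forall fun y => ?_)
    simp only [hhdef]
    exact (mul_inv_cancel_left₀ (hA0 y) (g y)).symm
  have hrep := isRep_multiplier_affine_mul hm hm₁t (hasDerivAt_grp t) a b hk2 hl2 hH hf hk hl
  have hgtl := hgt.locallyIntegrable le_top
  have hloc : LocallyIntegrable fun y : ℝ => (a + b * y) * k y - Complex.I * b * l y := by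
    refine LocallyIntegrable.sub ?_ ?_
    · exact (hk2.locallyIntegrable h2).continuous_mul hAc
    · exact (hl2.const_mul _).locallyIntegrable h2
  have hae := ht.ae_eq hrep hgtl hloc
  have hb1 : ‖Complex.I * b‖ = δ := by
    rw [hb, norm_mul, norm_mul, Complex.norm_I, Complex.norm_real, Real.norm_of_nonneg hδ.le]
    ring
  have hfin : eLpNorm (fun y => (A y)⁻¹ * gt y) 2 volume ≤
      ENNReal.ofReal (1 + δ * |t|) * eLpNorm hh 2 volume := by
    have e1 : eLpNorm (fun y => (A y)⁻¹ * gt y) 2 volume =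
        eLpNorm (k - fun y => (A y)⁻¹ * (Complex.I * b * l y)) 2 volume := by
      refine eLpNorm_congr_ae ?_
      filter_upwards [hae] with y hy
      rw [hy, Pi.sub_apply, mul_sub]
      congr 1
      exact inv_mul_cancel_left₀ (hA0 y) (k y)
    have e2 : eLpNorm (fun y => (A y)⁻¹ * (Complex.I * b * l y)) 2 volume ≤
        ENNReal.ofReal δ * eLpNorm l 2 volume := by
      refine eLpNorm_le_mul_eLpNorm_of_ae_le_mul (Eventually.of_forall fun y => ?_) 2
      rw [norm_mul, norm_mul, hb1]
      exact mul_le_of_le_one_left (by positivity) (hω1 y)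
    rw [e1]
    refine (eLpNorm_sub_le hk2.1 (hωc.aestronglyMeasurable.mul (hl2.1.const_mul _)) h2).trans ?_
    calc _ ≤ ENNReal.ofReal 1 * eLpNorm hh 2 volume +
          ENNReal.ofReal δ * (ENNReal.ofReal |t| * eLpNorm hh 2 volume) :=
          add_le_add hn1 (e2.trans (mul_le_mul_right hn2 _))
      _ = _ := by
          rw [← mul_assoc, ← ENNReal.ofReal_mul hδ.le, ← add_mul,
            ← ENNReal.ofReal_add (by norm_num) (by positivity)]
  rw [hint, hint]
  calc _ ≤ ENNReal.ofReal δ * (ENNReal.ofReal (1 + δ * |t|) * eLpNorm hh 2 volume) ^ (2 : ℝ) := by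
        gcongr
    _ = _ := by
        rw [ENNReal.mul_rpow_of_nonneg _ _ (by norm_num), ENNReal.ofReal_rpow_of_nonneg (by positivity)
          (by norm_num), Real.rpow_two]
        ring

/-- Jensen's inequality for a measure of mass at most 4. -/
theorem scaledWeight_holder {δ : ℝ} (hδ : 0 < δ) {q : ℝ} (hq : 1 < q) {g : ℝ → ℝ≥0∞}
    (hg : AEMeasurable g) (x : ℝ) :
    (∫⁻ y, scaledWeight δ (x - y) * g y) ^ q ≤
      4 ^ (q - 1) * ∫⁻ y, scaledWeight δ (x - y) * g y ^ q := by
  have hq0 : 0 < q := by linarith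
  have hW : AEMeasurable fun y => scaledWeight δ (x - y) :=
    ((measurable_scaledWeight δ).comp (measurable_const.sub measurable_id)).aemeasurable
  have hi : ∫⁻ y, scaledWeight δ (x - y) ≤ 4 := by
    rw [lintegral_sub_left_eq_self (scaledWeight δ) x]
    exact lintegral_scaledWeight_le hδ
  have h := ENNReal.lintegral_mul_norm_pow_le hW (hW.mul (hg.pow_const q)) (p := 1 - 1 / q)
    (q := 1 / q) (by rw [sub_nonneg, div_le_one hq0]; exact hq.le) (by positivity) (by ring)
  have e : ∀ y, scaledWeight δ (x - y) ^ (1 - 1 / q) * (scaledWeight δ (x - y) * g y ^ q) ^ (1 / q) =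
      scaledWeight δ (x - y) * g y := fun y => by
    rw [ENNReal.mul_rpow_of_nonneg _ _ (by positivity), ← ENNReal.rpow_mul, mul_one_div_cancel hq0.ne',
      ENNReal.rpow_one, ← mul_assoc, ← ENNReal.rpow_add_of_nonneg _ _
        (by rw [sub_nonneg, div_le_one hq0]; exact hq.le) (by positivity), sub_add_cancel,
      ENNReal.rpow_one]
  simp only [Pi.mul_apply, e] at h
  calc _ ≤ ((∫⁻ y, scaledWeight δ (x - y)) ^ (1 - 1 / q) *
        (∫⁻ y, scaledWeight δ (x - y) * g y ^ q) ^ (1 / q)) ^ q := ENNReal.rpow_le_rpow h hq0.le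
    _ = (∫⁻ y, scaledWeight δ (x - y)) ^ (q - 1) * ∫⁻ y, scaledWeight δ (x - y) * g y ^ q := by
        rw [ENNReal.mul_rpow_of_nonneg _ _ hq0.le, ← ENNReal.rpow_mul, ← ENNReal.rpow_mul,
          one_div_mul_cancel hq0.ne', ENNReal.rpow_one]
        congr 2
        field_simp
    _ ≤ _ := by
        gcongr

theorem scaledWeight_le {δ : ℝ} (x : ℝ) : scaledWeight δ x ≤ ENNReal.ofReal δ :=
  mul_le_of_le_one_right' (cauchyWeight_le_one _)

/-! ### Local energy of linear solutions. -/

namespace ModSpace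

variable {P : ModParams}

theorem exists_fn (e : ModSpace P) : ∃ g : ℝ → ℂ, MemLp g ∞ volume ∧ IsRep e.dist g :=
  exists_rep_top P.isBump P.hs P.hp e.modNorm_dist_lt

/-- The bounded function representing an element of the modulation space. -/
def fn (e : ModSpace P) : ℝ → ℂ := (exists_fn e).choose

theorem memLp_fn_top (e : ModSpace P) : MemLp e.fn ∞ volume := (exists_fn e).choose_spec.1

theorem isRep_fn (e : ModSpace P) : IsRep e.dist e.fn := (exists_fn e).choose_spec.2

theorem aestronglyMeasurable_fn (e : ModSpace P) : AEStronglyMeasurable e.fn volume :=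
  e.memLp_fn_top.1

theorem exists_eLpNorm_fn_le (P : ModParams) : ∃ C : ℝ, 0 < C ∧ ∀ (q : ℝ≥0∞), P.p ≤ q →
    ∀ e : ModSpace P, eLpNorm e.fn q volume ≤ ENNReal.ofReal (C * ‖e‖) := by
  obtain ⟨C, hC, h⟩ := exists_lpNorm_dist_le P
  refine ⟨C, hC, fun q hq e => ?_⟩
  have h1 := h q hq e
  have hq1 := P.hp.trans hq
  obtain ⟨g, hg, hgr⟩ := exists_rep (h1.trans_lt ENNReal.ofReal_lt_top)
  rw [lpNorm_eq hq1 hg hgr] at h1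
  rwa [eLpNorm_congr_ae (e.isRep_fn.ae_eq_of_memLp le_top hq1 hgr e.memLp_fn_top hg)]

theorem exists_lintegral_fn_le (P : ModParams) : ∃ C : ℝ, 0 < C ∧ ∀ (q : ℝ), 1 ≤ q →
    P.p ≤ ENNReal.ofReal q → ∀ e : ModSpace P,
      ∫⁻ y, ‖e.fn y‖ₑ ^ q ≤ ENNReal.ofReal ((C * ‖e‖) ^ q) := by
  obtain ⟨C, hC, h⟩ := exists_eLpNorm_fn_le P
  refine ⟨C, hC, fun q hq hpq e => ?_⟩
  have hq0 : 0 < q := by linarith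
  have h1 := ENNReal.rpow_le_rpow (h _ hpq e) hq0.le
  rwa [eLpNorm_eq_lintegral_rpow_enorm_toReal (by simpa using hq0) (by simp),
    ENNReal.toReal_ofReal hq0.le, ← ENNReal.rpow_mul, one_div_mul_cancel hq0.ne', ENNReal.rpow_one,
    ENNReal.ofReal_rpow_of_nonneg (by positivity) hq0.le] at h1

/-- The local energy at scale `1/δ`. -/
def loc (δ : ℝ) (e : ModSpace P) (x : ℝ) : ℝ≥0∞ :=
  ∫⁻ y, scaledWeight δ (x - y) * ‖e.fn y‖ₑ ^ (2 : ℝ)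

theorem loc_group_le {δ : ℝ} (hδ : 0 < δ) (t : ℝ) (e : ModSpace P) (x : ℝ) :
    loc δ (group P t e) x ≤ ENNReal.ofReal ((1 + δ * |t|) ^ 2) * loc δ e x := by
  refine local_energy e.memLp_fn_top (memLp_fn_top _) e.isRep_fn ?_ hδ x
  rw [← dist_group]
  exact isRep_fn _

theorem loc_le_group {δ t : ℝ} (hδ : 0 < δ) (ht : δ * |t| ≤ 1) (e : ModSpace P) (x : ℝ) :
    loc δ e x ≤ 4 * loc δ (group P t e) x := by
  have h := loc_group_le hδ (-t) (group P t e) x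
  rw [← group_add, neg_add_cancel, group_zero, abs_neg] at h
  refine h.trans (mul_le_mul_left ?_ _)
  rw [show (4 : ℝ≥0∞) = ENNReal.ofReal 4 by simp]
  refine ENNReal.ofReal_le_ofReal ?_
  have := abs_nonneg t
  have : 0 ≤ δ * |t| := by positivity
  nlinarith

theorem aemeasurable_fn_rpow (e : ModSpace P) (a : ℝ) : AEMeasurable fun y => ‖e.fn y‖ₑ ^ a :=
  e.aestronglyMeasurable_fn.enorm.pow_const a

theorem aemeasurable_loc (δ : ℝ) (e : ModSpace P) : AEMeasurable (loc δ e) := by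
  have hm : AEMeasurable (Function.uncurry fun x y => scaledWeight δ (x - y) * ‖e.fn y‖ₑ ^ (2 : ℝ))
      (volume.prod volume) :=
    ((measurable_scaledWeight δ).comp (measurable_fst.sub measurable_snd)).aemeasurable.mul
      (e.aemeasurable_fn_rpow 2).comp_snd
  exact hm.lintegral_prod_right'

/-- Jensen, then the pointwise bound of the weight by δ; thus the local energy is O(δ^{2/p}‖e‖²). -/
theorem exists_loc_rpow_le {p : ℝ} (hp : 2 < p) (hP : P.p = ENNReal.ofReal p) : ∃ C : ℝ, 0 < C ∧
    ∀ (δ : ℝ), 0 < δ → ∀ (e : ModSpace P) (x : ℝ),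
      loc δ e x ^ (p / 2) ≤ ENNReal.ofReal (C * δ * ‖e‖ ^ p) := by
  obtain ⟨C, hC, h⟩ := exists_lintegral_fn_le P
  refine ⟨4 ^ (p / 2 - 1) * C ^ p, by positivity, fun δ hδ e x => ?_⟩
  refine (scaledWeight_holder hδ (by linarith) (e.aemeasurable_fn_rpow 2) x).trans ?_
  have h1 : ∫⁻ y, scaledWeight δ (x - y) * (‖e.fn y‖ₑ ^ (2 : ℝ)) ^ (p / 2) ≤
      ENNReal.ofReal δ * ENNReal.ofReal ((C * ‖e‖) ^ p) := by
    calc _ ≤ ∫⁻ y, ENNReal.ofReal δ * ‖e.fn y‖ₑ ^ p := by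
          refine lintegral_mono fun y => ?_
          simp only
          rw [← ENNReal.rpow_mul, mul_div_cancel₀ p two_ne_zero]
          exact mul_le_mul_left (scaledWeight_le _) _
      _ = ENNReal.ofReal δ * ∫⁻ y, ‖e.fn y‖ₑ ^ p := lintegral_const_mul' _ _ ENNReal.ofReal_ne_top
      _ ≤ _ := by
          gcongr
          exact h p (by linarith) hP.le e
  refine (mul_le_mul_right h1 _).trans (le_of_eq ?_)
  rw [show (4 : ℝ≥0∞) = ENNReal.ofReal 4 by simp, ENNReal.ofReal_rpow_of_pos (by norm_num),
    ← ENNReal.ofReal_mul hδ.le, ← ENNReal.ofReal_mul (by positivity),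
    Real.mul_rpow hC.le (norm_nonneg _)]
  congr 1
  ring

theorem exists_lintegral_loc_le (hP : P.p = ENNReal.ofReal 6) : ∃ C : ℝ, 0 < C ∧
    ∀ (δ : ℝ), 0 < δ → ∀ (e : ModSpace P),
      ∫⁻ x, loc δ e x ^ (3 : ℝ) ≤ ENNReal.ofReal (C * ‖e‖ ^ (6 : ℝ)) := by
  obtain ⟨C, hC, h⟩ := exists_lintegral_fn_le P
  refine ⟨64 * C ^ (6 : ℝ), by positivity, fun δ hδ e => ?_⟩
  calc _ ≤ ∫⁻ x, 4 ^ (3 - 1 : ℝ) * ∫⁻ y, scaledWeight δ (x - y) * (‖e.fn y‖ₑ ^ (2 : ℝ)) ^ (3 : ℝ) :=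
        lintegral_mono fun x => scaledWeight_holder hδ (by norm_num) (e.aemeasurable_fn_rpow 2) x
    _ = 4 ^ (3 - 1 : ℝ) * ∫⁻ x, ∫⁻ y, scaledWeight δ (x - y) * (‖e.fn y‖ₑ ^ (2 : ℝ)) ^ (3 : ℝ) :=
        lintegral_const_mul' _ _ (by norm_num)
    _ ≤ 4 ^ (3 - 1 : ℝ) * (4 * ∫⁻ y, (‖e.fn y‖ₑ ^ (2 : ℝ)) ^ (3 : ℝ)) := by
        gcongr
        exact lintegral_scaledWeight_conv hδ ((e.aemeasurable_fn_rpow 2).pow_const 3)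
    _ ≤ 4 ^ (3 - 1 : ℝ) * (4 * ENNReal.ofReal ((C * ‖e‖) ^ (6 : ℝ))) := by
        gcongr
        simp only [← ENNReal.rpow_mul]
        norm_num1
        exact h 6 (by norm_num) hP.le e
    _ = _ := by
        rw [show (4 : ℝ≥0∞) = ENNReal.ofReal 4 by simp, ENNReal.ofReal_rpow_of_pos (by norm_num),
          ← ENNReal.ofReal_mul (by norm_num), ← ENNReal.ofReal_mul (by positivity),
          Real.mul_rpow hC.le (norm_nonneg _)]
        congr 1
        norm_num
        ring

/-- Averaging in time. -/
theorem rpow_mul_le_of_forall_group {A : ℝ≥0∞} {c r a L : ℝ} (hr : 0 < r) (hc : 0 ≤ c)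
    {e : ModSpace P} (h : ∀ t ∈ Set.Icc a (a + L), A ≤ ENNReal.ofReal (c * ‖group P t e‖ ^ (2 : ℝ))) :
    A ^ (r / 2) * ENNReal.ofReal L ≤
      ENNReal.ofReal (c ^ (r / 2)) * ∫⁻ t in Set.Icc a (a + L), ‖group P t e‖ₑ ^ r := by
  calc A ^ (r / 2) * ENNReal.ofReal L = ∫⁻ _ in Set.Icc a (a + L), A ^ (r / 2) := by
        rw [setLIntegral_const, Real.volume_Icc, add_sub_cancel_left]
    _ ≤ ∫⁻ t in Set.Icc a (a + L), ENNReal.ofReal (c ^ (r / 2)) * ‖group P t e‖ₑ ^ r := by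
        refine setLIntegral_mono' measurableSet_Icc fun t ht => ?_
        refine (ENNReal.rpow_le_rpow (h t ht) (by positivity)).trans (le_of_eq ?_)
        rw [ENNReal.ofReal_mul hc, ENNReal.mul_rpow_of_nonneg _ _ (by positivity),
          ENNReal.ofReal_rpow_of_nonneg hc (by positivity), ← ENNReal.ofReal_rpow_of_nonneg
          (norm_nonneg _) (by norm_num), ofReal_norm, ← ENNReal.rpow_mul, mul_div_cancel₀ r two_ne_zero]
    _ = _ := lintegral_const_mul' _ _ ENNReal.ofReal_ne_top

/-- The local energy of a linear solution in `L^r` in time. -/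
theorem exists_lintegral_loc_group_le (hP : P.p = ENNReal.ofReal 6) {r : ℝ} (hr : 0 < r) :
    ∃ C : ℝ, 0 < C ∧ ∀ (δ : ℝ), 0 < δ → ∀ (e : ModSpace P) (η : ℝ), 0 ≤ η →
      ∫⁻ t, ‖group P t e‖ₑ ^ r ≤ ENNReal.ofReal (η ^ r) → ∀ τ : ℝ,
      (∫⁻ x, loc δ (group P τ e) x ^ (3 : ℝ)) ^ (1 / 3 : ℝ) ≤
        ENNReal.ofReal (C * δ ^ (2 / r) * η ^ (2 : ℝ)) := by
  obtain ⟨C, hC, h⟩ := exists_lintegral_loc_le (P := P) hP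
  refine ⟨4 * C ^ (1 / 3 : ℝ), by positivity, fun δ hδ e η hη he τ => ?_⟩
  set A := (∫⁻ x, loc δ (group P τ e) x ^ (3 : ℝ)) ^ (1 / 3 : ℝ) with hA
  -- During a time 1/δ the local energy at scale 1/δ changes by a factor of at most 4, so A is
  -- bounded by ‖S(t)e‖² throughout an interval of length 1/δ; averaging over it gains the power of
  -- δ.
  have h1 : ∀ t ∈ Set.Icc τ (τ + δ⁻¹),
      A ≤ ENNReal.ofReal (4 * C ^ (1 / 3 : ℝ) * ‖group P t e‖ ^ (2 : ℝ)) := by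
    intro t ht
    have ht' : δ * |t - τ| ≤ 1 := by
      rw [abs_of_nonneg (by linarith [ht.1])]
      calc δ * (t - τ) ≤ δ * δ⁻¹ := by
            gcongr
            linarith [ht.2]
        _ = 1 := mul_inv_cancel₀ hδ.ne'
    have h2 : ∀ x, loc δ (group P τ e) x ≤ 4 * loc δ (group P t e) x := fun x => by
      have := loc_le_group hδ ht' (group P τ e) x
      rwa [← group_add, sub_add_cancel] at this
    calc A ≤ (∫⁻ x, (4 * loc δ (group P t e) x) ^ (3 : ℝ)) ^ (1 / 3 : ℝ) := by
          rw [hA]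
          gcongr with x
          exact h2 x
      _ = 4 * (∫⁻ x, loc δ (group P t e) x ^ (3 : ℝ)) ^ (1 / 3 : ℝ) := by
          simp_rw [ENNReal.mul_rpow_of_nonneg _ _ (by norm_num : (0 : ℝ) ≤ 3)]
          rw [lintegral_const_mul' _ _ (by norm_num), ENNReal.mul_rpow_of_nonneg _ _ (by norm_num),
            ← ENNReal.rpow_mul]
          norm_num
      _ ≤ 4 * ENNReal.ofReal (C * ‖group P t e‖ ^ (6 : ℝ)) ^ (1 / 3 : ℝ) := by
          gcongr
          exact h δ hδ _
      _ = _ := by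
          rw [ENNReal.ofReal_rpow_of_nonneg (by positivity) (by norm_num), Real.mul_rpow hC.le
            (by positivity), ← Real.rpow_mul (norm_nonneg _), show (4 : ℝ≥0∞) = ENNReal.ofReal 4 by simp,
            ← ENNReal.ofReal_mul (by norm_num), mul_assoc]
          norm_num
  have h2 := rpow_mul_le_of_forall_group hr (by positivity) h1
  have h3 : A ^ (r / 2) ≤
      ENNReal.ofReal ((4 * C ^ (1 / 3 : ℝ)) ^ (r / 2) * (δ * η ^ r)) := by
    have h4 : A ^ (r / 2) = A ^ (r / 2) * ENNReal.ofReal δ⁻¹ * ENNReal.ofReal δ := by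
      rw [mul_assoc, ← ENNReal.ofReal_mul (by positivity), inv_mul_cancel₀ hδ.ne', ENNReal.ofReal_one,
        mul_one]
    rw [h4]
    refine (mul_le_mul_left (h2.trans (mul_le_mul_right ((setLIntegral_le_lintegral _ _).trans he) _))
      _).trans (le_of_eq ?_)
    rw [← ENNReal.ofReal_mul (by positivity), ← ENNReal.ofReal_mul (by positivity)]
    congr 1
    ring
  have h5 := ENNReal.rpow_le_rpow h3 (by positivity : 0 ≤ 2 / r)
  rw [← ENNReal.rpow_mul, div_mul_div_cancel₀ two_ne_zero, div_self hr.ne', ENNReal.rpow_one,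
    ENNReal.ofReal_rpow_of_nonneg (by positivity) (by positivity), Real.mul_rpow (by positivity)
    (by positivity), Real.mul_rpow hδ.le (by positivity), ← Real.rpow_mul (by positivity),
    ← Real.rpow_mul hη, div_mul_div_cancel₀ two_ne_zero, div_self hr.ne', Real.rpow_one,
    mul_div_cancel₀ 2 hr.ne'] at h5
  rwa [mul_assoc]

/-- A linear solution in `L^r` with `r` small vanishes. -/
theorem eq_zero_of_lintegral_group {p : ℝ} (hp : 2 < p) (hP : P.p = ENNReal.ofReal p) {r : ℝ}
    (hr : 0 < r) (hrp : r / 2 ≤ r / p + 1) {e : ModSpace P}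
    (he : ∫⁻ t, ‖group P t e‖ₑ ^ r ≠ ∞) : e = 0 := by
  have hp0 : 0 < p := by linarith
  obtain ⟨C, hC, h⟩ := exists_loc_rpow_le hp hP
  set I : ℝ≥0∞ := ∫⁻ y, cauchyWeight (0 - y) * ‖e.fn y‖ₑ ^ (2 : ℝ) with hI
  set c : ℝ := (4 * C ^ (2 / p)) with hc
  have hcpos : 0 < c := by positivity
  -- In terms of R = 1/δ: the energy of e within distance R is controlled at all times in [R/2, R]
  -- by R^{1-2/p}‖S(t)e‖². Averaging over these times costs R^{r/2 - r/p - 1}, which is bounded by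
  -- hypothesis, against the tail of a convergent integral.
  have key : ∀ δ : ℝ, 0 < δ → δ ≤ 1 → I ^ (r / 2) ≤ ENNReal.ofReal (2 * c ^ (r / 2)) *
      ∫⁻ t in Set.Ici (2 * δ)⁻¹, ‖group P t e‖ₑ ^ r := by
    intro δ hδ hδ1
    have h0 : ENNReal.ofReal δ * I ≤ loc δ e 0 := by
      rw [hI, ← lintegral_const_mul' _ _ ENNReal.ofReal_ne_top]
      refine lintegral_mono fun y => ?_
      simp only [scaledWeight]
      rw [← mul_assoc]
      gcongr
      unfold cauchyWeight
      refine ENNReal.ofReal_le_ofReal (one_div_le_one_div_of_le (by positivity) ?_)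
      have : δ ^ 2 ≤ 1 := by nlinarith
      nlinarith [mul_nonneg (sub_nonneg.2 this) (sq_nonneg (0 - y))]
    have h1 : ∀ t ∈ Set.Icc (2 * δ)⁻¹ ((2 * δ)⁻¹ + (2 * δ)⁻¹),
        loc δ e 0 ≤ ENNReal.ofReal (c * δ ^ (2 / p) * ‖group P t e‖ ^ (2 : ℝ)) := by
      intro t ht
      have ht0 : 0 < (2 * δ)⁻¹ := by positivity
      have ht' : δ * |t| ≤ 1 := by
        rw [abs_of_nonneg (by linarith [ht.1])]
        calc δ * t ≤ δ * ((2 * δ)⁻¹ + (2 * δ)⁻¹) := by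
              gcongr
              exact ht.2
          _ = 1 := by
              field_simp
              norm_num
      refine (loc_le_group hδ ht' e 0).trans ?_
      have h2 := ENNReal.rpow_le_rpow (h δ hδ (group P t e) 0) (by positivity : 0 ≤ 2 / p)
      rw [← ENNReal.rpow_mul, div_mul_div_cancel₀ two_ne_zero, div_self hp0.ne', ENNReal.rpow_one,
        ENNReal.ofReal_rpow_of_nonneg (by positivity) (by positivity), Real.mul_rpow (by positivity)
        (by positivity), Real.mul_rpow hC.le hδ.le, ← Real.rpow_mul (norm_nonneg _),
        mul_div_cancel₀ 2 hp0.ne'] at h2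
      refine (mul_le_mul_right h2 _).trans (le_of_eq ?_)
      rw [show (4 : ℝ≥0∞) = ENNReal.ofReal 4 by simp, ← ENNReal.ofReal_mul (by norm_num), hc]
      congr 1
      ring
    have h2 := rpow_mul_le_of_forall_group hr (by positivity) h1
    have h3 : (ENNReal.ofReal δ * I) ^ (r / 2) ≤ ENNReal.ofReal (2 * c ^ (r / 2) * δ ^ (r / p + 1)) *
        ∫⁻ t in Set.Ici (2 * δ)⁻¹, ‖group P t e‖ₑ ^ r := by
      have h4 : loc δ e 0 ^ (r / 2) =
          loc δ e 0 ^ (r / 2) * ENNReal.ofReal (2 * δ)⁻¹ * ENNReal.ofReal (2 * δ) := by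
        rw [mul_assoc, ← ENNReal.ofReal_mul (by positivity), inv_mul_cancel₀ (by positivity),
          ENNReal.ofReal_one, mul_one]
      refine (ENNReal.rpow_le_rpow h0 (by positivity)).trans ?_
      rw [h4]
      refine (mul_le_mul_left (h2.trans (mul_le_mul_right (lintegral_mono_set
        Set.Icc_subset_Ici_self) _)) _).trans (le_of_eq ?_)
      rw [mul_right_comm, ← ENNReal.ofReal_mul (by positivity)]
      congr 2
      rw [Real.mul_rpow hcpos.le (by positivity), ← Real.rpow_mul hδ.le,
        div_mul_div_cancel₀' two_ne_zero, Real.rpow_add_one hδ.ne']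
      ring
    have hδr : δ ^ (r / p + 1) ≤ δ ^ (r / 2) := Real.rpow_le_rpow_of_exponent_ge hδ hδ1 hrp
    have hδpos : 0 < δ ^ (r / 2) := by positivity
    rw [ENNReal.mul_rpow_of_nonneg _ _ (by positivity), ENNReal.ofReal_rpow_of_nonneg hδ.le
      (by positivity)] at h3
    have h4 : ENNReal.ofReal (δ ^ (r / 2)) * I ^ (r / 2) ≤ ENNReal.ofReal (δ ^ (r / 2)) *
        (ENNReal.ofReal (2 * c ^ (r / 2)) * ∫⁻ t in Set.Ici (2 * δ)⁻¹, ‖group P t e‖ₑ ^ r) := by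
      refine h3.trans ?_
      rw [← mul_assoc, ← ENNReal.ofReal_mul (by positivity)]
      refine mul_le_mul_left (ENNReal.ofReal_le_ofReal ?_) _
      rw [mul_comm]
      gcongr
    exact (ENNReal.mul_le_mul_iff_right (by simpa using hδpos) ENNReal.ofReal_ne_top).1 h4
  have hmeas : Measurable fun t => ‖group P t e‖ₑ ^ r :=
    ((continuous_group.clm_apply continuous_const).enorm.measurable).pow_const r
  have hlim : Tendsto (fun n : ℕ => ∫⁻ t in Set.Ici (n : ℝ), ‖group P t e‖ₑ ^ r) atTop (𝓝 0) := by
    have h1 : Tendsto (fun n : ℕ => ∫⁻ t, (Set.Ici (n : ℝ)).indicator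
        (fun t => ‖group P t e‖ₑ ^ r) t) atTop (𝓝 (∫⁻ _ : ℝ, 0)) := by
      refine tendsto_lintegral_of_dominated_convergence (fun t => ‖group P t e‖ₑ ^ r)
        (fun n => hmeas.indicator measurableSet_Ici)
        (fun n => Eventually.of_forall fun t => Set.indicator_le_self _ _ _) he
        (Eventually.of_forall fun t => ?_)
      refine tendsto_const_nhds.congr' ?_
      filter_upwards [eventually_gt_atTop ⌈t⌉₊] with n hn
      rw [Set.indicator_of_notMem]
      rw [Set.mem_Ici, not_le]
      exact (Nat.le_ceil t).trans_lt (by exact_mod_cast hn)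
    rw [lintegral_zero] at h1
    refine h1.congr fun n => ?_
    rw [lintegral_indicator measurableSet_Ici]
  have hI0 : I ^ (r / 2) = 0 := by
    have h1 : I ^ (r / 2) ≤ ENNReal.ofReal (2 * c ^ (r / 2)) * 0 := by
      refine ge_of_tendsto (ENNReal.Tendsto.const_mul hlim (Or.inr ENNReal.ofReal_ne_top)) ?_
      filter_upwards [eventually_ge_atTop 1] with n hn
      have hn1 : (1 : ℝ) ≤ n := by exact_mod_cast hn
      have := key (2 * n)⁻¹ (by positivity) (inv_le_one_of_one_le₀ (by linarith))
      have e1 : (2 * (2 * (n : ℝ))⁻¹)⁻¹ = n := by field_simp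
      rwa [e1] at this
    rw [mul_zero] at h1
    exact le_antisymm h1 zero_le
  have hI1 : I = 0 := by
    rwa [ENNReal.rpow_eq_zero_iff_of_pos (by positivity)] at hI0
  have hm : AEMeasurable fun y => cauchyWeight (0 - y) * ‖e.fn y‖ₑ ^ (2 : ℝ) :=
    (measurable_cauchyWeight.comp (measurable_const.sub measurable_id)).aemeasurable.mul
      (e.aemeasurable_fn_rpow 2)
  have h0 := (lintegral_eq_zero_iff' hm).1 hI1
  have hfn : e.fn =ᵐ[volume] fun _ => 0 := by
    filter_upwards [h0] with y hy
    simp only [Pi.zero_apply, mul_eq_zero] at hy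
    rcases hy with hy | hy
    · rw [cauchyWeight, ENNReal.ofReal_eq_zero] at hy
      have : 0 < 1 / (1 + (0 - y) ^ 2) := by positivity
      linarith
    · rw [ENNReal.rpow_eq_zero_iff_of_pos (by norm_num)] at hy
      exact enorm_eq_zero.1 hy
  refine dist_injective ?_
  ext ψ
  rw [(e.isRep_fn.congr hfn) ψ, dist_zero]
  simp

end ModSpace

/-! ### L² bounds by duality and the dual exponents. -/

/-- The Riesz representation of a distribution which is bounded in `L²`. -/
theorem lpNorm_two_le_of_forall {f : 𝓢'(ℝ, ℂ)} {η : ℝ} (hη : 0 ≤ η)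
    (h : ∀ ψ : 𝓢(ℝ, ℂ), ‖f ψ‖ ≤ η * ‖ψ.toLp 2 volume‖) : lpNorm 2 f ≤ ENNReal.ofReal η := by
  set e : 𝓢(ℝ, ℂ) →ₗ[ℂ] Lp ℂ 2 (volume : Measure ℝ) := (SchwartzMap.toLpCLM ℂ ℂ 2 volume).toLinearMap
  have hdense : DenseRange e := SchwartzMap.denseRange_toLpCLM (F := ℂ) (by norm_num)
  set T₀ : 𝓢(ℝ, ℂ) →ₗ[ℂ] ℂ := { toFun := f, map_add' := map_add f, map_smul' := map_smul f }
  set T := T₀.extendOfNorm e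
  have hT : ∀ ψ, T (e ψ) = f ψ := fun ψ => LinearMap.extendOfNorm_eq hdense ⟨η, h⟩ ψ
  have hTn : ‖T‖ ≤ η := T.opNorm_le_bound hη (LinearMap.norm_extendOfNorm_apply_le hdense η h)
  set G := (InnerProductSpace.toDual ℂ (Lp ℂ 2 (volume : Measure ℝ))).symm T
  have hG : ‖G‖ ≤ η := by rwa [LinearIsometryEquiv.norm_map]
  have hrep : IsRep f fun x => star (G x) := fun ψ => by
    rw [← hT, ← InnerProductSpace.toDual_symm_apply, L2.inner_def]
    refine integral_congr_ae ?_
    filter_upwards [ψ.coeFn_toLp 2 volume] with x hx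
    have : (e ψ : ℝ → ℂ) x = ψ x := hx
    rw [this]
    simp [G]
  have hm : MemLp (fun x => star (G x)) 2 volume := (Lp.memLp G).star
  refine (lpNorm_le hm hrep).trans ?_
  have : eLpNorm (fun x => star (G x)) 2 volume = eLpNorm G 2 volume :=
    eLpNorm_congr_norm_ae (Eventually.of_forall fun x => norm_star _)
  rw [this, ← Lp.enorm_def, ← ofReal_norm]
  exact ENNReal.ofReal_le_ofReal hG

theorem enorm_apply_le_lpNorm_two (f : 𝓢'(ℝ, ℂ)) (ψ : 𝓢(ℝ, ℂ)) :
    ‖f ψ‖ₑ ≤ lpNorm 2 f * ‖ψ.toLp 2 volume‖ₑ := by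
  have h2 : (1 : ℝ≥0∞) ≤ 2 := by norm_num
  rcases eq_or_ne (lpNorm 2 f) ∞ with h | h
  · rcases eq_or_ne (ψ.toLp 2 volume) 0 with h0 | h0
    · have h1 : ψ = 0 := by
        ext x
        have h3 : (ψ : ℝ → ℂ) =ᵐ[volume] 0 :=
          (ψ.coeFn_toLp 2 volume).symm.trans (by rw [h0]; exact Lp.coeFn_zero _ _ _)
        exact congrFun ((ψ.continuous.ae_eq_iff_eq volume continuous_zero).1 h3) x
      simp [h1]
    · rw [h, ENNReal.top_mul (by simpa using h0)]
      exact le_top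
  obtain ⟨g, hg, hr⟩ := exists_rep h.lt_top
  rw [lpNorm_eq h2 hg hr, hr ψ]
  have h3 : MemLp ψ 2 volume := ψ.memLp 2 volume
  have h4 : ‖ψ.toLp 2 volume‖ₑ = eLpNorm ψ 2 volume := by
    rw [Lp.enorm_def]
    exact eLpNorm_congr_ae (ψ.coeFn_toLp 2 volume)
  rw [h4, mul_comm]
  refine (enorm_integral_le_lintegral_enorm _).trans ?_
  have h5 := eLpNorm_smul_le_mul_eLpNorm (p := 2) (q := 2) (r := 1) hg.1 h3.1
  rwa [eLpNorm_one_eq_lintegral_enorm] at h5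

/-- The point of p = λ+2: p/(λ+1) is the conjugate exponent of p, so the power estimate lands where
the decay estimate starts. -/
theorem exponents_eq {p : ℝ≥0∞} {lam : ℕ} (hp : p = (lam : ℝ≥0∞) + 2) :
    p = ENNReal.ofReal ((lam : ℝ) + 2) ∧ p / ((lam + 1 : ℕ) : ℝ≥0∞) =
      ENNReal.ofReal (((lam : ℝ) + 2) / (((lam : ℝ) + 2) - 1)) := by
  have h1 : p = ENNReal.ofReal ((lam : ℝ) + 2) := by
    rw [hp, ENNReal.ofReal_add (by positivity) (by norm_num)]
    simp
  refine ⟨h1, ?_⟩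
  rw [h1, show ((lam : ℝ) + 2) - 1 = ((lam + 1 : ℕ) : ℝ) by push_cast; ring,
    ENNReal.ofReal_div_of_pos (by positivity), ENNReal.ofReal_natCast]

/-! ### The nonlinearity -/

theorem distPow_zero (n : ℕ) : distPow (n + 1) 0 = 0 := by
  have h0 : IsRep 0 fun _ => 0 := fun ψ => by
    rw [show (0 : 𝓢'(ℝ, ℂ)) ψ = 0 from rfl]
    simp
  refine (isRep_distPow (memLp_top_const 0) h0 (n + 1)).unique ?_
  simpa using h0

theorem S_sub (t : ℝ) (f f' : 𝓢'(ℝ, ℂ)) : S t (f - f') = S t f - S t f' := multiplier_sub _ _ _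

theorem phiD_sub (f f' : 𝓢'(ℝ, ℂ)) : phiD (f - f') = phiD f - phiD f' := multiplier_sub _ _ _

open Classical in
/-- The nonlinearity `φ(D)[e^{λ+1}]`, as a map on the modulation space. -/
def nonlin (P : ModParams) (lam : ℕ) (e : ModSpace P) : ModSpace P :=
  if h : modNorm P.ρ P.s P.p 1 (phiD (distPow (lam + 1) e.dist)) < ∞ then ModSpace.mk _ h else 0

/-- The integrand of the Duhamel integral, as a map on the modulation space. -/
def duhamelMap (P : ModParams) (lam : ℕ) (t : ℝ) (e : ModSpace P) : ModSpace P :=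
  (-(Complex.I / ((lam : ℂ) + 1))) • ModSpace.group P t (nonlin P lam e)

theorem norm_coeff_le (lam : ℕ) : ‖-(Complex.I / ((lam : ℂ) + 1))‖ ≤ 1 := by
  rw [norm_neg, norm_div, Complex.norm_I, show (lam : ℂ) + 1 = ((lam + 1 : ℝ) : ℂ) by push_cast; rfl,
    Complex.norm_real, Real.norm_of_nonneg (by positivity)]
  refine div_le_one_of_le₀ ?_ (by positivity)
  have : (0 : ℝ) ≤ lam := by positivity
  linarith

section Nonlin

variable {P : ModParams} {lam : ℕ} (hlam : 1 ≤ lam) (hP : P.p = (lam : ℝ≥0∞) + 2)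

include hlam hP

/-- The default value 0 is never taken: the decay estimate at t = 0 already puts φ(D)[e^{λ+1}] into
the space. -/
theorem dist_nonlin (e : ModSpace P) : (nonlin P lam e).dist = phiD (distPow (lam + 1) e.dist) := by
  obtain ⟨h1, h2⟩ := exponents_eq hP
  have hp : (2 : ℝ) < (lam : ℝ) + 2 := by
    have : (1 : ℝ) ≤ lam := by exact_mod_cast hlam
    linarith
  obtain ⟨C₁, hC₁, hd⟩ := exists_modNorm_decay P.isBump hp
  obtain ⟨C₂, hC₂, hn⟩ := exists_modNorm_distPow_le P.isBump P.hs lam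
  have h3 := hd P.s 0 (distPow (lam + 1) e.dist)
  rw [S_zero, ← h1, ← h2] at h3
  have hle : ((lam + 1 : ℕ) : ℝ≥0∞) ≤ P.p := by
    rw [hP]
    push_cast
    gcongr
    norm_num
  have h4 := hn P.p (by rw [h1]; simp) hle e.dist e.modNorm_dist_lt
  have h5 : modNorm P.ρ P.s P.p 1 (phiD (distPow (lam + 1) e.dist)) < ∞ :=
    h3.trans_lt (ENNReal.mul_lt_top ENNReal.ofReal_lt_top (h4.trans_lt
      (ENNReal.mul_lt_top ENNReal.ofReal_lt_top (ENNReal.pow_lt_top e.modNorm_dist_lt))))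
  rw [nonlin, dif_pos h5, ModSpace.dist_mk]

theorem dist_duhamelMap (t : ℝ) (e : ModSpace P) : (duhamelMap P lam t e).dist =
    (-(Complex.I / ((lam : ℂ) + 1))) • S t (phiD (distPow (lam + 1) e.dist)) := by
  rw [duhamelMap, ModSpace.dist_smul, ModSpace.dist_group, dist_nonlin hlam hP]

theorem duhamelMap_zero (t : ℝ) : duhamelMap P lam t 0 = 0 := by
  have h : nonlin P lam 0 = 0 := by
    refine ModSpace.dist_injective ?_
    rw [dist_nonlin hlam hP, ModSpace.dist_zero, distPow_zero, phiD_eq, multiplier_zero]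
  rw [duhamelMap, h, map_zero, smul_zero]

/-- The decay M^s_{p',1} → M^s_{p,1} composed with the difference estimate for powers; (1-2/p)/3
becomes λ/(3(λ+2)). -/
theorem exists_group_nonlin_sub_le : ∃ M : ℝ, 0 < M ∧ ∀ (t : ℝ) (e e' : ModSpace P),
    ‖ModSpace.group P t (nonlin P lam e) - ModSpace.group P t (nonlin P lam e')‖ ≤
      M * (1 + |t|) ^ (-((lam : ℝ) / (3 * ((lam : ℝ) + 2)))) * (‖e‖ + ‖e'‖) ^ lam * ‖e - e'‖ := by
  obtain ⟨h1, h2⟩ := exponents_eq hP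
  have hl : (1 : ℝ) ≤ lam := by exact_mod_cast hlam
  have hp : (2 : ℝ) < (lam : ℝ) + 2 := by linarith
  obtain ⟨C₁, hC₁, hd⟩ := exists_modNorm_decay P.isBump hp
  obtain ⟨C₂, hC₂, hn⟩ := exists_modNorm_distPow_sub_le P.isBump P.hs lam
  have hle : ((lam + 1 : ℕ) : ℝ≥0∞) ≤ P.p := by
    rw [hP]
    push_cast
    gcongr
    norm_num
  refine ⟨C₁ * C₂, by positivity, fun t e e' => ModSpace.norm_le_of_modNorm_le (by positivity) ?_⟩
  have h3 := hd P.s t (distPow (lam + 1) e.dist - distPow (lam + 1) e'.dist)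
  rw [← h1, ← h2] at h3
  rw [ModSpace.dist_sub, ModSpace.dist_group, ModSpace.dist_group, dist_nonlin hlam hP,
    dist_nonlin hlam hP, ← S_sub, ← phiD_sub]
  refine h3.trans ((mul_le_mul_right (hn P.p (by rw [h1]; simp) hle e.dist e'.dist
    e.modNorm_dist_lt e'.modNorm_dist_lt) _).trans (le_of_eq ?_))
  rw [← ModSpace.dist_sub, ModSpace.modNorm_dist, ModSpace.modNorm_dist, ModSpace.modNorm_dist,
    ← ENNReal.ofReal_add (norm_nonneg _) (norm_nonneg _), ← ENNReal.ofReal_pow (by positivity),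
    ← ENNReal.ofReal_mul (by positivity), ← ENNReal.ofReal_mul (by positivity),
    ← ENNReal.ofReal_mul (by positivity)]
  have e1 : (1 - 2 / ((lam : ℝ) + 2)) / 3 = (lam : ℝ) / (3 * ((lam : ℝ) + 2)) := by
    field_simp
    ring
  rw [e1]
  congr 1
  ring

theorem exists_duhamelMap_sub_le : ∃ M : ℝ, 0 < M ∧ ∀ (t : ℝ) (e e' : ModSpace P),
    ‖duhamelMap P lam t e - duhamelMap P lam t e'‖ ≤
      M * (1 + |t|) ^ (-((lam : ℝ) / (3 * ((lam : ℝ) + 2)))) * (‖e‖ + ‖e'‖) ^ lam * ‖e - e'‖ := by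
  obtain ⟨M, hM, h⟩ := exists_group_nonlin_sub_le hlam hP
  refine ⟨M, hM, fun t e e' => ?_⟩
  rw [duhamelMap, duhamelMap, ← smul_sub, norm_smul]
  exact (mul_le_of_le_one_left (norm_nonneg _) (norm_coeff_le lam)).trans (h t e e')

theorem continuous_nonlin : Continuous (nonlin P lam) := by
  obtain ⟨M, hM, h⟩ := exists_group_nonlin_sub_le hlam hP
  rw [continuous_iff_continuousAt]
  intro e
  rw [ContinuousAt, tendsto_iff_norm_sub_tendsto_zero]
  have h1 : Continuous fun e' : ModSpace P =>
      M * (1 + |(0 : ℝ)|) ^ (-((lam : ℝ) / (3 * ((lam : ℝ) + 2)))) * (‖e'‖ + ‖e‖) ^ lam * ‖e' - e‖ := by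
    fun_prop
  have h2 := h1.tendsto e
  rw [sub_self, norm_zero, mul_zero] at h2
  refine squeeze_zero (fun _ => norm_nonneg _) (fun e' => ?_) h2
  have := h 0 e' e
  rwa [ModSpace.group_zero, ModSpace.group_zero] at this

theorem continuous_duhamelMap : Continuous (Function.uncurry (duhamelMap P lam)) := by
  have h : Continuous fun z : ℝ × ModSpace P => ModSpace.group P z.1 (nonlin P lam z.2) :=
    (ModSpace.continuous_group.comp continuous_fst).clm_apply
      ((continuous_nonlin hlam hP).comp continuous_snd)
  exact h.const_smul (-(Complex.I / ((lam : ℂ) + 1)))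

theorem exists_norm_duhamelMap_le : ∃ M : ℝ, 0 < M ∧ ∀ (t : ℝ) (e : ModSpace P),
    ‖duhamelMap P lam t e‖ ≤
      M * (1 + |t|) ^ (-((lam : ℝ) / (3 * ((lam : ℝ) + 2)))) * ‖e‖ ^ (lam + 1) := by
  obtain ⟨M, hM, h⟩ := exists_duhamelMap_sub_le hlam hP
  refine ⟨M, hM, fun t e => ?_⟩
  have := h t e 0
  rw [duhamelMap_zero hlam hP, sub_zero, norm_zero, add_zero, sub_zero] at this
  rwa [pow_succ, ← mul_assoc]

end Nonlin

/-! ### The quartic nonlinearity -/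

theorem isRep_distPow_fn {P : ModParams} (m : ℕ) (e : ModSpace P) : IsRep (distPow m e.dist) fun x => e.fn x ^ m :=
  isRep_distPow e.memLp_fn_top e.isRep_fn m

section Quintic

variable {P : ModParams} (hP : P.p = ((4 : ℕ) : ℝ≥0∞) + 2)

include hP

theorem p_eq_six : P.p = ENNReal.ofReal 6 := by
  rw [(exponents_eq hP).1]
  norm_num

theorem p_div_five_eq : P.p / ((4 + 1 : ℕ) : ℝ≥0∞) = ENNReal.ofReal (6 / (6 - 1)) := by
  rw [(exponents_eq hP).2]
  norm_num

/-- The nonlinearity is bounded in `L²`. -/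
theorem exists_norm_duhamelMap_apply_le : ∃ C : ℝ, 0 < C ∧ ∀ (t : ℝ) (e : ModSpace P)
    (ψ : 𝓢(ℝ, ℂ)), ‖(duhamelMap P 4 t e).dist ψ‖ ≤ C * ‖e‖ ^ (5 : ℝ) * ‖ψ.toLp 2 volume‖ := by
  obtain ⟨C, hC, h⟩ := ModSpace.exists_lintegral_fn_le P
  refine ⟨C ^ (5 : ℝ), by positivity, fun t e ψ => ?_⟩
  -- M^s_{6,1} embeds into L^{10}, so the fifth power lies in L², where S(t)φ(D) has norm at most 1.
  have h10 := h 10 (by norm_num) (by rw [p_eq_six hP]; exact ENNReal.ofReal_le_ofReal (by norm_num)) e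
  have hm : MemLp (fun x => e.fn x ^ 5) ∞ volume := memLp_top_pow e.memLp_fn_top 5
  have h2 : eLpNorm (fun x => e.fn x ^ 5) 2 volume ≤ ENNReal.ofReal ((C * ‖e‖) ^ (5 : ℝ)) := by
    rw [eLpNorm_eq_lintegral_rpow_enorm_toReal (by norm_num) (by norm_num), ENNReal.toReal_ofNat]
    have e1 : ∀ x, ‖e.fn x ^ 5‖ₑ ^ (2 : ℝ) = ‖e.fn x‖ₑ ^ (10 : ℝ) := fun x => by
      rw [enorm_pow, ← ENNReal.rpow_natCast, ← ENNReal.rpow_mul]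
      norm_num
    simp only [e1]
    refine (ENNReal.rpow_le_rpow h10 (by norm_num)).trans (le_of_eq ?_)
    rw [ENNReal.ofReal_rpow_of_nonneg (by positivity) (by norm_num), ← Real.rpow_mul (by positivity)]
    norm_num
  have h3 : lpNorm 2 (S t (phiD (distPow 5 e.dist))) ≤ ENNReal.ofReal ((C * ‖e‖) ^ (5 : ℝ)) := by
    have h4 := lpNorm_two_multiplier_le
      (m := fun ξ => (phi ξ : ℂ) * grp t ξ) (hasTemperateGrowth_phi.mul (hasTemperateGrowth_grp t))
      one_pos (fun ξ => by
        rw [norm_mul, norm_grp, Complex.norm_real, Real.norm_eq_abs, mul_one]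
        exact abs_phi_le ξ) (distPow 5 e.dist)
    rw [← S_phiD_eq, ENNReal.ofReal_one, one_mul] at h4
    exact h4.trans ((lpNorm_le ⟨hm.1, h2.trans_lt ENNReal.ofReal_lt_top⟩
      (isRep_distPow_fn 5 e)).trans h2)
  rw [dist_duhamelMap (by norm_num) hP]
  have h5 := (enorm_apply_le_lpNorm_two (S t (phiD (distPow 5 e.dist))) ψ).trans
    (mul_le_mul_left h3 _)
  rw [← ofReal_norm, ← ofReal_norm, ← ENNReal.ofReal_mul (by positivity),
    ENNReal.ofReal_le_ofReal_iff (by positivity), Real.mul_rpow hC.le (norm_nonneg _)] at h5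
  refine le_trans ?_ h5
  have e2 : ∀ (c : ℂ) (f : 𝓢'(ℝ, ℂ)), (c • f) ψ = c * f ψ := fun _ _ => rfl
  rw [e2, norm_mul]
  exact mul_le_of_le_one_left (norm_nonneg _) (norm_coeff_le 4)

/-- The contribution of the degenerate frequencies is controlled by the local energy. -/
theorem exists_lpNorm_degenerate_le : ∃ C : ℝ, 0 < C ∧ ∀ (δ : ℝ), 0 < δ → ∀ e : ModSpace P,
    lpNorm (ENNReal.ofReal (6 / (6 - 1))) (multiplier (degenerateCutoff P.ρ δ) (distPow 5 e.dist)) ≤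
      ENNReal.ofReal (C * ‖e‖ ^ (9 / 2 : ℝ)) *
        (∫⁻ x, ModSpace.loc δ e x ^ (3 : ℝ)) ^ (1 / 12 : ℝ) := by
  obtain ⟨C₁, hC₁, h₁⟩ := exists_norm_kernel_degenerateCutoff_le P.isBump
  obtain ⟨C₂, hC₂, h₂⟩ := ModSpace.exists_lintegral_fn_le P
  refine ⟨C₁ * (4 ^ (3 / 4 : ℝ) * C₂ ^ (9 / 2 : ℝ)), by positivity, fun δ hδ e => ?_⟩
  have h6 := h₂ 6 (by norm_num) (p_eq_six hP).le e
  have hχ := isSymbol_degenerateCutoff P.isBump hδ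
  have hq : (1 : ℝ≥0∞) ≤ ENNReal.ofReal (6 / (6 - 1)) := by
    rw [ENNReal.one_le_ofReal]
    norm_num
  have hq0 : ENNReal.ofReal (6 / (6 - 1)) ≠ 0 := (zero_lt_one.trans_le hq).ne'
  have hm : MemLp (fun x => e.fn x ^ 5) ∞ volume := memLp_top_pow e.memLp_fn_top 5
  have hmq : MemLp (fun x => e.fn x ^ 5) (ENNReal.ofReal (6 / (6 - 1))) volume := by
    refine ⟨hm.1, ?_⟩
    rw [eLpNorm_lt_top_iff_lintegral_rpow_enorm_lt_top hq0 ENNReal.ofReal_ne_top,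
      ENNReal.toReal_ofReal (by norm_num)]
    have e1 : ∀ x, ‖e.fn x ^ 5‖ₑ ^ (6 / (6 - 1) : ℝ) = ‖e.fn x‖ₑ ^ (6 : ℝ) := fun x => by
      rw [enorm_pow, ← ENNReal.rpow_natCast, ← ENNReal.rpow_mul]
      norm_num
    simp only [e1]
    exact h6.trans_lt ENNReal.ofReal_lt_top
  refine (lpNorm_le (memLp_conv hχ hq le_rfl hmq)
    (isRep_multiplier hχ hq hmq (isRep_distPow_fn 5 e))).trans ?_
  rw [eLpNorm_eq_lintegral_rpow_enorm_toReal hq0 ENNReal.ofReal_ne_top,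
    ENNReal.toReal_ofReal (by norm_num)]
  have hpt : ∀ x, ‖conv (kernel (degenerateCutoff P.ρ δ)) (fun x => e.fn x ^ 5) x‖ₑ ≤
      ENNReal.ofReal C₁ * ∫⁻ y, scaledWeight δ (x - y) * ‖e.fn y‖ₑ ^ (5 : ℝ) := fun x => by
    refine (enorm_conv_le x).trans ?_
    rw [← lintegral_const_mul' _ _ ENNReal.ofReal_ne_top]
    refine lintegral_mono fun y => ?_
    simp only
    rw [← mul_assoc, enorm_pow, ← ENNReal.rpow_natCast]
    norm_num1
    refine mul_le_mul_left ?_ _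
    rw [scaledWeight, cauchyWeight, ← ENNReal.ofReal_mul hδ.le, ← ENNReal.ofReal_mul hC₁.le,
      ← ofReal_norm]
    refine ENNReal.ofReal_le_ofReal ((h₁ δ (x - y) hδ).trans (le_of_eq ?_))
    ring
  have h7 := lintegral_scaledWeight_pow_le hδ (g := fun y => ‖e.fn y‖ₑ)
    e.aestronglyMeasurable_fn.enorm
  calc _ ≤ (∫⁻ x, (ENNReal.ofReal C₁ * ∫⁻ y, scaledWeight δ (x - y) * ‖e.fn y‖ₑ ^ (5 : ℝ)) ^
          (6 / 5 : ℝ)) ^ (5 / 6 : ℝ) := by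
        norm_num1
        gcongr with x
        exact hpt x
    _ = ENNReal.ofReal C₁ * (∫⁻ x, (∫⁻ y, scaledWeight δ (x - y) * ‖e.fn y‖ₑ ^ (5 : ℝ)) ^
          (6 / 5 : ℝ)) ^ (5 / 6 : ℝ) := by
        simp_rw [ENNReal.mul_rpow_of_nonneg _ _ (by norm_num : (0 : ℝ) ≤ 6 / 5)]
        rw [lintegral_const_mul' _ _ (by finiteness), ENNReal.mul_rpow_of_nonneg _ _ (by norm_num),
          ← ENNReal.rpow_mul]
        norm_num
    _ ≤ ENNReal.ofReal C₁ * ((∫⁻ x, ModSpace.loc δ e x ^ (3 : ℝ)) ^ (1 / 10 : ℝ) *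
          (4 * ENNReal.ofReal ((C₂ * ‖e‖) ^ (6 : ℝ))) ^ (9 / 10 : ℝ)) ^ (5 / 6 : ℝ) := by
        gcongr
        exact h7.trans (by gcongr; exact le_rfl)
    -- The exponents become (1/10)(5/6) = 1/12 for the local energy and 6·(9/10)(5/6) = 9/2 for the
    -- norm.
    _ = _ := by
        rw [ENNReal.mul_rpow_of_nonneg _ _ (by norm_num), ← ENNReal.rpow_mul, ← ENNReal.rpow_mul,
          show (4 : ℝ≥0∞) = ENNReal.ofReal 4 by simp, ← ENNReal.ofReal_mul (by norm_num),
          ENNReal.ofReal_rpow_of_nonneg (by positivity) (by norm_num),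
          Real.mul_rpow (by norm_num) (by positivity), ← Real.rpow_mul (by positivity),
          Real.mul_rpow hC₂.le (norm_nonneg _), mul_left_comm, ← ENNReal.ofReal_mul hC₁.le,
          mul_comm]
        norm_num
        ring_nf

/-- The second term decays only like |t|^{-2/9}; the missing |t|^{-1/36} has to come from the
smallness of the local energy at spatial scale |t|^{1/4}. -/
theorem exists_enorm_duhamelMap_split_le : ∃ C : ℝ, 0 < C ∧ ∀ (t : ℝ), 16 ≤ |t| →
    ∀ e : ModSpace P, ‖duhamelMap P 4 t e‖ₑ ≤
      ENNReal.ofReal (C * |t| ^ (-(1 / 4) : ℝ) * ‖e‖ ^ (5 : ℝ)) +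
      ENNReal.ofReal (C * |t| ^ (-(2 / 9) : ℝ) * ‖e‖ ^ (9 / 2 : ℝ)) *
        (∫⁻ x, ModSpace.loc (|t| ^ (-(1 / 4) : ℝ)) e x ^ (3 : ℝ)) ^ (1 / 12 : ℝ) := by
  obtain ⟨C₁, hC₁, h₁⟩ := exists_modNorm_decay_split P.isBump P.hs
  obtain ⟨C₂, hC₂, h₂⟩ := exists_modNorm_distPow_le P.isBump P.hs 4
  obtain ⟨C₃, hC₃, h₃⟩ := exists_lpNorm_degenerate_le hP
  refine ⟨C₁ * (C₂ + C₃), by positivity, fun t ht e => ?_⟩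
  have hT : 0 < |t| := by linarith
  have h4 := h₂ P.p (by rw [p_eq_six hP]; simp) (by rw [hP]; norm_num) e.dist e.modNorm_dist_lt
  rw [p_div_five_eq hP, ModSpace.modNorm_dist, ← ENNReal.ofReal_pow (norm_nonneg _),
    ← ENNReal.ofReal_mul hC₂.le, ← Real.rpow_natCast] at h4
  have h5 := h₃ (|t| ^ (-(1 / 4) : ℝ)) (by positivity) e
  have h6 : ‖duhamelMap P 4 t e‖ₑ ≤ ‖ModSpace.group P t (nonlin P 4 e)‖ₑ := by
    rw [duhamelMap, enorm_smul, ← ofReal_norm]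
    refine mul_le_of_le_one_left zero_le ?_
    rw [← ENNReal.ofReal_one]
    exact ENNReal.ofReal_le_ofReal (norm_coeff_le 4)
  refine h6.trans ?_
  rw [ModSpace.enorm_eq, ModSpace.dist_group, dist_nonlin (by norm_num) hP, p_eq_six hP]
  refine (h₁ t ht _).trans (add_le_add ?_ ?_)
  · refine (mul_le_mul_right h4 _).trans ?_
    rw [← ENNReal.ofReal_mul (by positivity)]
    refine ENNReal.ofReal_le_ofReal ?_
    norm_num1
    calc _ = C₁ * C₂ * (|t| ^ (-1 / 4 : ℝ) * ‖e‖ ^ (5 : ℝ)) := by ring_nf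
      _ ≤ C₁ * (C₂ + C₃) * (|t| ^ (-1 / 4 : ℝ) * ‖e‖ ^ (5 : ℝ)) := by
          gcongr
          linarith
      _ = _ := by ring_nf
  · refine (mul_le_mul_right h5 _).trans ?_
    rw [← mul_assoc, ← ENNReal.ofReal_mul (by positivity)]
    refine mul_le_mul_left (ENNReal.ofReal_le_ofReal ?_) _
    calc _ = C₁ * C₃ * (|t| ^ (-(2 / 9) : ℝ) * ‖e‖ ^ (9 / 2 : ℝ)) := by ring
      _ ≤ C₁ * (C₂ + C₃) * (|t| ^ (-(2 / 9) : ℝ) * ‖e‖ ^ (9 / 2 : ℝ)) := by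
          gcongr
          linarith
      _ = _ := by ring

end Quintic

/-! ### Local energy of elements close to a linear solution. -/

namespace ModSpace

variable {P : ModParams}

theorem loc_add_le (δ : ℝ) (e e' : ModSpace P) (x : ℝ) :
    loc δ (e + e') x ≤ 2 * loc δ e x + 2 * loc δ e' x := by
  have hfn : (e + e').fn =ᵐ[volume] fun y => e.fn y + e'.fn y := by
    refine (isRep_fn (e + e')).ae_eq_of_memLp le_top le_top ?_ (memLp_fn_top _)
      (e.memLp_fn_top.add e'.memLp_fn_top)
    rw [dist_add]
    exact isRep_add_of_memLp_top e.isRep_fn e'.isRep_fn e.memLp_fn_top e'.memLp_fn_top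
  have hm : ∀ e : ModSpace P, AEMeasurable fun y =>
      2 * (scaledWeight δ (x - y) * ‖e.fn y‖ₑ ^ (2 : ℝ)) := fun e =>
    (((measurable_scaledWeight δ).comp (measurable_const.sub measurable_id)).aemeasurable.mul
      (e.aemeasurable_fn_rpow 2)).const_mul 2
  unfold loc
  rw [← lintegral_const_mul' _ _ (by norm_num), ← lintegral_const_mul' _ _ (by norm_num),
    ← lintegral_add_left' (hm e)]
  refine lintegral_mono_ae ?_
  filter_upwards [hfn] with y hy
  rw [hy]
  have h1 : (‖e.fn y + e'.fn y‖ₑ) ^ (2 : ℝ) ≤ 2 * (‖e.fn y‖ₑ ^ (2 : ℝ) + ‖e'.fn y‖ₑ ^ (2 : ℝ)) := by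
    refine (ENNReal.rpow_le_rpow (enorm_add_le _ _) (by norm_num)).trans ?_
    have := ENNReal.rpow_add_le_mul_rpow_add_rpow ‖e.fn y‖ₑ ‖e'.fn y‖ₑ (p := 2) (by norm_num)
    norm_num at this ⊢
    exact this
  calc _ ≤ scaledWeight δ (x - y) * (2 * (‖e.fn y‖ₑ ^ (2 : ℝ) + ‖e'.fn y‖ₑ ^ (2 : ℝ))) := by gcongr
    _ = _ := by ring

/-- The local energy is at most δη² pointwise and has integral at most 4η². -/
theorem lintegral_loc_le_of_lpNorm_two {δ η : ℝ} (hδ : 0 < δ) (hη : 0 ≤ η) {e : ModSpace P}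
    (he : lpNorm 2 e.dist ≤ ENNReal.ofReal η) :
    ∫⁻ x, loc δ e x ^ (3 : ℝ) ≤ ENNReal.ofReal (4 * δ ^ 2 * η ^ 6) := by
  have h2 : (1 : ℝ≥0∞) ≤ 2 := by norm_num
  obtain ⟨g, hg, hr⟩ := exists_rep (he.trans_lt ENNReal.ofReal_lt_top)
  rw [lpNorm_eq h2 hg hr, eLpNorm_congr_ae (hr.ae_eq_of_memLp h2 le_top e.isRep_fn hg e.memLp_fn_top),
    eLpNorm_eq_lintegral_rpow_enorm_toReal (by norm_num) (by norm_num), ENNReal.toReal_ofNat] at he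
  have hI : ∫⁻ y, ‖e.fn y‖ₑ ^ (2 : ℝ) ≤ ENNReal.ofReal (η ^ 2) := by
    have := ENNReal.rpow_le_rpow he (zero_le_two (α := ℝ))
    rwa [← ENNReal.rpow_mul, one_div_mul_cancel two_ne_zero, ENNReal.rpow_one,
      ENNReal.ofReal_rpow_of_nonneg hη (by norm_num), Real.rpow_two] at this
  have h1 : ∀ x, loc δ e x ≤ ENNReal.ofReal (δ * η ^ 2) := fun x => by
    rw [ENNReal.ofReal_mul hδ.le]
    calc loc δ e x ≤ ∫⁻ y, ENNReal.ofReal δ * ‖e.fn y‖ₑ ^ (2 : ℝ) :=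
          lintegral_mono fun y => mul_le_mul_left (scaledWeight_le _) _
      _ = ENNReal.ofReal δ * ∫⁻ y, ‖e.fn y‖ₑ ^ (2 : ℝ) :=
          lintegral_const_mul' _ _ ENNReal.ofReal_ne_top
      _ ≤ _ := by gcongr
  calc ∫⁻ x, loc δ e x ^ (3 : ℝ) ≤ ∫⁻ x, ENNReal.ofReal ((δ * η ^ 2) ^ 2) * loc δ e x := by
        refine lintegral_mono fun x => ?_
        simp only
        rw [show (3 : ℝ) = 2 + 1 by norm_num, ENNReal.rpow_add_of_nonneg _ _ (by norm_num) (by norm_num),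
          ENNReal.rpow_one, ← Real.rpow_two (δ * η ^ 2),
          ← ENNReal.ofReal_rpow_of_nonneg (by positivity) (by norm_num)]
        gcongr
        exact h1 x
    _ = ENNReal.ofReal ((δ * η ^ 2) ^ 2) * ∫⁻ x, loc δ e x :=
        lintegral_const_mul' _ _ ENNReal.ofReal_ne_top
    _ ≤ ENNReal.ofReal ((δ * η ^ 2) ^ 2) * (4 * ENNReal.ofReal (η ^ 2)) := by
        gcongr
        exact (lintegral_scaledWeight_conv hδ (e.aemeasurable_fn_rpow 2)).trans (by gcongr)
    _ = _ := by
        rw [show (4 : ℝ≥0∞) = ENNReal.ofReal 4 by simp, ← ENNReal.ofReal_mul (by norm_num),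
          ← ENNReal.ofReal_mul (by positivity)]
        congr 1
        ring

/-- The linear part contributes δ^{2/r} with 2/r ≥ 4/9, the L²-small part δ^{2/3}; both are at most
δ^{4/9}, and the power 1/4 turns this into δ^{1/9} and η² into η^{1/2}. -/
theorem exists_lintegral_loc_constraint_le (hP : P.p = ENNReal.ofReal 6) {r : ℝ} (hr : 0 < r)
    (hr2 : r ≤ 9 / 2) : ∃ C : ℝ, 0 < C ∧ ∀ (δ η τ : ℝ) (e₀ e : ModSpace P), 0 < δ → δ ≤ 1 → 0 ≤ η →
      ∫⁻ t, ‖group P t e₀‖ₑ ^ r ≤ ENNReal.ofReal (η ^ r) →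
      (∀ ψ : 𝓢(ℝ, ℂ), ‖(e - group P τ e₀).dist ψ‖ ≤ η * ‖ψ.toLp 2 volume‖) →
      (∫⁻ x, loc δ e x ^ (3 : ℝ)) ^ (1 / 12 : ℝ) ≤
        ENNReal.ofReal (C * δ ^ (1 / 9 : ℝ) * η ^ (1 / 2 : ℝ)) := by
  obtain ⟨C, hC, h⟩ := exists_lintegral_loc_group_le hP hr
  refine ⟨(2 * C + 2 * 4) ^ (1 / 4 : ℝ), by positivity, fun δ η τ e₀ e hδ hδ1 hη he₀ he => ?_⟩
  set w := e - group P τ e₀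
  have hw := lintegral_loc_le_of_lpNorm_two hδ hη (lpNorm_two_le_of_forall hη he)
  have hv := h δ hδ e₀ η hη he₀ τ
  have hew : e = group P τ e₀ + w := by simp [w]
  have h2 : ∀ e : ModSpace P, (∫⁻ x, (2 * loc δ e x) ^ (3 : ℝ)) ^ (1 / 3 : ℝ) =
      2 * (∫⁻ x, loc δ e x ^ (3 : ℝ)) ^ (1 / 3 : ℝ) := fun e => by
    simp_rw [ENNReal.mul_rpow_of_nonneg _ _ (by norm_num : (0 : ℝ) ≤ 3)]
    rw [lintegral_const_mul' _ _ (by norm_num), ENNReal.mul_rpow_of_nonneg _ _ (by norm_num),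
      ← ENNReal.rpow_mul]
    norm_num
  have hδp : δ ^ (2 / r) ≤ δ ^ (4 / 9 : ℝ) := by
    refine Real.rpow_le_rpow_of_exponent_ge hδ hδ1 ?_
    rw [div_le_div_iff₀ (by norm_num) hr]
    linarith
  have hw' : (∫⁻ x, loc δ w x ^ (3 : ℝ)) ^ (1 / 3 : ℝ) ≤
      ENNReal.ofReal (4 * (δ ^ (4 / 9 : ℝ) * η ^ (2 : ℝ))) := by
    refine (ENNReal.rpow_le_rpow hw (by norm_num)).trans ?_
    rw [ENNReal.ofReal_rpow_of_nonneg (by positivity) (by norm_num)]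
    refine ENNReal.ofReal_le_ofReal ?_
    rw [Real.mul_rpow (by positivity) (by positivity), Real.mul_rpow (by norm_num) (by positivity),
      ← Real.rpow_natCast, ← Real.rpow_natCast, ← Real.rpow_mul hδ.le, ← Real.rpow_mul hη]
    have e1 : (4 : ℝ) ^ (1 / 3 : ℝ) ≤ 4 := Real.rpow_le_self_of_one_le (by norm_num) (by norm_num)
    have e2 : δ ^ (((2 : ℕ) : ℝ) * (1 / 3)) ≤ δ ^ (4 / 9 : ℝ) :=
      Real.rpow_le_rpow_of_exponent_ge hδ hδ1 (by norm_num)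
    have e3 : η ^ (((6 : ℕ) : ℝ) * (1 / 3)) = η ^ (2 : ℝ) := by norm_num
    rw [e3, ← mul_assoc]
    gcongr
  have key : (∫⁻ x, loc δ e x ^ (3 : ℝ)) ^ (1 / 3 : ℝ) ≤
      ENNReal.ofReal ((2 * C + 2 * 4) * (δ ^ (4 / 9 : ℝ) * η ^ (2 : ℝ))) := by
    calc (∫⁻ x, loc δ e x ^ (3 : ℝ)) ^ (1 / 3 : ℝ)
        ≤ (∫⁻ x, ((fun x => 2 * loc δ (group P τ e₀) x) + fun x => 2 * loc δ w x) x ^ (3 : ℝ)) ^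
            (1 / 3 : ℝ) := by
          gcongr with x
          rw [hew]
          exact loc_add_le _ _ _ _
      _ ≤ _ := ENNReal.lintegral_Lp_add_le ((aemeasurable_loc _ _).const_mul 2)
          ((aemeasurable_loc _ _).const_mul 2) (by norm_num)
      _ ≤ 2 * ENNReal.ofReal (C * δ ^ (2 / r) * η ^ (2 : ℝ)) +
          2 * ENNReal.ofReal (4 * (δ ^ (4 / 9 : ℝ) * η ^ (2 : ℝ))) := by
          rw [h2, h2]
          gcongr
      _ ≤ _ := by
          rw [show (2 : ℝ≥0∞) = ENNReal.ofReal 2 by simp, ← ENNReal.ofReal_mul (by norm_num),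
            ← ENNReal.ofReal_mul (by norm_num), ← ENNReal.ofReal_add (by positivity) (by positivity)]
          refine ENNReal.ofReal_le_ofReal ?_
          calc _ ≤ 2 * (C * δ ^ (4 / 9 : ℝ) * η ^ (2 : ℝ)) + 2 * (4 * (δ ^ (4 / 9 : ℝ) * η ^ (2 : ℝ))) := by
                gcongr
            _ = _ := by ring
  have h3 := ENNReal.rpow_le_rpow key (by norm_num : (0 : ℝ) ≤ 1 / 4)
  rw [← ENNReal.rpow_mul, ENNReal.ofReal_rpow_of_nonneg (by positivity) (by norm_num),
    Real.mul_rpow (by positivity) (by positivity), Real.mul_rpow (by positivity) (by positivity),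
    ← Real.rpow_mul hδ.le, ← Real.rpow_mul hη, ← mul_assoc] at h3
  norm_num at h3 ⊢
  exact h3

/-- The group is bounded on [-1,0], so ‖S(t)e‖ is controlled by its values on [t,t+1]: smallness in
L^r of time implies smallness at every time. -/
theorem exists_norm_group_le (P : ModParams) {r : ℝ} (hr : 0 < r) : ∃ C : ℝ, 1 ≤ C ∧
    ∀ (e : ModSpace P) (η : ℝ), 0 ≤ η → ∫⁻ t, ‖group P t e‖ₑ ^ r ≤ ENNReal.ofReal (η ^ r) →
      ∀ t, ‖group P t e‖ ≤ C * η := by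
  obtain ⟨B, hB⟩ := (isCompact_Icc (a := (-1 : ℝ)) (b := 0)).exists_bound_of_continuousOn
    (continuous_group (P := P)).continuousOn
  refine ⟨max 1 B, le_max_left _ _, fun e η hη he t => ?_⟩
  set C := max 1 B
  have hC : 0 < C := lt_of_lt_of_le one_pos (le_max_left _ _)
  have h1 : ∀ t' ∈ Set.Icc t (t + 1), ‖group P t e‖ₑ ^ r ≤ ENNReal.ofReal (C ^ r) * ‖group P t' e‖ₑ ^ r := by
    intro t' ht'
    rw [← ENNReal.ofReal_rpow_of_nonneg hC.le hr.le, ← ENNReal.mul_rpow_of_nonneg _ _ hr.le]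
    refine ENNReal.rpow_le_rpow ?_ hr.le
    rw [← ofReal_norm, ← ofReal_norm, ← ENNReal.ofReal_mul hC.le]
    refine ENNReal.ofReal_le_ofReal ?_
    calc ‖group P t e‖ = ‖group P (t - t') (group P t' e)‖ := by rw [← group_add, sub_add_cancel]
      _ ≤ ‖group P (t - t')‖ * ‖group P t' e‖ := ContinuousLinearMap.le_opNorm _ _
      _ ≤ C * ‖group P t' e‖ := by
          gcongr
          exact (hB _ ⟨by linarith [ht'.2], by linarith [ht'.1]⟩).trans (le_max_right _ _)
  have h2 : ‖group P t e‖ₑ ^ r ≤ ENNReal.ofReal ((C * η) ^ r) := by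
    calc ‖group P t e‖ₑ ^ r = ∫⁻ _ in Set.Icc t (t + 1), ‖group P t e‖ₑ ^ r := by
          rw [setLIntegral_const, Real.volume_Icc, add_sub_cancel_left, ENNReal.ofReal_one, mul_one]
      _ ≤ ∫⁻ t' in Set.Icc t (t + 1), ENNReal.ofReal (C ^ r) * ‖group P t' e‖ₑ ^ r :=
          setLIntegral_mono' measurableSet_Icc h1
      _ ≤ ENNReal.ofReal (C ^ r) * ∫⁻ t', ‖group P t' e‖ₑ ^ r := by
          rw [lintegral_const_mul' _ _ ENNReal.ofReal_ne_top]
          gcongr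
          exact Measure.restrict_le_self
      _ ≤ ENNReal.ofReal (C ^ r) * ENNReal.ofReal (η ^ r) := by gcongr
      _ = _ := by rw [← ENNReal.ofReal_mul (by positivity), Real.mul_rpow hC.le hη]
  rw [← ENNReal.ofReal_rpow_of_nonneg (by positivity) hr.le, ENNReal.rpow_le_rpow_iff hr, ← ofReal_norm,
    ENNReal.ofReal_le_ofReal_iff (by positivity)] at h2
  exact h2

end ModSpace

/-! ### Improved decay for λ = 4. -/

section Gain

variable {P : ModParams} (hP : P.p = ((4 : ℕ) : ℝ≥0∞) + 2)

include hP

/-- At δ = |t|^{-1/4} the local energy supplies δ^{1/9} = |t|^{-1/36}, and 2/9 + 1/36 = 1/4. The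
surplus η^{1/2} provides the smallness, because only ‖e‖^r, and not a higher power, is kept on the
right. -/
theorem exists_norm_duhamelMap_gain_le {r : ℝ} (hr : 0 < r) (hr2 : r ≤ 9 / 2) : ∃ C : ℝ, 0 < C ∧
    ∀ (η τ : ℝ) (e₀ e : ModSpace P), 0 < η → η ≤ 1 / 2 →
      ∫⁻ t, ‖ModSpace.group P t e₀‖ₑ ^ r ≤ ENNReal.ofReal (η ^ r) →
      (∀ ψ : 𝓢(ℝ, ℂ), ‖(e - ModSpace.group P τ e₀).dist ψ‖ ≤ η * ‖ψ.toLp 2 volume‖) →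
      ‖e‖ ≤ 2 * η → ∀ t,
      ‖duhamelMap P 4 t e‖ ≤ C * η ^ (1 / 2 : ℝ) * (1 + |t|) ^ (-(1 / 4) : ℝ) * ‖e‖ ^ r := by
  obtain ⟨M, hM, hm⟩ := exists_norm_duhamelMap_le (P := P) (lam := 4) (by norm_num) hP
  obtain ⟨C₁, hC₁, h₁⟩ := exists_enorm_duhamelMap_split_le hP
  obtain ⟨C₂, hC₂, h₂⟩ := ModSpace.exists_lintegral_loc_constraint_le (p_eq_six hP) hr hr2
  refine ⟨34 * M + 2 * (2 * C₁ + C₁ * C₂), by positivity,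
    fun η τ e₀ e hη hη1 he₀ he hen t => ?_⟩
  have hen1 : ‖e‖ ≤ 1 := by linarith
  set a := ‖e‖ with ha
  have ha0 : 0 ≤ a := norm_nonneg e
  have h92 : a ^ (9 / 2 : ℝ) ≤ a ^ r := Real.rpow_le_rpow_of_exponent_ge_of_imp ha0 hen1 hr2
    fun _ h => absurd h (by norm_num)
  have hη2 : a ^ (1 / 2 : ℝ) ≤ 2 * η ^ (1 / 2 : ℝ) := by
    calc a ^ (1 / 2 : ℝ) ≤ (2 * η) ^ (1 / 2 : ℝ) := by gcongr
      _ = 2 ^ (1 / 2 : ℝ) * η ^ (1 / 2 : ℝ) := Real.mul_rpow (by norm_num) hη.le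
      _ ≤ 2 * η ^ (1 / 2 : ℝ) := by
          gcongr
          exact Real.rpow_le_self_of_one_le (by norm_num) (by norm_num)
  -- 5 = 1/2 + 9/2: half a power is traded for η^{1/2}, and r ≤ 9/2 with ‖e‖ ≤ 1 handles the rest.
  have h5 : a ^ (5 : ℝ) ≤ 2 * η ^ (1 / 2 : ℝ) * a ^ r := by
    rw [show (5 : ℝ) = 1 / 2 + 9 / 2 by norm_num, Real.rpow_add_of_nonneg ha0 (by norm_num) (by norm_num)]
    gcongr
  have hT0 := abs_nonneg t
  set X := η ^ (1 / 2 : ℝ) * a ^ r with hX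
  have hX0 : 0 ≤ X := by positivity
  rw [show ∀ c d : ℝ, c * η ^ (1 / 2 : ℝ) * d * a ^ r = c * d * X from fun c d => by rw [hX]; ring]
  -- For |t| ≤ 16 any decay rate is free, as 1+|t| ≤ 17; beyond, the frequency splitting is
  -- available.
  rcases le_total |t| 16 with ht | ht
  · have h1 : (1 : ℝ) ≤ 17 * (1 + |t|) ^ (-(1 / 4) : ℝ) := by
      rw [Real.rpow_neg (by positivity), ← div_eq_mul_inv, le_div_iff₀ (by positivity), one_mul]
      calc (1 + |t|) ^ (1 / 4 : ℝ) ≤ 1 + |t| :=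
            Real.rpow_le_self_of_one_le (by linarith) (by norm_num)
        _ ≤ 17 := by linarith
    have h2 : (1 + |t|) ^ (-(((4 : ℕ) : ℝ) / (3 * (((4 : ℕ) : ℝ) + 2)))) ≤ 1 :=
      Real.rpow_le_one_of_one_le_of_nonpos (by linarith) (by norm_num)
    have h3 : a ^ (4 + 1) ≤ 2 * X := by
      rw [hX, ← mul_assoc]
      rwa [show (5 : ℝ) = ((4 + 1 : ℕ) : ℝ) by norm_num, Real.rpow_natCast] at h5
    calc _ ≤ M * (1 + |t|) ^ (-(((4 : ℕ) : ℝ) / (3 * (((4 : ℕ) : ℝ) + 2)))) * a ^ (4 + 1) := hm t e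
      _ ≤ M * (17 * (1 + |t|) ^ (-(1 / 4) : ℝ)) * (2 * X) := by
          gcongr
          exact h2.trans h1
      _ = 34 * M * (1 + |t|) ^ (-(1 / 4) : ℝ) * X := by ring
      _ ≤ _ := by
          gcongr
          have : 0 < 2 * (2 * C₁ + C₁ * C₂) := by positivity
          linarith
  · have hT : 0 < |t| := by linarith
    have h3 := h₂ (|t| ^ (-(1 / 4) : ℝ)) η τ e₀ e (by positivity)
      (Real.rpow_le_one_of_one_le_of_nonpos (by linarith) (by norm_num)) hη.le he₀ he
    have h4 := (h₁ t ht e).trans (add_le_add_right (mul_le_mul_right h3 _) _)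
    rw [← ENNReal.ofReal_mul (by positivity), ← ENNReal.ofReal_add (by positivity) (by positivity),
      ← ofReal_norm, ENNReal.ofReal_le_ofReal_iff (by positivity)] at h4
    refine h4.trans ?_
    have e1 : |t| ^ (-(2 / 9) : ℝ) * (|t| ^ (-(1 / 4) : ℝ)) ^ (1 / 9 : ℝ) = |t| ^ (-(1 / 4) : ℝ) := by
      rw [← Real.rpow_mul hT.le, ← Real.rpow_add hT]
      norm_num
    have e2 := rpow_neg_le_two_mul (T := |t|) (by linarith) (κ := 1 / 4) (by norm_num) (by norm_num)
    calc _ = C₁ * |t| ^ (-(1 / 4) : ℝ) * a ^ (5 : ℝ) + C₁ * C₂ *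
          (|t| ^ (-(2 / 9) : ℝ) * (|t| ^ (-(1 / 4) : ℝ)) ^ (1 / 9 : ℝ)) *
          (η ^ (1 / 2 : ℝ) * a ^ (9 / 2 : ℝ)) := by ring
      _ ≤ C₁ * |t| ^ (-(1 / 4) : ℝ) * (2 * X) + C₁ * C₂ * |t| ^ (-(1 / 4) : ℝ) * X := by
          rw [e1, hX, ← mul_assoc 2]
          gcongr
      _ = (2 * C₁ + C₁ * C₂) * X * |t| ^ (-(1 / 4) : ℝ) := by ring
      _ ≤ (2 * C₁ + C₁ * C₂) * X * (2 * (1 + |t|) ^ (-(1 / 4) : ℝ)) := by gcongr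
      _ = 2 * (2 * C₁ + C₁ * C₂) * (1 + |t|) ^ (-(1 / 4) : ℝ) * X := by ring
      _ ≤ _ := by
          gcongr
          linarith

end Gain

/-! ### Small solutions of the integral equation -/

theorem eLpNorm_ofReal_le_iff {E : Type*} [NormedAddCommGroup E] {r η : ℝ} (hr : 0 < r) (hη : 0 ≤ η)
    (u : ℝ → E) : eLpNorm u (ENNReal.ofReal r) volume ≤ ENNReal.ofReal η ↔
      ∫⁻ t, ‖u t‖ₑ ^ r ≤ ENNReal.ofReal (η ^ r) := by
  rw [eLpNorm_eq_lintegral_rpow_enorm_toReal (by simpa using hr) ENNReal.ofReal_ne_top,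
    ENNReal.toReal_ofReal hr.le, ← ENNReal.ofReal_rpow_of_nonneg hη hr.le, one_div,
    ENNReal.rpow_inv_le_iff hr]

section Solution

variable {P : ModParams} {lam : ℕ}

/-- The right hand side of the integral equation with initial value `e`. -/
def rhs (P : ModParams) (lam : ℕ) (e : ModSpace P) (u : ℝ → ModSpace P) : ℝ → ModSpace P :=
  picard (duhamelMap P lam) (fun t => ModSpace.group P t e) u

theorem continuous_group_apply (e : ModSpace P) : Continuous fun t => ModSpace.group P t e :=
  ModSpace.continuous_group.clm_apply continuous_const

/-- Reduces existence to the preservation of the L^r bound. Taking ε = η/C makes the linear solution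
small in sup norm as well. `Z₀` is an additional invariant closed set, later used for
real-valuedness, and is intersected with the sets `Z t`. -/
theorem exists_solution_of_self (hlam : 1 ≤ lam) (hP : P.p = (lam : ℝ≥0∞) + 2) {r : ℝ}
    (hlr : (lam : ℝ) < r) (hκ : 1 - (lam : ℝ) / r < (lam : ℝ) / (3 * ((lam : ℝ) + 2)))
    (hself : ∃ η₁ : ℝ, 0 < η₁ ∧ ∀ η : ℝ, 0 < η → η ≤ η₁ → ∀ e : ModSpace P,
      ∫⁻ t, ‖ModSpace.group P t e‖ₑ ^ r ≤ ENNReal.ofReal (η ^ r) → ∃ Z : ℝ → Set (ModSpace P),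
        (∀ t, IsClosed (Z t)) ∧ (∀ t, ModSpace.group P t e ∈ Z t) ∧
        ∀ u ∈ fixedPointSet r η Z, (∀ t, rhs P lam e u t ∈ Z t) ∧
          eLpNorm (fun t => rhs P lam e u t - ModSpace.group P t e) (ENNReal.ofReal r) volume ≤
            ENNReal.ofReal η) :
    ∃ ε : ℝ, 0 < ε ∧ ∀ e : ModSpace P,
      ∫⁻ t, ‖ModSpace.group P t e‖ₑ ^ r ≤ ENNReal.ofReal (ε ^ r) → ∀ Z₀ : Set (ModSpace P),
        IsClosed Z₀ → (∀ t, ModSpace.group P t e ∈ Z₀) →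
        (∀ u, Continuous u → (∀ t, u t ∈ Z₀) → ∀ t, rhs P lam e u t ∈ Z₀) →
        ∃ u : ℝ → ModSpace P, Continuous u ∧ ∫⁻ t, ‖u t‖ₑ ^ r < ∞ ∧ (∀ t, u t = rhs P lam e u t) ∧
          ∀ t, u t ∈ Z₀ := by
  have hl : (1 : ℝ) ≤ lam := by exact_mod_cast hlam
  have hr : 0 < r := by linarith
  obtain ⟨M, hM, hLip⟩ := exists_duhamelMap_sub_le hlam hP
  obtain ⟨η₀, hη₀, hfix⟩ := exists_fixedPoint (continuous_duhamelMap hlam hP)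
    (duhamelMap_zero hlam hP) hM (by omega) hlr hκ hLip
  obtain ⟨η₁, hη₁, hself⟩ := hself
  obtain ⟨C, hC, hC'⟩ := ModSpace.exists_norm_group_le P hr
  set η := min η₀ η₁
  have hη : 0 < η := lt_min hη₀ hη₁
  have hC0 : 0 < C := by linarith
  refine ⟨η / C, by positivity, fun e he Z₀ hZ₀ hv hinv => ?_⟩
  have he' : ∫⁻ t, ‖ModSpace.group P t e‖ₑ ^ r ≤ ENNReal.ofReal (η ^ r) := by
    refine he.trans (ENNReal.ofReal_le_ofReal ?_)
    gcongr
    exact div_le_self hη.le hC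
  obtain ⟨Z, hZ, hvZ, hZs⟩ := hself η hη (min_le_right _ _) e he'
  obtain ⟨u, hu, hfu⟩ := hfix η hη (min_le_left _ _) _ (continuous_group_apply e)
    (fun t => by
      have := hC' e (η / C) (by positivity) he t
      rwa [mul_div_cancel₀ _ hC0.ne'] at this)
    ((eLpNorm_ofReal_le_iff hr hη.le _).2 he') (fun t => Z t ∩ Z₀) (fun t => (hZ t).inter hZ₀)
    (fun t => ⟨hvZ t, hv t⟩) fun u hu => by
      have h1 := hZs u ⟨hu.1, hu.2.1, hu.2.2.1, fun t => (hu.2.2.2 t).1⟩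
      exact ⟨fun t => ⟨h1.1 t, hinv u hu.1 (fun t => (hu.2.2.2 t).2) t⟩, h1.2⟩
  exact ⟨u, hu.1, ((eLpNorm_ofReal_le_iff hr (by positivity) _).1 hu.2.2.1).trans_lt
    ENNReal.ofReal_lt_top, hfu, fun t => (hu.2.2.2 t).2⟩

/-- Since ‖u‖ ≤ 2η ≤ 1, the power λ+1 may be lowered to b = min(λ+1, r), and b ≤ r makes Young's
inequality applicable. As b > 1, the outcome (2η)^b is below η for small η. -/
theorem exists_self_of_five_le (hlam : 5 ≤ lam) (hP : P.p = (lam : ℝ≥0∞) + 2) {r : ℝ}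
    (hlr : (lam : ℝ) < r) (hκ : 1 - (lam : ℝ) / r < (lam : ℝ) / (3 * ((lam : ℝ) + 2))) :
    ∃ η₁ : ℝ, 0 < η₁ ∧ ∀ η : ℝ, 0 < η → η ≤ η₁ → ∀ e : ModSpace P,
      ∀ u ∈ fixedPointSet r η fun _ => Set.univ,
        eLpNorm (fun t => rhs P lam e u t - ModSpace.group P t e) (ENNReal.ofReal r) volume ≤
            ENNReal.ofReal η := by
  have hl : (5 : ℝ) ≤ lam := by exact_mod_cast hlam
  have hr : 0 < r := by linarith
  obtain ⟨M, hM, hm⟩ := exists_norm_duhamelMap_le (P := P) (lam := lam) (by omega) hP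
  set b : ℝ := min ((lam : ℝ) + 1) r with hb
  have hb5 : 5 ≤ b := le_min (by linarith) (by linarith)
  have hκb : 1 - (b - 1) / r < (lam : ℝ) / (3 * ((lam : ℝ) + 2)) := by
    rcases min_choice ((lam : ℝ) + 1) r with h | h
    · rw [hb, h, add_sub_cancel_right]
      exact hκ
    -- For b = r the kernel condition is 1/r < κ, that is 3(λ+2) < λr; it holds since r > λ ≥ 5. For
    -- λ = 4 it would fail.
    · rw [hb, h, show 1 - (r - 1) / r = 1 / r by field_simp; ring, div_lt_div_iff₀ hr (by positivity)]
      nlinarith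
  obtain ⟨C, hC, hsub⟩ := exists_eLpNorm_picard_sub_le (E := ModSpace P) (by linarith)
    (min_le_right ((lam : ℝ) + 1) r) hκb
  refine ⟨min (1 / 2) (1 / (4 * C * M)), by positivity, fun η hη hη1 e u hu => ?_⟩
  have h1 : η ≤ 1 / 2 := hη1.trans (min_le_left _ _)
  have h2 : 4 * C * M * η ≤ 1 := by
    have := hη1.trans (min_le_right _ _)
    rw [le_div_iff₀ (by positivity)] at this
    linarith
  refine (hsub (duhamelMap P lam) (fun t => ModSpace.group P t e) u M (2 * η) hM (by positivity) hu.1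
    hu.2.2.1 fun t τ => ?_).trans (ENNReal.ofReal_le_ofReal ?_)
  · refine (hm t (u τ)).trans ?_
    gcongr
    rw [← Real.rpow_natCast]
    refine Real.rpow_le_rpow_of_exponent_ge_of_imp (norm_nonneg _)
      ((hu.2.1 τ).trans (by linarith)) ?_ fun _ h => absurd h (by positivity)
    push_cast
    exact min_le_left _ _
  · calc C * M * (2 * η) ^ b ≤ C * M * (2 * η) ^ (2 : ℝ) := by
          gcongr C * M * ?_
          exact Real.rpow_le_rpow_of_exponent_ge (by positivity) (by linarith) (by linarith)
      _ = (4 * C * M * η) * η := by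
          rw [Real.rpow_two]
          ring
      _ ≤ η := mul_le_of_le_one_left hη.le h2

theorem continuous_integrand {E : Type*} [TopologicalSpace E] {F : ℝ → E → E}
    (hF : Continuous (Function.uncurry F)) {u : ℝ → E} (hu : Continuous u) (t : ℝ) :
    Continuous fun τ => F (t - τ) (u τ) :=
  hF.comp ((continuous_const.sub continuous_id).prodMk hu)

theorem evalCLM_intervalIntegral {f : ℝ → ModSpace P} (ψ : 𝓢(ℝ, ℂ)) {a b : ℝ}
    (hf : IntervalIntegrable f volume a b) :
    (∫ τ in a..b, f τ).dist ψ = ∫ τ in a..b, (f τ).dist ψ := by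
  have := ContinuousLinearMap.intervalIntegral_comp_comm (ModSpace.evalCLM ψ) hf
  simp only [ModSpace.evalCLM_apply] at this
  exact this.symm

theorem dist_rhs_sub_apply (hlam : 1 ≤ lam) (hP : P.p = (lam : ℝ≥0∞) + 2) {e : ModSpace P}
    {u : ℝ → ModSpace P} (hu : Continuous u) (t : ℝ) (ψ : 𝓢(ℝ, ℂ)) :
    (rhs P lam e u t - ModSpace.group P t e).dist ψ =
      ∫ τ in (0 : ℝ)..t, (duhamelMap P lam (t - τ) (u τ)).dist ψ := by
  have hc : Continuous fun τ => duhamelMap P lam (t - τ) (u τ) :=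
    continuous_integrand (continuous_duhamelMap hlam hP) hu t
  have e1 : rhs P lam e u t - ModSpace.group P t e =
      ∫ τ in (0 : ℝ)..t, duhamelMap P lam (t - τ) (u τ) := add_sub_cancel_left _ _
  rw [e1]
  exact evalCLM_intervalIntegral ψ (hc.intervalIntegrable _ _)

/-- The L² norm of the Duhamel term is at most C∫‖u‖⁵, and for r ≤ 5 this is at most R^{5-r}∫‖u‖^r.
The estimate is phrased by duality so that it passes through the time integral. -/
theorem exists_norm_rhs_sub_apply_le (hP : P.p = ((4 : ℕ) : ℝ≥0∞) + 2) {r : ℝ} (hr : 0 < r)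
    (hr2 : r ≤ 5) : ∃ C : ℝ, 0 < C ∧ ∀ (R : ℝ) (e : ModSpace P) (u : ℝ → ModSpace P), 0 < R →
      Continuous u → (∀ t, ‖u t‖ ≤ R) → ∫⁻ t, ‖u t‖ₑ ^ r ≤ ENNReal.ofReal (R ^ r) →
      ∀ t (ψ : 𝓢(ℝ, ℂ)), ‖(rhs P 4 e u t - ModSpace.group P t e).dist ψ‖ ≤
        C * R ^ 5 * ‖ψ.toLp 2 volume‖ := by
  obtain ⟨C, hC, hdual⟩ := exists_norm_duhamelMap_apply_le hP
  refine ⟨C, hC, fun R e u hR hu hb hi t ψ => ?_⟩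
  rw [dist_rhs_sub_apply (by norm_num) hP hu]
  set N := ‖ψ.toLp 2 volume‖ with hN
  have hN0 : 0 ≤ N := norm_nonneg _
  have h5 : ‖∫ τ in (0 : ℝ)..t, (duhamelMap P 4 (t - τ) (u τ)).dist ψ‖ₑ ≤
      ENNReal.ofReal (C * R ^ 5 * N) := by
    calc _ ≤ ∫⁻ τ, ‖(duhamelMap P 4 (t - τ) (u τ)).dist ψ‖ₑ := enorm_intervalIntegral_le _ _
      _ ≤ ∫⁻ τ, ENNReal.ofReal (C * R ^ (5 - r) * N) * ‖u τ‖ₑ ^ r := by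
          refine lintegral_mono fun τ => ?_
          rw [← ofReal_norm, ← ofReal_norm, ENNReal.ofReal_rpow_of_nonneg (norm_nonneg _) hr.le,
            ← ENNReal.ofReal_mul (by positivity)]
          refine ENNReal.ofReal_le_ofReal ((hdual (t - τ) (u τ) ψ).trans ?_)
          have : ‖u τ‖ ^ (5 : ℝ) ≤ R ^ (5 - r) * ‖u τ‖ ^ r := by
            conv_lhs => rw [show (5 : ℝ) = (5 - r) + r by ring]
            rw [Real.rpow_add_of_nonneg (norm_nonneg _) (by linarith) hr.le]
            gcongr
            exact hb τ
          calc C * ‖u τ‖ ^ (5 : ℝ) * N ≤ C * (R ^ (5 - r) * ‖u τ‖ ^ r) * N := by gcongr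
            _ = _ := by ring
      _ ≤ ENNReal.ofReal (C * R ^ (5 - r) * N) * ENNReal.ofReal (R ^ r) := by
          rw [lintegral_const_mul' _ _ ENNReal.ofReal_ne_top]
          gcongr
      _ = _ := by
          rw [← ENNReal.ofReal_mul (by positivity)]
          congr 1
          calc C * R ^ (5 - r) * N * R ^ r = C * (R ^ (5 - r) * R ^ r) * N := by ring
            _ = _ := by
                rw [← Real.rpow_add hR, sub_add_cancel,
                  show (5 : ℝ) = ((5 : ℕ) : ℝ) by norm_num, Real.rpow_natCast]
  rwa [← ofReal_norm, ENNReal.ofReal_le_ofReal_iff (by positivity)] at h5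

theorem isClosed_setOf_norm_sub_apply_le (w₀ : ModSpace P) (η : ℝ) :
    IsClosed {w : ModSpace P | ∀ ψ : 𝓢(ℝ, ℂ), ‖(w - w₀).dist ψ‖ ≤ η * ‖ψ.toLp 2 volume‖} := by
  have : {w : ModSpace P | ∀ ψ : 𝓢(ℝ, ℂ), ‖(w - w₀).dist ψ‖ ≤ η * ‖ψ.toLp 2 volume‖} =
      ⋂ ψ : 𝓢(ℝ, ℂ), {w | ‖ModSpace.evalCLM ψ (w - w₀)‖ ≤ η * ‖ψ.toLp 2 volume‖} := by
    ext w
    simp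
  rw [this]
  exact isClosed_iInter fun ψ => isClosed_le (by fun_prop) continuous_const

/-- The constraint `Z t` is the L² ball of radius η around the linear solution S(t)e. It returns to
itself because the Duhamel term is O(η⁵) in L², and it makes the decay |t|^{-1/4} available; then
Young with b = r needs only 1/r < 1/4. -/
theorem exists_self_of_eq_four (hP : P.p = ((4 : ℕ) : ℝ≥0∞) + 2) {r : ℝ} (hlr : 4 < r)
    (hr2 : r ≤ 9 / 2) :
    ∃ η₁ : ℝ, 0 < η₁ ∧ ∀ η : ℝ, 0 < η → η ≤ η₁ → ∀ e : ModSpace P,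
      ∫⁻ t, ‖ModSpace.group P t e‖ₑ ^ r ≤ ENNReal.ofReal (η ^ r) → ∃ Z : ℝ → Set (ModSpace P),
        (∀ t, IsClosed (Z t)) ∧ (∀ t, ModSpace.group P t e ∈ Z t) ∧
        ∀ u ∈ fixedPointSet r η Z, (∀ t, rhs P 4 e u t ∈ Z t) ∧
          eLpNorm (fun t => rhs P 4 e u t - ModSpace.group P t e) (ENNReal.ofReal r) volume ≤
            ENNReal.ofReal η := by
  have hr : 0 < r := by linarith
  obtain ⟨C₁, hC₁, hgain⟩ := exists_norm_duhamelMap_gain_le hP hr hr2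
  obtain ⟨C₂, hC₂, hdual⟩ := exists_norm_rhs_sub_apply_le hP hr (by linarith)
  obtain ⟨C, hC, hsub⟩ := exists_eLpNorm_picard_sub_le (E := ModSpace P) (κ := 1 / 4)
    (by linarith : 1 < r) le_rfl (by
      rw [show 1 - (r - 1) / r = 1 / r by field_simp; ring]
      exact one_div_lt_one_div_of_lt (by norm_num) hlr)
  -- The three bounds serve, in order, ‖u‖ ≤ 1, the L^r estimate and the L² ball, where 32 = 2⁵.
  refine ⟨min (1 / 2) (min ((1 / (2 * C * C₁)) ^ 2) (1 / (32 * C₂))), by positivity,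
    fun η hη hη1 e he => ?_⟩
  have h1 : η ≤ 1 / 2 := hη1.trans (min_le_left _ _)
  have h2 : 2 * C * C₁ * η ^ (1 / 2 : ℝ) ≤ 1 := by
    have := (hη1.trans (min_le_right _ _)).trans (min_le_left _ _)
    rw [← Real.sqrt_eq_rpow, ← le_div_iff₀' (by positivity)]
    exact Real.sqrt_le_iff.2 ⟨by positivity, this⟩
  have h3 : 32 * C₂ * η ≤ 1 := by
    have := (hη1.trans (min_le_right _ _)).trans (min_le_right _ _)
    rw [le_div_iff₀ (by positivity)] at this
    linarith
  refine ⟨fun t => {w | ∀ ψ : 𝓢(ℝ, ℂ), ‖(w - ModSpace.group P t e).dist ψ‖ ≤ η * ‖ψ.toLp 2 volume‖},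
    fun t => isClosed_setOf_norm_sub_apply_le _ _, fun t ψ => ?_, fun u hu => ⟨fun t ψ => ?_, ?_⟩⟩
  · rw [sub_self, ModSpace.dist_zero, show (0 : 𝓢'(ℝ, ℂ)) ψ = 0 from rfl, norm_zero]
    positivity
  · refine (hdual (2 * η) e u (by positivity) hu.1 hu.2.1
      ((eLpNorm_ofReal_le_iff hr (by positivity) _).1 hu.2.2.1) t ψ).trans ?_
    gcongr
    calc C₂ * (2 * η) ^ 5 = 32 * C₂ * η * η ^ 4 := by ring
      _ ≤ 1 * η ^ 1 := by
          gcongr ?_ * ?_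
          exact pow_le_pow_of_le_one hη.le (by linarith) (by norm_num)
      _ = η := by rw [one_mul, pow_one]
  · refine (hsub (duhamelMap P 4) (fun t => ModSpace.group P t e) u (C₁ * η ^ (1 / 2 : ℝ)) (2 * η)
      (by positivity) (by positivity) hu.1 hu.2.2.1 fun t τ =>
      hgain η τ e (u τ) hη h1 he (hu.2.2.2 τ) (hu.2.1 τ) t).trans (ENNReal.ofReal_le_ofReal ?_)
    calc C * (C₁ * η ^ (1 / 2 : ℝ)) * (2 * η) ^ r
        ≤ C * (C₁ * η ^ (1 / 2 : ℝ)) * (2 * η) ^ (1 : ℝ) := by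
          gcongr C * (C₁ * η ^ (1 / 2 : ℝ)) * ?_
          exact Real.rpow_le_rpow_of_exponent_ge (by positivity) (by linarith) (by linarith)
      _ = (2 * C * C₁ * η ^ (1 / 2 : ℝ)) * η := by
          rw [Real.rpow_one]
          ring
      _ ≤ η := mul_le_of_le_one_left hη.le h2

/-- For `λ ≤ 3` only the zero initial value is admissible. -/
theorem exists_solution (hlam : 1 ≤ lam) (hP : P.p = (lam : ℝ≥0∞) + 2) {r : ℝ}
    (hlr : (lam : ℝ) < r) (hκ : 1 - (lam : ℝ) / r < (lam : ℝ) / (3 * ((lam : ℝ) + 2)))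
    (h3 : lam ≤ 3 → r / 2 ≤ r / ((lam : ℝ) + 2) + 1) (h4 : lam = 4 → r ≤ 9 / 2) :
    ∃ ε : ℝ, 0 < ε ∧ ∀ e : ModSpace P,
      ∫⁻ t, ‖ModSpace.group P t e‖ₑ ^ r ≤ ENNReal.ofReal (ε ^ r) → ∀ Z₀ : Set (ModSpace P),
        IsClosed Z₀ → (∀ t, ModSpace.group P t e ∈ Z₀) →
        (∀ u, Continuous u → (∀ t, u t ∈ Z₀) → ∀ t, rhs P lam e u t ∈ Z₀) →
        ∃ u : ℝ → ModSpace P, Continuous u ∧ ∫⁻ t, ‖u t‖ₑ ^ r < ∞ ∧ (∀ t, u t = rhs P lam e u t) ∧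
          ∀ t, u t ∈ Z₀ := by
  have hl : (1 : ℝ) ≤ lam := by exact_mod_cast hlam
  have hr : 0 < r := by linarith
  rcases le_or_gt lam 3 with h | h
  · refine ⟨1, one_pos, fun e he Z₀ _ hv _ => ?_⟩
    have he0 : e = 0 := ModSpace.eq_zero_of_lintegral_group (by linarith) (exponents_eq hP).1 hr (h3 h)
      (he.trans_lt ENNReal.ofReal_lt_top).ne
    subst he0
    refine ⟨fun _ => 0, continuous_const, by simp [hr], fun t => ?_, fun t => by simpa using hv t⟩
    simp [rhs, picard, duhamelMap_zero hlam hP]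
  · refine exists_solution_of_self hlam hP hlr hκ ?_
    rcases eq_or_ne lam 4 with h' | h'
    · subst h'
      exact exists_self_of_eq_four hP (by exact_mod_cast hlr) (h4 rfl)
    · obtain ⟨η₁, hη₁, hs⟩ := exists_self_of_five_le (P := P) (by omega) hP hlr hκ
      exact ⟨η₁, hη₁, fun η hη hη1 e _ => ⟨fun _ => Set.univ, fun _ => isClosed_univ,
        fun _ => Set.mem_univ _, fun u hu => ⟨fun _ => Set.mem_univ _, hs η hη hη1 e u hu⟩⟩⟩

end Solution

/-! ### Bochner spaces of distributions and of elements of the modulation space -/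

namespace ModSpace

variable {P : ModParams}

open Classical in
/-- The element of the modulation space given by a distribution, `0` if there is none. -/
def lift (P : ModParams) (f : 𝓢'(ℝ, ℂ)) : ModSpace P :=
  if h : modNorm P.ρ P.s P.p 1 f < ∞ then mk f h else 0

theorem dist_lift {f : 𝓢'(ℝ, ℂ)} (h : modNorm P.ρ P.s P.p 1 f < ∞) : (lift P f).dist = f := by
  rw [lift, dif_pos h, dist_mk]

theorem lift_dist (e : ModSpace P) : lift P e.dist = e := dist_injective (dist_lift e.modNorm_dist_lt)

theorem enorm_lift_le (f : 𝓢'(ℝ, ℂ)) : ‖lift P f‖ₑ ≤ modNorm P.ρ P.s P.p 1 f := by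
  by_cases h : modNorm P.ρ P.s P.p 1 f < ∞
  · rw [enorm_eq, dist_lift h]
  · rw [lift, dif_neg h, enorm_zero]
    exact zero_le

theorem memBochner_dist {u : ℝ → ModSpace P} (hu : Continuous u) {r : ℝ} (hr : 0 < r) {μ : Measure ℝ}
    (h : ∫⁻ t, ‖u t‖ₑ ^ r ∂μ < ∞) : MemBochner P.ρ P.s P.p 1 r μ fun t => (u t).dist := by
  have hs : StronglyMeasurable u := hu.stronglyMeasurable
  refine ⟨⟨fun n => (hs.approx n).map dist, fun n t => modNorm_dist_lt _,
    Eventually.of_forall fun t => ?_⟩, ?_⟩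
  · have h1 := hs.tendsto_approx t
    have h2 := (tendsto_iff_edist_tendsto_0.1 h1)
    refine h2.congr fun n => ?_
    rw [edist_comm, edist_eq_enorm_sub, enorm_eq, dist_sub, SimpleFunc.map_apply]
  · unfold bochnerNorm
    simp only [← enorm_eq]
    exact ENNReal.rpow_lt_top_of_nonneg (by positivity) h.ne

end ModSpace

section

variable {P : ModParams}

open ModSpace

theorem MemBochner.ae_lt_top {r : ℝ} {μ : Measure ℝ} {F : ℝ → 𝓢'(ℝ, ℂ)}
    (h : MemBochner P.ρ P.s P.p 1 r μ F) : ∀ᵐ t ∂μ, modNorm P.ρ P.s P.p 1 (F t) < ∞ := by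
  obtain ⟨⟨a, ha, hlim⟩, -⟩ := h
  filter_upwards [hlim] with t ht
  obtain ⟨n, hn⟩ := (ht.eventually_lt_const ENNReal.zero_lt_top).exists
  have := modNorm_add_le (ρ := P.ρ) (s := P.s) P.hp (F t - a n t) (a n t)
  rw [sub_add_cancel] at this
  exact this.trans_lt (ENNReal.add_lt_top.2 ⟨hn, ha n t⟩)

theorem MemBochner.integrable_lift {μ : Measure ℝ} {F : ℝ → 𝓢'(ℝ, ℂ)}
    (h : MemBochner P.ρ P.s P.p 1 1 μ F) : Integrable (fun t => lift P (F t)) μ := by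
  have hlt := h.ae_lt_top
  obtain ⟨⟨a, ha, hlim⟩, hfin⟩ := h
  refine ⟨aestronglyMeasurable_of_tendsto_ae atTop (f := fun n => (a n).map (lift P))
    (fun n => (SimpleFunc.stronglyMeasurable _).aestronglyMeasurable) ?_, ?_⟩
  · filter_upwards [hlim, hlt] with t ht htt
    rw [tendsto_iff_edist_tendsto_0]
    refine ht.congr fun n => ?_
    rw [edist_comm, edist_eq_enorm_sub, enorm_eq, dist_sub, SimpleFunc.map_apply, dist_lift htt,
      dist_lift (ha n t)]
  · simp only [bochnerNorm, ENNReal.rpow_one, div_one] at hfin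
    exact (lintegral_mono fun t => enorm_lift_le (F t)).trans_lt hfin

end

namespace ModSpace

variable {P : ModParams}

/-- The initial value belongs to the modulation space. -/
theorem exists_dist_eq {u₀ : 𝓢'(ℝ, ℂ)} {r ε : ℝ} (hr : 0 < r) (hε : 0 ≤ ε)
    (h : bochnerNorm P.ρ P.s P.p 1 r volume (fun t => S t u₀) < ENNReal.ofReal ε) :
    ∃ e : ModSpace P, e.dist = u₀ ∧ ∫⁻ t, ‖group P t e‖ₑ ^ r ≤ ENNReal.ofReal (ε ^ r) := by
  have h1 : ∫⁻ t, modNorm P.ρ P.s P.p 1 (S t u₀) ^ r ≤ ENNReal.ofReal (ε ^ r) := by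
    rw [← ENNReal.ofReal_rpow_of_nonneg hε hr.le, ← ENNReal.rpow_inv_le_iff hr, ← one_div]
    exact h.le
  have h2 : ∃ t, modNorm P.ρ P.s P.p 1 (S t u₀) < ∞ := by
    by_contra! h2
    have h3 : ∫⁻ t, modNorm P.ρ P.s P.p 1 (S t u₀) ^ r = ∞ := by
      simp only [top_le_iff.1 (h2 _), ENNReal.top_rpow_of_pos hr]
      simp
    rw [h3] at h1
    exact absurd h1 (by simp)
  obtain ⟨t, ht⟩ := h2
  have h3 : (group P (-t) (mk _ ht)).dist = u₀ := by
    rw [dist_group, dist_mk, ← S_add, neg_add_cancel, S_zero]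
  refine ⟨_, h3, ?_⟩
  simpa only [enorm_eq, dist_group _ (group P (-t) _), h3] using h1

end ModSpace

end GBBM

end

open scoped SchwartzMap ENNReal FourierTransform ComplexConjugate

noncomputable section

namespace GBBM

/-! ### Real-valued distributions -/

theorem fourierInv_neg_of_real {ψ : 𝓢(ℝ, ℂ)} (hψ : ∀ x, (ψ x).im = 0) (y : ℝ) :
    𝓕⁻ (ψ : ℝ → ℂ) (-y) = conj (𝓕⁻ (ψ : ℝ → ℂ) y) := by
  rw [Real.fourierInv_eq', Real.fourierInv_eq',
    ← integral_conj]
  refine integral_congr_ae (Eventually.of_forall fun x => ?_)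
  simp only [smul_eq_mul, map_mul, ← Complex.exp_conj, Complex.conj_ofReal, Complex.conj_I,
    Complex.conj_eq_iff_im.2 (hψ x)]
  congr 2
  simp

theorem im_fourier_eq_zero {g : ℝ → ℂ} (hg : ∀ y, g (-y) = conj (g y)) (x : ℝ) :
    (𝓕 g x).im = 0 := by
  rw [← Complex.conj_eq_iff_im, Real.fourier_real_eq_integral_exp_smul, ← integral_conj,
    ← integral_neg_eq_self]
  refine integral_congr_ae (Eventually.of_forall fun y => ?_)
  simp only [smul_eq_mul, map_mul, ← Complex.exp_conj, Complex.conj_ofReal, Complex.conj_I, ← hg,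
    neg_neg]
  congr 2
  push_cast
  ring

/-- Hermitian symmetry of the symbol means that the transposed multiplier maps real test functions
to real ones. -/
theorem IsReal.multiplier {m : ℝ → ℂ} (hm : m.HasTemperateGrowth) (hs : ∀ ξ, m (-ξ) = conj (m ξ))
    {f : 𝓢'(ℝ, ℂ)} (hf : IsReal f) : IsReal (multiplier m f) := by
  intro ψ hψ
  rw [multiplier_apply]
  refine hf _ fun x => ?_
  rw [SchwartzMap.fourier_coe]
  refine im_fourier_eq_zero (fun y => ?_) x
  rw [SchwartzMap.smulLeftCLM_apply_apply (hasTemperateGrowth_dilate hm),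
    SchwartzMap.smulLeftCLM_apply_apply (hasTemperateGrowth_dilate hm), SchwartzMap.fourierInv_coe,
    fourierInv_neg_of_real hψ, smul_eq_mul, smul_eq_mul, map_mul, ← hs, mul_neg]

theorem grp_neg (t ξ : ℝ) : grp t (-ξ) = conj (grp t ξ) := by
  unfold grp
  rw [← Complex.exp_conj]
  congr 1
  simp only [map_mul, map_neg, Complex.conj_ofReal, Complex.conj_I, phi]
  push_cast
  ring

theorem isReal_S (t : ℝ) {f : 𝓢'(ℝ, ℂ)} (hf : IsReal f) : IsReal (S t f) :=
  hf.multiplier (hasTemperateGrowth_grp t) (grp_neg t)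

/-- φ is odd, so φ(D) alone does not preserve real-valuedness; the factor i of the equation restores
Hermitian symmetry. -/
theorem isReal_smul_S_phiD (lam : ℕ) (t : ℝ) {f : 𝓢'(ℝ, ℂ)} (hf : IsReal f) :
    IsReal ((-(Complex.I / ((lam : ℂ) + 1))) • S t (phiD f)) := by
  have h1 := hasTemperateGrowth_grp t
  have h2 := hasTemperateGrowth_phi
  rw [S_eq, phiD_eq, multiplier_multiplier h1 h2, ← multiplier_fun_smul (m := fun ξ => grp t ξ * phi ξ) (h1.mul h2)]
  refine hf.multiplier (by fun_prop) fun ξ => ?_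
  have : phi (-ξ) = -phi ξ := by
    unfold phi
    rw [neg_sq, neg_div]
  simp only [map_mul, map_neg, map_div₀, map_add, map_natCast, map_one, Complex.conj_ofReal,
    Complex.conj_I, grp_neg, this]
  push_cast
  ring

theorem IsReal.im_ae_eq_zero {f : 𝓢'(ℝ, ℂ)} {g : ℝ → ℂ} (hf : IsReal f) (h : IsRep f g)
    (hg : MemLp g ∞ volume) : ∀ᵐ x, (g x).im = 0 := by
  have hloc : LocallyIntegrable g := hg.locallyIntegrable le_top
  have him : MemLp (fun x => (g x).im) ∞ volume := hg.im
  refine ae_eq_zero_of_integral_contDiff_smul_eq_zero (him.locallyIntegrable le_top) fun u hu hc => ?_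
  have hc' : HasCompactSupport (Complex.ofRealCLM ∘ u) := hc.comp_left rfl
  have hu' : ContDiff ℝ (⊤ : ℕ∞) (Complex.ofRealCLM ∘ u) := by fun_prop
  have h1 := hf (hc'.toSchwartzMap hu') (fun x => by simp)
  have hi : Integrable fun x => u x • g x := hloc.integrable_smul_left_of_hasCompactSupport
    hu.continuous hc
  have h2 := integral_im (𝕜 := ℂ) hi
  rw [h] at h1
  simpa [Complex.real_smul] using h2.trans (by simpa [Complex.real_smul] using h1)

theorem IsReal.distPow {f : 𝓢'(ℝ, ℂ)} {g : ℝ → ℂ} (hf : IsReal f) (h : IsRep f g)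
    (hg : MemLp g ∞ volume) (m : ℕ) : IsReal (distPow m f) := by
  intro ψ hψ
  rw [isRep_distPow hg h m ψ]
  have : ∫ x, ψ x * g x ^ m = ∫ x, (((ψ x).re * (g x).re ^ m : ℝ) : ℂ) := by
    refine integral_congr_ae ?_
    filter_upwards [hf.im_ae_eq_zero h hg] with x hx
    push_cast
    rw [← Complex.conj_eq_iff_re.1 (Complex.conj_eq_iff_im.2 (hψ x)),
      ← Complex.conj_eq_iff_re.1 (Complex.conj_eq_iff_im.2 hx)]
    simp
  rw [this, integral_complex_ofReal, Complex.ofReal_im]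

section

variable {P : ModParams} {lam : ℕ}

theorem isClosed_setOf_isReal_dist : IsClosed {e : ModSpace P | IsReal e.dist} := by
  have : {e : ModSpace P | IsReal e.dist} = ⋂ (ψ : 𝓢(ℝ, ℂ)) (_ : ∀ x, (ψ x).im = 0),
      {e : ModSpace P | (ModSpace.evalCLM ψ e).im = 0} := by
    ext e
    simp [IsReal]
  rw [this]
  refine isClosed_iInter fun ψ => isClosed_iInter fun _ => isClosed_eq ?_ continuous_const
  exact Complex.continuous_im.comp (ModSpace.evalCLM ψ).continuous

theorem isReal_dist_duhamelMap (hlam : 1 ≤ lam) (hP : P.p = (lam : ℝ≥0∞) + 2) (t : ℝ)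
    {e : ModSpace P} (he : IsReal e.dist) : IsReal (duhamelMap P lam t e).dist := by
  rw [dist_duhamelMap hlam hP]
  obtain ⟨g, hg, h⟩ := exists_rep_top P.isBump P.hs P.hp e.modNorm_dist_lt
  exact isReal_smul_S_phiD lam t (he.distPow h hg _)

theorem isReal_dist_rhs (hlam : 1 ≤ lam) (hP : P.p = (lam : ℝ≥0∞) + 2) {e : ModSpace P}
    (he : IsReal e.dist) {u : ℝ → ModSpace P} (hu : Continuous u) (hur : ∀ t, IsReal (u t).dist)
    (t : ℝ) : IsReal (rhs P lam e u t).dist := by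
  intro ψ hψ
  have h1 := dist_rhs_sub_apply hlam hP (e := e) hu t ψ
  have h2 : ∫ τ in (0 : ℝ)..t, (duhamelMap P lam (t - τ) (u τ)).dist ψ =
      ∫ τ in (0 : ℝ)..t, (((duhamelMap P lam (t - τ) (u τ)).dist ψ).re : ℂ) := by
    refine intervalIntegral.integral_congr fun τ _ => ?_
    exact (Complex.conj_eq_iff_re.1 (Complex.conj_eq_iff_im.2
      (isReal_dist_duhamelMap hlam hP _ (hur τ) ψ hψ))).symm
  rw [h2, intervalIntegral.integral_ofReal, ModSpace.dist_sub,
    show ∀ f f' : 𝓢'(ℝ, ℂ), (f - f') ψ = f ψ - f' ψ from fun _ _ => rfl, sub_eq_iff_eq_add,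
    ModSpace.dist_group] at h1
  rw [h1, Complex.add_im, Complex.ofReal_im, isReal_S t he ψ hψ, add_zero]

end

/-! ### Solutions of the integral equation as distributions -/

section

variable {P : ModParams} {lam : ℕ} (hlam : 1 ≤ lam) (hP : P.p = (lam : ℝ≥0∞) + 2)

include hlam hP

theorem duhamel_dist (u : ℝ → ModSpace P) (t τ : ℝ) :
    duhamel lam (fun t => (u t).dist) t τ = (ModSpace.group P (t - τ) (nonlin P lam (u τ))).dist := by
  rw [ModSpace.dist_group, dist_nonlin hlam hP, duhamel]

theorem isSolution_dist {e : ModSpace P} {u : ℝ → ModSpace P} (hu : Continuous u)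
    (h : ∀ t, u t = rhs P lam e u t) :
    IsSolution P.ρ lam P.s P.p 1 e.dist fun t => (u t).dist := by
  refine Eventually.of_forall fun t => ⟨?_, fun ψ => ?_⟩
  · have hc : Continuous fun τ => ModSpace.group P (t - τ) (nonlin P lam (u τ)) :=
      (ModSpace.continuous_group.comp (continuous_const.sub continuous_id)).clm_apply
        ((continuous_nonlin hlam hP).comp hu)
    have h1 : duhamel lam (fun t => (u t).dist) t =
        fun τ => (ModSpace.group P (t - τ) (nonlin P lam (u τ))).dist :=
      funext fun τ => duhamel_dist hlam hP u t τ
    rw [h1]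
    refine ModSpace.memBochner_dist hc one_pos ?_
    simp only [ENNReal.rpow_one]
    exact (intervalIntegrable_iff.1 (hc.intervalIntegrable 0 t)).2
  · have h1 := dist_rhs_sub_apply hlam hP (e := e) hu t ψ
    have h2 : ∀ τ, (duhamelMap P lam (t - τ) (u τ)).dist ψ =
        -(Complex.I / ((lam : ℂ) + 1)) * duhamel lam (fun t => (u t).dist) t τ ψ := fun τ => by
      rw [duhamel_dist hlam hP]
      rfl
    simp only [h2, intervalIntegral.integral_const_mul] at h1
    rw [← h t, ModSpace.dist_sub, show ∀ f f' : 𝓢'(ℝ, ℂ), (f - f') ψ = f ψ - f' ψ from fun _ _ => rfl,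
      sub_eq_iff_eq_add, ModSpace.dist_group] at h1
    rw [h1]
    ring

/-- Factoring S(t) out of the integral leaves an integrand independent of t. The right hand side is
therefore continuous in t even when u is replaced by a merely integrable solution. -/
theorem rhs_eq (e : ModSpace P) {u : ℝ → ModSpace P} (hu : Continuous u) (t : ℝ) :
    rhs P lam e u t = ModSpace.group P t (e + (-(Complex.I / ((lam : ℂ) + 1))) •
      ∫ τ in (0 : ℝ)..t, ModSpace.group P (-τ) (nonlin P lam (u τ))) := by
  have hc : Continuous fun τ => ModSpace.group P (-τ) (nonlin P lam (u τ)) :=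
    (ModSpace.continuous_group.comp continuous_neg).clm_apply ((continuous_nonlin hlam hP).comp hu)
  rw [map_add, map_smul, ← ContinuousLinearMap.intervalIntegral_comp_comm _
    (hc.intervalIntegrable _ _), ← intervalIntegral.integral_smul]
  simp only [← ModSpace.group_add, ← sub_eq_add_neg]
  rfl

/-- Let H(τ) = S(-τ)φ(D)[v(τ)^{λ+1}]. Almost everywhere v(t) = S(t)(e + c∫₀ᵗ H), whose right side is
continuous in t and again solves the equation, the integral being blind to null sets. Two continuous
solutions agree by `picard_unique`, so smallness of v plays no role. -/
theorem ae_eq_of_isSolution {e : ModSpace P} {u : ℝ → ModSpace P} (hu : Continuous u)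
    (h : ∀ t, u t = rhs P lam e u t) {r : ℝ} {v : ℝ → 𝓢'(ℝ, ℂ)}
    (hv : MemBochner P.ρ P.s P.p 1 r volume v) (hsol : IsSolution P.ρ lam P.s P.p 1 e.dist v) :
    v =ᵐ[volume] fun t => (u t).dist := by
  set c : ℂ := -(Complex.I / ((lam : ℂ) + 1)) with hc
  set w : ℝ → ModSpace P := fun t => ModSpace.lift P (v t)
  have hw : ∀ᵐ t, (w t).dist = v t := hv.ae_lt_top.mono fun t ht => ModSpace.dist_lift ht
  set H : ℝ → ModSpace P := fun τ => ModSpace.group P (-τ) (nonlin P lam (w τ)) with hH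
  have hd : ∀ t, ∀ᵐ τ, duhamel lam v t τ = (ModSpace.group P t (H τ)).dist := fun t => by
    filter_upwards [hw] with τ hτ
    rw [hH, ← ModSpace.group_add, ← sub_eq_add_neg, ← duhamel_dist hlam hP, duhamel, duhamel, hτ]
  have hint : ∀ᵐ t, IntervalIntegrable H volume 0 t := by
    filter_upwards [hsol] with t ht
    have h1 := ht.1.integrable_lift
    have h2 := (ModSpace.group P (-t)).integrable_comp h1
    rw [intervalIntegrable_iff]
    refine h2.congr (ae_restrict_of_ae ?_)
    filter_upwards [hd t] with τ hτ
    rw [hτ, ModSpace.lift_dist, ← ModSpace.group_add, neg_add_cancel, ModSpace.group_zero]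
  -- Integrability on [0,t] is known for almost every t, hence for times beyond any given one, and
  -- it is inherited by subintervals.
  have hint0 : ∀ t, IntervalIntegrable H volume 0 t := fun t => by
    have hdense := Measure.dense_of_ae hint
    rcases le_total 0 t with ht | ht
    · obtain ⟨t', h', htt⟩ := hdense.exists_gt t
      refine IntervalIntegrable.mono_set h' (Set.uIcc_subset_uIcc_left ?_)
      rw [Set.uIcc_of_le (by linarith)]
      exact ⟨ht, htt.le⟩
    · obtain ⟨t', h', htt⟩ := hdense.exists_lt t
      refine IntervalIntegrable.mono_set h' (Set.uIcc_subset_uIcc_left ?_)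
      rw [Set.uIcc_of_ge (by linarith)]
      exact ⟨htt.le, ht⟩
  have hint' : ∀ a b, IntervalIntegrable H volume a b := fun a b => (hint0 a).symm.trans (hint0 b)
  set u' : ℝ → ModSpace P := fun t => ModSpace.group P t (e + c • ∫ τ in (0 : ℝ)..t, H τ) with hu'
  have hu'c : Continuous u' := ModSpace.continuous_group.clm_apply
    (continuous_const.add ((intervalIntegral.continuous_primitive hint' 0).const_smul c))
  have hvu : v =ᵐ[volume] fun t => (u' t).dist := by
    filter_upwards [hsol] with t ht
    ext ψ
    have h1 : ∫ τ in (0 : ℝ)..t, duhamel lam v t τ ψ =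
        (ModSpace.group P t (∫ τ in (0 : ℝ)..t, H τ)).dist ψ := by
      rw [← ContinuousLinearMap.intervalIntegral_comp_comm _ (hint0 t)]
      rw [evalCLM_intervalIntegral ψ]
      · refine intervalIntegral.integral_congr_ae ?_
        filter_upwards [hd t] with τ hτ _
        rw [hτ]
      · exact ⟨(ModSpace.group P t).integrable_comp (hint0 t).1,
          (ModSpace.group P t).integrable_comp (hint0 t).2⟩
    have h2 : (u' t).dist ψ = (ModSpace.group P t e).dist ψ +
        c * (ModSpace.group P t (∫ τ in (0 : ℝ)..t, H τ)).dist ψ := by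
      rw [hu']
      simp only
      rw [map_add, map_smul]
      rfl
    rw [ht.2 ψ, h1, h2, ModSpace.dist_group t e, hc]
    ring
  have hwu : w =ᵐ[volume] u' := by
    filter_upwards [hw, hvu] with t h1 h2
    exact ModSpace.dist_injective (h1.trans h2)
  have hfix : ∀ t, u' t = rhs P lam e u' t := fun t => by
    rw [rhs_eq hlam hP e hu'c]
    change ModSpace.group P t (e + c • ∫ τ in (0 : ℝ)..t, H τ) = _
    congr 3
    refine intervalIntegral.integral_congr_ae ?_
    filter_upwards [hwu] with τ hτ _
    simp only [hH, hτ]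
  obtain ⟨M, hM, hLip⟩ := exists_duhamelMap_sub_le hlam hP
  have huu : u' = u := by
    refine picard_unique (continuous_duhamelMap hlam hP) hM.le (l := lam) (fun t a b => ?_) hu'c hu hfix h
    refine (hLip t a b).trans ?_
    have h1 : (1 + |t|) ^ (-((lam : ℝ) / (3 * ((lam : ℝ) + 2)))) ≤ 1 :=
      Real.rpow_le_one_of_one_le_of_nonpos (by linarith [abs_nonneg t])
        (neg_nonpos.2 (by positivity))
    calc _ ≤ M * 1 * (‖a‖ + ‖b‖) ^ lam * ‖a - b‖ := by gcongr
      _ = _ := by rw [mul_one]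
  rwa [huu] at hvu

end

/-! ### The exponents -/

/-- With θ ≤ -1/σ the first range reduces to 2σ² + 5σ + 6 ≥ 0, which has negative discriminant; in
the second the quantity is even at most 3/36. -/
theorem neg_mul_beta_le {σ θ : ℝ} (hσ : σ < -1) (hθ₀ : 0 < θ) (hθ : θ ≤ -1 / σ) :
    -(θ * beta σ) ≤ 1 / 6 := by
  have h1 : θ * -σ ≤ 1 := by
    rw [le_div_iff_of_neg (by linarith)] at hθ
    linarith
  have h2 : 0 < 1 - 2 * σ := by linarith
  unfold beta
  split_ifs with h
  · rw [← mul_div_assoc, ← neg_div, div_le_iff₀ h2]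
    nlinarith [mul_pos hθ₀ h2, sq_nonneg (4 * σ + 5), mul_nonneg hθ₀.le (sq_nonneg (4 * σ + 5))]
  · rw [← mul_div_assoc, ← neg_div, div_le_iff₀ h2]
    nlinarith

/-- The second claim is x < 1/3. The bound 1/6 is exactly what the two small cases need: at λ = 3
the condition reads 9 ≤ 2(5-3x), and at λ = 4 it reads 24/(6-4x) ≤ 9/2. -/
theorem exponent_bounds {lam : ℕ} (hlam : 1 ≤ lam) {x r : ℝ} (hx₀ : 0 < x) (hx : x ≤ 1 / 6)
    (hr : r = (lam : ℝ) * ((lam : ℝ) + 2) / ((lam : ℝ) + 2 - (lam : ℝ) * x)) :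
    (lam : ℝ) < r ∧ 1 - (lam : ℝ) / r < (lam : ℝ) / (3 * ((lam : ℝ) + 2)) ∧
      (lam ≤ 3 → r / 2 ≤ r / ((lam : ℝ) + 2) + 1) ∧ (lam = 4 → r ≤ 9 / 2) := by
  have hl : (1 : ℝ) ≤ lam := by exact_mod_cast hlam
  have hD : 0 < (lam : ℝ) + 2 - (lam : ℝ) * x := by nlinarith
  have hr0 : 0 < r := by
    rw [hr]
    positivity
  refine ⟨?_, ?_, fun h3 => ?_, fun h4 => ?_⟩
  · rw [hr, lt_div_iff₀ hD]
    gcongr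
    nlinarith
  · have : 1 - (lam : ℝ) / r = (lam : ℝ) * x / ((lam : ℝ) + 2) := by
      rw [hr]
      field_simp
      ring
    rw [this, div_lt_div_iff₀ (by positivity) (by positivity)]
    have : x * 3 < 1 := by linarith
    nlinarith [mul_pos (by linarith : (0 : ℝ) < lam) (by linarith : (0 : ℝ) < (lam : ℝ) + 2)]
  · have h1 : r / 2 - r / ((lam : ℝ) + 2) =
        (lam : ℝ) ^ 2 / (2 * ((lam : ℝ) + 2 - (lam : ℝ) * x)) := by
      rw [hr]
      field_simp
      ring
    have h2 : (lam : ℝ) ^ 2 / (2 * ((lam : ℝ) + 2 - (lam : ℝ) * x)) ≤ 1 := by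
      rw [div_le_one (by positivity)]
      have : (lam : ℝ) ≤ 3 := by exact_mod_cast h3
      nlinarith
    linarith
  · subst h4
    rw [hr, div_le_iff₀ hD]
    norm_num
    linarith

theorem exists_unique_solution {P : ModParams} {lam : ℕ} (hlam : 1 ≤ lam)
    (hP : P.p = (lam : ℝ≥0∞) + 2) {r : ℝ} (hr0 : 0 < r)
    (hlr : (lam : ℝ) < r) (hκ : 1 - (lam : ℝ) / r < (lam : ℝ) / (3 * ((lam : ℝ) + 2)))
    (h3 : lam ≤ 3 → r / 2 ≤ r / ((lam : ℝ) + 2) + 1) (h4 : lam = 4 → r ≤ 9 / 2) :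
    ∃ ε : ℝ, 0 < ε ∧ ∀ u₀ : 𝓢'(ℝ, ℂ),
      bochnerNorm P.ρ P.s P.p 1 r volume (fun t => S t u₀) < ENNReal.ofReal ε →
      ∃ u : ℝ → 𝓢'(ℝ, ℂ),
        (MemBochner P.ρ P.s P.p 1 r volume u ∧ IsSolution P.ρ lam P.s P.p 1 u₀ u) ∧
        (∀ v : ℝ → 𝓢'(ℝ, ℂ), MemBochner P.ρ P.s P.p 1 r volume v →
          IsSolution P.ρ lam P.s P.p 1 u₀ v → v =ᵐ[volume] u) ∧
        (IsReal u₀ → ∀ᵐ t : ℝ, IsReal (u t)) := by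
  obtain ⟨ε, hε, h⟩ := exists_solution hlam hP hlr hκ h3 h4
  refine ⟨ε, hε, fun u₀ hu₀ => ?_⟩
  obtain ⟨e, rfl, he⟩ := ModSpace.exists_dist_eq hr0 hε.le hu₀
  have hmain : ∀ Z₀ : Set (ModSpace P), IsClosed Z₀ → (∀ t, ModSpace.group P t e ∈ Z₀) →
      (∀ u, Continuous u → (∀ t, u t ∈ Z₀) → ∀ t, rhs P lam e u t ∈ Z₀) →
      ∃ u : ℝ → 𝓢'(ℝ, ℂ),
        (MemBochner P.ρ P.s P.p 1 r volume u ∧ IsSolution P.ρ lam P.s P.p 1 e.dist u) ∧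
        (∀ v : ℝ → 𝓢'(ℝ, ℂ), MemBochner P.ρ P.s P.p 1 r volume v →
          IsSolution P.ρ lam P.s P.p 1 e.dist v → v =ᵐ[volume] u) ∧
        ∀ t, ∃ w ∈ Z₀, w.dist = u t := fun Z₀ hZ hv hinv => by
    obtain ⟨u, hu, hur, hfix, huZ⟩ := h e he Z₀ hZ hv hinv
    exact ⟨fun t => (u t).dist, ⟨ModSpace.memBochner_dist hu hr0 hur,
      isSolution_dist hlam hP hu hfix⟩,
      fun v hv hsol => ae_eq_of_isSolution hlam hP hu hfix hv hsol,
      fun t => ⟨u t, huZ t, rfl⟩⟩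
  -- The invariant set consists of the real-valued elements for real data and of the whole space
  -- otherwise, when the last assertion is vacuous.
  by_cases hreal : IsReal e.dist
  · obtain ⟨u, hu, huniq, huZ⟩ := hmain _ isClosed_setOf_isReal_dist
      (fun t => by
        rw [Set.mem_ofPred_eq, ModSpace.dist_group]
        exact isReal_S t hreal)
      fun u hu hur t => isReal_dist_rhs hlam hP hreal hu hur t
    refine ⟨u, hu, huniq, fun _ => Eventually.of_forall fun t => ?_⟩
    obtain ⟨w, hw, hwt⟩ := huZ t
    exact hwt ▸ hw
  · obtain ⟨u, hu, huniq, -⟩ := hmain Set.univ isClosed_univ (fun _ => Set.mem_univ _)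
      fun _ _ _ _ => Set.mem_univ _
    exact ⟨u, hu, huniq, fun h => absurd h hreal⟩

end GBBM

end

/-! ### The main theorem. -/

theorem mainTheorem2 (ρ : ℝ → ℝ) (hρ : GBBM.IsBump ρ)
    (lam : ℕ) (hlam : 1 ≤ lam) (s : ℝ) (hs : 0 ≤ s)
    (σ θ : ℝ) (hσ : σ < -1) (hθ₀ : 0 < θ) (hθ : θ ≤ -1 / σ)
    (hpos : 0 < -((lam : ℝ) * θ * GBBM.beta σ) / ((lam : ℝ) + 2))
    (hlt : -((lam : ℝ) * θ * GBBM.beta σ) / ((lam : ℝ) + 2) < 1)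
    (p : ℝ≥0∞) (hp : p = (lam : ℝ≥0∞) + 2)
    (r : ℝ)
    (hr : r = (lam : ℝ) * ((lam : ℝ) + 2) / ((lam : ℝ) + 2 + (lam : ℝ) * θ * GBBM.beta σ)) :
    ∃ ε : ℝ, 0 < ε ∧
      ∀ u₀ : 𝓢'(ℝ, ℂ),
        GBBM.bochnerNorm ρ s p 1 r volume (fun t => GBBM.S t u₀) < ENNReal.ofReal ε →
        ∃ u : ℝ → 𝓢'(ℝ, ℂ),
          (GBBM.MemBochner ρ s p 1 r volume u ∧ GBBM.IsSolution ρ lam s p 1 u₀ u) ∧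
          (∀ v : ℝ → 𝓢'(ℝ, ℂ),
            GBBM.MemBochner ρ s p 1 r volume v → GBBM.IsSolution ρ lam s p 1 u₀ v →
              v =ᵐ[volume] u) ∧
          (GBBM.IsReal u₀ → ∀ᵐ t : ℝ, GBBM.IsReal (u t)) := by
  have hl : (1 : ℝ) ≤ lam := by exact_mod_cast hlam
  have hx₀ : 0 < -(θ * GBBM.beta σ) := by
    rw [div_pos_iff_of_pos_right (by positivity)] at hpos
    nlinarith
  obtain ⟨hlr, hκ, h3, h4⟩ := GBBM.exponent_bounds hlam hx₀ (GBBM.neg_mul_beta_le hσ hθ₀ hθ)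
    (hr.trans (by ring_nf))
  have hp1 : 1 ≤ p := by
    rw [hp]
    exact le_add_left (by norm_num)
  exact GBBM.exists_unique_solution (P := ⟨ρ, s, p, hρ, hs, hp1⟩) hlam hp (by linarith) hlr hκ h3 h4
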